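/- **Setting.** Let $N\in\{1,2\}$ and consider $\partial_tU=\partial_x(B\,\delta\mathcal H[U])$, where, with $b\neq0$ and $f,\kappa,\tau$ smooth on an open interval $I$, $\kappa>0$, $\tau>0$: - $N=1$: $U=v$, $B=b$, $\mathcal H=f(v)+\tfrac12\kappa(v)v_x^2$; - $N=2$: $U=(v,u)^T$, $B=\begin{pmatrix}0&b\\b&0\end{pmatrix}$, $\mathcal H=\tfrac12\tau(v)u^2+f(v)+\tfrac12\kappa(v)v_x^2$. Put $Q(U)=\frac12U\cdot B^{-1}U$ and fix $(\boldsymbol\lambda,c)\in\mathbb R^N\times\mathbb R$. The profiles of travelling waves of speed $c$ and energy $\mu$ are $U=v$ if $N=1$ and $U=(v,g(v))^T$ if $N=2$, where $v:\mathbb R\to I$ solves $$\tfrac12\kappa(v)v_x^2+\mathcal W(v)=\mu,\qquad \kappa(v)v_{xx}+\tfrac12\kappa'(v)v_x^2+\mathcal W'(v)=0,$$ with $\mathcal W(v)=-f(v)-\frac c{2b}v^2-\lambda v$ if $N=1$, and $g(v)=-\frac1{\tau(v)}(\frac cbv+\lambda_2)$, $\mathcal W(v)=-f(v)+\frac12\tau(v)g(v)^2-\lambda_1v$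 if $N=2$. Assume that there are $v_\ell^s<v_s<v_r^s$ in $I$ with $\mathcal W(v_\ell^s)=\mathcal W(v_s)=\mathcal W(v_r^s)=:\mu_s$, $\mathcal W'(v_\ell^s)<0$, $\mathcal W'(v_r^s)>0$, $\mathcal W'(v_s)=0$, $\mathcal W''(v_s)<0$, and $\mathcal W<\mu_s$ on $(v_\ell^s,v_s)\cup(v_s,v_r^s)$. Let $U_s$ be the constant state with $v=v_s$, and let $U^0_i$ ($i=\ell,r$) be the soliton profile of energy $\mu_s$ with endstate $U_s$ and $v(0)=v_i^s$. For small $\varepsilon>0$ let $\underline U^\varepsilon$ be the two-pulse periodic wave profile of energy $\mu_s+\varepsilon^2$ with $v(0)=v_s$, $v_x(0)>0$; $X^\varepsilon$ is its period, and $X^\varepsilon_r>0$ (resp. $X^\varepsilon_\ell<0$) is the first positive (resp. last negative) zero of $v_x$. **Spectral problems.** Write the eigenvalue problem $zV=B\partial_x\big(\mathrm{Hess}(\mathcal H+cQ)[U]V\big)$ as a first-order system for $W=(V_1,\kappa(v)V_1',\mathrm{Hess}(\mathcal H+cQ)[U]V)$: $W'=A^\varepsilon(x,z)W$, $W'=A^0_\ell(x,z)W$,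 $W'=A^0_r(x,z)W$, $W'=A^0_\infty(z)W$ for $U=\underline U^\varepsilon,U^0_\ell,U^0_r,U_s$ respectively. For $\mathrm{Re}\,z>0$ the matrix $A^0_\infty(z)$ is hyperbolic. Let $n_s$ be the dimension of its stable subspace and $\Pi_s,\Pi_u$ its stable and unstable eigenprojections; let the columns of $R^-_\infty$ (resp. $R^+_\infty$) form a basis of the unstable (resp. stable) subspace, and let $\begin{pmatrix}L^-_\infty\\L^+_\infty\end{pmatrix}=(R^-_\infty,R^+_\infty)^{-1}$. For $i\in\{\ell,r\}$ let $P^0_{\pm,i}(y,z)$, $\pm y\ge0$, be invertible matrices such that $W=P^0_{\pm,i}Z$ reduces $W'=A^0_iW$ to $Z'=A^0_\infty Z$ and $P^0_{\pm,i}\to\mathrm{Id}$ as $y\to\pm\infty$. With $\Psi^\varepsilon$ a matrix solution of $\Psi'=A^\varepsilon\Psi$ with $\Psi^\varepsilon(0,z)$ invertible, define $$\tilde D^\varepsilon(z,\gamma)=e^{2X^\varepsilon_r\mathrm{tr}(A^0_\infty\Pi_s)}e^{2X^\varepsilon_\ell\mathrm{tr}(A^0_\infty\Pi_u)}(-\gamma)^{-n_s}\det\!\big(\Psi^\varepsilon(0)\Psi^\varepsilon(2X^\varepsilon_\ell)^{-1}-\gamma\Psi^\varepsilon(0)\Psi^\varepsilon(2X^\varepsilon_r)^{-1}\big),$$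 $$\tilde D^0(z)=\det\!\big(L^-_\infty P^0_{+,\ell}(0)^{-1}P^0_{-,\ell}(0)R^-_\infty\big)\det\!\big(L^+_\infty P^0_{-,r}(0)^{-1}P^0_{+,r}(0)R^+_\infty\big).$$ **Proposition.** (i) There are $\nu>0$ and $C>0$ such that for $i\in\{\ell,r\}$ and $x\in\mathbb R$, $$\|U^0_i(x)-U_s\|+\|\partial_xU^0_i(x)\|\le Ce^{-\nu|x|},\tag{1}$$ and there are $\theta>0$ and $C>0$ such that for all sufficiently small $\varepsilon>0$ and both $i\in\{\ell,r\}$, $$\|\underline U^\varepsilon(y+X^\varepsilon_i)-U^0_i(y)\|+\|\partial_x\underline U^\varepsilon(y+X^\varepsilon_i)-\partial_xU^0_i(y)\|\le Ce^{-\theta|X^\varepsilon_i|},\qquad |y|\le|X^\varepsilon_i|.\tag{2}$$ (ii) For $\mathrm{Re}\,z>0$ the number $\tilde D^0(z)$ is well defined: admissible $R^\pm_\infty,L^\pm_\infty,P^0_{\pm,i}$ exist, and the value does not depend on their choice. (iii) Let $\nu,\theta>0$ be any exponents for which (1) and (2) hold (with some $C$). Let $K\subset\{\mathrm{Re}\,z>0\}$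 be compact, let $\sigma$ be the minimum of $|\mathrm{Re}\,\eta|$ over the eigenvalues $\eta$ of $A^0_\infty(z)$, $z\in K$, and let $\tilde\nu<\min(\theta,\nu,\sigma)$. Then there are $C>0$ and $\varepsilon_0>0$ such that for all $0<\varepsilon<\varepsilon_0$, all $z\in K$ and all $\gamma\in\mathbb C$ with $|\gamma|=1$, $$\big|\tilde D^\varepsilon(z,\gamma)-\tilde D^0(z)\big|\le Ce^{-\tilde\nu X^\varepsilon/2}.$$ -/

import Mathlib

open scoped ContDiff

noncomputable section

namespace TwoPulse

/-! ### The Hamiltonian equation and its travelling waves -/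

/-- Coefficients of `∂ₜ U = ∂ₓ (B δℋ[U])` together with the wave parameters `(𝛌, c)`.

* `scalar`: `N = 1`, `U = v`, `B = b`, `ℋ = f(v) + ½ κ(v) vₓ²`, `𝛌 = lam1`.
* `system`: `N = 2`, `U = (v, u)`, `B = [[0, b], [b, 0]]`,
  `ℋ = ½ τ(v) u² + f(v) + ½ κ(v) vₓ²`, `𝛌 = (lam1, lam2)`.

The functions are only meaningful on the open interval `I`. -/
inductive Model where
  | scalar (I : Set ℝ) (κ f : ℝ → ℝ) (b c lam1 : ℝ) : Model
  | system (I : Set ℝ) (κ f τ : ℝ → ℝ) (b c lam1 lam2 : ℝ) : Model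

namespace Model

/-- Number of unknowns of the equation. -/
abbrev N : Model → ℕ
  | scalar .. => 1
  | system .. => 2

/-- Order of the spectral problem written as a first-order system. -/
abbrev dim : Model → ℕ
  | scalar .. => 3
  | system .. => 4

def I : Model → Set ℝ
  | scalar I .. => I
  | system I .. => I

def κ : Model → ℝ → ℝ
  | scalar _ κ .. => κ
  | system _ κ .. => κ

/-- The structural assumptions: `I` is an open interval, the coefficients are smooth on `I`,
`b ≠ 0`, `κ > 0`, and `τ > 0` if `N = 2`. -/
def Admissible : Model → Prop
  | scalar I κ f b _ _ =>
      IsOpen I ∧ I.OrdConnected ∧ ContDiffOn ℝ ∞ κ I ∧ ContDiffOn ℝ ∞ f I ∧ b ≠ 0 ∧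
        ∀ v ∈ I, 0 < κ v
  | system I κ f τ b _ _ _ =>
      IsOpen I ∧ I.OrdConnected ∧ ContDiffOn ℝ ∞ κ I ∧ ContDiffOn ℝ ∞ f I ∧
        ContDiffOn ℝ ∞ τ I ∧ b ≠ 0 ∧ (∀ v ∈ I, 0 < κ v) ∧ ∀ v ∈ I, 0 < τ v

/-- `u = g(v)` along a travelling wave of the system. -/
def g (τ : ℝ → ℝ) (b c lam2 : ℝ) (v : ℝ) : ℝ := -(1 / τ v) * (c / b * v + lam2)

/-- The potential `𝒲(· ; 𝛌, c)`. -/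
def W : Model → ℝ → ℝ
  | scalar _ _ f b c lam1, v => -f v - 1 / 2 * (c / b) * v ^ 2 - lam1 * v
  | system _ _ f τ b c lam1 lam2, v =>
      -f v + 1 / 2 * τ v * g τ b c lam2 v ^ 2 - lam1 * v

/-- The state `U` carried by the value `v`: `U = v` if `N = 1`, `U = (v, g(v))` if `N = 2`. -/
def lift : (M : Model) → ℝ → Fin M.N → ℝ
  | scalar .., v => ![v]
  | system _ _ _ τ b c _ lam2, v => ![v, g τ b c lam2 v]

/-- The potential has a saddle value `vs` and, on either side of it, a simple turning point at the
same energy level: there are two homoclinic orbits with the common endstate `vs`. -/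
structure TwoHomoclinics (M : Model) (vl vs vr : ℝ) : Prop where
  mem_l : vl ∈ M.I
  mem_s : vs ∈ M.I
  mem_r : vr ∈ M.I
  lt_l : vl < vs
  lt_r : vs < vr
  level_l : M.W vl = M.W vs
  level_r : M.W vr = M.W vs
  slope_l : deriv M.W vl < 0
  slope_r : 0 < deriv M.W vr
  crit : deriv M.W vs = 0
  saddle : deriv (deriv M.W) vs < 0
  below : ∀ v ∈ Set.Ioo vl vs ∪ Set.Ioo vs vr, M.W v < M.W vs

/-- `v` is (the first component of) a travelling wave profile of energy `μ`: it solves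
`½ κ(v) vₓ² + 𝒲(v) = μ` and the Euler–Lagrange equation `κ(v) vₓₓ + ½ κ'(v) vₓ² + 𝒲'(v) = 0`. -/
structure IsProfile (M : Model) (μ : ℝ) (v : ℝ → ℝ) : Prop where
  smooth : ContDiff ℝ 2 v
  mem : ∀ x, v x ∈ M.I
  energy : ∀ x, 1 / 2 * M.κ (v x) * deriv v x ^ 2 + M.W (v x) = μ
  eulerLagrange : ∀ x, M.κ (v x) * deriv (deriv v) x
    + 1 / 2 * deriv M.κ (v x) * deriv v x ^ 2 + deriv M.W (v x) = 0

/-- `v` is the profile of the soliton with endstate `vs`, equal at `x = 0` to the turning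
point `v0`. -/
structure IsSoliton (M : Model) (vs v0 : ℝ) (v : ℝ → ℝ) : Prop where
  profile : M.IsProfile (M.W vs) v
  center : v 0 = v0
  endstate_top : Filter.Tendsto v Filter.atTop (nhds vs)
  endstate_bot : Filter.Tendsto v Filter.atBot (nhds vs)

/-- `v` is the two-pulse periodic wave of energy `μ_s + ε²`, placed so that `v(0) = vs` and
`vₓ(0) > 0`; `X` is its period, `Xr` the first positive zero and `Xl` the last negative zero
of `vₓ`. -/
structure IsTwoPulse (M : Model) (vs ε : ℝ) (v : ℝ → ℝ) (Xl Xr X : ℝ) : Prop where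
  profile : M.IsProfile (M.W vs + ε ^ 2) v
  value_zero : v 0 = vs
  slope_zero : 0 < deriv v 0
  period : IsLeast {p : ℝ | 0 < p ∧ Function.Periodic v p} X
  first_max : IsLeast {x : ℝ | 0 < x ∧ deriv v x = 0} Xr
  last_min : IsGreatest {x : ℝ | x < 0 ∧ deriv v x = 0} Xl

/-- Both solitons converge to their endstate at the exponential rate `ν`. -/
def SolitonDecay (M : Model) (vs : ℝ) (ul ur : ℝ → ℝ) (ν : ℝ) : Prop :=
  ∃ C > 0, ∀ u ∈ ({ul, ur} : Set (ℝ → ℝ)), ∀ x : ℝ,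
    ‖M.lift (u x) - M.lift vs‖ + ‖deriv (fun y => M.lift (u y)) x‖ ≤ C * Real.exp (-ν * |x|)

/-- As `ε → 0`, each half of the two-pulse wave converges to the corresponding soliton at the
exponential rate `θ`. -/
def WaveConvergence (M : Model) (vs : ℝ) (ul ur : ℝ → ℝ) (θ : ℝ) : Prop :=
  ∃ C > 0, ∃ ε₀ > 0, ∀ ε : ℝ, 0 < ε → ε < ε₀ →
    ∀ (v : ℝ → ℝ) (Xl Xr X : ℝ), M.IsTwoPulse vs ε v Xl Xr X →
      (∀ y ∈ Set.Icc Xl (-Xl),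
        ‖M.lift (v (y + Xl)) - M.lift (ul y)‖
          + ‖deriv (fun x => M.lift (v x)) (y + Xl) - deriv (fun x => M.lift (ul x)) y‖
          ≤ C * Real.exp (θ * Xl)) ∧
      (∀ y ∈ Set.Icc (-Xr) Xr,
        ‖M.lift (v (y + Xr)) - M.lift (ur y)‖
          + ‖deriv (fun x => M.lift (v x)) (y + Xr) - deriv (fun x => M.lift (ur x)) y‖
          ≤ C * Real.exp (-θ * Xr))

/-! ### The spectral problem as a first-order system -/

/-- The common zeroth-order part `f''(v) + ½ κ''(v) vₓ² - ∂ₓ(κ'(v) vₓ)` of the Hessian. -/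
def q₀ (κ f : ℝ → ℝ) (v : ℝ → ℝ) (x : ℝ) : ℝ :=
  deriv (deriv f) (v x) + 1 / 2 * deriv (deriv κ) (v x) * deriv v x ^ 2
    - deriv (fun y => deriv κ (v y) * deriv v y) x

/-- Zeroth-order coefficient of the Hessian for `N = 1`. -/
def qS (κ f : ℝ → ℝ) (b c : ℝ) (v : ℝ → ℝ) (x : ℝ) : ℝ := q₀ κ f v x + c / b

/-- Zeroth-order coefficient of the upper left entry of the Hessian for `N = 2`. -/
def qE (κ f τ : ℝ → ℝ) (b c lam2 : ℝ) (v : ℝ → ℝ) (x : ℝ) : ℝ :=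
  q₀ κ f v x + 1 / 2 * deriv (deriv τ) (v x) * g τ b c lam2 (v x) ^ 2

/-- Off-diagonal entry `τ'(v) u + c / b` of the Hessian for `N = 2`. -/
def aE (τ : ℝ → ℝ) (b c lam2 : ℝ) (v : ℝ → ℝ) (x : ℝ) : ℝ :=
  deriv τ (v x) * g τ b c lam2 (v x) + c / b

/-- The Hessian `Hess(ℋ + cQ)[v]` acting on `p`, for `N = 1`. -/
def hessS (κ f : ℝ → ℝ) (b c : ℝ) (v : ℝ → ℝ) (p : ℝ → ℂ) (x : ℝ) : ℂ :=
  -deriv (fun y => (κ (v y) : ℂ) * deriv p y) x + (qS κ f b c v x : ℂ) * p x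

/-- First component of `Hess(ℋ + cQ)[(v, g(v))]` acting on `(p, w)`, for `N = 2`. -/
def hessE₁ (κ f τ : ℝ → ℝ) (b c lam2 : ℝ) (v : ℝ → ℝ) (p w : ℝ → ℂ) (x : ℝ) : ℂ :=
  -deriv (fun y => (κ (v y) : ℂ) * deriv p y) x + (qE κ f τ b c lam2 v x : ℂ) * p x
    + (aE τ b c lam2 v x : ℂ) * w x

/-- Second component of `Hess(ℋ + cQ)[(v, g(v))]` acting on `(p, w)`, for `N = 2`. -/
def hessE₂ (τ : ℝ → ℝ) (b c lam2 : ℝ) (v : ℝ → ℝ) (p w : ℝ → ℂ) (x : ℝ) : ℂ :=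
  (aE τ b c lam2 v x : ℂ) * p x + (τ (v x) : ℂ) * w x

/-- Coefficient matrix `A(x, z)` of the eigenvalue problem `z V = B ∂ₓ Hess(ℋ + cQ)[U] V` at the
profile `v`, written as `W' = A(x, z) W` with
* `N = 1`, `V = p`: `W = (p, κ(v) p', Hess V)`;
* `N = 2`, `V = (p, w)`: `W = (p, κ(v) p', (Hess V)₁, (Hess V)₂)`. -/
def A : (M : Model) → (ℝ → ℝ) → ℝ → ℂ → Matrix (Fin M.dim) (Fin M.dim) ℂ
  | scalar _ κ f b c _, v, x, z =>
      !![0, 1 / (κ (v x) : ℂ), 0;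
         (qS κ f b c v x : ℂ), 0, -1;
         z / b, 0, 0]
  | system _ κ f τ b c _ lam2, v, x, z =>
      !![0, 1 / (κ (v x) : ℂ), 0, 0;
         (qE κ f τ b c lam2 v x : ℂ) - (aE τ b c lam2 v x : ℂ) ^ 2 / τ (v x), 0, -1,
           (aE τ b c lam2 v x : ℂ) / τ (v x);
         -(z / b) * ((aE τ b c lam2 v x : ℂ) / τ (v x)), 0, 0, z / b / τ (v x);
         z / b, 0, 0, 0]

/-- Coefficient matrix at the constant endstate. -/
def Ainf (M : Model) (vs : ℝ) (z : ℂ) : Matrix (Fin M.dim) (Fin M.dim) ℂ :=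
  M.A (fun _ => vs) 0 z

/-- For `N = 1`, the first-order system is the eigenvalue problem. -/
theorem scalar_firstOrder (I : Set ℝ) (κ f : ℝ → ℝ) (b c lam1 : ℝ) (v : ℝ → ℝ) (z : ℂ)
    (p : ℝ → ℂ) (hb : b ≠ 0) (hκ : ∀ x, κ (v x) ≠ 0) (hp : Differentiable ℝ p)
    (hp' : Differentiable ℝ fun y => (κ (v y) : ℂ) * deriv p y)
    (hH : Differentiable ℝ (hessS κ f b c v p)) :
    (∀ x i, HasDerivAt (fun y => (![p y, κ (v y) * deriv p y, hessS κ f b c v p y] : Fin 3 → ℂ) i)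
      (((scalar I κ f b c lam1).A v x z).mulVec
        ![p x, κ (v x) * deriv p x, hessS κ f b c v p x] i) x) ↔
    ∀ x, z * p x = b * deriv (hessS κ f b c v p) x := by
  have hb' : (b : ℂ) ≠ 0 := by exact_mod_cast hb
  constructor
  · intro h x
    have h2 := (h x 2).deriv
    simp only [A, Matrix.mulVec, dotProduct, Fin.sum_univ_three] at h2
    simp at h2
    rw [h2]; field_simp
  · intro h x i
    have hk : (κ (v x) : ℂ) ≠ 0 := by exact_mod_cast hκ x
    fin_cases i
    · refine HasDerivAt.congr_deriv (f := p) (hp x).hasDerivAt ?_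
      simp [A, Matrix.mulVec, dotProduct, Fin.sum_univ_three]
      field_simp
    · refine HasDerivAt.congr_deriv (f := (fun y => (κ (v y) : ℂ) * deriv p y)) (hp' x).hasDerivAt ?_
      simp [A, Matrix.mulVec, dotProduct, Fin.sum_univ_three, hessS]
    · refine HasDerivAt.congr_deriv (f := hessS κ f b c v p) (hH x).hasDerivAt ?_
      simp [A, Matrix.mulVec, dotProduct, Fin.sum_univ_three]
      have := h x
      field_simp
      linear_combination -this

/-- For `N = 2`, the first-order system is the eigenvalue problem. -/
theorem system_firstOrder (I : Set ℝ) (κ f τ : ℝ → ℝ) (b c lam1 lam2 : ℝ) (v : ℝ → ℝ) (z : ℂ)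
    (p w : ℝ → ℂ) (hb : b ≠ 0) (hκ : ∀ x, κ (v x) ≠ 0) (hτ : ∀ x, τ (v x) ≠ 0)
    (hp : Differentiable ℝ p)
    (hp' : Differentiable ℝ fun y => (κ (v y) : ℂ) * deriv p y)
    (h₁ : Differentiable ℝ (hessE₁ κ f τ b c lam2 v p w))
    (h₂ : Differentiable ℝ (hessE₂ τ b c lam2 v p w)) :
    (∀ x i, HasDerivAt (fun y => (![p y, κ (v y) * deriv p y, hessE₁ κ f τ b c lam2 v p w y,
        hessE₂ τ b c lam2 v p w y] : Fin 4 → ℂ) i)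
      (((system I κ f τ b c lam1 lam2).A v x z).mulVec
        ![p x, κ (v x) * deriv p x, hessE₁ κ f τ b c lam2 v p w x,
          hessE₂ τ b c lam2 v p w x] i) x) ↔
    ∀ x, z * p x = b * deriv (hessE₂ τ b c lam2 v p w) x ∧
      z * w x = b * deriv (hessE₁ κ f τ b c lam2 v p w) x := by
  have hb' : (b : ℂ) ≠ 0 := by exact_mod_cast hb
  constructor
  · intro h x
    have ht : (τ (v x) : ℂ) ≠ 0 := by exact_mod_cast hτ x
    have h3 := (h x 3).deriv
    have h2 := (h x 2).deriv
    simp only [A, Matrix.mulVec, dotProduct, Fin.sum_univ_four] at h2 h3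
    simp at h2 h3
    rw [h2, h3]
    constructor
    · field_simp
    · rw [hessE₂]; field_simp; ring
  · intro h x i
    have hk : (κ (v x) : ℂ) ≠ 0 := by exact_mod_cast hκ x
    have ht : (τ (v x) : ℂ) ≠ 0 := by exact_mod_cast hτ x
    fin_cases i
    · refine HasDerivAt.congr_deriv (f := p) (hp x).hasDerivAt ?_
      simp [A, Matrix.mulVec, dotProduct, Fin.sum_univ_four]
      field_simp
    · refine HasDerivAt.congr_deriv (f := (fun y => (κ (v y) : ℂ) * deriv p y)) (hp' x).hasDerivAt ?_
      simp [A, Matrix.mulVec, dotProduct, Fin.sum_univ_four, hessE₁, hessE₂]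
      field_simp
      ring
    · refine HasDerivAt.congr_deriv (f := hessE₁ κ f τ b c lam2 v p w) (h₁ x).hasDerivAt ?_
      simp [A, Matrix.mulVec, dotProduct, Fin.sum_univ_four, hessE₂]
      have := (h x).2
      field_simp
      linear_combination -(τ (v x) : ℂ) * this
    · refine HasDerivAt.congr_deriv (f := hessE₂ τ b c lam2 v p w) (h₂ x).hasDerivAt ?_
      simp [A, Matrix.mulVec, dotProduct, Fin.sum_univ_four]
      have := (h x).1
      field_simp
      linear_combination -this

end Model

/-! ### Evans functions -/

section Evans

variable {ι : Type} [Fintype ι] [DecidableEq ι]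

/-- Sum of the generalized eigenspaces of the eigenvalues with negative real part. -/
def stableSubspace (A : Matrix ι ι ℂ) : Submodule ℂ (ι → ℂ) :=
  ⨆ μ : {μ : ℂ // μ.re < 0}, Module.End.maxGenEigenspace (Matrix.toLin' A) (μ : ℂ)

/-- Sum of the generalized eigenspaces of the eigenvalues with positive real part. -/
def unstableSubspace (A : Matrix ι ι ℂ) : Submodule ℂ (ι → ℂ) :=
  ⨆ μ : {μ : ℂ // 0 < μ.re}, Module.End.maxGenEigenspace (Matrix.toLin' A) (μ : ℂ)

/-- A choice of `R⁻`, `R⁺`, `L⁻`, `L⁺` for `A`: the columns of `R⁻` (of `R⁺`) are a basis of the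
unstable (of the stable) subspace of `A`, and `L⁻` over `L⁺` is the inverse of `(R⁻, R⁺)`.
`ns` is the dimension of the stable subspace. -/
structure SpectralFrame (A : Matrix ι ι ℂ) where
  nu : ℕ
  ns : ℕ
  Rm : Matrix ι (Fin nu) ℂ
  Rp : Matrix ι (Fin ns) ℂ
  Lm : Matrix (Fin nu) ι ℂ
  Lp : Matrix (Fin ns) ι ℂ
  indep_m : LinearIndependent ℂ Rm.col
  indep_p : LinearIndependent ℂ Rp.col
  span_m : Submodule.span ℂ (Set.range Rm.col) = unstableSubspace A
  span_p : Submodule.span ℂ (Set.range Rp.col) = stableSubspace A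
  left_inv : Matrix.fromRows Lm Lp * Matrix.fromCols Rm Rp = 1
  right_inv : Matrix.fromCols Rm Rp * Matrix.fromRows Lm Lp = 1

namespace SpectralFrame

variable {A : Matrix ι ι ℂ}

/-- Eigenprojection on the stable subspace, along the unstable one. -/
def projStable (F : SpectralFrame A) : Matrix ι ι ℂ := F.Rp * F.Lp

/-- Eigenprojection on the unstable subspace, along the stable one. -/
def projUnstable (F : SpectralFrame A) : Matrix ι ι ℂ := F.Rm * F.Lm

end SpectralFrame

/-- `Ψ` is a matrix solution of `Ψ' = A Ψ` on `ℝ` with invertible initial data. -/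
def IsFundamental (A : ℝ → Matrix ι ι ℂ) (Ψ : ℝ → Matrix ι ι ℂ) : Prop :=
  IsUnit (Ψ 0) ∧ ∀ x i j, HasDerivAt (fun y => Ψ y i j) ((A x * Ψ x) i j) x

/-- `P = P⁰₊` on `[0, ∞)`: the change of unknown `W = P Z` reduces `W' = A W` to `Z' = A∞ Z`, that
is `P' = A P - P A∞`, and `P → Id` at `+∞`. -/
structure IsConjugatorPlus (A : ℝ → Matrix ι ι ℂ) (Ainf : Matrix ι ι ℂ)
    (P : ℝ → Matrix ι ι ℂ) : Prop where
  isUnit : ∀ y ∈ Set.Ici (0 : ℝ), IsUnit (P y)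
  ode : ∀ y ∈ Set.Ici (0 : ℝ), ∀ i j,
    HasDerivWithinAt (fun x => P x i j) ((A y * P y - P y * Ainf) i j) (Set.Ici 0) y
  tendsto_one : Filter.Tendsto P Filter.atTop (nhds 1)

/-- `P = P⁰₋` on `(-∞, 0]`, with `P → Id` at `-∞`. -/
structure IsConjugatorMinus (A : ℝ → Matrix ι ι ℂ) (Ainf : Matrix ι ι ℂ)
    (P : ℝ → Matrix ι ι ℂ) : Prop where
  isUnit : ∀ y ∈ Set.Iic (0 : ℝ), IsUnit (P y)
  ode : ∀ y ∈ Set.Iic (0 : ℝ), ∀ i j,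
    HasDerivWithinAt (fun x => P x i j) ((A y * P y - P y * Ainf) i j) (Set.Iic 0) y
  tendsto_one : Filter.Tendsto P Filter.atBot (nhds 1)

/-- The balanced periodic Evans function
`Ẽ = det(Ψ(0) Ψ(2 Xl)⁻¹ - γ Ψ(0) Ψ(2 Xr)⁻¹)`. -/
def balancedEvans (Ψ : ℝ → Matrix ι ι ℂ) (Xl Xr : ℝ) (γ : ℂ) : ℂ :=
  (Ψ 0 * (Ψ (2 * Xl))⁻¹ - γ • (Ψ 0 * (Ψ (2 * Xr))⁻¹)).det

/-- The rescaled balanced periodic Evans function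
`D̃ = exp(2 Xr tr(A∞ Πₛ)) exp(2 Xl tr(A∞ Πᵤ)) (-γ)^(-nₛ) Ẽ`. -/
def rescaledEvans {Ainf : Matrix ι ι ℂ} (F : SpectralFrame Ainf) (Ψ : ℝ → Matrix ι ι ℂ)
    (Xl Xr : ℝ) (γ : ℂ) : ℂ :=
  Complex.exp ((Ainf * F.projStable).trace * (2 * Xr)) *
    Complex.exp ((Ainf * F.projUnstable).trace * (2 * Xl)) *
    ((-γ) ^ F.ns)⁻¹ * balancedEvans Ψ Xl Xr γ

/-- `d` is the value
`det(L⁻ P₊ₗ(0)⁻¹ P₋ₗ(0) R⁻) det(L⁺ P₋ᵣ(0)⁻¹ P₊ᵣ(0) R⁺)` of the limit determinant `D̃⁰` for the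
coefficient matrices `Al`, `Ar` of the two solitons with common limit `Ainf`. -/
def IsLimitEvans (Al Ar : ℝ → Matrix ι ι ℂ) (Ainf : Matrix ι ι ℂ) (d : ℂ) : Prop :=
  ∃ (F : SpectralFrame Ainf) (Pml Ppl Pmr Ppr : ℝ → Matrix ι ι ℂ),
    IsConjugatorMinus Al Ainf Pml ∧ IsConjugatorPlus Al Ainf Ppl ∧
    IsConjugatorMinus Ar Ainf Pmr ∧ IsConjugatorPlus Ar Ainf Ppr ∧
    d = (F.Lm * (Ppl 0)⁻¹ * Pml 0 * F.Rm).det * (F.Lp * (Pmr 0)⁻¹ * Ppr 0 * F.Rp).det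

end Evans

end TwoPulse

end

open scoped ContDiff

noncomputable section

namespace TwoPulse

open Set Filter Topology
open scoped ComplexConjugate
open Matrix (isUnit_iff_isUnit_det of_apply det_mul trace_mul_comm trace_smul trace_add
  trace_sub mul_nonsing_inv mul_nonsing_inv_cancel_right mul_nonsing_inv_cancel_left
  nonsing_inv_mul det_nonsing_inv mulVec_mulVec mulVec_smul submatrix_apply reindex_apply
  mul_diagonal ext_of_mulVec_single one_apply_ne mul_adjugate mulVec_single_one
  conjTranspose_apply smul_mul)
open Finset (sum_congr sum_add_distrib mul_sum sum_const card_univ single_le_sum add_sum_erase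
  sum_le_sum ne_of_mem_erase sum_eq_single sum_nonneg sum_sub_distrib)
open Fintype (card card_fin)
open Complex (normSq norm_real normSq_nonneg normSq_apply)
open Real (exp exp_add exp_nonneg exp_pos norm_eq_abs exp_le_one_iff exp_le_exp)
local notation "Mat6" => Matrix (Fin 6) (Fin 6) ℂ
local notation "cexp" => Complex.exp
local notation "Mat2" => Matrix (Fin 2) (Fin 2) ℂ
local notation "Mat3" => Matrix (Fin 3) (Fin 3) ℂ
local notation "Mat4" => Matrix (Fin 4) (Fin 4) ℂ

section

/-! ### A weighted energy estimate for linear systems -/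

lemma exp_neg_abs_mul_cosh_le (t : ℝ) : exp (-|t|) * Real.cosh t ≤ 1 := by
  rw [← Real.cosh_abs, Real.cosh_eq]
  have h1 : exp (-|t|) * exp |t| = 1 := by rw [← exp_add]; simp
  have h2 : exp (-|t|) ≤ 1 := exp_le_one_iff.2 (by simp)
  have h3 := exp_pos (-|t|)
  nlinarith

/-- Gronwall's inequality with an exponentially localized rate. -/
lemma gronwall_exp_decay {E E' : ℝ → ℝ} {a b c δ : ℝ} (hab : a ≤ b) (hδ : 0 < δ) (hc : 0 ≤ c)
    (hcont : ContinuousOn E (Icc a b)) (hd : ∀ x ∈ Ioo a b, HasDerivAt E (E' x) x)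
    (hE : ∀ x ∈ Ioo a b, E' x ≤ c * exp (-δ * |x|) * E x) (hpos : ∀ x ∈ Icc a b, 0 ≤ E x) :
    E b ≤ exp (c * Real.pi / δ) * E a := by
  set k : ℝ → ℝ := fun x => c / δ * Real.arctan (Real.sinh (δ * x)) with hk
  have hkd : ∀ x, HasDerivAt k (c / Real.cosh (δ * x)) x := fun x => by
    have h1 : HasDerivAt (fun x : ℝ => δ * x) δ x := by simpa using (hasDerivAt_id x).const_mul δ
    have h2 := ((h1.sinh).arctan).const_mul (c / δ)
    refine h2.congr_deriv ?_
    have hp := Real.cosh_pos (δ * x)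
    rw [add_comm 1 (Real.sinh (δ * x) ^ 2), ← Real.cosh_sq]; field_simp
  have hkb : ∀ x, |k x| ≤ c / δ * (Real.pi / 2) := fun x => by
    rw [hk, abs_mul, abs_of_nonneg (by positivity : 0 ≤ c / δ)]
    gcongr
    rw [abs_le]; exact ⟨(Real.neg_pi_div_two_lt_arctan _).le, (Real.arctan_lt_pi_div_two _).le⟩
  have hanti : AntitoneOn (fun x => E x * exp (-k x)) (Icc a b) := by
    have hder : ∀ x ∈ Ioo a b, HasDerivAt (fun x => E x * exp (-k x))
        (E' x * exp (-k x) + E x * (exp (-k x) * -(c / Real.cosh (δ * x)))) x :=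
      fun x hx => (hd x hx).mul (hkd x).neg.exp
    apply antitoneOn_of_deriv_nonpos (convex_Icc a b)
    · apply hcont.mul
      have : Continuous k := continuous_iff_continuousAt.2 fun x => (hkd x).continuousAt
      exact (Real.continuous_exp.comp this.neg).continuousOn
    · rw [interior_Icc]; exact fun x hx => (hder x hx).differentiableAt.differentiableWithinAt
    · rw [interior_Icc]
      intro x hx
      rw [(hder x hx).deriv]
      have h1 := hE x hx
      have h2 := hpos x (Ioo_subset_Icc_self hx)
      have h3 : exp (-δ * |x|) ≤ 1 / Real.cosh (δ * x) := by
        rw [le_div_iff₀ (Real.cosh_pos _)]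
        have := exp_neg_abs_mul_cosh_le (δ * x)
        rwa [abs_mul, abs_of_pos hδ, ← neg_mul] at this
      have h4 : E' x ≤ c / Real.cosh (δ * x) * E x := by
        refine h1.trans ?_
        gcongr
        calc c * exp (-δ * |x|) ≤ c * (1 / Real.cosh (δ * x)) := by gcongr
          _ = _ := by ring
      have h5 := exp_pos (-k x)
      nlinarith
  have h := hanti (left_mem_Icc.2 hab) (right_mem_Icc.2 hab) hab
  simp only at h
  have ea := hpos a (left_mem_Icc.2 hab)
  have : E b ≤ E a * exp (k b - k a) := by
    have h1 : E b = E b * exp (-k b) * exp (k b) := by rw [mul_assoc, ← exp_add]; simp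
    rw [h1]
    calc _ ≤ E a * exp (-k a) * exp (k b) := by gcongr
      _ = _ := by rw [mul_assoc, ← exp_add]; ring_nf
  refine this.trans ?_
  rw [mul_comm]
  gcongr
  have h1 := abs_le.1 (hkb a)
  have h2 := abs_le.1 (hkb b)
  have : c * Real.pi / δ = 2 * (c / δ * (Real.pi / 2)) := by ring
  linarith [h1.1, h2.2]

lemma hasDerivAt_normSq {u : ℝ → ℂ} {u' : ℂ} {x : ℝ} (h : HasDerivAt u u' x) :
    HasDerivAt (fun y => ‖u y‖ ^ 2) (2 * (conj (u x) * u').re) x := by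
  have := h.norm_sq
  convert this using 2
  rw [Complex.inner, mul_comm]

variable {κ : Type*} [Fintype κ] [DecidableEq κ]

/-- Growth constant of the weighted energy. -/
def energyConst (n : ℕ) (K δ : ℝ) : ℝ := exp ((2 * n + 1) * K * Real.pi / δ)

lemma pointwise_energy {D R : Matrix κ κ ℂ} {ψ f : κ → ℂ} {m : κ → ℝ} {x k β F : ℝ}
    (hD : ∀ i, (D i i).re + m i + 1 / 2 * ∑ j ∈ Finset.univ.erase i, (‖D i j‖ + ‖D j i‖) ≤ 0)
    (hDm : ∀ i j, D i j ≠ 0 → m i = m j) (hm : ∀ i j, |m i - m j| ≤ β) (hk : 0 ≤ k)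
    (hR : ∀ i j, exp (β * |x|) * ‖R i j‖ ≤ k) (hf : ∀ i, exp (m i * x) * ‖f i‖ ≤ F * k) :
    ∑ i, (exp (2 * m i * x) * (2 * m i) * ‖ψ i‖ ^ 2 + exp (2 * m i * x) *
      (2 * (conj (ψ i) * (∑ j, (D i j + R i j) * ψ j + f i)).re)) ≤
    (2 * card κ + 1) * k * (∑ i, (exp (m i * x) * ‖ψ i‖) ^ 2
      + card κ * F ^ 2) := by
  set a : κ → ℝ := fun i => exp (m i * x) * ‖ψ i‖ with ha
  have ha0 : ∀ i, 0 ≤ a i := fun i => by positivity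
  have hexp : ∀ i, exp (2 * m i * x) = exp (m i * x) * exp (m i * x) := by
    intro i; rw [← exp_add]; ring_nf
  have hRe : ∀ z w : ℂ, (conj z * w).re ≤ ‖z‖ * ‖w‖ := fun z w => by
    calc _ ≤ ‖conj z * w‖ := Complex.re_le_norm _
      _ = _ := by rw [norm_mul, RCLike.norm_conj]
  have key : ∀ i, exp (2 * m i * x) * (2 * m i) * ‖ψ i‖ ^ 2 + exp (2 * m i * x) *
      (2 * (conj (ψ i) * (∑ j, (D i j + R i j) * ψ j + f i)).re) ≤
      2 * ((D i i).re + m i) * a i ^ 2 +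
      ∑ j ∈ Finset.univ.erase i, ‖D i j‖ * (a i ^ 2 + a j ^ 2) +
      ∑ j, k * (a i ^ 2 + a j ^ 2) + k * (a i ^ 2 + F ^ 2) := fun i => by
    have e1 : (conj (ψ i) * (∑ j, (D i j + R i j) * ψ j + f i)).re = (D i i).re * ‖ψ i‖ ^ 2
        + ∑ j ∈ Finset.univ.erase i, (conj (ψ i) * (D i j * ψ j)).re
        + ∑ j, (conj (ψ i) * (R i j * ψ j)).re
        + (conj (ψ i) * f i).re := by
      have e2 : (conj (ψ i) * (D i i * ψ i)).re = (D i i).re * ‖ψ i‖ ^ 2 := by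
        have : conj (ψ i) * (D i i * ψ i) = D i i * ((‖ψ i‖ ^ 2 : ℝ) : ℂ) := by
          rw [← Complex.normSq_eq_norm_sq, Complex.normSq_eq_conj_mul_self]; ring
        rw [this, Complex.re_mul_ofReal]
      rw [← e2, add_sum_erase _ (fun j => (conj (ψ i) * (D i j * ψ j)).re) (Finset.mem_univ i)]
      simp only [add_mul, sum_add_distrib, mul_add, mul_sum, Complex.add_re, Complex.re_sum]
    have b1 : ∀ j, exp (2 * m i * x) * (2 * (conj (ψ i) * (D i j * ψ j)).re) ≤
        ‖D i j‖ * (a i ^ 2 + a j ^ 2) := fun j => by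
      by_cases h : D i j = 0
      · simp [h]
      have hmm := hDm i j h
      have h1 := hRe (ψ i) (D i j * ψ j)
      rw [norm_mul] at h1
      calc _ ≤ exp (2 * m i * x) * (2 * (‖ψ i‖ * (‖D i j‖ * ‖ψ j‖))) := by gcongr
        _ = ‖D i j‖ * (2 * a i * a j) := by rw [hexp]; simp only [ha]; rw [← hmm]; ring
        _ ≤ _ := by gcongr; nlinarith [sq_nonneg (a i - a j)]
    have b2 : ∀ j, exp (2 * m i * x) * (2 * (conj (ψ i) * (R i j * ψ j)).re) ≤
        k * (a i ^ 2 + a j ^ 2) := fun j => by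
      have h1 := hRe (ψ i) (R i j * ψ j)
      rw [norm_mul] at h1
      have h2 : exp (m i * x) ≤ exp (m j * x) * exp (β * |x|) := by
        rw [← exp_add]
        gcongr
        have h3 : (m i - m j) * x ≤ |m i - m j| * |x| := by rw [← abs_mul]; exact le_abs_self _
        have h4 := mul_le_mul_of_nonneg_right (hm i j) (abs_nonneg x)
        linarith
      calc _ ≤ exp (2 * m i * x) * (2 * (‖ψ i‖ * (‖R i j‖ * ‖ψ j‖))) := by gcongr
        _ = exp (m i * x) * (‖R i j‖ * ‖ψ j‖ * 2 * a i) := by rw [hexp]; simp only [ha]; ring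
        _ ≤ (exp (m j * x) * exp (β * |x|)) * (‖R i j‖ * ‖ψ j‖ * 2 * a i) := by
            have := ha0 i
            gcongr
        _ = (exp (β * |x|) * ‖R i j‖) * (2 * a i * a j) := by simp only [ha]; ring
        _ ≤ k * (2 * a i * a j) := by
            have := ha0 i
            have := ha0 j
            exact mul_le_mul_of_nonneg_right (hR i j) (by positivity)
        _ ≤ _ := by gcongr; nlinarith [sq_nonneg (a i - a j)]
    have b3 : exp (2 * m i * x) * (2 * (conj (ψ i) * f i).re) ≤
        k * (a i ^ 2 + F ^ 2) := by
      have h1 := hRe (ψ i) (f i)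
      calc _ ≤ exp (2 * m i * x) * (2 * (‖ψ i‖ * ‖f i‖)) := by gcongr
        _ = (exp (m i * x) * ‖f i‖) * (2 * a i) := by rw [hexp]; simp only [ha]; ring
        _ ≤ (F * k) * (2 * a i) := by
            have := ha0 i
            exact mul_le_mul_of_nonneg_right (hf i) (by positivity)
        _ = k * (2 * a i * F) := by ring
        _ ≤ _ := by gcongr; nlinarith [sq_nonneg (a i - F)]
    have b4 : exp (2 * m i * x) * ‖ψ i‖ ^ 2 = a i ^ 2 := by rw [hexp]; simp only [ha]; ring
    rw [e1]
    have : exp (2 * m i * x) * (2 * m i) * ‖ψ i‖ ^ 2 + exp (2 * m i * x) *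
      (2 * ((D i i).re * ‖ψ i‖ ^ 2 + ∑ j ∈ Finset.univ.erase i, (conj (ψ i) * (D i j * ψ j)).re
        + ∑ j, (conj (ψ i) * (R i j * ψ j)).re
        + (conj (ψ i) * f i).re)) =
      2 * ((D i i).re + m i) * (exp (2 * m i * x) * ‖ψ i‖ ^ 2)
      + ∑ j ∈ Finset.univ.erase i, exp (2 * m i * x) * (2 * (conj (ψ i) * (D i j * ψ j)).re)
      + ∑ j, exp (2 * m i * x) * (2 * (conj (ψ i) * (R i j * ψ j)).re)
      + exp (2 * m i * x) * (2 * (conj (ψ i) * f i).re) := by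
      simp only [← mul_sum]; ring
    rw [this, b4]
    exact add_le_add (add_le_add (add_le_add le_rfl (sum_le_sum fun j _ => b1 j))
      (sum_le_sum fun j _ => b2 j)) b3
  refine (sum_le_sum fun i _ => key i).trans ?_
  have s1 : ∑ i, ∑ j ∈ Finset.univ.erase i, ‖D i j‖ * (a i ^ 2 + a j ^ 2) =
      ∑ i, (∑ j ∈ Finset.univ.erase i, (‖D i j‖ + ‖D j i‖)) * a i ^ 2 := by
    have e : ∀ g : κ → κ → ℝ, ∑ i, ∑ j ∈ Finset.univ.erase i, g i j
        = ∑ i, ∑ j, if i = j then 0 else g i j := fun g => by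
      refine sum_congr rfl fun i _ => ?_
      rw [← Finset.sum_erase Finset.univ (a := i) (by simp)]
      refine sum_congr rfl fun j hj => ?_
      rw [if_neg (ne_of_mem_erase hj).symm]
    simp only [mul_add, sum_add_distrib, add_mul, Finset.sum_mul]
    congr 1
    rw [e, e, Finset.sum_comm]
    refine sum_congr rfl fun i _ => sum_congr rfl fun j _ => ?_
    simp only [eq_comm]
  have s2 : ∑ i, ∑ j : κ, k * (a i ^ 2 + a j ^ 2) = 2 * card κ * k * ∑ i, a i ^ 2 := by
    simp only [mul_add, sum_add_distrib, sum_const, card_univ, nsmul_eq_mul, ← mul_sum]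
    ring
  have s3 : ∑ i : κ, k * (a i ^ 2 + F ^ 2) = k * ∑ i, a i ^ 2 + k * (card κ * F ^ 2) := by
    simp only [mul_add, sum_add_distrib, sum_const, card_univ, nsmul_eq_mul, ← mul_sum]
    ring
  have s4 : ∑ i, 2 * ((D i i).re + m i) * a i ^ 2 +
      ∑ i, (∑ j ∈ Finset.univ.erase i, (‖D i j‖ + ‖D j i‖)) * a i ^ 2 ≤ 0 := by
    rw [← sum_add_distrib]
    refine Finset.sum_nonpos fun i _ => ?_
    rw [← add_mul]
    refine mul_nonpos_of_nonpos_of_nonneg ?_ (sq_nonneg _)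
    linarith [hD i]
  simp only [sum_add_distrib]
  simp only [sum_add_distrib] at s1 s2 s3 s4
  have p1 : 0 ≤ 2 * (card κ : ℝ) * k * (card κ * F ^ 2) := by positivity
  have e5 : (2 * card κ + 1) * k * (∑ i, a i ^ 2 + card κ * F ^ 2) =
    2 * card κ * k * ∑ i, a i ^ 2 + (k * ∑ i, a i ^ 2 + k * (card κ * F ^ 2))
    + 2 * (card κ : ℝ) * k * (card κ * F ^ 2) := by ring
  rw [e5]; linarith [s1, s2, s3, s4, p1]

/-- Weighted energy estimate for `ψ' = (D + R) ψ + f`, where `D` is dissipative for the weights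
`exp (m i x)` and `R` is exponentially localized. -/
lemma weighted_energy {D : Matrix κ κ ℂ} {R : ℝ → Matrix κ κ ℂ} {ψ f : ℝ → κ → ℂ}
    {m : κ → ℝ} {a b K α β F : ℝ} (hab : a ≤ b) (hK : 0 ≤ K) (hβ : β < α)
    (hψc : ∀ i, ContinuousOn (fun x => ψ x i) (Icc a b))
    (hψ : ∀ x ∈ Ioo a b, ∀ i,
      HasDerivAt (fun y => ψ y i) (∑ j, (D i j + R x i j) * ψ x j + f x i) x)
    (hD : ∀ i, (D i i).re + m i + 1 / 2 * ∑ j ∈ Finset.univ.erase i, (‖D i j‖ + ‖D j i‖) ≤ 0)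
    (hDm : ∀ i j, D i j ≠ 0 → m i = m j) (hm : ∀ i j, |m i - m j| ≤ β)
    (hR : ∀ x ∈ Ioo a b, ∀ i j, ‖R x i j‖ ≤ K * exp (-α * |x|))
    (hf : ∀ x ∈ Ioo a b, ∀ i, exp (m i * x) * ‖f x i‖ ≤ F * (K * exp (-(α - β) * |x|))) :
    ∑ i, (exp (m i * b) * ‖ψ b i‖) ^ 2 + card κ * F ^ 2 ≤
      energyConst (card κ) K (α - β) *
        (∑ i, (exp (m i * a) * ‖ψ a i‖) ^ 2 + card κ * F ^ 2) := by
  have hsq : ∀ x i, (exp (m i * x) * ‖ψ x i‖) ^ 2 = exp (2 * m i * x) * ‖ψ x i‖ ^ 2 := fun x i => by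
    rw [mul_pow, ← Real.exp_nat_mul]; push_cast; ring_nf
  refine gronwall_exp_decay (E := fun x => ∑ i, (exp (m i * x) * ‖ψ x i‖) ^ 2 + card κ * F ^ 2)
    (E' := fun x => ∑ i, (exp (2 * m i * x) * (2 * m i) * ‖ψ x i‖ ^ 2
      + exp (2 * m i * x) * (2 * (conj (ψ x i) *
        (∑ j, (D i j + R x i j) * ψ x j + f x i)).re))) (δ := α - β)
    (c := (2 * card κ + 1) * K) hab (by linarith) (by positivity) ?_ ?_ ?_ ?_
  · refine ContinuousOn.add (continuousOn_finsetSum _ fun i _ => ?_) continuousOn_const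
    exact ((Continuous.continuousOn (by fun_prop)).mul (hψc i).norm).pow 2
  · intro x hx
    simp only [hsq]
    refine HasDerivAt.add_const _ (HasDerivAt.fun_sum fun i _ => ?_)
    have h1 : HasDerivAt (fun x : ℝ => exp (2 * m i * x)) (exp (2 * m i * x) * (2 * m i)) x := by
      have : HasDerivAt (fun x : ℝ => 2 * m i * x) (2 * m i) x := by
        simpa using (hasDerivAt_id x).const_mul (2 * m i)
      exact this.exp
    exact h1.mul (hasDerivAt_normSq (hψ x hx i))
  · intro x hx
    have := pointwise_energy (ψ := ψ x) (f := f x) (R := R x) (x := x) (F := F)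
      (k := K * exp (-(α - β) * |x|)) hD hDm hm (by positivity) ?_ (hf x hx)
    · refine this.trans (le_of_eq ?_)
      ring
    · intro i j
      calc _ ≤ exp (β * |x|) * (K * exp (-α * |x|)) := by
            gcongr; exact hR x hx i j
        _ = K * (exp (β * |x|) * exp (-α * |x|)) := by ring
        _ = _ := by rw [← exp_add]; ring_nf
  · intro x hx; positivity

lemma isUnit_det {n : Type*} [Fintype n] [DecidableEq n] {R : Type*} [CommRing R]
    {A : Matrix n n R} (h : IsUnit A) : IsUnit A.det := (isUnit_iff_isUnit_det _).1 h

lemma norm_entry_le_sum {m n : Type*} [Fintype m] [Fintype n] (N : Matrix m n ℂ) (i : m) (j : n) :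
    ‖N i j‖ ≤ ∑ i, ∑ j, ‖N i j‖ :=
  (single_le_sum (f := fun j => ‖N i j‖) (fun _ _ => norm_nonneg _) (Finset.mem_univ j)).trans
    (single_le_sum (f := fun i => ∑ j, ‖N i j‖) (fun _ _ => sum_nonneg fun _ _ => norm_nonneg _)
      (Finset.mem_univ i))

end

section

variable {κ : Type*} [Fintype κ] [DecidableEq κ]

/-! ### Systems with one neutral direction and exponentially localized perturbations -/

/-- `ψ' = (D + R) ψ + f` on `[a, b]`. -/
def SolvesOn (D : Matrix κ κ ℂ) (R : ℝ → Matrix κ κ ℂ) (f ψ : ℝ → κ → ℂ) (a b : ℝ) : Prop :=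
  (∀ i, ContinuousOn (fun x => ψ x i) (Icc a b)) ∧ ∀ x ∈ Ioo a b, ∀ i,
    HasDerivAt (fun y => ψ y i) (∑ j, (D i j + R x i j) * ψ x j + f x i) x

lemma SolvesOn.mono {D : Matrix κ κ ℂ} {R : ℝ → Matrix κ κ ℂ} {f ψ : ℝ → κ → ℂ} {a b c d : ℝ}
    (h : SolvesOn D R f ψ a b) (hc : a ≤ c) (hd : d ≤ b) : SolvesOn D R f ψ c d :=
  ⟨fun i => (h.1 i).mono (Icc_subset_Icc hc hd), fun x hx => h.2 x (Ioo_subset_Ioo hc hd hx)⟩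

/-- The direction `o` is neutral and invariant for `D` and for its transpose, and the other
directions decay at a rate larger than `β`. -/
structure CenterGap (D : Matrix κ κ ℂ) (o : κ) (β : ℝ) : Prop where
  row : ∀ j, D o j = 0
  col : ∀ i, D i o = 0
  gap : ∀ i, i ≠ o → (D i i).re + β + 1 / 2 * ∑ j ∈ Finset.univ.erase i, (‖D i j‖ + ‖D j i‖) ≤ 0

/-- Propagation constant. -/
def centerConst (n : ℕ) (K δ : ℝ) : ℝ := 2 * n * energyConst n K δ

lemma one_le_energyConst {n : ℕ} {K δ : ℝ} (hK : 0 ≤ K) (hδ : 0 < δ) : 1 ≤ energyConst n K δ := by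
  rw [energyConst, Real.one_le_exp_iff]
  have := Real.pi_pos
  positivity

lemma one_le_centerConst [Nonempty κ] {K δ : ℝ} (hK : 0 ≤ K) (hδ : 0 < δ) :
    1 ≤ centerConst (card κ) K δ := by
  have h1 := one_le_energyConst (n := card κ) hK hδ
  have h2 : (1 : ℝ) ≤ card κ := by exact_mod_cast Fintype.card_pos
  rw [centerConst]; nlinarith

variable {D : Matrix κ κ ℂ} {R : ℝ → Matrix κ κ ℂ} {o : κ} {K α β : ℝ}
local notation "Cc" => centerConst (card κ) K (α - β)

lemma center_bound {f ψ : ℝ → κ → ℂ} {m a b F : ℝ} (hD : CenterGap D o β) (hK : 0 ≤ K)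
    (hβ : β < α) (hm : |m| ≤ β) (hab : a ≤ b) (hψ : SolvesOn D R f ψ a b)
    (hR : ∀ x ∈ Ioo a b, ∀ i j, ‖R x i j‖ ≤ K * exp (-α * |x|)) (hF : 0 ≤ F)
    (hfo : ∀ x ∈ Ioo a b, ‖f x o‖ ≤ F * (K * exp (-(α - β) * |x|)))
    (hf : ∀ x ∈ Ioo a b, ∀ i, i ≠ o → exp (m * x) * ‖f x i‖ ≤ F * (K * exp (-(α - β) * |x|)))
    (h0 : ‖ψ a o‖ ≤ F) (hi : ∀ i, i ≠ o → exp (m * a) * ‖ψ a i‖ ≤ F) :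
    ‖ψ b o‖ ≤ Cc * F ∧ ∀ i, i ≠ o →
      exp (m * b) * ‖ψ b i‖ ≤ Cc * F := by
  have : Nonempty κ := ⟨o⟩
  set w : κ → ℝ := fun i => if i = o then 0 else m with hw
  have hwo : w o = 0 := by simp [hw]
  have hwi : ∀ i, i ≠ o → w i = m := fun i h => by simp [hw, h]
  have hβ0 : 0 ≤ β := (abs_nonneg m).trans hm
  have E := weighted_energy (m := w) (D := D) (R := R) (f := f) (ψ := ψ) (F := F) hab hK hβ hψ.1 hψ.2
    ?_ ?_ ?_ hR ?_
  · have e1 : ∑ i, (exp (w i * a) * ‖ψ a i‖) ^ 2 ≤ card κ * F ^ 2 := by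
      rw [← nsmul_eq_mul, ← card_univ, ← sum_const]
      refine sum_le_sum fun i _ => ?_
      refine pow_le_pow_left₀ (by positivity) ?_ 2
      by_cases h : i = o
      · subst h; simpa [hwo] using h0
      · rw [hwi i h]; exact hi i h
    have e2 : ∀ i, exp (w i * b) * ‖ψ b i‖ ≤ Cc * F := fun i => by
      have hC := one_le_energyConst (n := card κ) hK (sub_pos.2 hβ)
      have hC' := one_le_centerConst (κ := κ) hK (sub_pos.2 hβ)
      refine (sq_le_sq₀ (by positivity) (by positivity)).1 ?_
      have e3 : (exp (w i * b) * ‖ψ b i‖) ^ 2 ≤ ∑ i, (exp (w i * b) * ‖ψ b i‖) ^ 2 :=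
        single_le_sum (f := fun i => (exp (w i * b) * ‖ψ b i‖) ^ 2)
          (fun i _ => sq_nonneg _) (Finset.mem_univ i)
      have e4 : (0 : ℝ) ≤ card κ * F ^ 2 := by positivity
      calc _ ≤ energyConst (card κ) K (α - β) *
            (card κ * F ^ 2 + card κ * F ^ 2) := by
              refine le_trans ?_ (mul_le_mul_of_nonneg_left (add_le_add_left e1 _) (by positivity))
              linarith
        _ = Cc * F ^ 2 := by rw [centerConst]; ring
        _ ≤ _ := by rw [mul_pow]; gcongr; nlinarith
    refine ⟨?_, fun i h => ?_⟩
    · simpa [hwo] using e2 o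
    · simpa [hwi i h] using e2 i
  · intro i
    by_cases h : i = o
    · subst h; simp [hwo, hD.row, hD.col]
    · have := hD.gap i h
      rw [hwi i h]; linarith [(abs_le.1 hm).2]
  · intro i j hij
    by_cases h : i = o
    · subst h; exact absurd (hD.row j) hij
    · by_cases h' : j = o
      · subst h'; exact absurd (hD.col i) hij
      · rw [hwi i h, hwi j h']
  · intro i j
    simp only [hw]
    split_ifs <;> simp [hβ0, hm]
  · intro x hx i
    by_cases h : i = o
    · subst h; simpa [hwo] using hfo x hx
    · rw [hwi i h]; exact hf x hx i h

/-- The estimate of `center_bound` with the symmetric weight `exp (m |x|)`. -/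
lemma center_bound_abs {f ψ : ℝ → κ → ℂ} {m a b F : ℝ} (hD : CenterGap D o β) (hK : 0 ≤ K)
    (hβ : β < α) (hm : |m| ≤ β) (hab : a ≤ b) (hψ : SolvesOn D R f ψ a b)
    (hR : ∀ x ∈ Ioo a b, ∀ i j, ‖R x i j‖ ≤ K * exp (-α * |x|)) (hF : 0 ≤ F)
    (hfo : ∀ x ∈ Ioo a b, ‖f x o‖ ≤ F * (K * exp (-(α - β) * |x|)))
    (hf : ∀ x ∈ Ioo a b, ∀ i, i ≠ o → exp (m * |x|) * ‖f x i‖ ≤ F * (K * exp (-(α - β) * |x|)))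
    (h0 : ‖ψ a o‖ ≤ F) (hi : ∀ i, i ≠ o → exp (m * |a|) * ‖ψ a i‖ ≤ F) :
    ‖ψ b o‖ ≤ Cc ^ 2 * F ∧ ∀ i, i ≠ o →
      exp (m * |b|) * ‖ψ b i‖ ≤ Cc ^ 2 * F := by
  have : Nonempty κ := ⟨o⟩
  set C := Cc with hC
  have hC1 : 1 ≤ C := one_le_centerConst hK (sub_pos.2 hβ)
  have hm' : |(-m)| ≤ β := by rwa [abs_neg]
  have hCF : C * F ≤ C ^ 2 * F := mul_le_mul_of_nonneg_right (by nlinarith) hF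
  rcases le_or_gt b 0 with hb | hb
  · have neg : ∀ x, x ≤ b → m * |x| = -m * x := fun x hx => by
      rw [abs_of_nonpos (hx.trans hb)]; ring
    have := center_bound (m := -m) hD hK hβ hm' hab hψ hR hF hfo
      (fun x hx i h => by rw [← neg x hx.2.le]; exact hf x hx i h) h0
      (fun i h => by rw [← neg a hab]; exact hi i h)
    refine ⟨this.1.trans hCF, fun i h => ?_⟩
    rw [neg b le_rfl]; exact (this.2 i h).trans hCF
  rcases le_or_gt 0 a with ha | ha
  · have pos : ∀ x, a ≤ x → m * |x| = m * x := fun x hx => by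
      rw [abs_of_nonneg (ha.trans hx)]
    have := center_bound (m := m) hD hK hβ hm hab hψ hR hF hfo
      (fun x hx i h => by rw [← pos x hx.1.le]; exact hf x hx i h) h0
      (fun i h => by rw [← pos a le_rfl]; exact hi i h)
    refine ⟨this.1.trans hCF, fun i h => ?_⟩
    rw [pos b hab]; exact (this.2 i h).trans hCF
  · have neg : ∀ x : ℝ, x ≤ 0 → m * |x| = -m * x := fun x hx => by rw [abs_of_nonpos hx]; ring
    have pos : ∀ x : ℝ, 0 ≤ x → m * |x| = m * x := fun x hx => by rw [abs_of_nonneg hx]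
    have s1 : Ioo a 0 ⊆ Ioo a b := Ioo_subset_Ioo le_rfl hb.le
    have s2 : Ioo 0 b ⊆ Ioo a b := Ioo_subset_Ioo ha.le le_rfl
    obtain ⟨h1, h2⟩ := center_bound (m := -m) hD hK hβ hm' ha.le (hψ.mono le_rfl hb.le)
      (fun x hx => hR x (s1 hx)) hF (fun x hx => hfo x (s1 hx))
      (fun x hx i h => by rw [← neg x hx.2.le]; exact hf x (s1 hx) i h) h0
      (fun i h => by rw [← neg a ha.le]; exact hi i h)
    have hle : F ≤ C * F := by nlinarith
    have e : ∀ x : ℝ, F * (K * exp (-(α - β) * |x|)) ≤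
        (C * F) * (K * exp (-(α - β) * |x|)) := fun x => by gcongr
    have := center_bound (m := m) (F := C * F) hD hK hβ hm hb.le (hψ.mono ha.le le_rfl)
      (fun x hx => hR x (s2 hx)) (by positivity) (fun x hx => (hfo x (s2 hx)).trans (e x))
      (fun x hx i h => by rw [← pos x hx.1.le]; exact (hf x (s2 hx) i h).trans (e x)) h1
      (fun i h => by simpa using h2 i h)
    rw [pos b hb.le, sq, mul_assoc]; exact this

/-- A homogeneous solution issued from data that are small in the weighted norm. -/
lemma center_bound_hom {ψ : ℝ → κ → ℂ} {m a b F : ℝ} (hD : CenterGap D o β) (hK : 0 ≤ K)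
    (hβ : β < α) (hm : |m| ≤ β) (hab : a ≤ b) (hψ : SolvesOn D R 0 ψ a b)
    (hR : ∀ x ∈ Ioo a b, ∀ i j, ‖R x i j‖ ≤ K * exp (-α * |x|)) (hF : 0 ≤ F)
    (h0 : ‖ψ a o‖ ≤ F) (hi : ∀ i, i ≠ o → exp (m * |a|) * ‖ψ a i‖ ≤ F) :
    ‖ψ b o‖ ≤ Cc ^ 2 * F ∧ ∀ i, i ≠ o →
      exp (m * |b|) * ‖ψ b i‖ ≤ Cc ^ 2 * F :=
  center_bound_abs hD hK hβ hm hab hψ hR hF (fun x _ => by simp; positivity)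
    (fun x _ i _ => by simp; positivity) h0 hi

lemma SolvesOn.sub {ψ φ f g : ℝ → κ → ℂ} {a b : ℝ} (h : SolvesOn D R f ψ a b)
    (h' : SolvesOn D R g φ a b) : SolvesOn D R (f - g) (ψ - φ) a b := by
  refine ⟨fun i => (h.1 i).sub (h'.1 i), fun x hx i => ?_⟩
  refine ((h.2 x hx i).sub (h'.2 x hx i)).congr_deriv ?_
  simp only [Pi.sub_apply, mul_sub, sum_sub_distrib]; ring

/-- A constant multiple of the neutral direction, as a solution with forcing. -/
lemma solvesOn_center (hD : CenterGap D o β) (d : ℂ) (a b : ℝ) :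
    SolvesOn D R (fun x i => -(R x i o * d)) (fun _ => Pi.single o d) a b := by
  refine ⟨fun i => continuousOn_const, fun x _ i => ?_⟩
  refine (hasDerivAt_const x _).congr_deriv ?_
  rw [sum_eq_single o]
  · simp [hD.col i]
  · intro j _ h; simp [h]
  · simp

lemma exp_le_exp_mul {a b c : ℝ} (h : a ≤ b + c) : exp a ≤ exp b * exp c := by
  rw [← exp_add]; exact exp_le_exp.2 h

/-- A solution that comes from the neutral direction at `-∞`. -/
structure CenterOrbit (D : Matrix κ κ ℂ) (R : ℝ → Matrix κ κ ℂ) (o : κ) (ψ : ℝ → κ → ℂ) : Prop where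
  solves : ∀ a b, SolvesOn D R 0 ψ a b
  bot : ∀ i, Tendsto (fun x => ψ x i) atBot (𝓝 ((Pi.single o 1 : κ → ℂ) i))

/-- Every initial value problem for `ψ' = (D + R) ψ` is solvable. -/
def Solvable (D : Matrix κ κ ℂ) (R : ℝ → Matrix κ κ ℂ) : Prop :=
  ∀ (t : ℝ) (ξ : κ → ℂ), ∃ ψ : ℝ → κ → ℂ, ψ t = ξ ∧ ∀ a b, SolvesOn D R 0 ψ a b

lemma CenterOrbit.decay {ψ : ℝ → κ → ℂ} (h : CenterOrbit D R o ψ)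
    (hs : Solvable D R) (hD : CenterGap D o β) (hK : 0 ≤ K) (hβ0 : 0 ≤ β) (hβ : β < α)
    (hR : ∀ x i j, ‖R x i j‖ ≤ K * exp (-α * |x|)) (y : ℝ) :
    ‖ψ y o‖ ≤ Cc ^ 2 ∧ ∀ i, i ≠ o →
      exp (β * |y|) * ‖ψ y i‖ ≤ Cc ^ 2 := by
  have : Nonempty κ := ⟨o⟩
  set C := Cc ^ 2 with hC
  have hC0 : 0 ≤ C := sq_nonneg _
  have key : ∀ e > 0, ‖ψ y o‖ ≤ C + C * e ∧ ∀ i, i ≠ o →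
      exp (β * |y|) * ‖ψ y i‖ ≤ C + exp (β * |y|) * (C * e) := fun e he => by
    have hev : ∀ᶠ x in atBot, ∀ i, ‖ψ x i - (Pi.single o 1 : κ → ℂ) i‖ ≤ e := by
      rw [eventually_all]
      intro i
      exact (tendsto_iff_norm_sub_tendsto_zero.1 (h.bot i)).eventually (ge_mem_nhds he)
    obtain ⟨T, hT, hTy⟩ := (hev.and (eventually_le_atBot y)).exists
    obtain ⟨φ, hφ, hφs⟩ := hs T (Pi.single o 1)
    have b1 := center_bound_hom (m := β) (F := 1) hD hK hβ (abs_of_nonneg hβ0).le hTy (hφs T y)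
      (fun x _ => hR x) zero_le_one (by simp [hφ]) (fun i hi => by simp [hφ, hi])
    have hd := (h.solves T y).sub (hφs T y)
    rw [sub_zero] at hd
    have b2 := center_bound_hom (m := 0) (F := e) hD hK hβ (by simpa) hTy hd
      (fun x _ => hR x) he.le (by simpa [hφ] using hT o) (fun i hi => by simpa [hφ] using hT i)
    rw [← hC] at b1 b2
    have tri : ∀ i, ‖ψ y i‖ ≤ ‖φ y i‖ + ‖(ψ - φ) y i‖ := fun i => by
      have : ψ y i = φ y i + (ψ - φ) y i := by simp
      rw [this]; exact norm_add_le _ _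
    refine ⟨(tri o).trans (by linarith [b1.1, b2.1]), fun i hi => ?_⟩
    have h1 := b1.2 i hi
    have h2 := b2.2 i hi
    simp only [zero_mul, Real.exp_zero, one_mul] at h2
    calc _ ≤ exp (β * |y|) * (‖φ y i‖ + ‖(ψ - φ) y i‖) := by gcongr; exact tri i
      _ ≤ _ := by rw [mul_add]; gcongr; linarith
  have lim : ∀ c : ℝ, Tendsto (fun e : ℝ => C + c * (C * e)) (𝓝[>] 0) (𝓝 C) := fun c => by
    have : Continuous fun e : ℝ => C + c * (C * e) := by fun_prop
    simpa using (this.tendsto 0).mono_left (nhdsWithin_le_nhds (s := Ioi 0))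
  refine ⟨?_, fun i hi => ?_⟩
  · refine ge_of_tendsto (lim 1) ?_
    filter_upwards [self_mem_nhdsWithin] with e he
    simpa using (key e he).1
  · refine ge_of_tendsto (lim (exp (β * |y|))) ?_
    filter_upwards [self_mem_nhdsWithin] with e he
    exact (key e he).2 i hi

lemma CenterOrbit.head {ψ : ℝ → κ → ℂ} (h : CenterOrbit D R o ψ) (hD : CenterGap D o β) (hK : 0 ≤ K)
    (hβ0 : 0 < β) (hβ : β < α) (hR : ∀ x i j, ‖R x i j‖ ≤ K * exp (-α * |x|))
    (hRo : ∀ x, ‖R x o o‖ ≤ K * exp (-2 * α * |x|)) {y : ℝ} (hy : y ≤ 0) :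
    ‖ψ y o - 1‖ ≤ Cc ^ 2 * exp (2 * β * y) := by
  set F := exp (2 * β * y) with hF
  have hF0 : 0 < F := exp_pos _
  have hev : ∀ᶠ x in atBot, ∀ i, ‖ψ x i - (Pi.single o 1 : κ → ℂ) i‖ ≤ F := by
    rw [eventually_all]
    intro i; exact (tendsto_iff_norm_sub_tendsto_zero.1 (h.bot i)).eventually (ge_mem_nhds hF0)
  obtain ⟨T, hT, hTy⟩ := (hev.and (eventually_le_atBot y)).exists
  have hd := (h.solves T y).sub (solvesOn_center (R := R) hD 1 T y)
  have := center_bound_abs (m := -β) (F := F) hD hK hβ (by rw [abs_neg, abs_of_pos hβ0]) hTy hd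
    (fun x _ => hR x) hF0.le ?_ ?_ (by simpa using hT o) ?_
  · simpa using this.1
  · intro x hx
    simp only [Pi.sub_apply, Pi.zero_apply, zero_sub, neg_neg, mul_one]
    refine (hRo x).trans ?_
    rw [mul_left_comm]
    refine mul_le_mul_of_nonneg_left (exp_le_exp_mul ?_) hK
    have hx0 : x ≤ y := hx.2.le
    rw [abs_of_nonpos (hx0.trans hy)]; nlinarith
  · intro x hx i _
    simp only [Pi.sub_apply, Pi.zero_apply, zero_sub, neg_neg, mul_one]
    calc _ ≤ exp (-β * |x|) * (K * exp (-α * |x|)) := by gcongr; exact hR x i o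
      _ = K * (exp (-β * |x| + -α * |x|)) := by rw [exp_add]; ring
      _ ≤ K * (F * exp (-(α - β) * |x|)) := by
          refine mul_le_mul_of_nonneg_left (exp_le_exp_mul ?_) hK
          have hx0 : x ≤ y := hx.2.le
          rw [abs_of_nonpos (hx0.trans hy)]; nlinarith
      _ = _ := by ring
  · intro i hi
    have h1 := hT i
    have h2 : exp (-β * |T|) ≤ 1 := exp_le_one_iff.2 (by have := abs_nonneg T; nlinarith)
    calc _ ≤ 1 * F := by gcongr; simpa using h1
      _ = F := one_mul _

lemma CenterOrbit.tail {ψ : ℝ → κ → ℂ} {d : ℂ} (h : CenterOrbit D R o ψ)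
    (htop : Tendsto (fun x => ψ x o) atTop (𝓝 d)) (hs : Solvable D R) (hD : CenterGap D o β)
    (hK : 0 ≤ K) (hβ0 : 0 < β) (hβ : β < α) (hR : ∀ x i j, ‖R x i j‖ ≤ K * exp (-α * |x|))
    (hRo : ∀ x, ‖R x o o‖ ≤ K * exp (-2 * α * |x|)) {y : ℝ} (hy : 0 ≤ y) :
    ‖ψ y o - d‖ ≤ Cc ^ 4 * exp (-2 * β * y) := by
  set C := Cc with hC
  obtain ⟨hd1, hd2⟩ := h.decay hs hD hK hβ0.le hβ hR y
  rw [← hC] at hd1 hd2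
  set F := C ^ 2 * exp (-2 * β * y) with hF
  have hF0 : 0 ≤ F := by positivity
  have key : ∀ T, y ≤ T → ‖ψ T o - ψ y o‖ ≤ C ^ 2 * F := fun T hT => by
    have hd := (h.solves y T).sub (solvesOn_center (R := R) hD (ψ y o) y T)
    have := center_bound_abs (m := -β) (F := F) hD hK hβ (by rw [abs_neg, abs_of_pos hβ0]) hT hd
      (fun x _ => hR x) hF0 ?_ ?_ (by simpa using hF0) ?_
    · simpa using this.1
    · intro x hx
      simp only [Pi.sub_apply, Pi.zero_apply, zero_sub, neg_neg, norm_mul]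
      calc _ ≤ (K * exp (-2 * α * |x|)) * C ^ 2 := by gcongr; exact hRo x
        _ ≤ (K * (exp (-2 * β * y) * exp (-(α - β) * |x|))) * C ^ 2 := by
            gcongr
            refine exp_le_exp_mul ?_
            have hx0 : y ≤ x := hx.1.le
            rw [abs_of_nonneg (hy.trans hx0)]; nlinarith
        _ = _ := by rw [hF]; ring
    · intro x hx i _
      simp only [Pi.sub_apply, Pi.zero_apply, zero_sub, neg_neg, norm_mul]
      calc _ ≤ exp (-β * |x|) * (K * exp (-α * |x|) * C ^ 2) := by
            gcongr; exact hR x i o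
        _ = K * (exp (-β * |x| + -α * |x|)) * C ^ 2 := by rw [exp_add]; ring
        _ ≤ K * (exp (-2 * β * y) * exp (-(α - β) * |x|)) * C ^ 2 := by
            gcongr
            refine exp_le_exp_mul ?_
            have hx0 : y ≤ x := hx.1.le
            rw [abs_of_nonneg (hy.trans hx0)]; nlinarith
        _ = _ := by rw [hF]; ring
    · intro i hi
      simp only [Pi.sub_apply, Pi.single_eq_of_ne hi, sub_zero]
      have := hd2 i hi
      calc exp (-β * |y|) * ‖ψ y i‖
          = exp (-2 * β * y) * (exp (β * |y|) * ‖ψ y i‖) := by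
            rw [← mul_assoc, ← exp_add, abs_of_nonneg hy]; ring_nf
        _ ≤ exp (-2 * β * y) * C ^ 2 := by gcongr
        _ = F := by rw [hF]; ring
  have lim : Tendsto (fun T => ‖ψ T o - ψ y o‖) atTop (𝓝 ‖d - ψ y o‖) := (htop.sub_const _).norm
  have := le_of_tendsto lim ((eventually_ge_atTop y).mono key)
  rw [norm_sub_rev]
  refine this.trans (le_of_eq ?_)
  rw [hF]; ring

/-- Passage through one pulse: comparison of a solution operator on `[-X, X]` with the
transmission coefficient of the limiting problem on the line. -/
lemma pulse_passage {R0 : ℝ → Matrix κ κ ℂ} {ψ : ℝ → κ → ℂ} {d : ℂ} {X : ℝ}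
    {S : ℝ → Matrix κ κ ℂ}
    (h : CenterOrbit D R0 o ψ)
    (htop : Tendsto (fun x => ψ x o) atTop (𝓝 d)) (hs : Solvable D R0) (hD : CenterGap D o β) (hK : 0 ≤ K)
    (hβ0 : 0 < β) (hβ : β < α)
    (hR0 : ∀ x i j, ‖R0 x i j‖ ≤ K * exp (-α * |x|))
    (hR₀o : ∀ x, ‖R0 x o o‖ ≤ K * exp (-2 * α * |x|)) (hX : 0 ≤ X)
    (hR : ∀ x ∈ Ioo (-X) X, ∀ i j, ‖R x i j‖ ≤ K * exp (-α * |x|))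
    (hdiff : ∀ x ∈ Ioo (-X) X, ∀ i j, ‖R x i j - R0 x i j‖ ≤ K * exp (-2 * α * X + α * |x|))
    (hdiffo : ∀ x ∈ Ioo (-X) X, ‖R x o o - R0 x o o‖ ≤ K * exp (-2 * α * X))
    (hS : ∀ j, SolvesOn D R 0 (fun x i => S x i j) (-X) X) (hS1 : S (-X) = 1) :
    let C := (card κ + 2) * Cc ^ 4
    ‖S X o o - d‖ ≤ C * exp (-2 * β * X) ∧
      (∀ i j, ¬ (i = o ∧ j = o) → ‖S X i j‖ ≤ C * exp (-β * X)) ∧ ‖d‖ ≤ C := by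
  have : Nonempty κ := ⟨o⟩
  set n := card κ with hn
  set c := centerConst n K (α - β) with hc
  have hc1 : 1 ≤ c := one_le_centerConst hK (sub_pos.2 hβ)
  intro C
  have hXX : -X ≤ X := by linarith
  have hc24 : c ^ 2 ≤ c ^ 4 := pow_le_pow_right₀ hc1 (by norm_num)
  have hcC : c ^ 4 ≤ C := by
    have : (0 : ℝ) ≤ n := by positivity
    have : (0 : ℝ) ≤ c ^ 4 := by positivity
    simp only [C]; nlinarith
  have hβa : |β| ≤ β := (abs_of_pos hβ0).le
  have hβn : |(-β)| ≤ β := by rw [abs_neg]; exact hβa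
  have hdec := h.decay hs hD hK hβ0.le hβ hR0
  rw [← hc] at hdec
  refine ⟨?_, ?_, ?_⟩
  · set F := (n + 1) * c ^ 2 * exp (-2 * β * X) with hF
    have hF0 : 0 ≤ F := by positivity
    have hc2F : c ^ 2 * exp (-2 * β * X) ≤ F := by
      rw [hF]; gcongr
      have : (0 : ℝ) ≤ n := by positivity
      have : (0 : ℝ) ≤ c ^ 2 := by positivity
      nlinarith
    have hψ' : SolvesOn D R (fun x i => ∑ j, (R0 x i j - R x i j) * ψ x j) ψ (-X) X := by
      refine ⟨(h.solves (-X) X).1, fun x hx i => ((h.solves (-X) X).2 x hx i).congr_deriv ?_⟩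
      rw [← sum_add_distrib, Pi.zero_apply, Pi.zero_apply, add_zero]
      exact sum_congr rfl fun j _ => by ring
    have hd := (hS o).sub hψ'
    have hψb : ∀ x j, ‖ψ x j‖ ≤ c ^ 2 := fun x j => by
      by_cases hj : j = o
      · subst hj; exact (hdec x).1
      · refine le_trans ?_ ((hdec x).2 j hj)
        refine le_mul_of_one_le_left (norm_nonneg _) (Real.one_le_exp (by positivity))
    have := center_bound_abs (m := -β) (F := F) hD hK hβ hβn hXX hd hR hF0 ?_ ?_ ?_ ?_
    · have t := h.tail htop hs hD hK hβ0 hβ hR0 hR₀o hX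
      have e1 : S X o o - d = ((fun x i => S x i o) - ψ) X o + (ψ X o - d) := by simp
      rw [e1]
      refine (norm_add_le _ _).trans ((add_le_add this.1 t).trans (le_of_eq ?_))
      rw [hF]; simp only [C]; ring
    · intro x hx
      have hx' : |x| ≤ X := abs_le.2 ⟨hx.1.le, hx.2.le⟩
      simp only [Pi.sub_apply, Pi.zero_apply, zero_sub, norm_neg]
      have hb : ∀ j, ‖(R0 x o j - R x o j) * ψ x j‖ ≤
          c ^ 2 * (exp (-2 * β * X) * (K * exp (-(α - β) * |x|))) := fun j => by
        rw [norm_mul, norm_sub_rev]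
        by_cases hj : j = o
        · subst hj
          calc _ ≤ (K * exp (-2 * α * X)) * c ^ 2 := by
                gcongr
                · exact hdiffo x hx
                · exact hψb x j
            _ ≤ (K * (exp (-2 * β * X) * exp (-(α - β) * |x|))) * c ^ 2 := by
                gcongr
                refine exp_le_exp_mul ?_
                nlinarith
            _ = _ := by ring
        · calc _ ≤ (K * exp (-2 * α * X + α * |x|)) * ‖ψ x j‖ := by
                gcongr; exact hdiff x hx o j
            _ ≤ (K * (exp (-2 * β * X + -(α - β) * |x|) * exp (β * |x|)))
                  * ‖ψ x j‖ := by
                gcongr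
                refine exp_le_exp_mul ?_
                nlinarith
            _ = (K * exp (-2 * β * X + -(α - β) * |x|)) * (exp (β * |x|) * ‖ψ x j‖) := by ring
            _ ≤ (K * exp (-2 * β * X + -(α - β) * |x|)) * c ^ 2 := by gcongr; exact (hdec x).2 j hj
            _ = _ := by rw [exp_add]; ring
      calc _ ≤ ∑ j : κ, c ^ 2 * (exp (-2 * β * X) * (K * exp (-(α - β) * |x|))) :=
            norm_sum_le_of_le _ fun j _ => hb j
        _ = n * c ^ 2 * exp (-2 * β * X) * (K * exp (-(α - β) * |x|)) := by
            rw [sum_const, card_univ, nsmul_eq_mul, ← hn]; ring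
        _ ≤ _ := by rw [hF]; gcongr; linarith
    · intro x hx i _
      have hx' : |x| ≤ X := abs_le.2 ⟨hx.1.le, hx.2.le⟩
      simp only [Pi.sub_apply, Pi.zero_apply, zero_sub, norm_neg]
      have hb : ∀ j, ‖(R0 x i j - R x i j) * ψ x j‖ ≤
          (K * exp (-2 * α * X + α * |x|)) * c ^ 2 := fun j => by
        rw [norm_mul, norm_sub_rev]
        gcongr
        · exact hdiff x hx i j
        · exact hψb x j
      calc _ ≤ exp (-β * |x|) * ∑ j : κ, (K * exp (-2 * α * X + α * |x|)) * c ^ 2 := by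
            gcongr; exact norm_sum_le_of_le _ fun j _ => hb j
        _ = n * c ^ 2 * K * (exp (-β * |x|+ (-2 * α * X + α * |x|))) := by
            rw [sum_const, card_univ, nsmul_eq_mul, ← hn, exp_add (-β * |x|)]; ring
        _ ≤ n * c ^ 2 * K * (exp (-2 * β * X) * exp (-(α - β) * |x|)) := by
            gcongr
            refine exp_le_exp_mul ?_
            nlinarith
        _ = n * c ^ 2 * exp (-2 * β * X) * (K * exp (-(α - β) * |x|)) := by ring
        _ ≤ _ := by rw [hF]; gcongr; linarith
    · simp only [Pi.sub_apply, hS1, Matrix.one_apply_eq]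
      rw [norm_sub_rev]
      refine (h.head hD hK hβ0 hβ hR0 hR₀o (neg_nonpos.2 hX)).trans (le_trans (le_of_eq ?_) hc2F)
      rw [hc, hn]; ring_nf
    · intro i hi
      simp only [Pi.sub_apply, hS1, one_apply_ne hi, zero_sub, norm_neg]
      rw [abs_neg, abs_of_nonneg hX]
      have := (hdec (-X)).2 i hi
      rw [abs_neg, abs_of_nonneg hX] at this
      calc exp (-β * X) * ‖ψ (-X) i‖
          = exp (-2 * β * X) * (exp (β * X) * ‖ψ (-X) i‖) := by
            rw [← mul_assoc, ← exp_add]; ring_nf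
        _ ≤ exp (-2 * β * X) * c ^ 2 := by gcongr
        _ ≤ F := by rw [mul_comm]; exact hc2F
  · intro i j hij
    by_cases hj : j = o
    · have hi : i ≠ o := fun hi => hij ⟨hi, hj⟩
      subst hj
      have := (center_bound_hom (m := β) (F := 1) hD hK hβ hβa hXX (hS j) hR zero_le_one
        (by simp [hS1]) (fun i hi => by simp [hS1, hi])).2 i hi
      rw [abs_of_nonneg hX, mul_one, ← hc] at this
      calc ‖S X i j‖ = exp (-β * X) * (exp (β * X) * ‖S X i j‖) := by
            rw [← mul_assoc, ← exp_add]; simp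
        _ ≤ exp (-β * X) * C := by gcongr; linarith
        _ = _ := mul_comm _ _
    · have b1 := center_bound_hom (m := -β) (b := 0) (F := exp (-β * X)) hD hK hβ hβn
        (by linarith) ((hS j).mono le_rfl hX) (fun x hx => hR x ⟨hx.1, hx.2.trans_le hX⟩)
        (exp_pos _).le (by rw [hS1, one_apply_ne (Ne.symm hj)]; simp; positivity)
        (fun i hi => by
          rw [abs_neg, abs_of_nonneg hX, hS1]
          refine mul_le_of_le_one_right (exp_pos _).le ?_
          rw [Matrix.one_apply]; split_ifs <;> simp)
      simp only [abs_zero, mul_zero, Real.exp_zero, one_mul] at b1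
      have b2 := center_bound_hom (m := β) (a := 0) (b := X) hD hK hβ hβa hX
        ((hS j).mono (by linarith) le_rfl)
        (fun x hx => hR x ⟨by linarith [hx.1], hx.2⟩) (by positivity) b1.1
        (fun i hi => by simpa using b1.2 i hi)
      rw [← hc] at b2
      have e : c ^ 2 * (c ^ 2 * exp (-β * X)) ≤ C * exp (-β * X) := by
        rw [← mul_assoc, ← pow_add]; gcongr
      by_cases hi : i = o
      · subst hi; exact b2.1.trans e
      · refine le_trans ?_ ((b2.2 i hi).trans e)
        exact le_mul_of_one_le_left (norm_nonneg _) (Real.one_le_exp (by positivity))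
  · refine le_of_tendsto htop.norm (Eventually.of_forall fun x => ?_)
    exact (hdec x).1.trans (hc24.trans hcC)

end

section

/-! ### Calculus of matrix-valued functions -/

section Calculus

variable {m n l : Type*} [Fintype m] [Fintype n] [Fintype l] {s : Set ℝ} {x : ℝ}

/-- Entrywise derivative of a matrix-valued function within a set. -/
def HasMatDeriv (M : ℝ → Matrix m n ℂ) (M' : Matrix m n ℂ) (s : Set ℝ) (x : ℝ) : Prop :=
  ∀ i j, HasDerivWithinAt (fun y => M y i j) (M' i j) s x

lemma HasMatDeriv.const (A : Matrix m n ℂ) : HasMatDeriv (fun _ => A) 0 s x :=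
  fun i j => hasDerivWithinAt_const x s (A i j)

lemma HasMatDeriv.mono {M : ℝ → Matrix m n ℂ} {M' : Matrix m n ℂ} {t : Set ℝ}
    (h : HasMatDeriv M M' s x) (hs : t ⊆ s) : HasMatDeriv M M' t x :=
  fun i j => (h i j).mono hs

lemma HasMatDeriv.mul {M : ℝ → Matrix m n ℂ} {M' : Matrix m n ℂ} {P : ℝ → Matrix n l ℂ}
    {P' : Matrix n l ℂ} (hM : HasMatDeriv M M' s x) (hP : HasMatDeriv P P' s x) :
    HasMatDeriv (fun y => M y * P y) (M' * P x + M x * P') s x := fun i j => by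
  simp only [Matrix.mul_apply, Matrix.add_apply]
  rw [← sum_add_distrib]; exact HasDerivWithinAt.fun_sum fun k _ => (hM i k).mul (hP k j)

lemma HasMatDeriv.const_mul (A : Matrix m n ℂ) {P : ℝ → Matrix n l ℂ} {P' : Matrix n l ℂ}
    (hP : HasMatDeriv P P' s x) : HasMatDeriv (fun y => A * P y) (A * P') s x := by
  simpa using (HasMatDeriv.const A).mul hP

lemma HasMatDeriv.mul_const {M : ℝ → Matrix m n ℂ} {M' : Matrix m n ℂ} (hM : HasMatDeriv M M' s x)
    (A : Matrix n l ℂ) : HasMatDeriv (fun y => M y * A) (M' * A) s x := by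
  simpa using hM.mul (HasMatDeriv.const A)

lemma HasMatDeriv.congr_deriv {M : ℝ → Matrix m n ℂ} {M' M'' : Matrix m n ℂ}
    (hM : HasMatDeriv M M' s x) (h : M' = M'') : HasMatDeriv M M'' s x := h ▸ hM

lemma HasMatDeriv.smul {c : ℝ → ℂ} {c' : ℂ} {M : ℝ → Matrix m n ℂ} {M' : Matrix m n ℂ}
    (hc : HasDerivWithinAt c c' s x) (hM : HasMatDeriv M M' s x) :
    HasMatDeriv (fun y => c y • M y) (c' • M x + c x • M') s x :=
  fun i j => hc.mul (hM i j)

variable [DecidableEq n]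

/-- Jacobi's formula. -/
lemma HasMatDeriv.det {M : ℝ → Matrix n n ℂ} {M' : Matrix n n ℂ} (hM : HasMatDeriv M M' s x) :
    HasDerivWithinAt (fun y => (M y).det) (((M x).adjugate * M').trace) s x := by
  simp only [Matrix.det_apply']
  have h : ∀ σ : Equiv.Perm n, HasDerivWithinAt
      (fun y => ((Equiv.Perm.sign σ : ℤ) : ℂ) * ∏ i, M y (σ i) i)
      (((Equiv.Perm.sign σ : ℤ) : ℂ) *
        ∑ i, (∏ j ∈ Finset.univ.erase i, M x (σ j) j) • M' (σ i) i) s x := fun σ => by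
    exact (HasDerivWithinAt.fun_finsetProd fun i _ => hM (σ i) i).const_mul _
  refine (HasDerivWithinAt.fun_sum fun σ _ => h σ).congr_deriv ?_
  have : ((M x).adjugate * M').trace = ∑ i, ((M x).updateCol i (fun k => M' k i)).det := by
    rw [Matrix.trace]
    refine sum_congr rfl fun i _ => ?_
    rw [← Matrix.cramer_apply, Matrix.cramer_eq_adjugate_mulVec]; rfl
  rw [this]
  simp only [mul_sum]
  rw [Finset.sum_comm]
  refine sum_congr rfl fun i _ => ?_
  rw [Matrix.det_apply']
  refine sum_congr rfl fun σ _ => ?_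
  rw [← Finset.mul_prod_erase _ _ (Finset.mem_univ i), Matrix.updateCol_self, smul_eq_mul,
    mul_comm (M' (σ i) i)]
  congr 2
  refine Finset.prod_congr rfl fun j hj => ?_
  rw [Matrix.updateCol_ne (ne_of_mem_erase hj)]

/-- Liouville's formula. -/
lemma HasMatDeriv.det_of_linear {M : ℝ → Matrix n n ℂ} {A : Matrix n n ℂ}
    (hM : HasMatDeriv M (A * M x) s x) :
    HasDerivWithinAt (fun y => (M y).det) (A.trace * (M x).det) s x := by
  refine hM.det.congr_deriv ?_
  rw [trace_mul_comm, mul_assoc, mul_adjugate, Matrix.mul_smul, mul_one,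
    trace_smul, smul_eq_mul, mul_comm]

lemma HasMatDeriv.inv {M : ℝ → Matrix n n ℂ} {M' : Matrix n n ℂ} (hM : HasMatDeriv M M' s x)
    (hu : ∀ y ∈ s, IsUnit (M y)) (hx : x ∈ s) (hs : UniqueDiffWithinAt ℝ s x) :
    HasMatDeriv (fun y => (M y)⁻¹) (-((M x)⁻¹ * M' * (M x)⁻¹)) s x := by
  have hdet : ∀ y ∈ s, (M y).det ≠ 0 := fun y hy =>
    (isUnit_det (hu y hy)).ne_zero
  have hadj : ∀ i j, DifferentiableWithinAt ℝ (fun y => (M y).adjugate i j) s x := fun i j => by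
    simp only [Matrix.adjugate_apply]
    have : HasMatDeriv (fun y => (M y).updateRow j (Pi.single i 1)) (M'.updateRow j 0) s x := fun a b => by
      by_cases h : a = j
      · subst h; simpa using hasDerivWithinAt_const x s ((Pi.single i 1 : n → ℂ) b)
      · simpa [Matrix.updateRow_ne h] using hM a b
    exact this.det.differentiableWithinAt
  have hdiff : ∀ i j, DifferentiableWithinAt ℝ (fun y => (M y)⁻¹ i j) s x := fun i j => by
    simp only [Matrix.inv_def, Ring.inverse_eq_inv', Matrix.smul_apply, smul_eq_mul]
    exact (hM.det.differentiableWithinAt.inv (hdet x hx)).mul (hadj i j)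
  set G' : Matrix n n ℂ := Matrix.of fun i j => derivWithin (fun y => (M y)⁻¹ i j) s x with hG'
  have hG : HasMatDeriv (fun y => (M y)⁻¹) G' s x := fun i j => (hdiff i j).hasDerivWithinAt
  have h1 := hM.mul hG
  have h2 : HasMatDeriv (fun y => M y * (M y)⁻¹) 0 s x := fun i j => by
    refine (hasDerivWithinAt_const x s ((1 : Matrix n n ℂ) i j)).congr (fun y hy => ?_) ?_
    · change (M _ * (M _)⁻¹) i j = _
      rw [mul_nonsing_inv _ (isUnit_det (hu y hy))]
    · change (M _ * (M _)⁻¹) i j = _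
      rw [mul_nonsing_inv _ (isUnit_det (hu x hx))]
  have h3 : M' * (M x)⁻¹ + M x * G' = 0 := by
    ext i j; exact hs.eq_deriv s (h1 i j) (h2 i j)
  have hux := isUnit_det (hu x hx)
  have h4 : G' = -((M x)⁻¹ * M' * (M x)⁻¹) := by
    have h5 : (M x)⁻¹ * (M' * (M x)⁻¹ + M x * G') = 0 := by rw [h3, mul_zero]
    rw [mul_add, Matrix.nonsing_inv_mul_cancel_left _ _ hux] at h5
    rw [mul_assoc]; exact (neg_eq_of_add_eq_zero_right h5).symm
  exact hG.congr_deriv h4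

lemma const_of_hasDerivWithinAt_zero {f : ℝ → ℂ} (hs : Convex ℝ s)
    (hf : ∀ x ∈ s, HasDerivWithinAt f 0 s x) {a b : ℝ} (ha : a ∈ s) (hb : b ∈ s) : f a = f b := by
  have := hs.norm_image_sub_le_of_norm_hasDerivWithin_le (C := 0) hf (by simp) ha hb
  rw [zero_mul, norm_le_zero_iff, sub_eq_zero] at this; exact this.symm

lemma const_of_hasMatDeriv_zero {M : ℝ → Matrix m n ℂ} (hs : Convex ℝ s)
    (hM : ∀ x ∈ s, HasMatDeriv M 0 s x) {a b : ℝ} (ha : a ∈ s) (hb : b ∈ s) : M a = M b := by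
  ext i j; exact const_of_hasDerivWithinAt_zero hs (fun x hx => hM x hx i j) ha hb

end Calculus

/-! ### Second compounds of `4 × 4` matrices -/

/-- First index of the pairs `01, 02, 03, 12, 13, 23`. -/
def pairFst : Fin 6 → Fin 4 := ![0, 0, 0, 1, 1, 2]

/-- Second index of the pairs `01, 02, 03, 12, 13, 23`. -/
def pairSnd : Fin 6 → Fin 4 := ![1, 2, 3, 2, 3, 3]

/-- The `2 × 2` minor with rows `i, j` and columns `a, b`. -/
def minor₂ (M : Mat4) (i j a b : Fin 4) : ℂ := M i a * M j b - M i b * M j a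

/-- The second compound matrix. -/
def compound (M : Mat4) : Mat6 :=
  Matrix.of fun s t => minor₂ M (pairFst s) (pairSnd s) (pairFst t) (pairSnd t)

/-- The second additive compound matrix. -/
def addCompound (A : Mat4) : Mat6 :=
  !![A 0 0 + A 1 1, A 1 2, A 1 3, -A 0 2, -A 0 3, 0; A 2 1, A 0 0 + A 2 2, A 2 3, A 0 1, 0, -A 0 3;
     A 3 1, A 3 2, A 0 0 + A 3 3, 0, A 0 1, A 0 2;
     -A 2 0, A 1 0, 0, A 1 1 + A 2 2, A 2 3, -A 1 3;
     -A 3 0, 0, A 1 0, A 3 2, A 1 1 + A 3 3, A 1 2;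
     0, -A 3 0, A 2 0, -A 3 1, A 2 1, A 2 2 + A 3 3]

lemma minor₂_mul (M P : Mat4) (i j a b : Fin 4) :
    minor₂ (M * P) i j a b =
      ∑ t, minor₂ M i j (pairFst t) (pairSnd t) * minor₂ P (pairFst t) (pairSnd t) a b := by
  simp [minor₂, Matrix.mul_apply, Fin.sum_univ_succ, pairFst, pairSnd]; ring

lemma compound_mul (M P : Mat4) : compound (M * P) = compound M * compound P := by
  ext s t
  simp only [compound, of_apply, Matrix.mul_apply (M := Matrix.of _)]; exact minor₂_mul M P _ _ _ _

lemma compound_one : compound 1 = 1 := by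
  ext s t
  fin_cases s <;> fin_cases t <;> simp [compound, minor₂, pairFst, pairSnd, Matrix.one_apply]

lemma addCompound_mul_compound (A M : Mat4) (s t : Fin 6) :
    (addCompound A * compound M) s t = (A * M) (pairFst s) (pairFst t) * M (pairSnd s) (pairSnd t)
      + M (pairFst s) (pairFst t) * (A * M) (pairSnd s) (pairSnd t)
      - ((A * M) (pairFst s) (pairSnd t) * M (pairSnd s) (pairFst t)
      + M (pairFst s) (pairSnd t) * (A * M) (pairSnd s) (pairFst t)) := by
  simp only [Matrix.mul_apply, compound, of_apply]
  generalize pairFst t = a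
  generalize pairSnd t = b
  fin_cases s <;>
    simp [addCompound, minor₂, Fin.sum_univ_succ, pairFst, pairSnd] <;> ring

lemma compound_mul_addCompound (A M : Mat4) (s t : Fin 6) :
    (compound M * addCompound A) s t = (M * A) (pairFst s) (pairFst t) * M (pairSnd s) (pairSnd t)
      + M (pairFst s) (pairFst t) * (M * A) (pairSnd s) (pairSnd t)
      - ((M * A) (pairFst s) (pairSnd t) * M (pairSnd s) (pairFst t)
      + M (pairFst s) (pairSnd t) * (M * A) (pairSnd s) (pairFst t)) := by
  simp only [Matrix.mul_apply, compound, of_apply]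
  generalize pairFst s = a
  generalize pairSnd s = b
  fin_cases t <;>
    simp [addCompound, minor₂, Fin.sum_univ_succ, pairFst, pairSnd] <;> ring

lemma HasMatDeriv.compound {M : ℝ → Mat4} {A B : Mat4}
    {s : Set ℝ} {x : ℝ} (hM : HasMatDeriv M (A * M x - M x * B) s x) :
    HasMatDeriv (fun y => compound (M y))
      (addCompound A * compound (M x) - compound (M x) * addCompound B) s x := fun i j => by
  have h := ((hM (pairFst i) (pairFst j)).mul (hM (pairSnd i) (pairSnd j))).sub
    ((hM (pairFst i) (pairSnd j)).mul (hM (pairSnd i) (pairFst j)))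
  refine h.congr_deriv ?_
  simp only [Matrix.sub_apply, addCompound_mul_compound, compound_mul_addCompound]; ring

lemma det_fin_four (M : Mat4) : M.det =
    minor₂ M 0 1 0 1 * minor₂ M 2 3 2 3 - minor₂ M 0 1 0 2 * minor₂ M 2 3 1 3
    + minor₂ M 0 1 0 3 * minor₂ M 2 3 1 2 + minor₂ M 0 1 1 2 * minor₂ M 2 3 0 3
    - minor₂ M 0 1 1 3 * minor₂ M 2 3 0 2 + minor₂ M 0 1 2 3 * minor₂ M 2 3 0 1 := by
  simp [Matrix.det_succ_row_zero, Fin.sum_univ_succ, minor₂, Fin.succAbove]; ring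

lemma det_sub_smul_one (M : Mat4) (γ : ℂ) :
    (M - γ • (1 : Mat4)).det =
      M.det - γ * M.adjugate.trace + γ ^ 2 * (compound M).trace - γ ^ 3 * M.trace + γ ^ 4 := by
  have h : M.adjugate.trace = ∑ i : Fin 4, (M.submatrix i.succAbove i.succAbove).det := by
    rw [Matrix.trace]
    refine sum_congr rfl fun i _ => ?_
    rw [Matrix.diag_apply, Matrix.adjugate_fin_succ_eq_det_submatrix, ← two_mul, pow_mul]; simp
  rw [h, det_fin_four, det_fin_four]
  simp [Fin.sum_univ_succ, minor₂, compound, Matrix.trace, pairFst, pairSnd,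
    Matrix.one_apply, Matrix.det_fin_three, Fin.succAbove]
  ring

end

section

/-! ### Block triangular systems with two unstable and two stable directions -/

/-- `N` is made of two upper triangular `2 × 2` blocks, the first one unstable, the second one
stable, with spectral gap `σ` and off-diagonal entries of size at most `η`. -/
structure BlockForm (N : Mat4) (σ η : ℝ) : Prop where
  zero : ∀ i j, i ≠ j → ¬ (i = 0 ∧ j = 1) → ¬ (i = 2 ∧ j = 3) → N i j = 0
  off₀ : ‖N 0 1‖ ≤ η
  off₂ : ‖N 2 3‖ ≤ η
  re₀ : σ ≤ (N 0 0).re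
  re₁ : σ ≤ (N 1 1).re
  re₂ : (N 2 2).re ≤ -σ
  re₃ : (N 3 3).re ≤ -σ

/-- Sum of the unstable diagonal entries. -/
def growth (N : Mat4) : ℂ := N 0 0 + N 1 1

lemma trace_eq_growth_add (N : Mat4) : N.trace = growth N + (N 2 2 + N 3 3) := by
  rw [Matrix.trace, Fin.sum_univ_four, growth]; simp only [Matrix.diag_apply]; ring

lemma addCompound_zero : addCompound (0 : Mat4) = 0 := by
  ext i j; fin_cases i <;> fin_cases j <;> simp [addCompound]

/-- Generator on the second exterior power, with the dominant growth removed. -/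
def compoundGen (N : Mat4) : Mat6 := addCompound N - growth N • 1

/-- Perturbation of the generator, with the gauge `p` taken into account. -/
def compoundPert (B : ℝ → Mat4) (p' : ℝ → ℂ) (x : ℝ) : Mat6 :=
  addCompound (B x) - p' x • 1

lemma sum_erase_six (g : Fin 6 → ℝ) (i : Fin 6) :
    ∑ j ∈ Finset.univ.erase i, g j = g 0 + g 1 + g 2 + g 3 + g 4 + g 5 - g i := by
  have := add_sum_erase Finset.univ g (Finset.mem_univ i)
  rw [Fin.sum_univ_six] at this; linarith

lemma sum_erase_four (g : Fin 4 → ℝ) (i : Fin 4) :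
    ∑ j ∈ Finset.univ.erase i, g j = g 0 + g 1 + g 2 + g 3 - g i := by
  have := add_sum_erase Finset.univ g (Finset.mem_univ i)
  rw [Fin.sum_univ_four] at this; linarith

namespace BlockForm

variable {N : Mat4} {σ η β : ℝ}

lemma zeros (h : BlockForm N σ η) : N 0 2 = 0 ∧ N 0 3 = 0 ∧ N 1 0 = 0 ∧ N 1 2 = 0 ∧ N 1 3 = 0 ∧
    N 2 0 = 0 ∧ N 2 1 = 0 ∧ N 3 0 = 0 ∧ N 3 1 = 0 ∧ N 3 2 = 0 := by
  refine ⟨?_, ?_, ?_, ?_, ?_, ?_, ?_, ?_, ?_, ?_⟩ <;>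
    exact h.zero _ _ (by decide) (by decide) (by decide)

lemma centerGap (h : BlockForm N σ η) (hβ0 : 0 ≤ β) (hβ : β + η ≤ σ) :
    CenterGap (compoundGen N) 0 β := by
  obtain ⟨h02, h03, h10, h12, h13, h20, h21, h30, h31, h32⟩ := h.zeros
  have o1 := h.off₀
  have o2 := h.off₂
  have r0 := h.re₀
  have r1 := h.re₁
  have r2 := h.re₂
  have r3 := h.re₃
  have n1 := norm_nonneg (N 0 1)
  have n2 := norm_nonneg (N 2 3)
  refine ⟨fun j => ?_, fun i => ?_, fun i hi => ?_⟩
  · fin_cases j <;> simp [compoundGen, addCompound, growth, *]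
  · fin_cases i <;> simp [compoundGen, addCompound, growth, *]
  · rw [sum_erase_six]
    fin_cases i <;> simp [compoundGen, addCompound, growth, *] at hi ⊢ <;> linarith

lemma dissipative (h : BlockForm N σ η) (hβ0 : 0 ≤ β) (hβ : β + η ≤ σ) (i : Fin 4) :
    ((N - growth N • (1 : Mat4)) i i).re + β + 1 / 2 *
      ∑ j ∈ Finset.univ.erase i, (‖(N - growth N • (1 : Mat4)) i j‖ +
        ‖(N - growth N • (1 : Mat4)) j i‖) ≤ 0 := by
  obtain ⟨h02, h03, h10, h12, h13, h20, h21, h30, h31, h32⟩ := h.zeros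
  have o1 := h.off₀
  have o2 := h.off₂
  have r0 := h.re₀
  have r1 := h.re₁
  have r2 := h.re₂
  have r3 := h.re₃
  have n1 := norm_nonneg (N 0 1)
  have n2 := norm_nonneg (N 2 3)
  rw [sum_erase_four]
  fin_cases i <;> simp [growth, *] <;> linarith

lemma dissipative_adj (h : BlockForm N σ η) (hβ0 : 0 ≤ β) (hβ : β + η ≤ σ) (i : Fin 4) :
    (((N 2 2 + N 3 3) • (1 : Mat4) - N.transpose) i i).re + β + 1 / 2 *
      ∑ j ∈ Finset.univ.erase i, (‖((N 2 2 + N 3 3) • (1 : Mat4) - N.transpose) i j‖ +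
        ‖((N 2 2 + N 3 3) • (1 : Mat4) - N.transpose) j i‖) ≤ 0 := by
  obtain ⟨h02, h03, h10, h12, h13, h20, h21, h30, h31, h32⟩ := h.zeros
  have o1 := h.off₀
  have o2 := h.off₂
  have r0 := h.re₀
  have r1 := h.re₁
  have r2 := h.re₂
  have r3 := h.re₃
  have n1 := norm_nonneg (N 0 1)
  have n2 := norm_nonneg (N 2 3)
  rw [sum_erase_four]
  fin_cases i <;> simp [*] <;> linarith

lemma addCompound_col (h : BlockForm N σ η) (i : Fin 6) :
    addCompound N i 0 = growth N * (1 : Mat6) i 0 := by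
  obtain ⟨h02, h03, h10, h12, h13, h20, h21, h30, h31, h32⟩ := h.zeros
  fin_cases i <;> simp [addCompound, growth, Matrix.one_apply, *]

lemma addCompound_row (h : BlockForm N σ η) (i : Fin 6) :
    addCompound N 0 i = growth N * (1 : Mat6) 0 i := by
  obtain ⟨h02, h03, h10, h12, h13, h20, h21, h30, h31, h32⟩ := h.zeros
  fin_cases i <;> simp [addCompound, growth, Matrix.one_apply, *]

end BlockForm

lemma norm_compoundPert_le {B : ℝ → Mat4} {p' : ℝ → ℂ} {x c : ℝ} (hB : ∀ i j, ‖B x i j‖ ≤ c)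
    (hp : ‖p' x‖ ≤ c) (i j : Fin 6) : ‖compoundPert B p' x i j‖ ≤ 3 * c := by
  have hc : 0 ≤ c := (norm_nonneg _).trans hp
  have h2 : ∀ a b : ℂ, ‖a‖ ≤ c → ‖b‖ ≤ c → ‖a + b - p' x‖ ≤ 3 * c := fun a b ha hb =>
    (norm_sub_le _ _).trans (by linarith [norm_add_le a b])
  have h1 : ∀ a : ℂ, ‖a‖ ≤ c → ‖a‖ ≤ 3 * c := fun a ha => by linarith
  fin_cases i <;> fin_cases j <;> simp [compoundPert, addCompound] <;>
    first
      | positivity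
      | exact h2 _ _ (hB _ _) (hB _ _)
      | exact h1 _ (hB _ _)

/-- A localized perturbation `B` on `s`, with a gauge function `p` that captures the first order
part of its effect on the dominant direction. -/
structure Localized (K α : ℝ) (B : ℝ → Mat4) (p p' : ℝ → ℂ) (s : Set ℝ) : Prop where
  deriv : ∀ x ∈ s, HasDerivWithinAt p (p' x) s x
  bound : ∀ x ∈ s, ∀ i j, ‖B x i j‖ ≤ K * exp (-α * |x|)
  bound_gauge : ∀ x ∈ s, ‖p' x‖ ≤ K * exp (-α * |x|)
  center : ∀ x ∈ s, ‖B x 0 0 + B x 1 1 - p' x‖ ≤ K * exp (-2 * α * |x|)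
  traceless : ∀ x ∈ s, (B x).trace = 0

/-- `M` is an invertible matrix solution of `M' = (N + B) M` on `s`. -/
structure IsFlow (N : Mat4) (B M : ℝ → Mat4) (s : Set ℝ) : Prop where
  ode : ∀ x ∈ s, HasMatDeriv M ((N + B x) * M x) s x
  isUnit : ∀ x ∈ s, IsUnit (M x)

lemma IsFlow.mono {N : Mat4} {B M : ℝ → Mat4}
    {s t : Set ℝ} (h : IsFlow N B M s) (hs : t ⊆ s) : IsFlow N B M t :=
  ⟨fun x hx => (h.ode x (hs hx)).mono hs, fun x hx => h.isUnit x (hs hx)⟩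

section

variable {N : Mat4} {σ η α β K : ℝ}

lemma addCompound_add (A B : Mat4) : addCompound (A + B) = addCompound A + addCompound B := by
  ext i j
  fin_cases i <;> fin_cases j <;> simp [addCompound] <;> ring

lemma solvesOn_of_hasMatDeriv {κ : Type*} [Fintype κ] [DecidableEq κ] {D : Matrix κ κ ℂ}
    {R : ℝ → Matrix κ κ ℂ} {Y : ℝ → Matrix κ κ ℂ} {a b : ℝ}
    (h : ∀ x ∈ Icc a b, HasMatDeriv Y ((D + R x) * Y x) (Icc a b) x) (ξ : κ → ℂ) :
    SolvesOn D R 0 (fun x => (Y x).mulVec ξ) a b := by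
  have key : ∀ x ∈ Icc a b, ∀ i, HasDerivWithinAt (fun y => (Y y).mulVec ξ i)
      (∑ j, (D i j + R x i j) * (Y x).mulVec ξ j) (Icc a b) x := fun x hx i => by
    have := HasDerivWithinAt.fun_sum (u := Finset.univ) fun j _ => (h x hx i j).mul_const (ξ j)
    refine this.congr_deriv ?_
    change (((D + R x) * Y x).mulVec ξ) i = ((D + R x).mulVec ((Y x).mulVec ξ)) i
    rw [mulVec_mulVec]
  refine ⟨fun i x hx => (key x hx i).continuousWithinAt, fun x hx i => ?_⟩
  simp only [Pi.zero_apply, add_zero]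
  exact (key x (Ioo_subset_Icc_self hx) i).hasDerivAt (Icc_mem_nhds hx.1 hx.2)

/-- The rescaled second compound of a flow. -/
lemma IsFlow.hasMatDeriv_compound {B M : ℝ → Mat4} {s : Set ℝ} {p p' : ℝ → ℂ} (h : IsFlow N B M s)
    {x : ℝ} (hx : x ∈ s) (hp : HasDerivWithinAt p (p' x) s x) (c : ℂ) (G : Mat4) :
    HasMatDeriv (fun y => cexp (c - growth N * y - p y) • compound (M y * G))
      ((compoundGen N + compoundPert B p' x) *
        (cexp (c - growth N * x - p x) • compound (M x * G))) s x := by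
  have h1 : HasMatDeriv (fun y => M y * G) ((N + B x) * (M x * G) - (M x * G) * 0) s x :=
    ((h.ode x hx).mul_const G).congr_deriv (by rw [mul_assoc, mul_zero, sub_zero])
  have h2 := h1.compound
  have h3 : HasDerivWithinAt (fun y : ℝ => cexp (c - growth N * y - p y))
      (cexp (c - growth N * x - p x) * (-growth N - p' x)) s x := by
    have : HasDerivWithinAt (fun y : ℝ => c - growth N * (y : ℂ) - p y) (-growth N - p' x) s x := by
      have e : HasDerivWithinAt (fun y : ℝ => (y : ℂ)) 1 s x :=
        (hasDerivAt_id x).ofReal_comp.hasDerivWithinAt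
      exact (((e.const_mul (growth N)).const_sub c).sub hp).congr_deriv (by rw [mul_one])
    exact this.cexp
  refine (HasMatDeriv.smul h3 h2).congr_deriv ?_
  rw [addCompound_zero, mul_zero, sub_zero, addCompound_add, compoundGen, compoundPert]
  simp only [add_mul, sub_mul, Matrix.mul_smul, smul_add, smul_sub, smul_mul, one_mul]
  module

lemma IsFlow.solvable {B M : ℝ → Mat4} {p p' : ℝ → ℂ}
    (h : IsFlow N B M univ) (hp : ∀ x, HasDerivAt p (p' x) x) :
    Solvable (compoundGen N) (compoundPert B p') := fun t ξ => by
  refine ⟨fun x => (cexp ((growth N * t + p t) - growth N * x - p x) •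
    compound (M x * (M t)⁻¹)).mulVec ξ, ?_, fun a b => ?_⟩
  · simp only
    rw [mul_nonsing_inv _ (isUnit_det (h.isUnit t trivial)), compound_one]
    simp
  · refine solvesOn_of_hasMatDeriv (fun x hx => ?_) ξ
    exact (h.mono (subset_univ _)).hasMatDeriv_compound hx (hp x).hasDerivWithinAt _ _

/-- Conjugators on the two half-lines, in block coordinates. -/
structure BlockConjugator (N : Mat4) (B Q : ℝ → Mat4) (s : Set ℝ) (l : Filter ℝ) : Prop where
  isUnit : ∀ x ∈ s, IsUnit (Q x)
  ode : ∀ x ∈ s, HasMatDeriv Q ((N + B x) * Q x - Q x * N) s x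
  tendsto_one : Tendsto Q l (𝓝 1)

lemma continuous_compound : Continuous compound := by
  refine continuous_pi fun s => continuous_pi fun t => ?_
  simp only [compound, of_apply, minor₂]
  fun_prop

lemma tendsto_matrix_inv {n : Type*} [Fintype n] [DecidableEq n] {l : Filter ℝ}
    {P : ℝ → Matrix n n ℂ} (h : Tendsto P l (𝓝 1)) : Tendsto (fun x => (P x)⁻¹) l (𝓝 1) := by
  have h1 : Tendsto (fun x => (P x).det) l (𝓝 (1 : Matrix n n ℂ).det) :=
    ((continuous_id.matrix_det).tendsto _).comp h
  have h2 : Tendsto (fun x => (P x).adjugate) l (𝓝 (1 : Matrix n n ℂ).adjugate) :=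
    ((continuous_id.matrix_adjugate).tendsto _).comp h
  simp only [Matrix.inv_def, Ring.inverse_eq_inv']
  have h3 := (h1.inv₀ (by simp)).smul h2
  simpa using h3

lemma hasMatDeriv_inv_mul {B M Q : ℝ → Mat4} {s : Set ℝ} {x : ℝ}
    (hM : IsFlow N B M s) (hQ : HasMatDeriv Q ((N + B x) * Q x - Q x * N) s x) (hx : x ∈ s)
    (hs : UniqueDiffWithinAt ℝ s x) :
    HasMatDeriv (fun y => (M y)⁻¹ * Q y) (-((M x)⁻¹ * Q x * N)) s x := by
  have h1 := ((hM.ode x hx).inv hM.isUnit hx hs).mul hQ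
  refine h1.congr_deriv ?_
  have hu := isUnit_det (hM.isUnit x hx)
  rw [mul_assoc ((M x)⁻¹) ((N + B x) * M x), mul_nonsing_inv_cancel_right _ _ hu]
  noncomm_ring

lemma hasDerivWithinAt_exp_mul {μ : ℂ} {f : ℝ → ℂ} {f' : ℂ} {s : Set ℝ} {x : ℝ}
    (hf : HasDerivWithinAt f f' s x) : HasDerivWithinAt (fun y : ℝ => cexp (μ * y) * f y)
      (cexp (μ * x) * (μ * f x + f')) s x := by
  have e : HasDerivWithinAt (fun y : ℝ => μ * (y : ℂ)) μ s x := by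
    simpa using ((hasDerivAt_id x).ofReal_comp.hasDerivWithinAt (s := s)).const_mul μ
  exact (e.cexp.mul hf).congr_deriv (by ring)

/-- The solution on the line that is asymptotic to the unstable directions at `-∞`, in second
compound form. -/
def centerSol (N : Mat4) (M : ℝ → Mat4) (p : ℝ → ℂ) (G : Mat4) (x : ℝ) (i : Fin 6) : ℂ :=
  (cexp (0 - growth N * x - p x) • compound (M x * G)).mulVec (Pi.single 0 1) i

lemma centerSol_eq (M : ℝ → Mat4) (p : ℝ → ℂ) (G : Mat4) (x : ℝ) (i : Fin 6) :
    centerSol N M p G x i = cexp (-growth N * x - p x) * compound (M x * G) i 0 := by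
  rw [centerSol, Matrix.smul_mulVec, mulVec_single_one]; simp

lemma centerOrbit_centerSol {B M Q : ℝ → Mat4} {p p' : ℝ → ℂ}
    (hN : BlockForm N σ η) (hM : IsFlow N B M univ) (hp : ∀ x, HasDerivAt p (p' x) x)
    (hp0 : Tendsto p atBot (𝓝 0)) (hQ : BlockConjugator N B Q (Iic 0) atBot) :
    CenterOrbit (compoundGen N) (compoundPert B p') 0 (centerSol N M p ((M 0)⁻¹ * Q 0)) := by
  refine ⟨fun a b => ?_, fun i => ?_⟩
  · exact solvesOn_of_hasMatDeriv (fun x hx => (hM.mono (subset_univ _)).hasMatDeriv_compound hx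
      (hp x).hasDerivWithinAt 0 _) _
  · set G : ℝ → Mat4 := fun y => (M y)⁻¹ * Q y with hG
    have hconst : ∀ x ∈ Iic (0 : ℝ), ∀ i, cexp (growth N * x) * compound (G x) i 0 =
        compound (G 0) i 0 := fun x hx i => by
      have hder : ∀ y ∈ Iic (0 : ℝ), HasDerivWithinAt
          (fun y : ℝ => cexp (growth N * y) * compound (G y) i 0) 0 (Iic 0) y := fun y hy => by
        have h1 := hasMatDeriv_inv_mul (hM.mono (subset_univ (Iic 0))) (hQ.ode y hy) hy
          (uniqueDiffOn_Iic 0 y hy)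
        have h2 : HasMatDeriv G (0 * G y - G y * N) (Iic 0) y :=
          h1.congr_deriv (by rw [zero_mul, zero_sub])
        refine (hasDerivWithinAt_exp_mul (h2.compound i 0)).congr_deriv ?_
        rw [addCompound_zero, zero_mul, zero_sub, Matrix.neg_apply, Matrix.mul_apply]
        simp only [hN.addCompound_col, Matrix.one_apply, mul_ite, mul_one, mul_zero,
          Finset.sum_ite_eq', Finset.mem_univ, if_true]
        ring
      have := const_of_hasDerivWithinAt_zero (convex_Iic 0) hder hx self_mem_Iic
      simpa using this
    have hEq : ∀ x ∈ Iic (0 : ℝ), centerSol N M p ((M 0)⁻¹ * Q 0) x i =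
        cexp (-p x) * compound (Q x) i 0 := fun x hx => by
      have hu := isUnit_det (hM.isUnit x trivial)
      have e1 : compound (Q x) = compound (M x) * compound (G x) := by
        rw [← compound_mul, hG]; simp only
        rw [mul_nonsing_inv_cancel_left _ _ hu]
      rw [centerSol_eq, e1, compound_mul, Matrix.mul_apply, Matrix.mul_apply, mul_sum, mul_sum]
      refine sum_congr rfl fun k _ => ?_
      have := hconst x hx k
      change _ * (_ * compound (G 0) k 0) = _
      rw [← this]
      have e2 : cexp (-growth N * x - p x) * cexp (growth N * x) =
          cexp (-p x) := by rw [← Complex.exp_add]; ring_nf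
      rw [← e2]; ring
    have hlim : Tendsto (fun x => cexp (-p x) * compound (Q x) i 0) atBot
        (𝓝 (cexp (-0) * compound 1 i 0)) := by
      refine Tendsto.mul ((Complex.continuous_exp.tendsto _).comp hp0.neg) ?_
      have := (continuous_compound.tendsto 1).comp hQ.tendsto_one
      exact (tendsto_pi_nhds.1 (tendsto_pi_nhds.1 this i) 0)
    rw [compound_one, neg_zero, Complex.exp_zero, one_mul] at hlim
    have e3 : (1 : Mat6) i 0 = (Pi.single 0 1 : Fin 6 → ℂ) i := by
      rw [Matrix.one_apply, Pi.single_apply]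
    rw [← e3]
    refine hlim.congr' ?_
    filter_upwards [eventually_le_atBot (0 : ℝ)] with x hx
    exact (hEq x hx).symm

lemma centerSol_tendsto_top {B M Q P : ℝ → Mat4} {p p' : ℝ → ℂ} (hN : BlockForm N σ η) (hη : 0 < β)
    (hβσ : β + η ≤ σ) (hβ : β < α) (hK : 0 ≤ K) (hB : Localized K α B p p' univ)
    (hM : IsFlow N B M univ) (hp0 : Tendsto p atBot (𝓝 0)) (hp1 : Tendsto p atTop (𝓝 0))
    (hQ : BlockConjugator N B Q (Iic 0) atBot) (hP : BlockConjugator N B P (Ici 0) atTop) :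
    Tendsto (fun x => centerSol N M p ((M 0)⁻¹ * Q 0) x 0) atTop
      (𝓝 (minor₂ ((P 0)⁻¹ * Q 0) 0 1 0 1)) := by
  have hp : ∀ x, HasDerivAt p (p' x) x := fun x => by simpa using hB.deriv x trivial
  have horb := centerOrbit_centerSol hN hM hp hp0 hQ
  have hR : ∀ x i j, ‖compoundPert B p' x i j‖ ≤ 3 * K * exp (-α * |x|) := fun x i j => by
    rw [mul_assoc]; exact norm_compoundPert_le (hB.bound x trivial) (hB.bound_gauge x trivial) i j
  have hdec := horb.decay (hM.solvable hp) (hN.centerGap hη.le hβσ) (by positivity) hη.le hβ hR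
  set ψ := centerSol N M p ((M 0)⁻¹ * Q 0) with hψ
  set C := centerConst (card (Fin 6)) (3 * K) (α - β) ^ 2 with hC
  set d := minor₂ ((P 0)⁻¹ * Q 0) 0 1 0 1 with hd
  set G : ℝ → Mat4 := fun y => (P y)⁻¹ * M y with hG
  have hbd : ∀ x i, ‖ψ x i‖ ≤ C := fun x i => by
    by_cases hi : i = 0
    · subst hi; exact (hdec x).1
    · refine le_trans ?_ ((hdec x).2 i hi)
      exact le_mul_of_one_le_left (norm_nonneg _) (Real.one_le_exp (by positivity))
  have hconst : ∀ x ∈ Ici (0 : ℝ), ∀ j, cexp (-growth N * x) * compound (G x) 0 j =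
      compound (G 0) 0 j := fun x hx j => by
    have hder : ∀ y ∈ Ici (0 : ℝ), HasDerivWithinAt
        (fun y : ℝ => cexp (-growth N * y) * compound (G y) 0 j) 0 (Ici 0) y := fun y hy => by
      have hu := isUnit_det (hP.isUnit y hy)
      have h1 := ((hP.ode y hy).inv hP.isUnit hy (uniqueDiffOn_Ici 0 y hy)).mul
        ((hM.mono (subset_univ (Ici 0))).ode y hy)
      have h2 : HasMatDeriv G (N * G y - G y * 0) (Ici 0) y := by
        refine h1.congr_deriv ?_
        simp only [hG]
        rw [mul_zero, sub_zero, mul_sub, sub_mul,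
          mul_assoc ((P y)⁻¹) ((N + B y) * P y), mul_nonsing_inv_cancel_right _ _ hu,
          ← mul_assoc _ (P y) N, nonsing_inv_mul _ hu]
        noncomm_ring
      refine (hasDerivWithinAt_exp_mul (h2.compound 0 j)).congr_deriv ?_
      rw [addCompound_zero, mul_zero, sub_zero, Matrix.mul_apply]
      simp only [hN.addCompound_row, Matrix.one_apply, mul_ite, mul_one, mul_zero, ite_mul,
        zero_mul, Finset.sum_ite_eq, Finset.mem_univ, if_true]
      ring
    simpa using const_of_hasDerivWithinAt_zero (convex_Ici 0) hder hx self_mem_Ici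
  have hpair : ∀ x ∈ Ici (0 : ℝ), ∑ j, compound ((P x)⁻¹) 0 j * ψ x j = cexp (-p x) * d := fun x hx => by
    have hu := isUnit_det (hM.isUnit 0 trivial)
    have e1 : ∑ j, compound ((P x)⁻¹) 0 j * ψ x j =
        cexp (-growth N * x - p x) * (compound (G x) * compound ((M 0)⁻¹ * Q 0)) 0 0 := by
      rw [← compound_mul, hG]
      simp only [hψ, centerSol_eq]
      rw [mul_assoc, compound_mul ((P x)⁻¹), Matrix.mul_apply, mul_sum]
      exact sum_congr rfl fun j _ => by ring
    have e2 : d = (compound (G 0) * compound ((M 0)⁻¹ * Q 0)) 0 0 := by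
      rw [← compound_mul, hG]
      simp only
      rw [mul_assoc, mul_nonsing_inv_cancel_left _ _ hu]; rfl
    rw [e1, e2, Matrix.mul_apply, Matrix.mul_apply, mul_sum, mul_sum]
    refine sum_congr rfl fun j _ => ?_
    rw [← hconst x hx j, sub_eq_add_neg, Complex.exp_add]; ring
  have hlim : Tendsto (fun x => cexp (-p x) * d
      - ∑ j, (compound ((P x)⁻¹) 0 j - (1 : Mat6) 0 j) * ψ x j) atTop
      (𝓝 (cexp (-0) * d - ∑ j : Fin 6, 0)) := by
    refine Tendsto.sub (((Complex.continuous_exp.tendsto _).comp hp1.neg).mul_const d) ?_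
    refine tendsto_finsetSum _ fun j _ => ?_
    have hinv := tendsto_matrix_inv hP.tendsto_one
    have h1 : Tendsto (fun x => compound ((P x)⁻¹) 0 j - (1 : Mat6) 0 j) atTop
        (𝓝 0) := by
      have := (continuous_compound.tendsto 1).comp hinv
      have := (tendsto_pi_nhds.1 (tendsto_pi_nhds.1 this 0) j).sub_const ((1 : Mat6) 0 j)
      simpa [compound_one] using this
    exact h1.zero_mul_isBoundedUnder_le (isBoundedUnder_of ⟨C, fun x => hbd x j⟩)
  rw [neg_zero, Complex.exp_zero, one_mul, Finset.sum_const_zero, sub_zero] at hlim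
  refine hlim.congr' ?_
  filter_upwards [eventually_ge_atTop (0 : ℝ)] with x hx
  rw [← hpair x hx, ← sum_sub_distrib]
  calc _ = ∑ j, (1 : Mat6) 0 j * ψ x j :=
        sum_congr rfl fun j _ => by ring
    _ = _ := by simp [Matrix.one_apply]

end

end

section

/-! ### Passage through a pulse for block triangular systems -/

section

variable {N : Mat4} {σ η α β K X : ℝ} {B M : ℝ → Mat4} {p p' : ℝ → ℂ}

/-- Constant in the estimates of the second compound. -/
def compoundConst (K δ : ℝ) : ℝ := 8 * centerConst 6 (3 * K) δ ^ 4

lemma one_le_compoundConst {K δ : ℝ} (hK : 0 ≤ K) (hδ : 0 < δ) : 1 ≤ compoundConst K δ := by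
  have h := one_le_centerConst (κ := Fin 6) (K := 3 * K) (by positivity) hδ
  rw [card_fin] at h
  have : 1 ≤ centerConst 6 (3 * K) δ ^ 4 := one_le_pow₀ h
  rw [compoundConst]; linarith

lemma compoundPert_zero_zero (B : ℝ → Mat4) (p' : ℝ → ℂ) (x : ℝ) :
    compoundPert B p' x 0 0 = B x 0 0 + B x 1 1 - p' x := by
  simp [compoundPert, addCompound]

lemma norm_compoundPert_sub_le {B B0 : ℝ → Mat4} {p' p₀' : ℝ → ℂ} {x c : ℝ}
    (hB : ∀ i j, ‖B x i j - B0 x i j‖ ≤ c) (hp : ‖p' x - p₀' x‖ ≤ c) (i j : Fin 6) :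
    ‖compoundPert B p' x i j - compoundPert B0 p₀' x i j‖ ≤ 3 * c := by
  have e : compoundPert B p' x - compoundPert B0 p₀' x =
      compoundPert (fun y => B y - B0 y) (fun y => p' y - p₀' y) x := by
    have : addCompound (B x) = addCompound (B x - B0 x) + addCompound (B0 x) := by
      rw [← addCompound_add, sub_add_cancel]
    simp only [compoundPert, this]; module
  have h := norm_compoundPert_le (B := fun y => B y - B0 y) (p' := fun y => p' y - p₀' y) (x := x)
    (c := c) (fun i j => by simpa only [Matrix.sub_apply] using hB i j) hp i j
  rwa [← e, Matrix.sub_apply] at h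

lemma pulse_transmission {B0 M0 Q P : ℝ → Mat4} {p0 p₀' : ℝ → ℂ}
    (hN : BlockForm N σ η) (hβ0 : 0 < β) (hβσ : β + η ≤ σ) (hβ : β < α) (hK : 0 ≤ K)
    (hB0 : Localized K α B0 p0 p₀' univ) (hM0 : IsFlow N B0 M0 univ)
    (hp0 : Tendsto p0 atBot (𝓝 0)) (hp1 : Tendsto p0 atTop (𝓝 0))
    (hQ : BlockConjugator N B0 Q (Iic 0) atBot) (hP : BlockConjugator N B0 P (Ici 0) atTop)
    (hX : 0 ≤ X) (hB : Localized K α B p p' (Icc (-X) X)) (hM : IsFlow N B M (Icc (-X) X))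
    (hdiff : ∀ x ∈ Icc (-X) X, ∀ i j, ‖B x i j - B0 x i j‖ ≤ K * exp (-2 * α * X + α * |x|))
    (hdiffp : ∀ x ∈ Icc (-X) X, ‖p' x - p₀' x‖ ≤ K * exp (-2 * α * X + α * |x|))
    (hdiffo : ∀ x ∈ Icc (-X) X,
      ‖(B x 0 0 + B x 1 1 - p' x) - (B0 x 0 0 + B0 x 1 1 - p₀' x)‖ ≤ K * exp (-2 * α * X)) :
    ‖cexp (-growth N * (2 * X) - (p X - p (-X))) *
        compound (M X * (M (-X))⁻¹) 0 0 - minor₂ ((P 0)⁻¹ * Q 0) 0 1 0 1‖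
        ≤ compoundConst K (α - β) * exp (-2 * β * X) ∧
      (∀ i j, ¬ (i = 0 ∧ j = 0) → ‖cexp (-growth N * (2 * X) - (p X - p (-X))) *
        compound (M X * (M (-X))⁻¹) i j‖ ≤ compoundConst K (α - β) * exp (-β * X)) ∧
      ‖minor₂ ((P 0)⁻¹ * Q 0) 0 1 0 1‖ ≤ compoundConst K (α - β) := by
  have hp : ∀ x, HasDerivAt p0 (p₀' x) x := fun x => by simpa using hB0.deriv x trivial
  have hle : -X ≤ X := by linarith
  set S : ℝ → Mat6 := fun x =>
    cexp ((-growth N * X + p (-X)) - growth N * x - p x) • compound (M x * (M (-X))⁻¹) with hS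
  have hSd : ∀ x ∈ Icc (-X) X, HasMatDeriv S ((compoundGen N + compoundPert B p' x) * S x)
      (Icc (-X) X) x := fun x hx => by
    exact hM.hasMatDeriv_compound hx (hB.deriv x hx) (-growth N * X + p (-X)) ((M (-X))⁻¹)
  have hS1 : S (-X) = 1 := by
    simp only [hS]
    rw [mul_nonsing_inv _ ((isUnit_iff_isUnit_det _).1
      (hM.isUnit (-X) (left_mem_Icc.2 hle))), compound_one]
    have : -growth N * ↑X + p (-X) - growth N * ↑(-X) - p (-X) = 0 := by push_cast; ring
    rw [this, Complex.exp_zero, one_smul]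
  have hSX : S X = cexp (-growth N * (2 * X) - (p X - p (-X))) •
      compound (M X * (M (-X))⁻¹) := by
    simp only [hS]; congr 2; ring
  clear_value S
  have main := pulse_passage (o := 0) (R := compoundPert B p') (S := S) (K := 3 * K) (α := α)
    (β := β) (X := X)
    (centerOrbit_centerSol hN hM0 hp hp0 hQ)
    (centerSol_tendsto_top hN hβ0 hβσ hβ hK hB0 hM0 hp0 hp1 hQ hP) (hM0.solvable hp)
    (hN.centerGap hβ0.le hβσ) (by positivity) hβ0 hβ ?_ ?_ hX ?_ ?_ ?_ ?_ ?_
  · have e2 : ((card (Fin 6) : ℝ) + 2) * centerConst (card (Fin 6)) (3 * K) (α - β) ^ 4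
        = compoundConst K (α - β) := by
      rw [compoundConst, card_fin]; norm_num
    simp only [hSX, e2, Matrix.smul_apply, smul_eq_mul] at main; exact main
  · intro x i j
    rw [mul_assoc]; exact norm_compoundPert_le (hB0.bound x trivial) (hB0.bound_gauge x trivial) i j
  · intro x
    have := hB0.center x trivial
    have h2 : 0 ≤ K * exp (-2 * α * |x|) := by positivity
    rw [compoundPert_zero_zero, mul_assoc]; linarith
  · intro x hx i j
    rw [mul_assoc]
    exact norm_compoundPert_le (hB.bound x (Ioo_subset_Icc_self hx))
      (hB.bound_gauge x (Ioo_subset_Icc_self hx)) i j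
  · intro x hx i j
    rw [mul_assoc]
    exact norm_compoundPert_sub_le (hdiff x (Ioo_subset_Icc_self hx))
      (hdiffp x (Ioo_subset_Icc_self hx)) i j
  · intro x hx
    have h2 : 0 ≤ K * exp (-2 * α * X) := by positivity
    have := hdiffo x (Ioo_subset_Icc_self hx)
    rw [compoundPert_zero_zero, compoundPert_zero_zero, mul_assoc]; linarith
  · intro j
    have h := solvesOn_of_hasMatDeriv hSd (Pi.single j 1)
    simp only [mulVec_single_one] at h; exact h
  · exact hS1

/-- Decay of solutions of uniformly dissipative systems. -/
lemma dissipative_decay {D : Mat4} {R Y : ℝ → Mat4}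
    (hK : 0 ≤ K) (hβ0 : 0 < β) (hβ : β < α) (hX : 0 ≤ X)
    (hD : ∀ i, (D i i).re + β + 1 / 2 * ∑ j ∈ Finset.univ.erase i, (‖D i j‖ + ‖D j i‖) ≤ 0)
    (hY : ∀ x ∈ Icc (-X) X, HasMatDeriv Y ((D + R x) * Y x) (Icc (-X) X) x)
    (hR : ∀ x ∈ Icc (-X) X, ∀ i j, ‖R x i j‖ ≤ K * exp (-α * |x|))
    (hY1 : Y (-X) = 1) (i j : Fin 4) :
    ‖Y X i j‖ ≤ energyConst 4 K (α - β) * exp (-2 * β * X) := by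
  have hs := solvesOn_of_hasMatDeriv hY (Pi.single j 1)
  have hC := one_le_energyConst (n := 4) hK (sub_pos.2 hβ)
  have := weighted_energy (m := fun _ => β) (F := 0) (by linarith) hK hβ hs.1 hs.2 hD
    (fun _ _ _ => rfl) (fun _ _ => by simpa using hβ0.le)
    (fun x hx => hR x (Ioo_subset_Icc_self hx)) (by simp)
  simp only [hY1, mulVec_single_one, Matrix.col_apply, card_fin] at this
  have e1 : ∑ i : Fin 4, (exp (β * -X) * ‖(1 : Mat4) i j‖) ^ 2 =
      exp (-β * X) ^ 2 := by
    rw [sum_eq_single j]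
    · simp
    · intro b _ hb; simp [one_apply_ne hb]
    · simp
  rw [e1] at this
  have e3 : (exp (β * X) * ‖Y X i j‖) ^ 2 ≤ ∑ i, (exp (β * X) * ‖Y X i j‖) ^ 2 :=
    single_le_sum (f := fun i => (exp (β * X) * ‖Y X i j‖) ^ 2)
      (fun i _ => sq_nonneg _) (Finset.mem_univ i)
  have e4 : exp (β * X) * ‖Y X i j‖ ≤ energyConst 4 K (α - β) * exp (-β * X) := by
    refine (sq_le_sq₀ (by positivity) (by positivity)).1 ?_
    rw [mul_pow (energyConst 4 K (α - β))]
    have h5 : energyConst 4 K (α - β) * exp (-β * X) ^ 2 ≤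
        energyConst 4 K (α - β) ^ 2 * exp (-β * X) ^ 2 := by
      gcongr; nlinarith
    linarith
  calc ‖Y X i j‖ = exp (-β * X) * (exp (β * X) * ‖Y X i j‖) := by
        rw [← mul_assoc, ← exp_add]; simp
    _ ≤ exp (-β * X) * (energyConst 4 K (α - β) * exp (-β * X)) := by gcongr
    _ = energyConst 4 K (α - β) * (exp (-β * X) * exp (-β * X)) := by ring
    _ = _ := by rw [← exp_add]; ring_nf

lemma hasMatDeriv_exp_smul {μ : ℂ} {n : Type*} [Fintype n] {Y : ℝ → Matrix n n ℂ}
    {Y' : Matrix n n ℂ} {s : Set ℝ} {x : ℝ} (c : ℂ) (hY : HasMatDeriv Y Y' s x) :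
    HasMatDeriv (fun y => cexp (c + μ * y) • Y y)
      (cexp (c + μ * x) • (μ • Y x + Y')) s x := by
  have e : HasDerivWithinAt (fun y : ℝ => c + μ * (y : ℂ)) μ s x := by
    simpa using (((hasDerivAt_id x).ofReal_comp.hasDerivWithinAt (s := s)).const_mul μ).const_add c
  exact (HasMatDeriv.smul e.cexp hY).congr_deriv (by module)

lemma IsFlow.norm_entry_le (hN : BlockForm N σ η) (hβ0 : 0 < β) (hβσ : β + η ≤ σ) (hβ : β < α)
    (hK : 0 ≤ K) (hX : 0 ≤ X) (hB : Localized K α B p p' (Icc (-X) X))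
    (hM : IsFlow N B M (Icc (-X) X)) (i j : Fin 4) :
    ‖cexp (-growth N * (2 * X)) * (M X * (M (-X))⁻¹) i j‖ ≤
      energyConst 4 K (α - β) * exp (-2 * β * X) := by
  have h := dissipative_decay (R := B)
    (Y := fun x => cexp (-growth N * X + -growth N * x) • (M x * (M (-X))⁻¹)) hK hβ0 hβ hX
    (hN.dissipative hβ0.le hβσ) ?_ hB.bound ?_ i j
  · rw [show -growth N * (2 * X) = -growth N * X + -growth N * (X : ℂ) by ring]; exact h
  · intro x hx
    refine (hasMatDeriv_exp_smul _ ((hM.ode x hx).mul_const _)).congr_deriv ?_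
    simp only [add_mul, sub_mul, Matrix.mul_smul, smul_add, smul_mul, one_mul, mul_assoc]
    module
  · rw [mul_nonsing_inv _ ((isUnit_iff_isUnit_det _).1
      (hM.isUnit (-X) (left_mem_Icc.2 (by linarith))))]
    have : -growth N * ↑X + -growth N * ↑(-X) = 0 := by push_cast; ring
    rw [this, Complex.exp_zero, one_smul]

lemma adjugate_eq_det_smul_inv {n : Type*} [Fintype n] [DecidableEq n] {A : Matrix n n ℂ}
    (h : IsUnit A) : A.adjugate = A.det • A⁻¹ := by
  have hd := (isUnit_det h).ne_zero
  rw [Matrix.inv_def, Ring.inverse_eq_inv', smul_smul, mul_inv_cancel₀ hd, one_smul]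

lemma IsFlow.norm_adjugate_le (hN : BlockForm N σ η) (hβ0 : 0 < β) (hβσ : β + η ≤ σ) (hβ : β < α)
    (hK : 0 ≤ K) (hX : 0 ≤ X) (hB : Localized K α B p p' (Icc (-X) X))
    (hM : IsFlow N B M (Icc (-X) X)) (i j : Fin 4) :
    ‖cexp (-growth N * (2 * X)) * (M X * (M (-X))⁻¹).adjugate i j‖ ≤
      energyConst 4 K (α - β) * exp (-2 * β * X) := by
  have hmem : -X ∈ Icc (-X) X := left_mem_Icc.2 (by linarith)
  have hu0 := isUnit_det (hM.isUnit (-X) hmem)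
  set T : ℝ → Mat4 := fun x => M x * (M (-X))⁻¹ with hT
  have hTu : ∀ x ∈ Icc (-X) X, IsUnit (T x) := fun x hx =>
    (hM.isUnit x hx).mul ((isUnit_iff_isUnit_det _).2 (by
      rw [det_nonsing_inv]; simpa using hu0))
  have hT1 : T (-X) = 1 := mul_nonsing_inv _ hu0
  rcases hX.eq_or_lt with rfl | hX'
  · have : T 0 = 1 := by simpa using hT1
    rw [show M 0 * (M (-0))⁻¹ = T 0 from rfl, this, Matrix.adjugate_one]
    have hC := one_le_energyConst (n := 4) hK (sub_pos.2 hβ)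
    simp only [Complex.ofReal_zero, mul_zero, Complex.exp_zero, one_mul, Real.exp_zero, mul_one]
    rw [Matrix.one_apply]
    split_ifs <;> simp <;> linarith
  have hTd : ∀ x ∈ Icc (-X) X, HasMatDeriv T ((N + B x) * T x) (Icc (-X) X) x := fun x hx =>
    ((hM.ode x hx).mul_const _).congr_deriv (by rw [mul_assoc])
  have hadj : ∀ x ∈ Icc (-X) X, HasMatDeriv (fun y => (T y).adjugate.transpose)
      ((N.trace • (1 : Mat4) - N.transpose - (B x).transpose)
        * (T x).adjugate.transpose) (Icc (-X) X) x := fun x hx => by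
    have hu := isUnit_det (hTu x hx)
    have h1 := HasMatDeriv.smul (hTd x hx).det_of_linear
      ((hTd x hx).inv hTu hx (uniqueDiffOn_Icc (by linarith) x hx))
    have h2 : HasMatDeriv (fun y => (T y).adjugate)
        ((T x).adjugate * (N.trace • (1 : Mat4) - N - B x))
        (Icc (-X) X) x := by
      have h2' := h1.congr_deriv (M'' := (T x).adjugate *
        (N.trace • (1 : Mat4) - N - B x)) (by
          rw [adjugate_eq_det_smul_inv (hTu x hx), mul_assoc ((T x)⁻¹),
            mul_nonsing_inv_cancel_right _ _ hu,
            trace_add, hB.traceless x hx, add_zero]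
          simp only [mul_sub, mul_add, smul_mul, Matrix.mul_smul, mul_one]
          module)
      intro i j
      refine (h2' i j).congr_of_mem (fun y hy => ?_) hx
      change (T y).adjugate i j = ((T y).det • (T y)⁻¹) i j
      rw [adjugate_eq_det_smul_inv (hTu y hy)]
    intro i j
    have h3 := h2 j i
    refine h3.congr_deriv ?_
    change _ = ((N.trace • (1 : Mat4) - N.transpose - (B x).transpose)
        * (T x).adjugate.transpose) i j
    rw [← Matrix.transpose_apply (_ * _) j i, Matrix.transpose_mul]; simp [Matrix.transpose_sub]
  have h := dissipative_decay (R := fun x => -(B x).transpose)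
    (Y := fun x => cexp (-growth N * X + -growth N * x) • (T x).adjugate.transpose)
    hK hβ0 hβ hX (hN.dissipative_adj hβ0.le hβσ) ?_ ?_ ?_ j i
  · rw [show -growth N * (2 * X) = -growth N * X + -growth N * (X : ℂ) by ring]; exact h
  · intro x hx
    refine (hasMatDeriv_exp_smul _ (hadj x hx)).congr_deriv ?_
    rw [trace_eq_growth_add]
    simp only [add_mul, sub_mul, Matrix.mul_smul, smul_add, smul_mul, one_mul, neg_mul]
    module
  · intro x hx i j; simpa using hB.bound x hx j i
  · simp only [hT1]
    have : -growth N * ↑X + -growth N * ↑(-X) = 0 := by push_cast; ring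
    rw [this, Complex.exp_zero, one_smul, Matrix.adjugate_one, Matrix.transpose_one]

lemma IsFlow.norm_det_le (hN : BlockForm N σ η) (hβσ : β ≤ σ) (hσ : 0 ≤ σ) (hX : 0 ≤ X)
    (hB : Localized K α B p p' (Icc (-X) X)) (hM : IsFlow N B M (Icc (-X) X)) :
    ‖cexp (-growth N * (2 * X)) * (M X * (M (-X))⁻¹).det‖ ≤ exp (-2 * β * X) := by
  have hmem : -X ∈ Icc (-X) X := left_mem_Icc.2 (by linarith)
  have hmem' : X ∈ Icc (-X) X := right_mem_Icc.2 (by linarith)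
  have hu0 := isUnit_det (hM.isUnit (-X) hmem)
  have hder : ∀ y ∈ Icc (-X) X, HasDerivWithinAt
      (fun y : ℝ => cexp (-N.trace * y) * (M y).det) 0 (Icc (-X) X) y := fun y hy => by
    refine (hasDerivWithinAt_exp_mul (hM.ode y hy).det_of_linear).congr_deriv ?_
    rw [trace_add, hB.traceless y hy]; ring
  have hc := const_of_hasDerivWithinAt_zero (convex_Icc _ _) hder hmem hmem'
  have hdet : (M X * (M (-X))⁻¹).det = cexp (N.trace * (2 * X)) := by
    rw [det_mul, det_nonsing_inv, Ring.inverse_eq_inv', ← div_eq_mul_inv, div_eq_iff hu0.ne_zero]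
    have e1 : (M X).det = cexp (N.trace * X) * (cexp (-N.trace * X) * (M X).det) := by
      rw [← mul_assoc, ← Complex.exp_add]; simp
    rw [e1, ← hc, ← mul_assoc, ← Complex.exp_add]
    congr 2; push_cast; ring
  rw [hdet, ← Complex.exp_add, Complex.norm_exp, trace_eq_growth_add]
  refine exp_le_exp.2 ?_
  have e : (-growth N * (2 * X) + (growth N + (N 2 2 + N 3 3)) * (2 * X)) =
      ((2 * X : ℝ) : ℂ) * (N 2 2 + N 3 3) := by push_cast; ring
  rw [e, Complex.re_ofReal_mul, Complex.add_re]; nlinarith [hN.re₂, hN.re₃]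

end

/-- Trace of a product of two nearly rank one operators. -/
lemma norm_trace_mul_sub_le {S T : Mat6} {d e : ℂ} {C a b : ℝ} (hC : 0 ≤ C) (ha : 0 ≤ a)
    (hb : 0 ≤ b) (ha1 : a ≤ 1) (hS : ‖S 0 0 - d‖ ≤ C * a ^ 2) (hT : ‖T 0 0 - e‖ ≤ C * b ^ 2)
    (hS' : ∀ i j, ¬ (i = 0 ∧ j = 0) → ‖S i j‖ ≤ C * a)
    (hT' : ∀ i j, ¬ (i = 0 ∧ j = 0) → ‖T i j‖ ≤ C * b) (hd : ‖d‖ ≤ C) (he : ‖e‖ ≤ C) :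
    ‖(S * T).trace - d * e‖ ≤ 40 * C ^ 2 * (a ^ 2 + b ^ 2) := by
  have h1 : (S * T).trace = ∑ i, ∑ j, S i j * T j i := rfl
  have h2 : (S * T).trace - d * e =
      ∑ i, ∑ j, (S i j * T j i - if i = 0 ∧ j = 0 then d * e else 0) := by
    simp only [sum_sub_distrib, ← h1]
    congr 1
    rw [sum_eq_single 0, sum_eq_single 0] <;> simp +contextual
  have hab : a * b ≤ a ^ 2 + b ^ 2 := by nlinarith [sq_nonneg (a - b)]
  have h3 : ∀ i j, ‖S i j * T j i - if i = 0 ∧ j = 0 then d * e else 0‖ ≤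
      C ^ 2 * (a ^ 2 + b ^ 2) + if i = 0 ∧ j = 0 then C ^ 2 * (a ^ 2 + b ^ 2) else 0 := fun i j => by
    by_cases h : i = 0 ∧ j = 0
    · obtain ⟨rfl, rfl⟩ := h
      simp only [and_self, if_true]
      have e1 : S 0 0 * T 0 0 - d * e = S 0 0 * (T 0 0 - e) + (S 0 0 - d) * e := by ring
      have e2 : ‖S 0 0‖ ≤ 2 * C := by
        have : S 0 0 = (S 0 0 - d) + d := by ring
        rw [this]
        refine (norm_add_le _ _).trans ?_
        nlinarith [mul_le_mul_of_nonneg_left (pow_le_one₀ ha ha1 : a ^ 2 ≤ 1) hC]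
      rw [e1]
      refine (norm_add_le _ _).trans ?_
      rw [norm_mul, norm_mul]
      calc _ ≤ 2 * C * (C * b ^ 2) + C * a ^ 2 * C := by gcongr
        _ ≤ _ := by nlinarith [mul_nonneg (sq_nonneg C) (sq_nonneg a)]
    · simp only [h, if_false, sub_zero, add_zero, norm_mul]
      have h' : ¬ (j = 0 ∧ i = 0) := fun hh => h ⟨hh.2, hh.1⟩
      calc _ ≤ (C * a) * (C * b) := mul_le_mul (hS' i j h) (hT' j i h') (norm_nonneg _) (by positivity)
        _ = C ^ 2 * (a * b) := by ring
        _ ≤ _ := by gcongr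
  rw [h2]
  calc _ ≤ ∑ i : Fin 6, ∑ j : Fin 6, (C ^ 2 * (a ^ 2 + b ^ 2) +
        if i = 0 ∧ j = 0 then C ^ 2 * (a ^ 2 + b ^ 2) else 0) :=
        norm_sum_le_of_le _ fun i _ => norm_sum_le_of_le _ fun j _ => h3 i j
    _ = 37 * (C ^ 2 * (a ^ 2 + b ^ 2)) := by
        simp only [sum_add_distrib, sum_const, card_univ, card_fin]
        rw [sum_eq_single 0, sum_eq_single 0] <;> simp +contextual; ring
    _ ≤ _ := by nlinarith [mul_nonneg (sq_nonneg C) (add_nonneg (sq_nonneg a) (sq_nonneg b))]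

/-- Constant in the estimate of the periodic Evans function. -/
def evansConst (K δ : ℝ) : ℝ := 40 * compoundConst K δ ^ 2 + 32 * energyConst 4 K δ ^ 2 + 2

/-- The determinant of the monodromy matrix, in terms of estimates for the two passages. -/
lemma norm_evans_sub_le {S T : Mat4} {μ p q d e γ : ℂ} {C c a b X Y : ℝ} (hC : 0 ≤ C) (hc : 0 ≤ c)
    (ha : 0 ≤ a) (hb : 0 ≤ b) (ha1 : a ≤ 1) (hb1 : b ≤ 1) (hγ : ‖γ‖ = 1) (hpq : p + q = 0)
    (hS : ‖cexp (-μ * (2 * X) - p) * compound S 0 0 - d‖ ≤ C * a ^ 2)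
    (hT : ‖cexp (-μ * (2 * Y) - q) * compound T 0 0 - e‖ ≤ C * b ^ 2)
    (hS' : ∀ i j, ¬ (i = 0 ∧ j = 0) → ‖cexp (-μ * (2 * X) - p) * compound S i j‖ ≤ C * a)
    (hT' : ∀ i j, ¬ (i = 0 ∧ j = 0) → ‖cexp (-μ * (2 * Y) - q) * compound T i j‖ ≤ C * b)
    (hd : ‖d‖ ≤ C) (he : ‖e‖ ≤ C) (hS1 : ∀ i j, ‖cexp (-μ * (2 * X)) * S i j‖ ≤ c * a ^ 2)
    (hT1 : ∀ i j, ‖cexp (-μ * (2 * Y)) * T i j‖ ≤ c * b ^ 2)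
    (hS3 : ∀ i j, ‖cexp (-μ * (2 * X)) * S.adjugate i j‖ ≤ c * a ^ 2)
    (hT3 : ∀ i j, ‖cexp (-μ * (2 * Y)) * T.adjugate i j‖ ≤ c * b ^ 2)
    (hS4 : ‖cexp (-μ * (2 * X)) * S.det‖ ≤ a ^ 2) (hT4 : ‖cexp (-μ * (2 * Y)) * T.det‖ ≤ b ^ 2)
    (hS0 : ‖cexp (-μ * (2 * X))‖ ≤ a ^ 2) (hT0 : ‖cexp (-μ * (2 * Y))‖ ≤ b ^ 2) :
    ‖cexp (-μ * (2 * X + 2 * Y)) * (γ ^ 2)⁻¹ * (S * T - γ • (1 : Mat4)).det - d * e‖ ≤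
      (40 * C ^ 2 + 32 * c ^ 2 + 2) * (a ^ 2 + b ^ 2) := by
  have hγ0 : γ ≠ 0 := by rintro rfl; simp at hγ
  set E := cexp (-μ * (2 * X)) with hE
  set F := cexp (-μ * (2 * Y)) with hF
  have hEF : cexp (-μ * (2 * X + 2 * Y)) = E * F := by rw [hE, hF, ← Complex.exp_add]; ring_nf
  have hEF' : E * F = cexp (-μ * (2 * X) - p) * cexp (-μ * (2 * Y) - q) := by
    rw [hE, hF, ← Complex.exp_add, ← Complex.exp_add]; congr 1; linear_combination hpq
  have hab : a ^ 2 * b ^ 2 ≤ a ^ 2 + b ^ 2 := by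
    have := pow_le_one₀ hb hb1 (n := 2)
    nlinarith [sq_nonneg a, sq_nonneg b]
  have t2 := norm_trace_mul_sub_le (S := cexp (-μ * (2 * X) - p) • compound S)
    (T := cexp (-μ * (2 * Y) - q) • compound T) hC ha hb ha1 hS hT hS' hT' hd he
  rw [smul_mul, Matrix.mul_smul, smul_smul, ← hEF', ← compound_mul, trace_smul, smul_eq_mul] at t2
  have tr : ∀ U V : Mat4, (∀ i j, ‖E * U i j‖ ≤ c * a ^ 2) →
      (∀ i j, ‖F * V i j‖ ≤ c * b ^ 2) → ‖E * F * (U * V).trace‖ ≤ 16 * c ^ 2 * (a ^ 2 * b ^ 2) := fun U V hU hV => by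
    have e1 : E * F * (U * V).trace = ∑ i, ∑ j, (E * U i j) * (F * V j i) := by
      rw [show (U * V).trace = ∑ i, ∑ j, U i j * V j i from rfl]
      simp only [mul_sum]; exact sum_congr rfl fun i _ => sum_congr rfl fun j _ => by ring
    rw [e1]
    calc _ ≤ ∑ i : Fin 4, ∑ j : Fin 4, (c * a ^ 2) * (c * b ^ 2) :=
          norm_sum_le_of_le _ fun i _ => norm_sum_le_of_le _ fun j _ => by
            rw [norm_mul]; exact mul_le_mul (hU i j) (hV j i) (norm_nonneg _) (by positivity)
      _ = _ := by
          simp only [sum_const, card_univ, card_fin]; ring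
  have t1 := tr S T hS1 hT1
  have t3 : ‖E * F * (S * T).adjugate.trace‖ ≤ 16 * c ^ 2 * (a ^ 2 * b ^ 2) := by
    rw [Matrix.adjugate_mul_distrib, trace_mul_comm]; exact tr _ _ hS3 hT3
  have t4 : ‖E * F * (S * T).det‖ ≤ a ^ 2 * b ^ 2 := by
    rw [det_mul, show E * F * (S.det * T.det) = (E * S.det) * (F * T.det) by ring, norm_mul]
    exact mul_le_mul hS4 hT4 (norm_nonneg _) (by positivity)
  have t0 : ‖E * F‖ ≤ a ^ 2 * b ^ 2 := by
    rw [norm_mul]; exact mul_le_mul hS0 hT0 (norm_nonneg _) (by positivity)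
  rw [hEF, det_sub_smul_one]
  have expand : E * F * (γ ^ 2)⁻¹ * ((S * T).det - γ * (S * T).adjugate.trace +
      γ ^ 2 * (compound (S * T)).trace - γ ^ 3 * (S * T).trace + γ ^ 4) - d * e =
      (E * F * (compound (S * T)).trace - d * e) + (γ ^ 2)⁻¹ * (E * F * (S * T).det)
      + -(γ⁻¹ * (E * F * (S * T).adjugate.trace)) + -(γ * (E * F * (S * T).trace))
      + γ ^ 2 * (E * F) := by
    field_simp; ring
  rw [expand]
  refine (norm_add_le _ _).trans ?_
  refine (add_le_add (norm_add_le _ _) le_rfl).trans ?_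
  refine (add_le_add (add_le_add (norm_add_le _ _) le_rfl) le_rfl).trans ?_
  refine (add_le_add (add_le_add (add_le_add (norm_add_le _ _) le_rfl) le_rfl) le_rfl).trans ?_
  simp only [norm_neg, norm_mul (γ ^ 2)⁻¹, norm_mul γ⁻¹, norm_mul γ, norm_mul (γ ^ 2), norm_inv,
    norm_pow, hγ, one_pow, inv_one, one_mul]
  have hc2 : 16 * c ^ 2 * (a ^ 2 * b ^ 2) ≤ 16 * c ^ 2 * (a ^ 2 + b ^ 2) := by gcongr
  linarith

end

section

/-! ### The periodic Evans function in block coordinates -/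

/-- A pulse in block coordinates, with transmission coefficient `d`. -/
structure IsPulse (N : Mat4) (K α : ℝ) (B : ℝ → Mat4) (p p' : ℝ → ℂ) (d : ℂ) : Prop where
  localized : Localized K α B p p' univ
  bot : Tendsto p atBot (𝓝 0)
  top : Tendsto p atTop (𝓝 0)
  transmission : ∃ M Q P : ℝ → Mat4, IsFlow N B M univ ∧
    BlockConjugator N B Q (Iic 0) atBot ∧ BlockConjugator N B P (Ici 0) atTop ∧
    d = minor₂ ((P 0)⁻¹ * Q 0) 0 1 0 1

/-- `B` is close to the pulse `B0` on `[-X, X]`. -/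
structure IsNear (K α X : ℝ) (B : ℝ → Mat4) (p p' : ℝ → ℂ)
    (B0 : ℝ → Mat4) (p₀' : ℝ → ℂ) : Prop where
  localized : Localized K α B p p' (Icc (-X) X)
  diff : ∀ x ∈ Icc (-X) X, ∀ i j, ‖B x i j - B0 x i j‖ ≤ K * exp (-2 * α * X + α * |x|)
  diff_gauge : ∀ x ∈ Icc (-X) X, ‖p' x - p₀' x‖ ≤ K * exp (-2 * α * X + α * |x|)
  diff_center : ∀ x ∈ Icc (-X) X,
    ‖(B x 0 0 + B x 1 1 - p' x) - (B0 x 0 0 + B0 x 1 1 - p₀' x)‖ ≤ K * exp (-2 * α * X)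

lemma norm_cexp_growth_le {N : Mat4} {σ η β X : ℝ} (hN : BlockForm N σ η) (hσ : β ≤ σ) (hβ : 0 ≤ β)
    (hX : 0 ≤ X) : ‖cexp (-growth N * (2 * X))‖ ≤ exp (-2 * β * X) := by
  rw [Complex.norm_exp]
  refine exp_le_exp.2 ?_
  have e : -growth N * (2 * X) = ((2 * X : ℝ) : ℂ) * (-growth N) := by push_cast; ring
  rw [e, Complex.re_ofReal_mul, growth, Complex.neg_re, Complex.add_re]; nlinarith [hN.re₀, hN.re₁]

section

variable {N : Mat4} {σ η α β K X Y : ℝ}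

lemma norm_evans_block_sub_le {B B0 M E E0 Z : ℝ → Mat4} {p p' p0 p₀' q q' q₀ q₀' : ℝ → ℂ}
    {d e γ : ℂ} (hN : BlockForm N σ η) (hη : 0 ≤ η) (hβ0 : 0 < β) (hβσ : β + η ≤ σ) (hβ : β < α)
    (hK : 0 ≤ K) (hB0 : IsPulse N K α B0 p0 p₀' d) (hE0 : IsPulse N K α E0 q₀ q₀' e) (hX : 0 ≤ X)
    (hY : 0 ≤ Y) (hB : IsNear K α X B p p' B0 p₀') (hE : IsNear K α Y E q q' E0 q₀')
    (hM : IsFlow N B M (Icc (-X) X)) (hZ : IsFlow N E Z (Icc (-Y) Y))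
    (hpq : (p X - p (-X)) + (q Y - q (-Y)) = 0) (hγ : ‖γ‖ = 1) :
    ‖cexp (-growth N * (2 * X + 2 * Y)) * (γ ^ 2)⁻¹ *
        (M X * (M (-X))⁻¹ * (Z Y * (Z (-Y))⁻¹) - γ • (1 : Mat4)).det - d * e‖ ≤
      evansConst K (α - β) * (exp (-2 * β * X) + exp (-2 * β * Y)) := by
  obtain ⟨M0, Q, P, hM0, hQ, hP, rfl⟩ := hB0.transmission
  obtain ⟨Z0, Q', P', hZ0, hQ', hP', rfl⟩ := hE0.transmission
  obtain ⟨a1, a2, a3⟩ := pulse_transmission hN hβ0 hβσ hβ hK hB0.localized hM0 hB0.bot hB0.top hQ hP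
    hX hB.localized hM hB.diff hB.diff_gauge hB.diff_center
  obtain ⟨b1, b2, b3⟩ := pulse_transmission hN hβ0 hβσ hβ hK hE0.localized hZ0 hE0.bot hE0.top
    hQ' hP' hY hE.localized hZ hE.diff hE.diff_gauge hE.diff_center
  have hsq : ∀ x : ℝ, exp (-2 * β * x) = exp (-β * x) ^ 2 := fun x => by
    rw [← Real.exp_nat_mul]; congr 1; push_cast; ring
  have hle : ∀ x : ℝ, 0 ≤ x → exp (-β * x) ≤ 1 := fun x hx => exp_le_one_iff.2 (by nlinarith)
  have hβσ' : β ≤ σ := by linarith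
  have hσ : 0 ≤ σ := by linarith
  have c1 := one_le_compoundConst hK (sub_pos.2 hβ)
  have c2 := one_le_energyConst (n := 4) hK (sub_pos.2 hβ)
  have h1 := fun i j => IsFlow.norm_entry_le hN hβ0 hβσ hβ hK hX hB.localized hM i j
  have h2 := fun i j => IsFlow.norm_entry_le hN hβ0 hβσ hβ hK hY hE.localized hZ i j
  have h3 := fun i j => IsFlow.norm_adjugate_le hN hβ0 hβσ hβ hK hX hB.localized hM i j
  have h4 := fun i j => IsFlow.norm_adjugate_le hN hβ0 hβσ hβ hK hY hE.localized hZ i j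
  have h5 := IsFlow.norm_det_le hN hβσ' hσ hX hB.localized hM
  have h6 := IsFlow.norm_det_le hN hβσ' hσ hY hE.localized hZ
  have h7 := norm_cexp_growth_le hN hβσ' hβ0.le hX
  have h8 := norm_cexp_growth_le hN hβσ' hβ0.le hY
  rw [hsq] at a1 b1 h5 h6 h7 h8
  simp only [hsq] at h1 h2 h3 h4
  rw [hsq, hsq, evansConst]
  exact norm_evans_sub_le (by linarith) (by linarith) (exp_nonneg _) (exp_nonneg _)
    (hle X hX) (hle Y hY) hγ hpq a1 b1 a2 b2 a3 b3 h1 h2 h3 h4 h5 h6 h7 h8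

lemma IsPulse.norm_le {B : ℝ → Mat4} {p p' : ℝ → ℂ} {d : ℂ}
    (hN : BlockForm N σ η) (hβ0 : 0 < β) (hβσ : β + η ≤ σ) (hβ : β < α) (hK : 0 ≤ K)
    (h : IsPulse N K α B p p' d) : ‖d‖ ≤ compoundConst K (α - β) := by
  obtain ⟨M, Q, P, hM, hQ, hP, rfl⟩ := h.transmission
  have hl := h.localized
  refine (pulse_transmission (X := 0) (B := B) (M := M) (p := p) (p' := p') hN hβ0 hβσ hβ hK hl hM
    h.bot h.top hQ hP le_rfl
    ⟨fun x _ => (hl.deriv x trivial).mono (subset_univ _), fun x _ => hl.bound x trivial,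
      fun x _ => hl.bound_gauge x trivial, fun x _ => hl.center x trivial,
      fun x _ => hl.traceless x trivial⟩
    (hM.mono (subset_univ _)) (fun x _ i j => ?_) (fun x _ => ?_) (fun x _ => ?_)).2.2
  all_goals rw [sub_self, norm_zero]; positivity

lemma IsPulse.unique {B : ℝ → Mat4} {p p' : ℝ → ℂ} {d e : ℂ}
    (hN : BlockForm N σ η) (hβ0 : 0 < β) (hβσ : β + η ≤ σ) (hβ : β < α) (hK : 0 ≤ K)
    (h : IsPulse N K α B p p' d) (h' : IsPulse N K α B p p' e) : d = e := by
  obtain ⟨M, -, -, hM, -⟩ := h.transmission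
  have hl := h.localized
  have key : ∀ {d}, IsPulse N K α B p p' d → ∀ X : ℝ, 0 ≤ X →
      ‖cexp (-growth N * (2 * X) - (p X - p (-X))) * compound (M X * (M (-X))⁻¹) 0 0 - d‖ ≤
        compoundConst K (α - β) * exp (-2 * β * X) := by
    intro d hd X hX
    obtain ⟨M', Q, P, hM', hQ, hP, rfl⟩ := hd.transmission
    refine (pulse_transmission (X := X) (B := B) (M := M) (p := p) (p' := p') hN hβ0 hβσ hβ hK hl
      hM' h.bot h.top hQ hP hX
      ⟨fun x _ => (hl.deriv x trivial).mono (subset_univ _), fun x _ => hl.bound x trivial,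
        fun x _ => hl.bound_gauge x trivial, fun x _ => hl.center x trivial,
        fun x _ => hl.traceless x trivial⟩
      (hM.mono (subset_univ _)) (fun x _ i j => ?_) (fun x _ => ?_) (fun x _ => ?_)).1
    all_goals rw [sub_self, norm_zero]; positivity
  have hbound : ∀ X : ℝ, 0 ≤ X →
      ‖d - e‖ ≤ 2 * compoundConst K (α - β) * exp (-2 * β * X) := fun X hX => by
    have h1 := key h X hX
    have h2 := key h' X hX
    rw [norm_sub_rev] at h1
    calc ‖d - e‖ ≤ _ := norm_sub_le_norm_sub_add_norm_sub d (cexp (-growth N * (2 * X) -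
          (p X - p (-X))) * compound (M X * (M (-X))⁻¹) 0 0) e
      _ ≤ _ := by linarith
  have hlim : Tendsto (fun X : ℝ => 2 * compoundConst K (α - β) * exp (-2 * β * X)) atTop
      (𝓝 (2 * compoundConst K (α - β) * 0)) := by
    refine Tendsto.const_mul _ (Real.tendsto_exp_atBot.comp ?_)
    exact tendsto_id.const_mul_atTop_of_neg (by linarith)
  rw [mul_zero] at hlim
  have := ge_of_tendsto hlim ((eventually_ge_atTop (0 : ℝ)).mono hbound)
  exact sub_eq_zero.1 (norm_le_zero_iff.1 this)

end

/-! ### Frames adapted to a splitting -/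

/-- Projection on the first two coordinates. -/
def headProj : Mat4 := Matrix.diagonal ![1, 1, 0, 0]

lemma minor₂_eq_det (X : Mat4) : minor₂ X 0 1 0 1 = (1 + (X - 1) * headProj).det := by
  rw [det_fin_four]; simp [minor₂, headProj, mul_diagonal, Matrix.one_apply]

/-- The columns of `R`, with inverse `L`, bring `A` to block form, and `E` is the projection on the
unstable directions along the stable ones. -/
structure BlockFrame (A E R L : Mat4) (σ η : ℝ) : Prop where
  left_inv : L * R = 1
  proj : R * headProj * L = E
  block : BlockForm (L * A * R) σ η

namespace BlockFrame

variable {A E R L : Mat4} {σ η : ℝ}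

lemma right_inv (h : BlockFrame A E R L σ η) : R * L = 1 := mul_eq_one_comm.1 h.left_inv

lemma minor₂_conj (h : BlockFrame A E R L σ η) (M : Mat4) :
    minor₂ (L * M * R) 0 1 0 1 = (1 + (M - 1) * E).det := by
  have e : (1 : Mat4) + (L * M * R - 1) * headProj = L * (1 + (M - 1) * E) * R := by
    rw [← h.proj]
    have h1 := h.left_inv
    have h2 : L * ((M - 1) * (R * headProj * L)) * R = (L * M * R - L * R) * headProj * (L * R) := by
      noncomm_ring
    rw [mul_add, add_mul, h2, mul_one, h1, mul_one]
  rw [minor₂_eq_det, e, det_mul, det_mul, mul_comm, ← mul_assoc, ← det_mul,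
    h.right_inv, Matrix.det_one, one_mul]

lemma trace_conj (h : BlockFrame A E R L σ η) (M : Mat4) :
    (L * M * R) 0 0 + (L * M * R) 1 1 = (M * E).trace := by
  have e : (M * E).trace = (L * M * R * headProj).trace := by
    rw [← h.proj, mul_assoc L, mul_assoc L, trace_mul_comm L]
    simp only [mul_assoc]
  rw [e, Matrix.trace, Fin.sum_univ_four]; simp [headProj, mul_diagonal]

lemma growth_eq (h : BlockFrame A E R L σ η) : growth (L * A * R) = (A * E).trace := h.trace_conj A

end BlockFrame

end

section

lemma norm_mul_entry_le {l m n : Type*} [Fintype m] {A : Matrix l m ℂ} {B : Matrix m n ℂ}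
    {a b : ℝ} (ha : 0 ≤ a) (hA : ∀ i j, ‖A i j‖ ≤ a) (hB : ∀ i j, ‖B i j‖ ≤ b) (i : l) (j : n) :
    ‖(A * B) i j‖ ≤ card m * (a * b) := by
  rw [Matrix.mul_apply]
  refine (norm_sum_le_of_le _ fun k _ => (norm_mul_le _ _).trans
    (mul_le_mul (hA i k) (hB k j) (norm_nonneg _) ha)).trans ?_
  simp

lemma mul_mul_mul_assoc {k l m n o : Type*} [Fintype l] [Fintype m] [Fintype n] (A : Matrix k l ℂ)
    (B : Matrix l m ℂ) (C : Matrix m n ℂ) (D : Matrix n o ℂ) :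
    A * B * (C * D) = A * (B * C) * D := by
  simp only [Matrix.mul_assoc]

lemma mul_conj_eq {m n : Type*} [Fintype m] [Fintype n] [DecidableEq n] {A : Matrix m m ℂ}
    {R : Matrix m n ℂ} {G H T : Matrix n n ℂ} (hGH : G * H = 1) (hA : A * R = R * T) :
    A * (R * G) = R * G * (H * T * G) := by
  rw [← Matrix.mul_assoc, hA, ← Matrix.mul_assoc, mul_mul_mul_assoc, hGH, Matrix.mul_one]

open scoped ComplexOrder in
/-- Schur form of the restriction of `A` to a two-dimensional invariant subspace, with orthonormal
columns. -/
lemma exists_schur {n : ℕ} {A : Matrix (Fin n) (Fin n) ℂ} {R : Matrix (Fin n) (Fin 2) ℂ}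
    {L : Matrix (Fin 2) (Fin n) ℂ} {T : Mat2} (hL : L * R = 1)
    (hA : A * R = R * T) : ∃ G H : Mat2, G * H = 1 ∧ H * G = 1 ∧
      (R * G).conjTranspose * (R * G) = 1 ∧ (H * T * G) 1 0 = 0 := by
  obtain ⟨t, ht⟩ := Module.End.exists_eigenvalue (Matrix.toLin' T)
  obtain ⟨w, hw⟩ := ht.exists_hasEigenvector
  have hTw : T.mulVec w = t • w := by simpa using hw.apply_eq_smul
  have hw0 : w ≠ 0 := hw.2
  have hinj : ∀ x : Fin 2 → ℂ, R.mulVec x = 0 → x = 0 := fun x hx => by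
    have : (L * R).mulVec x = 0 := by rw [← mulVec_mulVec, hx, Matrix.mulVec_zero]
    rwa [hL, Matrix.one_mulVec] at this
  have hpos : ∀ x : Fin n → ℂ, x ≠ 0 → ∃ r : ℝ, 0 < r ∧ star x ⬝ᵥ x = ((r ^ 2 : ℝ) : ℂ) := fun x hx => by
    have h1 : 0 < star x ⬝ᵥ x := by rw [Matrix.dotProduct_star_self_pos_iff]; exact hx
    obtain ⟨h2, h3⟩ := Complex.pos_iff.1 h1
    refine ⟨Real.sqrt (star x ⬝ᵥ x).re, Real.sqrt_pos.2 h2, ?_⟩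
    rw [Real.sq_sqrt h2.le]; exact Complex.ext (by simp) (by simpa using h3.symm)
  set a := R.mulVec w with ha
  obtain ⟨r, hr, har⟩ := hpos a fun h => hw0 (hinj w h)
  set u : Fin 2 → ℂ := ![-star (w 1), star (w 0)] with hu
  set c := (star a ⬝ᵥ R.mulVec u) / ((r ^ 2 : ℝ) : ℂ) with hc
  set u' := u - c • w with hu'
  have hdet0 : w 0 * u' 1 - u' 0 * w 1 = w 0 * star (w 0) + w 1 * star (w 1) := by
    have u0 : u' 0 = -star (w 1) - c * w 0 := rfl
    have u1 : u' 1 = star (w 0) - c * w 1 := rfl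
    rw [u0, u1]; ring
  have hdet : w 0 * u' 1 - u' 0 * w 1 ≠ 0 := by
    rw [hdet0]
    have h1 : star w ⬝ᵥ w ≠ 0 := by exact fun h => hw0 (dotProduct_star_self_eq_zero.1 h)
    have h2 : star w ⬝ᵥ w = w 0 * star (w 0) + w 1 * star (w 1) := by
      simp [dotProduct, Fin.sum_univ_two, mul_comm]
    rwa [h2] at h1
  have hu'0 : u' ≠ 0 := by
    rintro h
    rw [h] at hdet; simp at hdet
  set b := R.mulVec u' with hb
  obtain ⟨s, hs, hbs⟩ := hpos b fun h => hu'0 (hinj u' h)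
  have hrC : (r : ℂ) ≠ 0 := by exact_mod_cast hr.ne'
  have hsC : (s : ℂ) ≠ 0 := by exact_mod_cast hs.ne'
  have hab : star a ⬝ᵥ b = 0 := by
    rw [hb, hu', Matrix.mulVec_sub, mulVec_smul, dotProduct_sub, dotProduct_smul, ← ha, har,
      hc, smul_eq_mul]
    push_cast
    field_simp; ring
  have hba : star b ⬝ᵥ a = 0 := by rw [Matrix.star_dotProduct, hab, star_zero]
  set G : Mat2 := !![w 0 / r, u' 0 / s; w 1 / r, u' 1 / s] with hG
  have hGd : G.det = (w 0 * u' 1 - u' 0 * w 1) / (r * s) := by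
    rw [hG, Matrix.det_fin_two_of]; field_simp
  have hGu : IsUnit G.det := by
    rw [hGd, isUnit_iff_ne_zero]; exact div_ne_zero hdet (mul_ne_zero hrC hsC)
  have hG0 : G.mulVec (Pi.single 0 1) = (r : ℂ)⁻¹ • w := by
    ext i; fin_cases i <;> simp [hG, div_eq_inv_mul]
  have hcol0 : ∀ i, (R * G) i 0 = (r : ℂ)⁻¹ * a i := fun i => by
    simp [Matrix.mul_apply, hG, ha, Matrix.mulVec, dotProduct, Fin.sum_univ_two]; ring
  have hcol1 : ∀ i, (R * G) i 1 = (s : ℂ)⁻¹ * b i := fun i => by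
    simp [Matrix.mul_apply, hG, hb, Matrix.mulVec, dotProduct, Fin.sum_univ_two]; ring
  have hgram : ∀ (x y : Fin n → ℂ) (p q : ℝ), ∑ k, star ((p : ℂ)⁻¹ * x k) * ((q : ℂ)⁻¹ * y k) =
      (p : ℂ)⁻¹ * (q : ℂ)⁻¹ * (star x ⬝ᵥ y) := fun x y p q => by
    rw [dotProduct, mul_sum]
    refine sum_congr rfl fun k _ => ?_
    simp; ring
  refine ⟨G, G⁻¹, mul_nonsing_inv _ hGu, nonsing_inv_mul _ hGu, ?_, ?_⟩
  · ext i j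
    rw [Matrix.mul_apply]
    simp only [conjTranspose_apply]
    fin_cases i <;> fin_cases j <;> simp only [Fin.zero_eta, Fin.mk_one, hcol0, hcol1, hgram, har, hbs,
      hab, hba]
    · simp; field_simp
    · simp
    · simp
    · simp; field_simp
  · have : (G⁻¹ * T * G).mulVec (Pi.single 0 1) = t • Pi.single 0 1 := by
      rw [← mulVec_mulVec, hG0, mulVec_smul, ← mulVec_mulVec, hTw,
        mulVec_smul, smul_comm, ← mulVec_smul, ← hG0, mulVec_mulVec,
        nonsing_inv_mul _ hGu, Matrix.one_mulVec]
    simpa using congrFun this 1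

/-- Schur form of the restriction of `A` to a two-dimensional invariant subspace, with small
off-diagonal entry. -/
lemma exists_small_schur {n : ℕ} {A : Matrix (Fin n) (Fin n) ℂ} {R : Matrix (Fin n) (Fin 2) ℂ}
    {L : Matrix (Fin 2) (Fin n) ℂ} {T : Mat2} {Λ η : ℝ} (hL : L * R = 1)
    (hA : A * R = R * T) (hΛ : 0 ≤ Λ) (hη : 0 < η) (hb : ∀ i j, ‖A i j‖ ≤ Λ) :
    ∃ G H : Mat2, ∃ S : Matrix (Fin 2) (Fin n) ℂ, G * H = 1 ∧ H * G = 1 ∧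
      (H * T * G) 1 0 = 0 ∧ ‖(H * T * G) 0 1‖ ≤ η ∧ (∀ i j, ‖(H * T * G) i j‖ ≤ n * (n * Λ) + η) ∧
      (∀ i j, ‖(R * G) i j‖ ≤ 1) ∧ S * (R * G) = 1 ∧
      ∀ i j, ‖S i j‖ ≤ (n * (n * Λ) + η) / η := by
  obtain ⟨G, H, hGH, hHG, hU, h10⟩ := exists_schur hL hA
  set U := R * G with hUdef
  have hU1 : ∀ i j, ‖U i j‖ ≤ 1 := fun i j => by
    have h := congrFun (congrFun hU j) j
    rw [Matrix.mul_apply, Matrix.one_apply_eq] at h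
    have h2 : ∑ k, ‖U k j‖ ^ 2 = 1 := by
      have : (∑ k, ((‖U k j‖ ^ 2 : ℝ) : ℂ)) = 1 := by
        rw [← h]
        refine sum_congr rfl fun k _ => ?_
        rw [conjTranspose_apply, ← Complex.normSq_eq_norm_sq, Complex.normSq_eq_conj_mul_self]; rfl
      exact_mod_cast this
    have h3 : ‖U i j‖ ^ 2 ≤ 1 := by
      rw [← h2]
      exact single_le_sum (f := fun k => ‖U k j‖ ^ 2) (fun k _ => sq_nonneg _) (Finset.mem_univ i)
    exact (sq_le_one_iff₀ (norm_nonneg _)).1 h3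
  have hUs : ∀ i j, ‖U.conjTranspose i j‖ ≤ 1 := fun i j => by
    rw [conjTranspose_apply, norm_star]; exact hU1 j i
  set T0 := H * T * G with hT0
  have hT₀e : T0 = U.conjTranspose * (A * U) := by
    rw [hUdef, mul_conj_eq hGH hA, ← Matrix.mul_assoc, hU, Matrix.one_mul]
  have hT₀b : ∀ i j, ‖T0 i j‖ ≤ n * (n * Λ) := fun i j => by
    rw [hT₀e]
    have := norm_mul_entry_le zero_le_one hUs (fun i j => norm_mul_entry_le hΛ hb hU1 i j) i j
    simpa using this
  set m : ℝ := n * (n * Λ) + η with hm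
  have hm0 : 0 < m := by positivity
  set θ : ℝ := η / m with hθ
  have hθ0 : 0 < θ := by positivity
  have hθ1 : θ ≤ 1 := by
    rw [hθ, div_le_one hm0, hm]
    have : (0 : ℝ) ≤ n * (n * Λ) := by positivity
    linarith
  have hθC : (θ : ℂ) ≠ 0 := by exact_mod_cast hθ0.ne'
  set D : Mat2 := Matrix.diagonal ![1, (θ : ℂ)] with hD
  set D' : Mat2 := Matrix.diagonal ![1, (θ : ℂ)⁻¹] with hD'
  have hDD : D * D' = 1 := by ext i j; fin_cases i <;> fin_cases j <;> simp [hD, hD', hθC]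
  have hDD' : D' * D = 1 := mul_eq_one_comm.1 hDD
  have hTe : D' * H * T * (G * D) = D' * T0 * D := by simp only [hT0, mul_assoc]
  have hT : ∀ i j, (D' * T0 * D) i j = ![1, (θ : ℂ)⁻¹] i * T0 i j * ![1, (θ : ℂ)] j := fun i j => by
    rw [hD, hD', mul_diagonal, Matrix.diagonal_mul]
  have h01 : ‖(D' * T0 * D) 0 1‖ ≤ η := by
    rw [hT]
    simp only [Matrix.cons_val_zero, Matrix.cons_val_one, one_mul, norm_mul, norm_real,
      norm_eq_abs, abs_of_pos hθ0]
    calc ‖T0 0 1‖ * θ ≤ m * θ := by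
          gcongr; exact (hT₀b 0 1).trans (by rw [hm]; linarith)
      _ = η := by rw [hθ]; field_simp
  have hT10 : (D' * T0 * D) 1 0 = 0 := by rw [hT, h10]; simp
  refine ⟨G * D, D' * H, D' * U.conjTranspose, ?_, ?_, ?_, ?_, ?_, ?_, ?_, ?_⟩
  · rw [mul_mul_mul_assoc, hDD, mul_one, hGH]
  · rw [mul_mul_mul_assoc, hHG, mul_one, hDD']
  · rw [hTe, hT10]
  · rw [hTe]; exact h01
  · intro i j
    rw [hTe]
    fin_cases i <;> fin_cases j
    · simp only [Fin.zero_eta, hT]; simpa using (hT₀b 0 0).trans (by linarith)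
    · simp only [Fin.zero_eta, Fin.mk_one]
      refine h01.trans ?_
      rw [hm]
      have : (0 : ℝ) ≤ n * (n * Λ) := by positivity
      linarith
    · simp only [Fin.zero_eta, Fin.mk_one]
      rw [hT10, norm_zero]; exact hm0.le
    · simp only [Fin.mk_one, hT]
      have : ![1, (θ : ℂ)⁻¹] 1 * T0 1 1 * ![1, (θ : ℂ)] 1 = T0 1 1 := by simp; field_simp
      rw [this]; exact (hT₀b 1 1).trans (by linarith)
  · intro i j
    rw [← Matrix.mul_assoc, hD, mul_diagonal, norm_mul]
    have : ‖![1, (θ : ℂ)] j‖ ≤ 1 := by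
      fin_cases j
      · simp
      · simpa [abs_of_pos hθ0] using hθ1
    calc ‖U i j‖ * ‖![1, (θ : ℂ)] j‖ ≤ 1 * 1 := by
          gcongr; exact hU1 i j
      _ = 1 := one_mul 1
  · rw [← Matrix.mul_assoc R]
    rw [mul_mul_mul_assoc, hU, mul_one, hDD']
  · intro i j
    rw [hD', Matrix.diagonal_mul, norm_mul]
    have hmη : m / η = θ⁻¹ := by rw [hθ, inv_div]
    have : ‖![1, (θ : ℂ)⁻¹] i‖ ≤ θ⁻¹ := by
      fin_cases i
      · simpa using (one_le_inv₀ hθ0).2 hθ1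
      · simp [abs_of_pos hθ0]
    rw [hmη]
    calc ‖![1, (θ : ℂ)⁻¹] i‖ * ‖U.conjTranspose i j‖ ≤ θ⁻¹ * 1 := by
          gcongr; exact hUs i j
      _ = _ := mul_one _

/-- Bound for the rows dual to an invariant subspace, in terms of the spectral gap. -/
lemma norm_dual_le {A : Mat4} {U V : Matrix (Fin 4) (Fin 2) ℂ} {Lu Lv S : Matrix (Fin 2) (Fin 4) ℂ}
    {Tu Tv : Mat2} {Λ σ c : ℝ} (hUV : U * Lu + V * Lv = 1) (hU : A * U = U * Tu)
    (hV : A * V = V * Tv) (hTu : Tu 1 0 = 0) (hTv : Tv 1 0 = 0) (hS : S * U = 1) (hσ : 0 < σ)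
    (hgap : ∀ i j, σ ≤ ‖Tu i i - Tv j j‖) (hΛ : 0 ≤ Λ) (hc : 0 ≤ c) (hA : ∀ i j, ‖A i j‖ ≤ Λ)
    (hSb : ∀ i j, ‖S i j‖ ≤ c) (hTub : ∀ i j, ‖Tu i j‖ ≤ c) (hTvb : ∀ i j, ‖Tv i j‖ ≤ c) (i : Fin 2)
    (j : Fin 4) : ‖Lu i j‖ ≤ (1 + (1 + 8 * c ^ 2 / σ ^ 2)) * (16 * c * (Λ + c) ^ 2 / σ ^ 2) := by
  set q : Mat4 := (A - Tv 0 0 • 1) * (A - Tv 1 1 • 1) with hq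
  set Q : Mat2 := (Tu - Tv 0 0 • 1) * (Tu - Tv 1 1 • 1) with hQ
  have comm : ∀ (W : Matrix (Fin 4) (Fin 2) ℂ) (T : Mat2), A * W = W * T →
      q * W = W * ((T - Tv 0 0 • 1) * (T - Tv 1 1 • 1)) := fun W T h => by
    have h1 : ∀ s : ℂ, (A - s • (1 : Mat4)) * W =
        W * (T - s • (1 : Mat2)) := fun s => by
      rw [Matrix.sub_mul, Matrix.mul_sub, h]; simp
    rw [hq, Matrix.mul_assoc, h1, ← Matrix.mul_assoc, h1, Matrix.mul_assoc]
  have hqV : q * V = 0 := by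
    rw [comm V Tv hV]
    have : (Tv - Tv 0 0 • 1) * (Tv - Tv 1 1 • 1) = 0 := by
      ext i j
      fin_cases i <;> fin_cases j <;> simp [Matrix.mul_apply, Fin.sum_univ_two, hTv]
    rw [this, Matrix.mul_zero]
  have hmain : Q * Lu = S * q := by
    have h1 : q = U * Q * Lu := by
      calc q = q * (U * Lu + V * Lv) := by rw [hUV, mul_one]
        _ = q * U * Lu + q * V * Lv := by rw [Matrix.mul_add, Matrix.mul_assoc q, Matrix.mul_assoc q]
        _ = _ := by rw [hqV, comm U Tu hU, Matrix.zero_mul, add_zero]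
    rw [h1, ← Matrix.mul_assoc, ← Matrix.mul_assoc, hS, Matrix.one_mul]
  have hsub : ∀ {n : ℕ} (M : Matrix (Fin n) (Fin n) ℂ) (b : ℝ), (∀ i j, ‖M i j‖ ≤ b) → ∀ k,
      ∀ i j, ‖(M - Tv k k • (1 : Matrix (Fin n) (Fin n) ℂ)) i j‖ ≤ b + c := by
    intro n M b hM k i j
    rw [Matrix.sub_apply, Matrix.smul_apply, Matrix.one_apply]
    refine (norm_sub_le _ _).trans (add_le_add (hM i j) ?_)
    split_ifs
    · simpa using hTvb k k
    · simpa using hc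
  have hqb : ∀ i j, ‖q i j‖ ≤ 4 * ((Λ + c) * (Λ + c)) := fun i j => by
    simpa using norm_mul_entry_le (by positivity) (hsub A Λ hA 0) (hsub A Λ hA 1) i j
  have hQb : ‖Q 0 1‖ ≤ 8 * c ^ 2 := by
    have := norm_mul_entry_le (by positivity) (hsub Tu c hTub 0) (hsub Tu c hTub 1) 0 1
    simp only [card_fin] at this
    refine this.trans (le_of_eq ?_)
    push_cast; ring
  have hY : ∀ i j, ‖(S * q) i j‖ ≤ 16 * c * (Λ + c) ^ 2 := fun i j => by
    have := norm_mul_entry_le hc hSb hqb i j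
    simp only [card_fin] at this
    refine this.trans (le_of_eq ?_)
    push_cast; ring
  have hQd : ∀ i, σ ^ 2 ≤ ‖Q i i‖ := fun i => by
    have : Q i i = (Tu i i - Tv 0 0) * (Tu i i - Tv 1 1) := by
      fin_cases i <;> simp [hQ, Matrix.mul_apply, Fin.sum_univ_two, hTu]
    rw [this, norm_mul, sq]; exact mul_le_mul (hgap i 0) (hgap i 1) hσ.le (norm_nonneg _)
  have hQ10 : Q 1 0 = 0 := by simp [hQ, Matrix.mul_apply, Fin.sum_univ_two, hTu]
  set y := 16 * c * (Λ + c) ^ 2 with hy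
  have hσ2 : 0 < σ ^ 2 := by positivity
  have hL1 : ‖Lu 1 j‖ ≤ y / σ ^ 2 := by
    have h := congrFun (congrFun hmain 1) j
    rw [Matrix.mul_apply, Fin.sum_univ_two, hQ10, zero_mul, zero_add] at h
    have h2 := hY 1 j
    rw [← h, norm_mul] at h2
    rw [le_div_iff₀ hσ2]
    rw [mul_comm] at h2
    exact (mul_le_mul_of_nonneg_left (hQd 1) (norm_nonneg _)).trans h2
  have hL0 : ‖Lu 0 j‖ ≤ (1 + 8 * c ^ 2 / σ ^ 2) * (y / σ ^ 2) := by
    have h := congrFun (congrFun hmain 0) j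
    rw [Matrix.mul_apply, Fin.sum_univ_two] at h
    have h3 : Q 0 0 * Lu 0 j = (S * q) 0 j - Q 0 1 * Lu 1 j := by rw [← h]; ring
    have h2 : ‖Q 0 0 * Lu 0 j‖ ≤ y + 8 * c ^ 2 * (y / σ ^ 2) := by
      rw [h3]
      refine (norm_sub_le _ _).trans (add_le_add (hY 0 j) ?_)
      rw [norm_mul]; exact mul_le_mul hQb hL1 (norm_nonneg _) (by positivity)
    rw [norm_mul, mul_comm] at h2
    have e : (1 + 8 * c ^ 2 / σ ^ 2) * (y / σ ^ 2) = (y + 8 * c ^ 2 * (y / σ ^ 2)) / σ ^ 2 := by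
      field_simp
    rw [e, le_div_iff₀ hσ2]
    exact (mul_le_mul_of_nonneg_left (hQd 0) (norm_nonneg _)).trans h2
  have hy0 : 0 ≤ y / σ ^ 2 := by positivity
  have hc0 : 0 ≤ 8 * c ^ 2 / σ ^ 2 := by positivity
  fin_cases i
  · exact hL0.trans (by nlinarith)
  · exact hL1.trans (by nlinarith [mul_nonneg hc0 hy0])

/-- A splitting of `A` into a two-dimensional unstable and a two-dimensional stable part. -/
structure Splitting (A : Mat4) (Rm Rp : Matrix (Fin 4) (Fin 2) ℂ)
    (Lm Lp : Matrix (Fin 2) (Fin 4) ℂ) (σ : ℝ) : Prop where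
  mm : Lm * Rm = 1
  mp : Lm * Rp = 0
  pm : Lp * Rm = 0
  pp : Lp * Rp = 1
  sum : Rm * Lm + Rp * Lp = 1
  inv_m : A * Rm = Rm * (Lm * A * Rm)
  inv_p : A * Rp = Rp * (Lp * A * Rp)
  spec_m : ∀ μ : ℂ, (Lm * A * Rm - μ • (1 : Mat2)).det = 0 → σ ≤ μ.re
  spec_p : ∀ μ : ℂ, (Lp * A * Rp - μ • (1 : Mat2)).det = 0 → μ.re ≤ -σ

/-- Bound for the entries of the matrices of `Splitting.exists_blockFrame`. -/
def frameConst (Λ σ η : ℝ) : ℝ :=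
  let c := (16 * Λ + η) + (16 * Λ + η) / η
  1 + (1 + (1 + 8 * c ^ 2 / σ ^ 2)) * (16 * c * (Λ + c) ^ 2 / σ ^ 2)

lemma Splitting.exists_blockFrame {A : Mat4} {Rm Rp : Matrix (Fin 4) (Fin 2) ℂ}
    {Lm Lp : Matrix (Fin 2) (Fin 4) ℂ} {σ Λ η : ℝ} (h : Splitting A Rm Rp Lm Lp σ) (hσ : 0 < σ)
    (hη : 0 < η) (hΛ : 0 ≤ Λ) (hA : ∀ i j, ‖A i j‖ ≤ Λ) :
    ∃ R L : Mat4, BlockFrame A (Rm * Lm) R L σ η ∧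
      (∀ i j, ‖R i j‖ ≤ frameConst Λ σ η) ∧ ∀ i j, ‖L i j‖ ≤ frameConst Λ σ η := by
  obtain ⟨G, H, S, hGH, hHG, h10, h01, hT, hR1, hS, hSb⟩ := exists_small_schur h.mm h.inv_m hΛ hη hA
  obtain ⟨G', H', S', hGH', hHG', h10', h01', hT', hR1', hS', hSb'⟩ :=
    exists_small_schur h.pp h.inv_p hΛ hη hA
  norm_num only [← mul_assoc] at hT hT' hSb hSb'
  set T := H * (Lm * A * Rm) * G with hTdef
  set T' := H' * (Lp * A * Rp) * G' with hTdef'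
  set c := (16 * Λ + η) + (16 * Λ + η) / η with hc
  have hc1 : 16 * Λ + η ≤ c := by rw [hc]; linarith [show 0 ≤ (16 * Λ + η) / η by positivity]
  have hc2 : (16 * Λ + η) / η ≤ c := by rw [hc]; linarith
  have hc0 : 0 ≤ c := by positivity
  have cancel : ∀ {X : Mat2} {P Q : Mat2}, P * Q = 1 →
      Q * P = 1 → ∀ i : Fin 2, (Q * X * P) 1 0 = 0 →
      (X - (Q * X * P) i i • (1 : Mat2)).det = 0 := by
    intro X P Q hPQ hQP i h0
    have e : X - (Q * X * P) i i • (1 : Mat2) =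
        P * (Q * X * P - (Q * X * P) i i • 1) * Q := by
      rw [mul_sub, sub_mul, Matrix.mul_smul, mul_one, smul_mul, hPQ]
      congr 1
      calc X = (P * Q) * X * (P * Q) := by rw [hPQ, one_mul, mul_one]
        _ = _ := by simp only [mul_assoc]
    rw [e, det_mul, det_mul, Matrix.det_fin_two (Q * X * P - _)]
    have : ((Q * X * P) 0 0 - (Q * X * P) i i) * ((Q * X * P) 1 1 - (Q * X * P) i i) = 0 := by
      fin_cases i <;> simp
    simp [h0, this]
  have hre : ∀ i, σ ≤ (T i i).re := fun i => h.spec_m _ (cancel hGH hHG i h10)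
  have hre' : ∀ i, (T' i i).re ≤ -σ := fun i => h.spec_p _ (cancel hGH' hHG' i h10')
  have hgap : ∀ i j, σ ≤ ‖T i i - T' j j‖ := fun i j => by
    refine le_trans ?_ (Complex.re_le_norm _)
    rw [Complex.sub_re]; linarith [hre i, hre' j]
  have hgap' : ∀ i j, σ ≤ ‖T' i i - T j j‖ := fun i j => by rw [norm_sub_rev]; exact hgap j i
  have hUV : Rm * G * (H * Lm) + Rp * G' * (H' * Lp) = 1 := by
    rw [← h.sum]
    congr 1
    · rw [mul_mul_mul_assoc, hGH, Matrix.mul_one]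
    · rw [mul_mul_mul_assoc, hGH', Matrix.mul_one]
  have hAU : A * (Rm * G) = Rm * G * T := mul_conj_eq hGH h.inv_m
  have hAV : A * (Rp * G') = Rp * G' * T' := mul_conj_eq hGH' h.inv_p
  have hLm := norm_dual_le hUV hAU hAV h10 h10' hS hσ hgap hΛ hc0 hA
    (fun i j => (hSb i j).trans hc2) (fun i j => (hT i j).trans hc1) fun i j => (hT' i j).trans hc1
  have hLp := norm_dual_le ((add_comm _ _).trans hUV) hAV hAU h10' h10 hS' hσ hgap' hΛ hc0 hA
    (fun i j => (hSb' i j).trans hc2) (fun i j => (hT' i j).trans hc1) fun i j => (hT i j).trans hc1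
  set U := Rm * G with hU
  set V := Rp * G' with hV
  set Lu := H * Lm with hLu
  set Lv := H' * Lp with hLv
  have huu : Lu * U = 1 := by rw [hLu, hU, mul_mul_mul_assoc, h.mm, mul_one, hHG]
  have huv : Lu * V = 0 := by
    rw [hLu, hV, mul_mul_mul_assoc, h.mp, Matrix.mul_zero, Matrix.zero_mul]
  have hvu : Lv * U = 0 := by
    rw [hLv, hU, mul_mul_mul_assoc, h.pm, Matrix.mul_zero, Matrix.zero_mul]
  have hvv : Lv * V = 1 := by rw [hLv, hV, mul_mul_mul_assoc, h.pp, mul_one, hHG']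
  let e : Fin 4 ≃ Fin 2 ⊕ Fin 2 := (finSumFinEquiv (m := 2) (n := 2)).symm
  have e0 : e 0 = Sum.inl 0 := rfl
  have e1 : e 1 = Sum.inl 1 := rfl
  have e2 : e 2 = Sum.inr 0 := rfl
  have e3 : e 3 = Sum.inr 1 := rfl
  have hsub : ∀ X : Mat4, (Matrix.fromRows Lu Lv).submatrix e (Equiv.refl _) * X *
        (Matrix.fromCols U V).submatrix (Equiv.refl _) e =
      (Matrix.fromBlocks (Lu * X * U) (Lu * X * V) (Lv * X * U) (Lv * X * V)).submatrix e e := fun X => by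
    have : X = X.submatrix (Equiv.refl _) (Equiv.refl _) := rfl
    rw [this, Matrix.submatrix_mul_equiv, Matrix.submatrix_mul_equiv, Matrix.fromRows_mul,
      Matrix.fromRows_mul_fromCols]
    rfl
  have hone := hsub 1
  rw [mul_one] at hone
  simp only [Matrix.mul_one, huu, huv, hvu, hvv, Matrix.fromBlocks_one] at hone
  rw [Matrix.submatrix_one_equiv] at hone
  have hAb := hsub A
  have a1 : Lu * A * U = T := by rw [Matrix.mul_assoc, hAU, ← Matrix.mul_assoc, huu, Matrix.one_mul]
  have a2 : Lu * A * V = 0 := by rw [Matrix.mul_assoc, hAV, ← Matrix.mul_assoc, huv, Matrix.zero_mul]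
  have a3 : Lv * A * U = 0 := by rw [Matrix.mul_assoc, hAU, ← Matrix.mul_assoc, hvu, Matrix.zero_mul]
  have a4 : Lv * A * V = T' := by rw [Matrix.mul_assoc, hAV, ← Matrix.mul_assoc, hvv, Matrix.one_mul]
  rw [a1, a2, a3, a4] at hAb
  have hC : 1 ≤ frameConst Λ σ η := by
    rw [frameConst, ← hc]
    have : 0 ≤ (1 + (1 + 8 * c ^ 2 / σ ^ 2)) * (16 * c * (Λ + c) ^ 2 / σ ^ 2) := by positivity
    linarith
  have hC' : (1 + (1 + 8 * c ^ 2 / σ ^ 2)) * (16 * c * (Λ + c) ^ 2 / σ ^ 2) ≤ frameConst Λ σ η := by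
    rw [frameConst, ← hc]; linarith
  refine ⟨_, _, ⟨hone, ?_, ?_⟩, ?_, ?_⟩
  · have hUL : U * Lu = Rm * Lm := by rw [hU, hLu, mul_mul_mul_assoc, hGH, Matrix.mul_one]
    rw [← hUL]
    ext i j
    have hx : (U * Lu) i j = U i 0 * Lu 0 j + U i 1 * Lu 1 j := by
      rw [Matrix.mul_apply, Fin.sum_univ_two]
    rw [hx, Matrix.mul_apply, Fin.sum_univ_four]; simp [headProj, mul_diagonal, e0, e1, e2, e3]
  · rw [hAb]
    refine ⟨fun i j hij h1 h2 => ?_, ?_, ?_, ?_, ?_, ?_, ?_⟩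
    · fin_cases i <;> fin_cases j <;> simp [e0, e1, e2, e3, h10, h10'] at hij h1 h2 ⊢
    · simpa [e0, e1] using h01
    · simpa [e2, e3] using h01'
    · simpa [e0] using hre 0
    · simpa [e1] using hre 1
    · simpa [e2] using hre' 0
    · simpa [e3] using hre' 1
  · intro i j
    refine le_trans ?_ hC
    simp only [submatrix_apply]
    cases e j with
    | inl k => simpa using hR1 i k
    | inr k => simpa using hR1' i k
  · intro i j
    refine le_trans ?_ hC'
    simp only [submatrix_apply]
    cases e i with
    | inl k => simpa using hLm k j
    | inr k => simpa using hLp k j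

end

section

open MeasureTheory

/-! ### Bounded solutions of perturbed hyperbolic systems on a half-line -/

/-- Initial value of the solution of `x' = μ x + g` that is bounded on `[0, ∞)`; it is free if
`Re μ < 0`. -/
def boundedInit (μ ξ : ℂ) (g : ℝ → ℂ) : ℂ :=
  if μ.re < 0 then ξ else -∫ s in Ioi (0 : ℝ), cexp (-μ * s) * g s

/-- The solution of `x' = μ x + g` that is bounded on `[0, ∞)`. -/
def boundedSol (μ ξ : ℂ) (g : ℝ → ℂ) (y : ℝ) : ℂ :=
  cexp (μ * y) * (boundedInit μ ξ g + ∫ s in (0 : ℝ)..y, cexp (-μ * s) * g s)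

section

variable {μ ξ : ℂ} {g g1 g2 : ℝ → ℂ} {G : ℝ}

lemma hasDerivAt_boundedSol (hg : Continuous g) (y : ℝ) :
    HasDerivAt (boundedSol μ ξ g) (μ * boundedSol μ ξ g y + g y) y := by
  have hc : Continuous fun s : ℝ => cexp (-μ * s) * g s := by fun_prop
  have h1 : HasDerivAt (fun y : ℝ => boundedInit μ ξ g +
      ∫ s in (0 : ℝ)..y, cexp (-μ * s) * g s) (cexp (-μ * y) * g y) y :=
    (hc.integral_hasStrictDerivAt 0 y).hasDerivAt.const_add _
  have h2 := hasDerivWithinAt_exp_mul (μ := μ) (h1.hasDerivWithinAt (s := univ))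
  rw [hasDerivWithinAt_univ] at h2
  refine h2.congr_deriv ?_
  rw [mul_add, ← mul_assoc _ (cexp (-μ * y)), ← Complex.exp_add, boundedSol]; simp; ring

lemma norm_cexp_mul_ofReal (μ : ℂ) (y : ℝ) : ‖cexp (μ * y)‖ = exp (μ.re * y) := by
  rw [Complex.norm_exp]; simp

lemma integrableOn_exp_mul (hμ : 0 < μ.re) (hg : Continuous g) (hG : ∀ s, 0 ≤ s → ‖g s‖ ≤ G)
    {y : ℝ} (hy : 0 ≤ y) : IntegrableOn (fun s : ℝ => cexp (-μ * s) * g s) (Ioi y) := by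
  have hc : Continuous fun s : ℝ => cexp (-μ * s) * g s := by fun_prop
  refine Integrable.mono' ((integrableOn_exp_mul_Ioi (a := -μ.re) (by linarith) y).mul_const G)
    hc.aestronglyMeasurable.restrict ?_
  filter_upwards [ae_restrict_mem measurableSet_Ioi] with s hs
  rw [norm_mul, norm_cexp_mul_ofReal, Complex.neg_re]
  exact mul_le_mul_of_nonneg_left (hG s (hy.trans (le_of_lt hs))) (exp_nonneg _)

lemma norm_boundedSol_le (hμ : μ.re ≠ 0) (hg : Continuous g) (hG : ∀ s, 0 ≤ s → ‖g s‖ ≤ G)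
    {y : ℝ} (hy : 0 ≤ y) : ‖boundedSol μ ξ g y‖ ≤ ‖ξ‖ + G / |μ.re| := by
  have hG0 : 0 ≤ G := (norm_nonneg _).trans (hG 0 le_rfl)
  rcases lt_or_gt_of_ne hμ with h | h
  · rw [boundedSol, boundedInit, if_pos h, mul_add]
    refine (norm_add_le _ _).trans (add_le_add ?_ ?_)
    · rw [norm_mul, norm_cexp_mul_ofReal]
      exact mul_le_of_le_one_left (norm_nonneg _) (exp_le_one_iff.2 (by nlinarith))
    · rw [norm_mul, norm_cexp_mul_ofReal]
      have h1 : ‖∫ s in (0 : ℝ)..y, cexp (-μ * s) * g s‖ ≤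
          ∫ s in (0 : ℝ)..y, exp (-μ.re * s) * G := by
        refine intervalIntegral.norm_integral_le_of_norm_le hy ?_
          (Continuous.intervalIntegrable (by fun_prop) _ _)
        refine Eventually.of_forall fun s hs => ?_
        rw [norm_mul, norm_cexp_mul_ofReal, Complex.neg_re]
        exact mul_le_mul_of_nonneg_left (hG s hs.1.le) (exp_nonneg _)
      have h2 : ∫ s in (0 : ℝ)..y, exp (-μ.re * s) * G =
          (exp (-μ.re * y) - 1) / (-μ.re) * G := by
        rw [intervalIntegral.integral_mul_const, intervalIntegral.integral_comp_mul_left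
          (f := exp) (by linarith : -μ.re ≠ 0)]
        simp [div_eq_inv_mul]
      rw [h2] at h1
      have h3 : exp (μ.re * y) * exp (-μ.re * y) = 1 := by rw [← exp_add]; simp
      calc _ ≤ exp (μ.re * y) * ((exp (-μ.re * y) - 1) / (-μ.re) * G) := by gcongr
        _ = (1 - exp (μ.re * y)) * (G / (-μ.re)) := by
            have e : exp (μ.re * y) * ((exp (-μ.re * y) - 1) / (-μ.re) * G) =
              (exp (μ.re * y) * exp (-μ.re * y) - exp (μ.re * y)) * (G / (-μ.re)) := by ring
            rw [e, h3]
        _ ≤ 1 * (G / (-μ.re)) := by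
            gcongr
            · exact div_nonneg hG0 (by linarith)
            · linarith [exp_nonneg (μ.re * y)]
        _ = G / |μ.re| := by rw [one_mul, abs_of_neg h]
  · have hI := fun {y : ℝ} (hy : 0 ≤ y) => integrableOn_exp_mul h hg hG hy
    have e : boundedSol μ ξ g y =
        -(cexp (μ * y) * ∫ s in Ioi y, cexp (-μ * s) * g s) := by
      rw [boundedSol, boundedInit, if_neg (not_lt.2 h.le),
        ← intervalIntegral.integral_interval_add_Ioi (hI le_rfl) (hI hy)]
      ring
    rw [e, norm_neg, norm_mul, norm_cexp_mul_ofReal]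
    have h1 : ‖∫ s in Ioi y, cexp (-μ * s) * g s‖ ≤
        ∫ s in Ioi y, exp (-μ.re * s) * G := by
      refine norm_integral_le_of_norm_le
        ((integrableOn_exp_mul_Ioi (a := -μ.re) (by linarith) y).mul_const G) ?_
      filter_upwards [ae_restrict_mem measurableSet_Ioi] with s hs
      rw [norm_mul, norm_cexp_mul_ofReal, Complex.neg_re]
      exact mul_le_mul_of_nonneg_left (hG s (hy.trans (le_of_lt hs))) (exp_nonneg _)
    rw [integral_mul_const, integral_exp_mul_Ioi (by linarith)] at h1
    have h3 : exp (μ.re * y) * exp (-μ.re * y) = 1 := by rw [← exp_add]; simp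
    calc _ ≤ exp (μ.re * y) * (-exp (-μ.re * y) / -μ.re * G) := by gcongr
      _ = (exp (μ.re * y) * exp (-μ.re * y)) * (G / μ.re) := by rw [neg_div_neg_eq]; ring
      _ = G / |μ.re| := by rw [h3, one_mul, abs_of_pos h]
      _ ≤ _ := by linarith [norm_nonneg ξ]

lemma boundedSol_sub (hμ : μ.re ≠ 0) (hg1 : Continuous g1) (hg2 : Continuous g2)
    (hG1 : ∀ s, 0 ≤ s → ‖g1 s‖ ≤ G) (hG2 : ∀ s, 0 ≤ s → ‖g2 s‖ ≤ G) (y : ℝ) :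
    boundedSol μ ξ g1 y - boundedSol μ ξ g2 y = boundedSol μ 0 (fun s => g1 s - g2 s) y := by
  have hc1 : Continuous fun s : ℝ => cexp (-μ * s) * g1 s := by fun_prop
  have hc2 : Continuous fun s : ℝ => cexp (-μ * s) * g2 s := by fun_prop
  have hi : boundedInit μ 0 (fun s => g1 s - g2 s) = boundedInit μ ξ g1 - boundedInit μ ξ g2 := by
    rw [boundedInit, boundedInit, boundedInit]
    split_ifs with h
    · simp
    · have h' : 0 < μ.re := lt_of_le_of_ne (not_lt.1 h) hμ.symm
      simp only [mul_sub]
      rw [integral_sub (integrableOn_exp_mul h' hg1 hG1 le_rfl)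
        (integrableOn_exp_mul h' hg2 hG2 le_rfl)]
      ring
  rw [boundedSol, boundedSol, boundedSol, hi]
  simp only [mul_sub]
  rw [intervalIntegral.integral_sub (hc1.intervalIntegrable _ _) (hc2.intervalIntegrable _ _)]; ring

end

/-- Bounded solutions on `[0, ∞)` of a small perturbation of a diagonal hyperbolic system, with
prescribed stable components at `0`. -/
lemma exists_bounded_solution {κ : Type*} [Fintype κ] (μ ξ : κ → ℂ) {C : ℝ → Matrix κ κ ℂ}
    {f : ℝ → κ → ℂ} {g F : ℝ} (hg : 0 < g) (hμ : ∀ i, g ≤ |(μ i).re|)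
    (hC : ∀ i j, Continuous fun y => C y i j) (hCb : ∀ y, 0 ≤ y → ∀ i, ∑ j, ‖C y i j‖ ≤ g / 2)
    (hf : ∀ i, Continuous fun y => f y i) (hfb : ∀ y, 0 ≤ y → ∀ i, ‖f y i‖ ≤ F) :
    ∃ x : ℝ → κ → ℂ, (∃ b, ∀ y i, ‖x y i‖ ≤ b) ∧
      (∀ y ∈ Ici (0 : ℝ), ∀ i, HasDerivWithinAt (fun t => x t i)
        (μ i * x y i + (∑ j, C y i j * x y j + f y i)) (Ici 0) y) ∧
      ∀ i, (μ i).re < 0 → x 0 i = ξ i := by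
  have hμ0 : ∀ i, (μ i).re ≠ 0 := fun i h => by have := hμ i; rw [h, abs_zero] at this; linarith
  let H : BoundedContinuousFunction ℝ (κ → ℂ) → κ → ℝ → ℂ := fun x i s =>
    ∑ j, C s i j * x s j + f s i
  have hxc : ∀ (x : BoundedContinuousFunction ℝ (κ → ℂ)) j, Continuous fun s => x s j :=
    fun x j => (continuous_apply j).comp x.continuous
  have hH : ∀ x i, Continuous (H x i) := fun x i =>
    (continuous_finsetSum _ fun j _ => (hC i j).mul (hxc x j)).add (hf i)
  have hlin : ∀ (w : κ → ℂ) (b : ℝ), (∀ j, ‖w j‖ ≤ b) → ∀ s, 0 ≤ s → ∀ i,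
      ‖∑ j, C s i j * w j‖ ≤ g / 2 * b := fun w b hw s hs i => by
    refine (norm_sum_le_of_le _ fun j _ => (norm_mul_le _ _).trans
      (mul_le_mul_of_nonneg_left (hw j) (norm_nonneg _))).trans ?_
    rw [← Finset.sum_mul]
    have hb : 0 ≤ b := (norm_nonneg _).trans (hw i)
    exact mul_le_mul_of_nonneg_right (hCb s hs i) hb
  have hHb : ∀ x i s, 0 ≤ s → ‖H x i s‖ ≤ g / 2 * ‖x‖ + F := fun x i s hs =>
    (norm_add_le _ _).trans (add_le_add
      (hlin (x s) ‖x‖ (fun j => (norm_le_pi_norm (x s) j).trans (x.norm_coe_le_norm s)) s hs i)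
      (hfb s hs i))
  have hTc : ∀ x, Continuous fun (y : ℝ) i => boundedSol (μ i) (ξ i) (H x i) (max y 0) := fun x =>
    continuous_pi fun i => (continuous_iff_continuousAt.2 fun y =>
      (hasDerivAt_boundedSol (hH x i) y).continuousAt).comp (continuous_id.max continuous_const)
  have hdiv : ∀ (i : κ) (b : ℝ), 0 ≤ b → b / |(μ i).re| ≤ b / g := fun i b hb =>
    div_le_div_of_nonneg_left hb hg (hμ i)
  by_cases hκ : Nonempty κ
  swap
  · refine ⟨fun _ _ => 0, ⟨0, fun y i => (hκ ⟨i⟩).elim⟩, fun y _ i => (hκ ⟨i⟩).elim,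
      fun i => (hκ ⟨i⟩).elim⟩
  have hF : 0 ≤ F := (norm_nonneg _).trans (hfb 0 le_rfl hκ.some)
  let T : BoundedContinuousFunction ℝ (κ → ℂ) → BoundedContinuousFunction ℝ (κ → ℂ) := fun x =>
    BoundedContinuousFunction.ofNormedAddCommGroup
      (fun (y : ℝ) i => boundedSol (μ i) (ξ i) (H x i) (max y 0)) (hTc x)
      (‖ξ‖ + (g / 2 * ‖x‖ + F) / g) fun y => by
        refine (pi_norm_le_iff_of_nonneg (by positivity)).2 fun i => ?_
        refine (norm_boundedSol_le (hμ0 i) (hH x i) (hHb x i) (le_max_right _ _)).trans ?_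
        exact add_le_add (norm_le_pi_norm ξ i) (hdiv i _ (by positivity))
  have hT : ContractingWith (1 / 2) T := by
    refine ⟨by rw [← NNReal.coe_lt_coe]; norm_num, LipschitzWith.of_dist_le_mul fun x x' => ?_⟩
    rw [dist_eq_norm, dist_eq_norm]
    refine (BoundedContinuousFunction.norm_le (by positivity)).2 fun y => ?_
    refine (pi_norm_le_iff_of_nonneg (by positivity)).2 fun i => ?_
    change ‖boundedSol (μ i) (ξ i) (H x i) (max y 0) - boundedSol (μ i) (ξ i) (H x' i) (max y 0)‖ ≤ _
    rw [boundedSol_sub (G := max (g / 2 * ‖x‖ + F) (g / 2 * ‖x'‖ + F)) (hμ0 i) (hH x i) (hH x' i)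
      (fun s hs => (hHb x i s hs).trans (le_max_left _ _))
      (fun s hs => (hHb x' i s hs).trans (le_max_right _ _))]
    have hd : ∀ s, 0 ≤ s → ‖H x i s - H x' i s‖ ≤ g / 2 * ‖x - x'‖ := fun s hs => by
      have e : H x i s - H x' i s = ∑ j, C s i j * (x - x') s j := by
        simp only [H, BoundedContinuousFunction.coe_sub, Pi.sub_apply, mul_sub, sum_sub_distrib]
        ring
      rw [e]
      exact hlin _ _ (fun j => (norm_le_pi_norm _ j).trans ((x - x').norm_coe_le_norm s)) s hs i
    refine (norm_boundedSol_le (hμ0 i) ((hH x i).sub (hH x' i)) hd (le_max_right _ _)).trans ?_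
    rw [norm_zero, zero_add]
    refine (hdiv i _ (by positivity)).trans (le_of_eq ?_)
    push_cast; field_simp
  obtain ⟨x, hx, -⟩ := hT.exists_fixedPoint 0 (edist_ne_top _ _)
  have hx' : ∀ y, 0 ≤ y → ∀ i, x y i = boundedSol (μ i) (ξ i) (H x i) y := fun y hy i => by
    have : T x y i = x y i := by rw [hx.eq]
    rw [← this]
    change boundedSol (μ i) (ξ i) (H x i) (max y 0) = _
    rw [max_eq_left hy]
  refine ⟨fun y => x y, ⟨‖x‖, fun y i => (norm_le_pi_norm _ i).trans (x.norm_coe_le_norm y)⟩,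
    fun y hy i => ?_, fun i hi => ?_⟩
  · have := (hasDerivAt_boundedSol (μ := μ i) (ξ := ξ i) (hH x i) y).hasDerivWithinAt (s := Ici 0)
    rw [← hx' y hy i] at this; exact this.congr_of_mem (fun t ht => hx' t ht i) hy
  · change x 0 i = ξ i
    rw [hx' 0 le_rfl, boundedSol, boundedInit, if_pos hi]; simp

end

section

/-! ### Linear systems and conjugators on a half-line -/

section

variable {n : Type} [Fintype n] [DecidableEq n]

lemma exists_halfLine_flow {A : ℝ → Matrix n n ℂ} {Λ : ℝ}
    (hA : ∀ i j, Continuous fun y => A y i j) (hΛ : ∀ y, 0 ≤ y → ∀ i j, ‖A y i j‖ ≤ Λ) :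
    ∃ M : ℝ → Matrix n n ℂ, M 0 = 1 ∧
      ∀ y ∈ Ici (0 : ℝ), HasMatDeriv M (A y * M y) (Ici 0) y := by
  by_cases hn : Nonempty n
  swap
  · exact ⟨fun _ => 1, rfl, fun y _ i => (hn ⟨i⟩).elim⟩
  have hΛ0 : 0 ≤ Λ := (norm_nonneg _).trans (hΛ 0 le_rfl hn.some hn.some)
  set m : ℝ := 2 * (card n * Λ) + 1 with hm
  have hm0 : 0 < m := by positivity
  have key : ∀ j : n, ∃ x : ℝ → n → ℂ, (∀ y ∈ Ici (0 : ℝ), ∀ i, HasDerivWithinAt (fun t => x t i)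
      (-(m : ℂ) * x y i + (∑ k, A y i k * x y k + 0)) (Ici 0) y) ∧
      ∀ i, x 0 i = (1 : Matrix n n ℂ) i j := by
    intro j
    obtain ⟨x, -, hx, hx0⟩ := exists_bounded_solution (fun _ : n => -(m : ℂ))
      (fun i => (1 : Matrix n n ℂ) i j) (C := A) (f := fun _ _ => 0) (F := 0) hm0
      (fun i => by simp [abs_of_pos hm0]) hA (fun y hy i => by
        refine (sum_le_sum fun k _ => hΛ y hy i k).trans ?_
        rw [sum_const, card_univ, nsmul_eq_mul, hm]; linarith)
      (fun _ => continuous_const) (fun _ _ _ => by simp)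
    exact ⟨x, hx, fun i => hx0 i (by simpa using hm0)⟩
  choose x hx hx0 using key
  refine ⟨fun y => Matrix.of fun i j => cexp (m * y) * x j y i, ?_, fun y hy i j => ?_⟩
  · ext i j; simp [hx0]
  · refine (hasDerivWithinAt_exp_mul (hx j y hy i)).congr_deriv ?_
    rw [Matrix.mul_apply]
    simp only [of_apply]
    have : ∑ k, A y i k * (cexp (m * y) * x j y k) =
        cexp (m * y) * ∑ k, A y i k * x j y k := by
      rw [mul_sum]; exact sum_congr rfl fun k _ => by ring
    rw [this]; ring

lemma isUnit_of_flow {A M : ℝ → Matrix n n ℂ} {t : ℂ} (h0 : M 0 = 1)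
    (htr : ∀ y, (A y).trace = t)
    (hM : ∀ y ∈ Ici (0 : ℝ), HasMatDeriv M (A y * M y) (Ici 0) y) :
    ∀ y ∈ Ici (0 : ℝ), IsUnit (M y) := fun y hy => by
  have hder : ∀ y ∈ Ici (0 : ℝ), HasDerivWithinAt
      (fun y : ℝ => cexp (-t * y) * (M y).det) 0 (Ici 0) y := fun y hy => by
    refine (hasDerivWithinAt_exp_mul (hM y hy).det_of_linear).congr_deriv ?_
    rw [htr]; ring
  have hc := const_of_hasDerivWithinAt_zero (convex_Ici 0) hder hy self_mem_Ici
  rw [h0] at hc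
  rw [isUnit_iff_isUnit_det, isUnit_iff_ne_zero]
  intro hdet
  rw [hdet] at hc; simp at hc

lemma HasMatDeriv.comp_neg {A : ℝ → Matrix n n ℂ} {M' : Matrix n n ℂ} {y : ℝ}
    (h : HasMatDeriv A M' (Ici 0) (-y)) : HasMatDeriv (fun x => A (-x)) (-M') (Iic 0) y := fun i j => by
  have h1 : HasDerivWithinAt (fun x : ℝ => -x) (-1) (Iic 0) y := (hasDerivAt_neg y).hasDerivWithinAt
  have := HasDerivWithinAt.scomp y (h i j) h1 (fun x hx => by simpa using hx)
  refine this.congr_deriv ?_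
  simp

lemma exists_line_flow {A : ℝ → Matrix n n ℂ} {Λ : ℝ} {t : ℂ}
    (hA : ∀ i j, Continuous fun y => A y i j) (hΛ : ∀ y i j, ‖A y i j‖ ≤ Λ)
    (htr : ∀ y, (A y).trace = t) :
    ∃ M : ℝ → Matrix n n ℂ, (∀ y, HasMatDeriv M (A y * M y) univ y) ∧ ∀ y, IsUnit (M y) := by
  obtain ⟨M, hM0, hM⟩ := exists_halfLine_flow hA fun y _ => hΛ y
  obtain ⟨Z, hZ0, hZ⟩ := exists_halfLine_flow (A := fun y => -A (-y)) (Λ := Λ)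
    (fun i j => ((hA i j).comp continuous_neg).neg) fun y _ i j => by
      rw [Matrix.neg_apply, norm_neg]; exact hΛ _ i j
  have hMu := isUnit_of_flow hM0 htr hM
  have hZu := isUnit_of_flow (t := -t) hZ0 (fun y => by rw [Matrix.trace_neg, htr]) hZ
  set W : ℝ → Matrix n n ℂ := fun y => if 0 ≤ y then M y else Z (-y) with hW
  have hWp : ∀ y ∈ Ici (0 : ℝ), W y = M y := fun y hy => if_pos hy
  have hWm : ∀ y ∈ Iic (0 : ℝ), W y = Z (-y) := by
    intro y hy
    rcases eq_or_lt_of_le (mem_Iic.1 hy) with rfl | h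
    · rw [hW]; simp [hM0, hZ0]
    · exact if_neg (not_le.2 h)
  have hdp : ∀ y ∈ Ici (0 : ℝ), HasMatDeriv W (A y * W y) (Ici 0) y := fun y hy i j => by
    rw [hWp y hy]; exact (hM y hy i j).congr_of_mem (fun x hx => by rw [hWp x hx]) hy
  have hdm : ∀ y ∈ Iic (0 : ℝ), HasMatDeriv W (A y * W y) (Iic 0) y := fun y hy i j => by
    rw [hWm y hy]
    have h := (hZ (-y) (by simpa using hy)).comp_neg i j
    refine (h.congr_of_mem (fun x hx => by rw [hWm x hx]) hy).congr_deriv ?_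
    simp
  refine ⟨W, fun y i j => ?_, fun y => ?_⟩
  · rcases lt_trichotomy y 0 with h | rfl | h
    · exact ((hdm y h.le i j).hasDerivAt (Iic_mem_nhds h)).hasDerivWithinAt
    · rw [← Iic_union_Ici (a := (0 : ℝ))]
      exact (hdm 0 self_mem_Iic i j).union (hdp 0 self_mem_Ici i j)
    · exact ((hdp y h.le i j).hasDerivAt (Ici_mem_nhds h)).hasDerivWithinAt
  · rcases le_total 0 y with h | h
    · rw [hWp y h]; exact hMu y h
    · rw [hWm y h]; exact hZu _ (by simpa using h)

/-- Coefficients of the equation for the coordinates of a conjugator. -/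
def conjugatorCoeff (N : Matrix n n ℂ) (B : Matrix n n ℂ) : Matrix (n × n) (n × n) ℂ :=
  Matrix.of fun s t => (if t.2 = s.2 then (if t.1 = s.1 then 0 else N s.1 t.1) + B s.1 t.1 else 0) -
    if t.1 = s.1 then (if t.2 = s.2 then 0 else N t.2 s.2) else 0

lemma sum_norm_conjugatorCoeff_le {N B : Matrix n n ℂ} {η c : ℝ}
    (hr : ∀ i, ∑ k ∈ Finset.univ.erase i, ‖N i k‖ ≤ η)
    (hc : ∀ j, ∑ k ∈ Finset.univ.erase j, ‖N k j‖ ≤ η) (hB : ∀ i, ∑ k, ‖B i k‖ ≤ c) (s : n × n) :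
    ∑ t, ‖conjugatorCoeff N B s t‖ ≤ 2 * η + c := by
  have er : ∀ i, ∑ k, ‖if k = i then 0 else N i k‖ ≤ η := fun i => by
    refine le_trans (le_of_eq ?_) (hr i)
    rw [← add_sum_erase _ _ (Finset.mem_univ i), if_pos rfl, norm_zero, zero_add]
    exact sum_congr rfl fun k hk => by rw [if_neg (ne_of_mem_erase hk)]
  have ec : ∀ j, ∑ k, ‖if k = j then 0 else N k j‖ ≤ η := fun j => by
    refine le_trans (le_of_eq ?_) (hc j)
    rw [← add_sum_erase _ _ (Finset.mem_univ j), if_pos rfl, norm_zero, zero_add]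
    exact sum_congr rfl fun k hk => by rw [if_neg (ne_of_mem_erase hk)]
  rw [Fintype.sum_prod_type]
  calc _ ≤ ∑ k, ∑ l, ((if l = s.2 then ‖if k = s.1 then 0 else N s.1 k‖ + ‖B s.1 k‖ else 0) +
        if k = s.1 then ‖if l = s.2 then 0 else N l s.2‖ else 0) := by
        refine sum_le_sum fun k _ => sum_le_sum fun l _ => ?_
        simp only [conjugatorCoeff, of_apply]
        refine (norm_sub_le _ _).trans (add_le_add ?_ ?_)
        · split_ifs
          · exact norm_add_le _ _
          · exact norm_add_le _ _
          · simp
        · split_ifs <;> simp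
    _ = ∑ k, (‖if k = s.1 then 0 else N s.1 k‖ + ‖B s.1 k‖) +
        ∑ l, ‖if l = s.2 then 0 else N l s.2‖ := by
        simp only [sum_add_distrib]
        congr 1
        · simp [sum_add_distrib]
        · rw [Finset.sum_comm]; simp
    _ ≤ _ := by
        rw [sum_add_distrib]; linarith [er s.1, ec s.2, hB s.1]

lemma sum_conjugatorCoeff (N B X : Matrix n n ℂ) (i j : n) :
    ∑ t : n × n, conjugatorCoeff N B (i, j) t * X t.1 t.2 =
      (N * X - X * N + B * X) i j - (N i i - N j j) * X i j := by
  rw [Fintype.sum_prod_type]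
  simp only [conjugatorCoeff, of_apply, sub_mul, ite_mul, zero_mul, add_mul,
    sum_sub_distrib, Finset.sum_ite_eq', Finset.mem_univ, if_true]
  have h1 : ∀ k, (∑ l, if k = i then (if l = j then 0 else N l j * X k l) else 0) =
      if k = i then ∑ l, (if l = j then 0 else N l j * X k l) else 0 := fun k => by
    split_ifs <;> simp
  simp only [h1, Finset.sum_ite_eq', Finset.mem_univ, if_true, sum_add_distrib,
    Matrix.add_apply, Matrix.sub_apply, Matrix.mul_apply]
  have h2 : (∑ k, if k = i then 0 else N i k * X k j) = ∑ k, N i k * X k j - N i i * X i j := by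
    rw [← add_sum_erase _ _ (Finset.mem_univ i), if_pos rfl, zero_add,
      ← add_sum_erase _ (fun k => N i k * X k j) (Finset.mem_univ i), add_sub_cancel_left]
    exact sum_congr rfl fun k hk => by rw [if_neg (ne_of_mem_erase hk)]
  have h3 : (∑ k, if k = j then 0 else N k j * X i k) = ∑ k, X i k * N k j - N j j * X i j := by
    rw [← add_sum_erase _ _ (Finset.mem_univ j), if_pos rfl, zero_add,
      ← add_sum_erase _ (fun k => X i k * N k j) (Finset.mem_univ j), mul_comm (X i j),
      add_sub_cancel_left]
    exact sum_congr rfl fun k hk => by rw [if_neg (ne_of_mem_erase hk), mul_comm]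
  rw [h2, h3]; ring

/-- A conjugator from `Z' = N Z` to `W' = (N + B) W` on `[0, ∞)`, for a matrix `N` with small
off-diagonal entries and an exponentially decaying perturbation `B`. -/
lemma exists_conjugator {N : Matrix n n ℂ} {B : ℝ → Matrix n n ℂ} {K α β g η : ℝ}
    (hB : ∀ i j, Continuous fun y => B y i j)
    (hBb : ∀ y, 0 ≤ y → ∀ i j, ‖B y i j‖ ≤ K * exp (-α * y)) (htr : ∀ y, (B y).trace = 0)
    (hβ0 : 0 < β) (hβ : β ≤ α) (hg : 0 < g) (hgap : ∀ i j, g ≤ |β + (N i i).re - (N j j).re|)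
    (hr : ∀ i, ∑ k ∈ Finset.univ.erase i, ‖N i k‖ ≤ η)
    (hc : ∀ j, ∑ k ∈ Finset.univ.erase j, ‖N k j‖ ≤ η) (hη : 8 * η ≤ g) :
    ∃ Q : ℝ → Matrix n n ℂ, (∀ y ∈ Ici (0 : ℝ), IsUnit (Q y)) ∧
      (∀ y ∈ Ici (0 : ℝ), HasMatDeriv Q ((N + B y) * Q y - Q y * N) (Ici 0) y) ∧
      Tendsto Q atTop (𝓝 1) := by
  by_cases hn : Nonempty n
  swap
  · refine ⟨fun _ => 1, fun _ _ => isUnit_one, fun y _ i => (hn ⟨i⟩).elim, tendsto_const_nhds⟩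
  have hα : 0 < α := hβ0.trans_le hβ
  have hK : 0 ≤ K := by
    simpa using (norm_nonneg _).trans (hBb 0 le_rfl hn.some hn.some)
  obtain ⟨y0, hy0, hsmall⟩ : ∃ y0 : ℝ, 0 ≤ y0 ∧
      card n * (K * exp (-α * y0)) ≤ g / 4 := by
    have hlim : Tendsto (fun y : ℝ => card n * (K * exp (-α * y))) atTop
        (𝓝 (card n * (K * 0))) := by
      refine Tendsto.const_mul _ (Tendsto.const_mul _ (Real.tendsto_exp_atBot.comp ?_))
      exact tendsto_id.const_mul_atTop_of_neg (by linarith)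
    rw [mul_zero, mul_zero] at hlim
    obtain ⟨y, h1, h2⟩ := ((hlim.eventually_le_const (by positivity : 0 < g / 4)).and
      (eventually_ge_atTop 0)).exists
    exact ⟨y, h2, h1⟩
  have hdec : ∀ y, 0 ≤ y → ∀ i j, ‖B (y0 + y) i j‖ ≤ K * exp (-α * y0) * exp (-α * y) := fun y hy i j => by
    refine (hBb _ (by linarith) i j).trans (le_of_eq ?_)
    rw [mul_assoc, ← exp_add]; ring_nf
  obtain ⟨x, ⟨b, hb⟩, hx, -⟩ := exists_bounded_solution
    (fun s : n × n => (β : ℂ) + N s.1 s.1 - N s.2 s.2) 0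
    (C := fun y => conjugatorCoeff N (B (y0 + y)))
    (f := fun y s => cexp (β * y) * B (y0 + y) s.1 s.2) (F := K) hg
    (fun s => by simpa using hgap s.1 s.2) (fun s t => by
      have : ∀ i j, Continuous fun y => B (y0 + y) i j := fun i j =>
        (hB i j).comp (continuous_const.add continuous_id)
      simp only [conjugatorCoeff, of_apply]
      split_ifs <;> fun_prop)
    (fun y hy s => by
      refine (sum_norm_conjugatorCoeff_le (c := g / 4) hr hc (fun i => ?_) s).trans (by linarith)
      refine le_trans ?_ hsmall
      refine (sum_le_sum fun k _ => (hdec y hy i k).trans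
        (mul_le_of_le_one_right (by positivity) (exp_le_one_iff.2 (by nlinarith)))).trans ?_
      rw [sum_const, card_univ, nsmul_eq_mul])
    (fun s => by
      have : ∀ i j, Continuous fun y => B (y0 + y) i j := fun i j =>
        (hB i j).comp (continuous_const.add continuous_id)
      fun_prop)
    (fun y hy s => by
      rw [norm_mul, norm_cexp_mul_ofReal, Complex.ofReal_re]
      calc _ ≤ exp (β * y) * (K * exp (-α * y0) * exp (-α * y)) := by
            gcongr; exact hdec y hy _ _
        _ = K * (exp (-α * y0) * exp ((β - α) * y)) := by
            rw [show (β - α) * y = β * y + -α * y by ring, exp_add]; ring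
        _ ≤ K * (1 * 1) := by
            gcongr
            · exact exp_le_one_iff.2 (by nlinarith)
            · exact exp_le_one_iff.2 (by nlinarith)
        _ = K := by ring)
  -- the conjugator near infinity
  set V : ℝ → Matrix n n ℂ := fun y => 1 + cexp (-β * y) • Matrix.of fun i j => x y (i, j) with hV
  have hVd : ∀ y ∈ Ici (0 : ℝ), HasMatDeriv V ((N + B (y0 + y)) * V y - V y * N) (Ici 0) y := fun y hy i j => by
    have h1 := (hasDerivWithinAt_exp_mul (μ := -β) (hx y hy (i, j))).const_add
      ((1 : Matrix n n ℂ) i j)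
    refine HasDerivWithinAt.congr_deriv (f := fun t => V t i j) h1 ?_
    have h2 := sum_conjugatorCoeff N (B (y0 + y)) (Matrix.of fun i j => x y (i, j)) i j
    simp only [of_apply, Prod.mk.eta] at h2
    rw [h2]
    obtain ⟨Y, hY⟩ : ∃ Y : Matrix n n ℂ, Y = Matrix.of fun i j => x y (i, j) := ⟨_, rfl⟩
    rw [← hY]
    have hVy : V y = 1 + cexp (-β * y) • Y := by rw [hY]
    have h3 : (N + B (y0 + y)) * V y - V y * N = B (y0 + y) +
        cexp (-β * y) • (N * Y - Y * N + B (y0 + y) * Y) := by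
      rw [hVy]
      simp only [mul_add, add_mul, Matrix.mul_smul, smul_mul, mul_one, one_mul, smul_add, smul_sub]
      abel
    have h4 : x y (i, j) = Y i j := by rw [hY]; rfl
    have h5 : cexp (-β * y) * cexp (β * y) = 1 := by rw [← Complex.exp_add]; simp
    have h6 : (B (y0 + y) + cexp (-β * y) • (N * Y - Y * N + B (y0 + y) * Y)) i j =
        B (y0 + y) i j + cexp (-β * y) * (N * Y - Y * N + B (y0 + y) * Y) i j := rfl
    rw [h3, h4, h6]
    linear_combination (B (y0 + y) i j) * h5
  have hVlim : Tendsto V atTop (𝓝 1) := by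
    have h0 : Tendsto (fun y : ℝ => cexp (-β * y) • Matrix.of fun i j => x y (i, j)) atTop
        (𝓝 (0 : Matrix n n ℂ)) := by
      refine tendsto_pi_nhds.2 fun i => tendsto_pi_nhds.2 fun j => ?_
      have hlim : Tendsto (fun y : ℝ => exp (-β * y) * b) atTop (𝓝 (0 * b)) := by
        refine Tendsto.mul_const _ (Real.tendsto_exp_atBot.comp ?_)
        exact tendsto_id.const_mul_atTop_of_neg (by linarith)
      rw [zero_mul] at hlim
      refine squeeze_zero_norm (fun y => ?_) hlim
      rw [Matrix.smul_apply, smul_eq_mul, norm_mul, ← Complex.ofReal_neg, norm_cexp_mul_ofReal,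
        Complex.ofReal_re]
      exact mul_le_mul_of_nonneg_left (hb y (i, j)) (exp_nonneg _)
    have h1 := (tendsto_const_nhds (x := (1 : Matrix n n ℂ))).add h0
    rwa [add_zero] at h1
  -- extension to the whole half-line
  have hΛ := norm_entry_le_sum N
  obtain ⟨M, hM0, hM⟩ := exists_halfLine_flow (A := fun y => N + B y)
    (Λ := (∑ i, ∑ j, ‖N i j‖) + K)
    (fun i j => continuous_const.add (hB i j)) fun y hy i j => by
      refine (norm_add_le _ _).trans (add_le_add (hΛ i j) ((hBb y hy i j).trans ?_))
      exact mul_le_of_le_one_right hK (exp_le_one_iff.2 (by nlinarith))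
  obtain ⟨Z, hZ0, hZ⟩ := exists_halfLine_flow (A := fun _ : ℝ => N)
    (fun i j => continuous_const) fun y _ => hΛ
  have hMu := isUnit_of_flow (t := N.trace) hM0 (fun y => by
    rw [trace_add, htr, add_zero]) hM
  have hZu := isUnit_of_flow hZ0 (fun _ => rfl) hZ
  have hMd := fun y hy => isUnit_det (hMu y hy)
  have hZd := fun y hy => isUnit_det (hZu y hy)
  have hmem : ∀ y ∈ Ici (0 : ℝ), y0 + y ∈ Ici (0 : ℝ) := fun y hy => by
    simp only [mem_Ici] at hy ⊢; linarith
  have hshift : ∀ {W : ℝ → Matrix n n ℂ} {W' : Matrix n n ℂ} {y : ℝ},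
      HasMatDeriv W W' (Ici 0) (y0 + y) → HasMatDeriv (fun y => W (y0 + y)) W' (Ici 0) y := by
    intro W W' y h i j
    have h1 : HasDerivWithinAt (fun y : ℝ => y0 + y) 1 (Ici 0) y :=
      ((hasDerivAt_id y).const_add y0).hasDerivWithinAt
    have := HasDerivWithinAt.scomp y (h i j) h1 hmem
    exact this.congr_deriv (one_smul _ _)
  set G : ℝ → Matrix n n ℂ := fun y => (M (y0 + y))⁻¹ * V y * Z (y0 + y) with hG
  have hGc : ∀ y ∈ Ici (0 : ℝ), G y = G 0 := fun y hy => by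
    refine const_of_hasMatDeriv_zero (convex_Ici 0) (fun y hy => ?_) hy self_mem_Ici
    have h1 := ((hshift (hM _ (hmem y hy))).inv (fun t ht => hMu _ (hmem t ht)) hy
      (uniqueDiffOn_Ici 0 y hy)).mul (hVd y hy)
    have h2 := h1.mul (hshift (hZ _ (hmem y hy)))
    refine h2.congr_deriv ?_
    rw [← mul_assoc ((M (y0 + y))⁻¹) (N + B (y0 + y)),
      mul_nonsing_inv_cancel_right _ _ (hMd _ (hmem y hy))]
    noncomm_ring
  set Q : ℝ → Matrix n n ℂ := fun y => M y * G 0 * (Z y)⁻¹ with hQ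
  have hQV : ∀ y ∈ Ici (0 : ℝ), Q (y0 + y) = V y := fun y hy => by
    rw [hQ]; simp only
    rw [← hGc y hy, hG]; simp only
    rw [← mul_assoc, mul_nonsing_inv_cancel_right _ _ (hZd _ (hmem y hy)),
      mul_nonsing_inv_cancel_left _ _ (hMd _ (hmem y hy))]
  have hQd : ∀ y ∈ Ici (0 : ℝ), HasMatDeriv Q ((N + B y) * Q y - Q y * N) (Ici 0) y := fun y hy => by
    have h1 := ((hM y hy).mul_const (G 0)).mul ((hZ y hy).inv hZu hy (uniqueDiffOn_Ici 0 y hy))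
    refine h1.congr_deriv ?_
    have hQy : Q y = M y * G 0 * (Z y)⁻¹ := rfl
    rw [← mul_assoc ((Z y)⁻¹) N, mul_nonsing_inv_cancel_right _ _ (hZd y hy), hQy]
    noncomm_ring
  have hQlim : Tendsto Q atTop (𝓝 1) := by
    have h1 : Tendsto (fun y => V (y - y0)) atTop (𝓝 1) :=
      hVlim.comp (tendsto_atTop_add_const_right _ _ tendsto_id)
    refine h1.congr' ?_
    filter_upwards [eventually_ge_atTop y0] with y hy
    rw [← hQV (y - y0) (by simpa using hy), add_sub_cancel]
  refine ⟨Q, fun y hy => ?_, hQd, hQlim⟩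
  have h1 : Tendsto (fun t => (Q t).det) atTop (𝓝 (1 : Matrix n n ℂ).det) :=
    ((continuous_id.matrix_det).tendsto _).comp hQlim
  obtain ⟨t, ht⟩ := (h1.eventually_ne (by simp : (1 : Matrix n n ℂ).det ≠ 0)).exists
  have hne : (G 0).det ≠ 0 := fun h => ht (by simp [hQ, h])
  exact ((hMu y hy).mul ((isUnit_iff_isUnit_det _).2 hne.isUnit)).mul
    (Matrix.isUnit_nonsing_inv_iff.2 (hZu y hy))

end

end

section

/-! ### Calculus on an open interval -/

section

variable {I : Set ℝ} {φ : ℝ → ℝ} {a b s : ℝ}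

lemma hasDerivAt_of_contDiffOn {n : WithTop ℕ∞} (hI : IsOpen I) (hφ : ContDiffOn ℝ n φ I)
    (hn : 1 ≤ n) {x : ℝ} (hx : x ∈ I) : HasDerivAt φ (deriv φ x) x :=
  ((hφ.contDiffAt (hI.mem_nhds hx)).differentiableAt
    (by rintro rfl; exact absurd hn (by simp))).hasDerivAt

lemma contDiffOn_deriv (hI : IsOpen I) (hφ : ContDiffOn ℝ ∞ φ I) : ContDiffOn ℝ ∞ (deriv φ) I :=
  ((contDiffOn_infty_iff_deriv_of_isOpen hI).1 hφ).2

lemma exists_bound_of_contDiffOn (hφ : ContDiffOn ℝ ∞ φ I) (hab : Icc a b ⊆ I) :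
    ∃ C > 0, ∀ x ∈ Icc a b, |φ x| ≤ C := by
  obtain ⟨C, hC⟩ := isCompact_Icc.exists_bound_of_continuousOn (hφ.continuousOn.mono hab)
  exact ⟨max C 1, by positivity, fun x hx => (hC x hx).trans (le_max_left _ _)⟩

lemma abs_sub_le_of_deriv_le {C : ℝ} (hI : IsOpen I) (hφ : ContDiffOn ℝ ∞ φ I) {x y : ℝ}
    (hxy : uIcc x y ⊆ I) (hC : ∀ t ∈ uIcc x y, |deriv φ t| ≤ C) : |φ x - φ y| ≤ C * |x - y| := by
  have := (convex_uIcc x y).norm_image_sub_le_of_norm_hasDerivWithin_le (f := φ) (f' := deriv φ)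
    (fun t ht => (hasDerivAt_of_contDiffOn hI hφ (by simp) (hxy ht)).hasDerivWithinAt) hC
    right_mem_uIcc left_mem_uIcc
  simpa [norm_eq_abs] using this

lemma exists_lipschitz (hI : IsOpen I) (hφ : ContDiffOn ℝ ∞ φ I) (hab : Icc a b ⊆ I) :
    ∃ C > 0, ∀ x ∈ Icc a b, ∀ y ∈ Icc a b, |φ x - φ y| ≤ C * |x - y| := by
  obtain ⟨C, hC0, hC⟩ := exists_bound_of_contDiffOn (contDiffOn_deriv hI hφ) hab
  refine ⟨C, hC0, fun x hx y hy => ?_⟩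
  have hsub : uIcc x y ⊆ Icc a b := uIcc_subset_Icc hx hy
  exact abs_sub_le_of_deriv_le hI hφ (hsub.trans hab) fun t ht => hC t (hsub ht)

lemma exists_lipschitz_critical (hI : IsOpen I) (hφ : ContDiffOn ℝ ∞ φ I) (hab : Icc a b ⊆ I)
    (hs : s ∈ Icc a b) (hcrit : deriv φ s = 0) :
    ∃ C > 0, ∀ x ∈ Icc a b, ∀ y ∈ Icc a b,
      |φ x - φ y| ≤ C * (|x - s| + |y - s|) * |x - y| := by
  obtain ⟨C, hC0, hC⟩ := exists_lipschitz hI (contDiffOn_deriv hI hφ) hab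
  refine ⟨C, hC0, fun x hx y hy => ?_⟩
  have hsub : uIcc x y ⊆ Icc a b := uIcc_subset_Icc hx hy
  refine abs_sub_le_of_deriv_le hI hφ (hsub.trans hab) fun t ht => ?_
  have h1 := hC t (hsub ht) s hs
  rw [hcrit, sub_zero] at h1
  refine h1.trans (mul_le_mul_of_nonneg_left ?_ hC0.le)
  rcases le_total x y with h | h
  · rw [uIcc_of_le h] at ht
    rw [abs_le]
    exact ⟨by linarith [ht.1, neg_abs_le (x - s), abs_nonneg (y - s)],
      by linarith [ht.2, le_abs_self (y - s), abs_nonneg (x - s)]⟩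
  · rw [uIcc_of_ge h] at ht
    rw [abs_le]
    exact ⟨by linarith [ht.1, neg_abs_le (y - s), abs_nonneg (x - s)],
      by linarith [ht.2, le_abs_self (x - s), abs_nonneg (y - s)]⟩

/-- Functions of value and slope that are even in the slope agree with their linear part up to
quadratic terms. -/
lemma exists_quadratic {ψ : ℝ → ℝ} {vs V : ℝ} (hI : IsOpen I) (hφ : ContDiffOn ℝ ∞ φ I)
    (hψ : ContDiffOn ℝ ∞ ψ I) (hab : Icc a b ⊆ I) (hs : vs ∈ Icc a b) (hV : 0 ≤ V) :
    ∃ C > 0, ∀ v1 ∈ Icc a b, ∀ v2 ∈ Icc a b, ∀ p1 p2 : ℝ, |p1| ≤ V → |p2| ≤ V →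
      |(φ v1 + ψ v1 * p1 ^ 2 - deriv φ vs * (v1 - vs)) -
        (φ v2 + ψ v2 * p2 ^ 2 - deriv φ vs * (v2 - vs))| ≤
        C * ((|v1 - vs| + |p1|) + (|v2 - vs| + |p2|)) * (|v1 - v2| + |p1 - p2|) := by
  set d := deriv φ vs with hd
  have hsm : ContDiffOn ℝ ∞ (fun v => φ v - d * (v - vs)) I :=
    hφ.sub (contDiffOn_const.mul (contDiffOn_id.sub contDiffOn_const))
  have hcr : deriv (fun v => φ v - d * (v - vs)) vs = 0 := by
    have h1 := hasDerivAt_of_contDiffOn hI hφ (by simp) (hab hs)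
    have h2 := ((hasDerivAt_id vs).sub_const vs).const_mul d
    have h3 : deriv (fun v => φ v - d * (v - vs)) vs = _ := (h1.sub h2).deriv
    rw [h3, mul_one, sub_self]
  obtain ⟨C0, hC₀, h0⟩ := exists_lipschitz_critical hI hsm hab hs hcr
  obtain ⟨C1, hC1, h1⟩ := exists_lipschitz hI hψ hab
  obtain ⟨C2, hC2, h2⟩ := exists_bound_of_contDiffOn hψ hab
  refine ⟨C0 + C1 * V + C2, by positivity, fun v1 hv1 v2 hv2 p1 p2 hp1 hp2 => ?_⟩
  have a0 := h0 v1 hv1 v2 hv2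
  have a1 := h1 v1 hv1 v2 hv2
  have a2 := h2 v2 hv2
  have e : (φ v1 + ψ v1 * p1 ^ 2 - d * (v1 - vs)) - (φ v2 + ψ v2 * p2 ^ 2 - d * (v2 - vs)) =
      ((φ v1 - d * (v1 - vs)) - (φ v2 - d * (v2 - vs))) + (ψ v1 - ψ v2) * (p1 * p1) +
      ψ v2 * ((p1 + p2) * (p1 - p2)) := by
    ring
  rw [e]
  set w := (|v1 - vs| + |p1|) + (|v2 - vs| + |p2|) with hw
  have q1 := abs_nonneg (v1 - vs)
  have q2 := abs_nonneg (v2 - vs)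
  have q3 := abs_nonneg p1
  have q4 := abs_nonneg p2
  have b1 : |v1 - vs| + |v2 - vs| ≤ w := by rw [hw]; linarith
  have b2 : |p1 + p2| ≤ w := (abs_add_le _ _).trans (by rw [hw]; linarith)
  have b3 : |p1| ≤ w := by rw [hw]; linarith
  have hw0 : 0 ≤ w := by positivity
  refine (abs_add_three _ _ _).trans ?_
  rw [abs_mul, abs_mul, abs_mul, abs_mul]
  calc _ ≤ C0 * w * |v1 - v2| + C1 * |v1 - v2| * (V * w) + C2 * (w * |p1 - p2|) := by
        gcongr; exact a0.trans (by gcongr)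
    _ ≤ _ := by
      have := abs_nonneg (v1 - v2)
      have := abs_nonneg (p1 - p2)
      have : 0 ≤ C0 * w * |p1 - p2| := by positivity
      have : 0 ≤ C1 * V * w * |p1 - p2| := by positivity
      have : 0 ≤ C2 * w * |v1 - v2| := by positivity
      nlinarith

end

/-- Comparison for differential inequalities. -/
lemma gronwall_le {f f' G g : ℝ → ℝ} {a b : ℝ} (hab : a ≤ b)
    (hf : ∀ x ∈ Icc a b, HasDerivAt f (f' x) x) (hG : ∀ x ∈ Icc a b, HasDerivAt G (g x) x)
    (h : ∀ x ∈ Icc a b, f' x ≤ g x * f x) : f b ≤ f a * exp (G b - G a) := by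
  have hd : ∀ x ∈ Icc a b, HasDerivAt (fun x => f x * exp (-G x))
      ((f' x - g x * f x) * exp (-G x)) x := fun x hx =>
    ((hf x hx).mul ((hG x hx).neg.exp)).congr_deriv (by simp only [Pi.neg_apply]; ring)
  have hanti : AntitoneOn (fun x => f x * exp (-G x)) (Icc a b) := by
    refine antitoneOn_of_deriv_nonpos (convex_Icc a b)
      (fun x hx => (hd x hx).continuousAt.continuousWithinAt)
      (fun x hx => (hd x (interior_subset hx)).differentiableAt.differentiableWithinAt)
      fun x hx => ?_
    rw [(hd x (interior_subset hx)).deriv]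
    have := h x (interior_subset hx)
    exact mul_nonpos_of_nonpos_of_nonneg (by linarith) (exp_nonneg _)
  have h1 := hanti (left_mem_Icc.2 hab) (right_mem_Icc.2 hab) hab
  simp only at h1
  have h2 : f b = f b * exp (-G b) * exp (G b) := by rw [mul_assoc, ← exp_add]; simp
  rw [h2, sub_eq_add_neg, add_comm, exp_add, ← mul_assoc]
  exact mul_le_mul_of_nonneg_right h1 (exp_nonneg _)

lemma le_gronwall {f f' G g : ℝ → ℝ} {a b : ℝ} (hab : a ≤ b)
    (hf : ∀ x ∈ Icc a b, HasDerivAt f (f' x) x) (hG : ∀ x ∈ Icc a b, HasDerivAt G (g x) x)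
    (h : ∀ x ∈ Icc a b, g x * f x ≤ f' x) : f a * exp (G b - G a) ≤ f b := by
  have := gronwall_le (f := fun x => -f x) hab (fun x hx => (hf x hx).neg) hG
    (fun x hx => by have := h x hx; change -f' x ≤ g x * -f x; linarith)
  linarith

/-! ### Orbits of the travelling wave equation -/

/-- Structural assumptions on a capillarity `κ` and a potential `W`, with a saddle value `vs`. -/
structure Saddle (I : Set ℝ) (κ W : ℝ → ℝ) (vs : ℝ) : Prop where
  isOpen : IsOpen I
  ordConnected : I.OrdConnected
  smooth_κ : ContDiffOn ℝ ∞ κ I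
  smooth_W : ContDiffOn ℝ ∞ W I
  pos : ∀ v ∈ I, 0 < κ v
  mem : vs ∈ I
  crit : deriv W vs = 0
  neg : deriv (deriv W) vs < 0

/-- The right-hand well of a potential with a saddle. -/
structure Well (I : Set ℝ) (κ W : ℝ → ℝ) (vs vr : ℝ) : Prop extends Saddle I κ W vs where
  mem_r : vr ∈ I
  lt : vs < vr
  level : W vr = W vs
  slope : 0 < deriv W vr
  below : ∀ v ∈ Ioo vs vr, W v < W vs

/-- Profiles of energy `μ`. -/
structure IsOrbit (I : Set ℝ) (κ W : ℝ → ℝ) (μ : ℝ) (v : ℝ → ℝ) : Prop where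
  smooth : ContDiff ℝ 2 v
  mem : ∀ x, v x ∈ I
  energy : ∀ x, 1 / 2 * κ (v x) * deriv v x ^ 2 + W (v x) = μ
  eulerLagrange : ∀ x, κ (v x) * deriv (deriv v) x + 1 / 2 * deriv κ (v x) * deriv v x ^ 2
    + deriv W (v x) = 0

/-- Rate of the saddle. -/
def saddleRate (κ W : ℝ → ℝ) (vs : ℝ) : ℝ := Real.sqrt (-deriv (deriv W) vs / κ vs)

/-- Second derivative of an orbit, as a function of value and slope. -/
def acc (κ W : ℝ → ℝ) (v p : ℝ) : ℝ := -deriv W v / κ v + -deriv κ v / (2 * κ v) * p ^ 2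

section

variable {I : Set ℝ} {κ W : ℝ → ℝ} {vs vr μ : ℝ} {v u : ℝ → ℝ}
local notation "rate" => saddleRate κ W vs

lemma IsOrbit.hasDerivAt (h : IsOrbit I κ W μ v) (x : ℝ) : HasDerivAt v (deriv v x) x :=
  (h.smooth.differentiable (by norm_num) x).hasDerivAt

lemma IsOrbit.hasDerivAt_deriv (h : IsOrbit I κ W μ v) (x : ℝ) :
    HasDerivAt (deriv v) (deriv (deriv v) x) x :=
  ((ContDiff.differentiable (n := 1) (h.smooth.iterate_deriv' 1 1) (by norm_num)) x).hasDerivAt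

lemma IsOrbit.continuous (h : IsOrbit I κ W μ v) : Continuous v := h.smooth.continuous

lemma IsOrbit.continuous_deriv (h : IsOrbit I κ W μ v) : Continuous (deriv v) :=
  continuous_iff_continuousAt.2 fun x => (h.hasDerivAt_deriv x).continuousAt

lemma IsOrbit.deriv_deriv (hκ : ∀ v ∈ I, 0 < κ v) (h : IsOrbit I κ W μ v) (x : ℝ) :
    deriv (deriv v) x = acc κ W (v x) (deriv v x) := by
  have h1 := h.eulerLagrange x
  have h2 := (hκ _ (h.mem x)).ne'
  rw [acc]
  field_simp; linarith

namespace Saddle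

variable (h : Saddle I κ W vs)

include h

lemma rate_sq : rate ^ 2 = -deriv (deriv W) vs / κ vs :=
  Real.sq_sqrt (div_nonneg (by linarith [h.neg]) (h.pos _ h.mem).le)

lemma rate_pos : 0 < rate :=
  Real.sqrt_pos.2 (div_pos (by linarith [h.neg]) (h.pos _ h.mem))

lemma smooth_acc₀ : ContDiffOn ℝ ∞ (fun v => -deriv W v / κ v) I :=
  (contDiffOn_deriv h.isOpen h.smooth_W).neg.div h.smooth_κ fun v hv => (h.pos v hv).ne'

lemma smooth_acc₁ : ContDiffOn ℝ ∞ (fun v => -deriv κ v / (2 * κ v)) I :=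
  (contDiffOn_deriv h.isOpen h.smooth_κ).neg.div (contDiffOn_const.mul h.smooth_κ) fun v hv =>
    mul_ne_zero two_ne_zero (h.pos v hv).ne'

lemma acc_lipschitz {a b V : ℝ} (hab : Icc a b ⊆ I) (hV : 0 ≤ V) :
    ∃ C > 0, ∀ v1 ∈ Icc a b, ∀ v2 ∈ Icc a b, ∀ p1 p2 : ℝ, |p1| ≤ V → |p2| ≤ V →
      |acc κ W v1 p1 - acc κ W v2 p2| ≤ C * (|v1 - v2| + |p1 - p2|) := by
  obtain ⟨C0, hC₀, h0⟩ := exists_lipschitz h.isOpen h.smooth_acc₀ hab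
  obtain ⟨C1, hC1, h1⟩ := exists_lipschitz h.isOpen h.smooth_acc₁ hab
  obtain ⟨C2, hC2, h2⟩ := exists_bound_of_contDiffOn h.smooth_acc₁ hab
  refine ⟨C0 + C1 * V ^ 2 + C2 * (2 * V), by positivity, fun v1 hv1 v2 hv2 p1 p2 hp1 hp2 => ?_⟩
  have a0 := h0 v1 hv1 v2 hv2
  have a1 := h1 v1 hv1 v2 hv2
  have a2 := h2 v2 hv2
  have e : acc κ W v1 p1 - acc κ W v2 p2 = (-deriv W v1 / κ v1 - -deriv W v2 / κ v2) +
      (-deriv κ v1 / (2 * κ v1) - -deriv κ v2 / (2 * κ v2)) * p1 ^ 2 +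
      -deriv κ v2 / (2 * κ v2) * ((p1 + p2) * (p1 - p2)) := by
    rw [acc, acc]; ring
  rw [e]
  have b1 : p1 ^ 2 ≤ V ^ 2 := by rw [← sq_abs]; gcongr
  have b2 : |p1 + p2| ≤ 2 * V := (abs_add_le _ _).trans (by linarith)
  refine (abs_add_three _ _ _).trans ?_
  rw [abs_mul, abs_mul, abs_mul, abs_of_nonneg (sq_nonneg p1)]
  calc _ ≤ C0 * |v1 - v2| + C1 * |v1 - v2| * V ^ 2 + C2 * (2 * V * |p1 - p2|) := by gcongr
    _ ≤ _ := by
      have := abs_nonneg (v1 - v2)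
      have := abs_nonneg (p1 - p2)
      have : 0 ≤ C0 * |p1 - p2| := by positivity
      have : 0 ≤ C1 * V ^ 2 * |p1 - p2| := by positivity
      have : 0 ≤ C2 * (2 * V) * |v1 - v2| := by positivity
      nlinarith

lemma deriv_acc₀ : deriv (fun v => -deriv W v / κ v) vs = rate ^ 2 := by
  have h1 := (hasDerivAt_of_contDiffOn h.isOpen (contDiffOn_deriv h.isOpen h.smooth_W)
    (by simp) h.mem).neg.div
    (hasDerivAt_of_contDiffOn h.isOpen h.smooth_κ (by simp) h.mem) (h.pos _ h.mem).ne'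
  have h2 : deriv (fun v => -deriv W v / κ v) vs = _ := h1.deriv
  have h3 := (h.pos _ h.mem).ne'
  rw [h2, h.rate_sq, Pi.neg_apply, h.crit]
  field_simp; ring

/-- The nonlinear part of the equation is quadratically small near the saddle. -/
lemma acc_quadratic {a b V : ℝ} (hab : Icc a b ⊆ I) (hs : vs ∈ Icc a b) (hV : 0 ≤ V) :
    ∃ C > 0, ∀ v1 ∈ Icc a b, ∀ v2 ∈ Icc a b, ∀ p1 p2 : ℝ, |p1| ≤ V → |p2| ≤ V →
      |(acc κ W v1 p1 - rate ^ 2 * (v1 - vs)) -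
        (acc κ W v2 p2 - rate ^ 2 * (v2 - vs))| ≤
        C * ((|v1 - vs| + |p1|) + (|v2 - vs| + |p2|)) * (|v1 - v2| + |p1 - p2|) := by
  obtain ⟨C, hC, hq⟩ := exists_quadratic h.isOpen h.smooth_acc₀ h.smooth_acc₁ hab hs hV
  rw [h.deriv_acc₀] at hq; exact ⟨C, hC, hq⟩

/-- Orbits are determined by value and slope at one point. -/
lemma orbit_unique {μ' : ℝ} (hv : IsOrbit I κ W μ v) (hu : IsOrbit I κ W μ' u) {x₀ : ℝ}
    (h0 : v x₀ = u x₀) (h1 : deriv v x₀ = deriv u x₀) : v = u := by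
  funext x
  set J := uIcc x₀ x with hJ
  have hJc : IsCompact J := isCompact_uIcc
  have hJn : J.Nonempty := ⟨x₀, left_mem_uIcc⟩
  obtain ⟨m1, hm1, hm₁'⟩ := hJc.exists_isMinOn hJn (hv.continuous.min hu.continuous).continuousOn
  obtain ⟨m2, hm2, hm₂'⟩ := hJc.exists_isMaxOn hJn (hv.continuous.max hu.continuous).continuousOn
  obtain ⟨V, hV⟩ := hJc.exists_bound_of_continuousOn (f := fun x => |deriv v x| + |deriv u x|)
    (hv.continuous_deriv.abs.add hu.continuous_deriv.abs).continuousOn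
  set a := min (v m1) (u m1)
  set b := max (v m2) (u m2)
  have ha : a ∈ I := by
    rcases min_choice (v m1) (u m1) with h | h
    · simp only [a, h]; exact hv.mem _
    · simp only [a, h]; exact hu.mem _
  have hb : b ∈ I := by
    rcases max_choice (v m2) (u m2) with h | h
    · simp only [b, h]; exact hv.mem _
    · simp only [b, h]; exact hu.mem _
  have hab : Icc a b ⊆ I := h.ordConnected.out ha hb
  have hvm : ∀ t ∈ J, v t ∈ Icc a b := fun t ht =>
    ⟨(hm₁' ht).trans (min_le_left _ _), (le_max_left _ _).trans (hm₂' ht)⟩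
  have hum : ∀ t ∈ J, u t ∈ Icc a b := fun t ht =>
    ⟨(hm₁' ht).trans (min_le_right _ _), (le_max_right _ _).trans (hm₂' ht)⟩
  have hV' : ∀ t ∈ J, |deriv v t| ≤ V ∧ |deriv u t| ≤ V := fun t ht => by
    have := (le_abs_self _).trans (hV t ht)
    constructor <;> linarith [abs_nonneg (deriv v t), abs_nonneg (deriv u t)]
  have hV0 : 0 ≤ V := (abs_nonneg _).trans (hV' x₀ left_mem_uIcc).1
  obtain ⟨C, hC, hL⟩ := h.acc_lipschitz hab hV0
  set D : ℝ → ℝ := fun t => (v t - u t) ^ 2 + (deriv v t - deriv u t) ^ 2 with hD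
  set D' : ℝ → ℝ := fun t => 2 * (v t - u t) * (deriv v t - deriv u t) +
    2 * (deriv v t - deriv u t) * (deriv (deriv v) t - deriv (deriv u) t) with hD'
  have hder : ∀ t, HasDerivAt D (D' t) t := fun t => by
    have h2 := (((hv.hasDerivAt t).sub (hu.hasDerivAt t)).pow 2).add
      (((hv.hasDerivAt_deriv t).sub (hu.hasDerivAt_deriv t)).pow 2)
    refine HasDerivAt.congr_deriv (f := D) h2 ?_
    simp [hD']
  have hbd : ∀ t ∈ J, |D' t| ≤ (1 + 3 * C) * D t := fun t ht => by
    have h2 := hL (v t) (hvm t ht) (u t) (hum t ht) _ _ (hV' t ht).1 (hV' t ht).2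
    rw [← hv.deriv_deriv h.pos, ← hu.deriv_deriv h.pos] at h2
    simp only [hD', hD]
    set δ := v t - u t
    set ρ := deriv v t - deriv u t
    set r := deriv (deriv v) t - deriv (deriv u) t
    have q1 : |2 * δ * ρ| ≤ δ ^ 2 + ρ ^ 2 := by
      rw [abs_le]; constructor <;> nlinarith [sq_nonneg (δ + ρ), sq_nonneg (δ - ρ)]
    have q2 : |2 * ρ * r| ≤ 3 * C * (δ ^ 2 + ρ ^ 2) := by
      rw [abs_mul, abs_mul, abs_two]
      calc 2 * |ρ| * |r| ≤ 2 * |ρ| * (C * (|δ| + |ρ|)) := by gcongr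
        _ = C * (2 * |ρ| * |δ| + 2 * |ρ| ^ 2) := by ring
        _ ≤ C * (3 * (|δ| ^ 2 + |ρ| ^ 2)) := by gcongr; nlinarith [sq_nonneg (|ρ| - |δ|)]
        _ = _ := by rw [sq_abs, sq_abs]; ring
    calc _ ≤ |2 * δ * ρ| + |2 * ρ * r| := abs_add_le _ _
      _ ≤ _ := by linarith
  have hG : ∀ k t : ℝ, HasDerivAt (fun t => k * t) k t := fun k t => by
    simpa using (hasDerivAt_id t).const_mul k
  have hD0 : D x₀ = 0 := by simp [hD, h0, h1]
  have hDx : D x ≤ 0 := by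
    rcases le_total x₀ x with hx | hx
    · have hJ' : J = Icc x₀ x := uIcc_of_le hx
      have := gronwall_le hx (fun t _ => hder t) (fun t _ => hG (1 + 3 * C) t)
        (fun t ht => (le_abs_self _).trans (hbd t (hJ' ▸ ht)))
      rwa [hD0, zero_mul] at this
    · have hJ' : J = Icc x x₀ := uIcc_of_ge hx
      have := le_gronwall hx (fun t _ => hder t) (fun t _ => hG (-(1 + 3 * C)) t)
        (fun t ht => by
          have := (neg_abs_le (D' t)); have := hbd t (hJ' ▸ ht); linarith)
      rw [hD0] at this; exact nonpos_of_mul_nonpos_left this (exp_pos _)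
  have : (v x - u x) ^ 2 = 0 := by
    have h2 := sq_nonneg (v x - u x)
    have h3 := sq_nonneg (deriv v x - deriv u x)
    simp only [hD] at hDx; linarith
  exact sub_eq_zero.1 (pow_eq_zero_iff two_ne_zero |>.1 this)

end Saddle

lemma IsOrbit.comp_reflect (h : IsOrbit I κ W μ v) (c : ℝ) :
    IsOrbit I κ W μ (fun x => v (c - x)) := by
  have h1 : deriv (fun x => v (c - x)) = fun x => -deriv v (c - x) := by
    funext x; exact deriv_comp_const_sub ..
  have h2 : deriv (fun x => -deriv v (c - x)) = fun x => deriv (deriv v) (c - x) := by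
    funext x
    rw [deriv.fun_neg, deriv_comp_const_sub, neg_neg]
  refine ⟨h.smooth.comp (contDiff_const.sub contDiff_id), fun x => h.mem _, fun x => ?_, fun x => ?_⟩
  · rw [h1]; simpa using h.energy (c - x)
  · rw [h1, h2]; simpa using h.eulerLagrange (c - x)

lemma IsOrbit.comp_add (h : IsOrbit I κ W μ v) (c : ℝ) : IsOrbit I κ W μ (fun x => v (x + c)) := by
  have h1 : deriv (fun x => v (x + c)) = fun x => deriv v (x + c) := by
    funext x; exact deriv_comp_add_const ..
  have h2 : deriv (fun x => deriv v (x + c)) = fun x => deriv (deriv v) (x + c) := by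
    funext x; exact deriv_comp_add_const ..
  refine ⟨h.smooth.comp (contDiff_id.add contDiff_const), fun x => h.mem _, fun x => ?_, fun x => ?_⟩
  · rw [h1]; exact h.energy (x + c)
  · rw [h1, h2]; exact h.eulerLagrange (x + c)

/-- Orbits are symmetric about their critical points. -/
lemma Saddle.orbit_symm (h : Saddle I κ W vs) (hv : IsOrbit I κ W μ v) {x₀ : ℝ}
    (h0 : deriv v x₀ = 0) (x : ℝ) : v (2 * x₀ - x) = v x := by
  have := h.orbit_unique (hv.comp_reflect (2 * x₀)) hv (x₀ := x₀) (by ring_nf) (by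
    rw [deriv_comp_const_sub]
    rw [show 2 * x₀ - x₀ = x₀ by ring, h0, neg_zero])
  exact congrFun this x

lemma deriv_orbit_symm {x₀ : ℝ} (h : ∀ x, v (2 * x₀ - x) = v x) (x : ℝ) :
    deriv v (2 * x₀ - x) = -deriv v x := by
  have h1 : deriv (fun x => v (2 * x₀ - x)) x = -deriv v (2 * x₀ - x) := deriv_comp_const_sub ..
  rw [show (fun x => v (2 * x₀ - x)) = v from funext h] at h1; linarith

end

end

section

section

variable {I : Set ℝ} {κ W : ℝ → ℝ} {vs vr : ℝ}

lemma le_sub_of_deriv_ge {φ : ℝ → ℝ} {a b m : ℝ} (hI : IsOpen I) (hφ : ContDiffOn ℝ ∞ φ I)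
    (hab : Icc a b ⊆ I) (h : ∀ t ∈ Icc a b, m ≤ deriv φ t) (hle : a ≤ b) :
    m * (b - a) ≤ φ b - φ a :=
  (convex_Icc a b).mul_sub_le_image_sub_of_le_deriv (hφ.continuousOn.mono hab)
    (fun x hx => (hasDerivAt_of_contDiffOn hI hφ (by simp)
      (hab (interior_subset hx))).differentiableAt.differentiableWithinAt)
    (fun x hx => h x (interior_subset hx)) a (left_mem_Icc.2 hle) b (right_mem_Icc.2 hle) hle

namespace Well

variable (h : Well I κ W vs vr)

include h

lemma exists_slope : ∃ η > 0, ∃ m > 0, vs < vr - η ∧ Icc (vr - η) (vr + η) ⊆ I ∧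
    ∀ v ∈ Icc (vr - η) (vr + η), m ≤ deriv W v := by
  have hc : ContinuousAt (deriv W) vr :=
    (contDiffOn_deriv h.isOpen h.smooth_W).continuousOn.continuousAt (h.isOpen.mem_nhds h.mem_r)
  have hev : ∀ᶠ v in 𝓝 vr, deriv W vr / 2 < deriv W v ∧ v ∈ I ∧ vs < v :=
    (hc.eventually (lt_mem_nhds (half_lt_self h.slope))).and
      ((h.isOpen.eventually_mem h.mem_r).and (lt_mem_nhds h.lt))
  obtain ⟨r, hr, hr'⟩ := Metric.eventually_nhds_iff.1 hev
  have key : ∀ v ∈ Icc (vr - r / 2) (vr + r / 2), deriv W vr / 2 < deriv W v ∧ v ∈ I ∧ vs < v :=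
    fun v hv => hr' (by rw [Real.dist_eq, abs_lt]; constructor <;> linarith [hv.1, hv.2])
  refine ⟨r / 2, by positivity, deriv W vr / 2, half_pos h.slope, ?_, fun v hv => (key v hv).2.1,
    fun v hv => (key v hv).1.le⟩
  exact (key (vr - r / 2) ⟨le_rfl, by linarith⟩).2.2

lemma exists_depth {η : ℝ} (hη : 0 < η) (hη' : vs < vr - η) :
    ∃ c > 0, ∀ v ∈ Icc vs (vr - η), c * (v - vs) ^ 2 ≤ W vs - W v := by
  have hIcc : Icc vs vr ⊆ I := h.ordConnected.out h.mem h.mem_r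
  have hW' := contDiffOn_deriv h.isOpen h.smooth_W
  have hc : ContinuousAt (deriv (deriv W)) vs :=
    (contDiffOn_deriv h.isOpen hW').continuousOn.continuousAt (h.isOpen.mem_nhds h.mem)
  set c0 := -deriv (deriv W) vs / 2 with hc0
  have hc₀' : 0 < c0 := by have := h.neg; rw [hc0]; linarith
  have hev : ∀ᶠ v in 𝓝 vs, deriv (deriv W) v < -c0 ∧ v < vr - η :=
    (hc.eventually (gt_mem_nhds (by rw [hc0]; linarith [h.neg]))).and (gt_mem_nhds hη')
  obtain ⟨r, hr, hr'⟩ := Metric.eventually_nhds_iff.1 hev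
  set δ := r / 2 with hδ
  have hδ0 : 0 < δ := by positivity
  have key : ∀ v ∈ Icc vs (vs + δ), deriv (deriv W) v < -c0 ∧ v < vr - η :=
    fun v hv => hr' (by rw [Real.dist_eq, abs_lt]; constructor <;> linarith [hv.1, hv.2])
  have hδr : vs + δ < vr - η := (key _ ⟨by linarith, le_rfl⟩).2
  have hsub : Icc vs (vs + δ) ⊆ I := (Icc_subset_Icc le_rfl (by linarith)).trans hIcc
  have hslope : ∀ v ∈ Icc vs (vs + δ), deriv W v ≤ -c0 * (v - vs) := fun v hv => by
    have hs : Icc vs v ⊆ Icc vs (vs + δ) := Icc_subset_Icc le_rfl hv.2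
    have hd : ∀ t ∈ I, deriv (fun v => -deriv W v) t = -deriv (deriv W) t := fun t _ => deriv.fun_neg
    have := le_sub_of_deriv_ge h.isOpen hW'.neg (hs.trans hsub) (m := c0) (fun t ht => by
      rw [hd t (hsub (hs ht))]
      linarith [(key t (hs ht)).1]) hv.1
    simp only [Pi.neg_apply, h.crit] at this; linarith
  have hnear : ∀ v ∈ Icc vs (vs + δ), c0 / 2 * (v - vs) ^ 2 ≤ W vs - W v := fun v hv => by
    have hs : Icc vs v ⊆ Icc vs (vs + δ) := Icc_subset_Icc le_rfl hv.2
    have hg := le_gronwall (f := fun v => W vs - W v - c0 / 2 * (v - vs) ^ 2)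
      (f' := fun v => -deriv W v - c0 * (v - vs)) (G := fun _ => 0) (g := fun _ => 0) hv.1
      (fun t ht => by
        have h1 := (hasDerivAt_of_contDiffOn h.isOpen h.smooth_W (by simp)
          (hsub (hs ht))).const_sub (W vs)
        have h2 := (((hasDerivAt_id t).sub_const vs).pow 2).const_mul (c0 / 2)
        refine HasDerivAt.congr_deriv (f := fun v => W vs - W v - c0 / 2 * (v - vs) ^ 2)
          (h1.sub h2) ?_
        simp; ring)
      (fun t _ => hasDerivAt_const t 0) (fun t ht => by
        have := hslope t (hs ht); simp only [zero_mul]; linarith)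
    simp only [sub_self, Real.exp_zero] at hg; linarith
  have hfar : ∃ c > 0, ∀ v ∈ Icc (vs + δ) (vr - η), c ≤ W vs - W v := by
    obtain ⟨x, hx, hmin⟩ := (isCompact_Icc (a := vs + δ) (b := vr - η)).exists_isMinOn
      ⟨_, left_mem_Icc.2 hδr.le⟩ (f := fun v => W vs - W v)
      (continuousOn_const.sub (h.smooth_W.continuousOn.mono
        ((Icc_subset_Icc (by linarith) (by linarith)).trans hIcc)))
    refine ⟨W vs - W x, ?_, fun v hv => hmin hv⟩
    have := h.below x ⟨by linarith [hx.1], by linarith [hx.2]⟩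
    linarith
  obtain ⟨c1, hc1, hfar⟩ := hfar
  have hd : 0 < vr - vs := by linarith [h.lt]
  refine ⟨min (c0 / 2) (c1 / (vr - vs) ^ 2), by positivity, fun v hv => ?_⟩
  rcases le_total v (vs + δ) with hle | hle
  · refine le_trans ?_ (hnear v ⟨hv.1, hle⟩)
    gcongr; exact min_le_left _ _
  · refine le_trans ?_ (hfar v ⟨hle, hv.2⟩)
    calc _ ≤ c1 / (vr - vs) ^ 2 * (vr - vs) ^ 2 := by
          gcongr
          · exact min_le_right _ _
          · linarith [hv.1]
          · linarith [hv.2]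
      _ = c1 := by field_simp

end Well

/-- Uniform bounds for the orbits in a well with energy slightly above the saddle level. -/
structure WellBounds (I : Set ℝ) (κ W : ℝ → ℝ) (vs vr vm V C1 C2 m : ℝ) : Prop where
  lt : vr < vm
  sub : Icc vs vm ⊆ I
  V_nonneg : 0 ≤ V
  C₁_nonneg : 0 ≤ C1
  C₂_nonneg : 0 ≤ C2
  m_pos : 0 < m
  rise : ∀ v ∈ Icc vr vm, m * (v - vr) ≤ W v - W vs
  slope : ∀ v p e : ℝ, v ∈ Icc vs vm → e ≤ 1 → 1 / 2 * κ v * p ^ 2 + W v = W vs + e → |p| ≤ V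
  drift : ∀ v p e : ℝ, v ∈ Icc vs vm → 0 ≤ e → e ≤ 1 → 0 ≤ p →
    1 / 2 * κ v * p ^ 2 + W v = W vs + e → (v - vs) + p ≤ C1 * p - C2 * acc κ W v p
  slope_le : ∀ v p : ℝ, v ∈ Icc vs vm → 1 / 2 * κ v * p ^ 2 + W v = W vs → |p| ≤ C1 * (v - vs)

set_option maxHeartbeats 800000 in
lemma Well.exists_bounds (h : Well I κ W vs vr) :
    ∃ vm V C1 C2 m, WellBounds I κ W vs vr vm V C1 C2 m := by
  obtain ⟨η, hη, m, hm, hsη, hIη, hmW⟩ := h.exists_slope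
  obtain ⟨c, hc, hdepth⟩ := h.exists_depth hη hsη
  set vm := vr + η with hvm
  have hmem : vm ∈ I := hIη ⟨by linarith, le_rfl⟩
  have hsub : Icc vs vm ⊆ I := h.ordConnected.out h.mem hmem
  have hlt := h.lt
  have hs : vs ∈ Icc vs vm := ⟨le_rfl, by linarith⟩
  obtain ⟨k1, hk1, hκ1⟩ := exists_bound_of_contDiffOn h.smooth_κ hsub
  obtain ⟨k0, hk0, hκ0⟩ : ∃ k > 0, ∀ v ∈ Icc vs vm, k ≤ κ v := by
    obtain ⟨x, hx, hmin⟩ := (isCompact_Icc (a := vs) (b := vm)).exists_isMinOn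
      ⟨vs, hs⟩ (h.smooth_κ.continuousOn.mono hsub)
    exact ⟨κ x, h.pos _ (hsub hx), fun v hv => hmin hv⟩
  obtain ⟨w, hw, hWb⟩ := exists_bound_of_contDiffOn h.smooth_W hsub
  obtain ⟨L, hL, hWq⟩ := exists_lipschitz_critical h.isOpen h.smooth_W hsub hs h.crit
  obtain ⟨a0, ha0, hacc₀⟩ := exists_lipschitz h.isOpen h.smooth_acc₀ hsub
  obtain ⟨a1, ha1, hacc₁⟩ := exists_bound_of_contDiffOn h.smooth_acc₁ hsub
  set V := 2 * (2 * w + 1) / k0 + 1 with hV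
  have hV0 : 0 ≤ V := by positivity
  have hslope : ∀ v p e : ℝ, v ∈ Icc vs vm → e ≤ 1 → 1 / 2 * κ v * p ^ 2 + W v = W vs + e →
      |p| ≤ V := fun v p e hv he hE => by
    have h1 := hκ0 v hv
    have h2 := abs_le.1 (hWb v hv)
    have h3 := abs_le.1 (hWb vs hs)
    have h4 : p ^ 2 ≤ 2 * (2 * w + 1) / k0 := by
      rw [le_div_iff₀ hk0]; nlinarith [mul_le_mul_of_nonneg_right h1 (sq_nonneg p)]
    have h5 : |p| ^ 2 ≤ V - 1 := by rw [sq_abs, hV]; linarith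
    nlinarith [sq_nonneg (|p| - 1), abs_nonneg p]
  set b := Real.sqrt (2 * c / k1) with hb
  have hb0 : 0 < b := Real.sqrt_pos.2 (by positivity)
  have hb2 : b ^ 2 = 2 * c / k1 := Real.sq_sqrt (by positivity)
  set m1 := m / k1 with hm1
  have hm₁0 : 0 < m1 := by positivity
  set C2 := (vm - vs) / m1 with hC2
  have hC₂0 : 0 ≤ C2 := div_nonneg (by linarith) hm₁0.le
  set C3 := a0 / b + a1 * V with hC3
  have hC₃0 : 0 ≤ C3 := by positivity
  set C1 := (1 / b + 1 + C2 * C3) + 2 * L / k0 + 1 with hC1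
  have hC₁0 : 0 ≤ C1 := by positivity
  have hF0 : -deriv W vs / κ vs = 0 := by simp [h.crit]
  refine ⟨vm, V, C1, C2, m, ⟨by linarith, hsub, hV0, hC₁0, hC₂0, hm, ?_, hslope, ?_, ?_⟩⟩
  · intro v hv
    have := le_sub_of_deriv_ge h.isOpen h.smooth_W
      ((Icc_subset_Icc (by linarith) hv.2).trans hIη) (m := m)
      (fun t ht => hmW t ⟨by linarith [ht.1], by linarith [ht.2, hv.2]⟩) hv.1
    rwa [h.level] at this
  · intro v p e hv he0 he1 hp hE
    have hpV := hslope v p e hv he1 hE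
    rw [abs_of_nonneg hp] at hpV
    have hk := hκ0 v hv
    have hk' := (le_abs_self _).trans (hκ1 v hv)
    have hkpos := hk0.trans_le hk
    have h1 : |-deriv κ v / (2 * κ v) * p ^ 2| ≤ a1 * V * p := by
      rw [abs_mul, abs_of_nonneg (sq_nonneg p), sq, mul_assoc]
      gcongr; exact hacc₁ v hv
    have hbp : 0 ≤ 1 / b * p := by positivity
    have hLp : 0 ≤ 2 * L / k0 * p := by positivity
    have hsplit : C1 * p = 1 / b * p + p + C2 * (C3 * p) + 2 * L / k0 * p + p := by rw [hC1]; ring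
    rcases le_total v (vr - η) with hvη | hvη
    · have h2 : (b * (v - vs)) ^ 2 ≤ p ^ 2 := by
        have h3 := hdepth v ⟨hv.1, hvη⟩
        have h4 : k1 * p ^ 2 ≥ 2 * (c * (v - vs) ^ 2) := by
          nlinarith [mul_le_mul_of_nonneg_right hk' (sq_nonneg p)]
        rw [mul_pow, hb2]
        rw [div_mul_eq_mul_div, div_le_iff₀ hk1]; linarith
      have h3 : v - vs ≤ 1 / b * p := by
        rw [one_div, ← div_eq_inv_mul, le_div_iff₀ hb0, mul_comm]
        exact (sq_le_sq₀ (mul_nonneg hb0.le (by linarith [hv.1])) hp).1 h2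
      have h4 : |acc κ W v p| ≤ C3 * p := by
        rw [acc]
        have h5 := hacc₀ v hv vs hs
        rw [hF0, sub_zero, abs_of_nonneg (by linarith [hv.1] : 0 ≤ v - vs)] at h5
        calc _ ≤ _ := abs_add_le _ _
          _ ≤ a0 * (1 / b * p) + a1 * V * p := by
              gcongr; exact h5.trans (by gcongr)
          _ = C3 * p := by rw [hC3]; ring
      have h5 := mul_le_mul_of_nonneg_left ((le_abs_self _).trans h4) hC₂0
      linarith
    · have h2 := hmW v ⟨hvη, hv.2⟩
      have h3 : -deriv W v / κ v ≤ -m1 := by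
        rw [hm1, neg_div, neg_le_neg_iff]; exact div_le_div₀ (hm.le.trans h2) h2 hkpos hk'
      have h4 : acc κ W v p ≤ -m1 + C3 * p := by
        rw [acc]
        have := (le_abs_self _).trans h1
        have : 0 ≤ a0 / b * p := by positivity
        rw [hC3]; linarith
      have h5 := mul_le_mul_of_nonneg_left h4 hC₂0
      have h6 : C2 * m1 = vm - vs := by rw [hC2]; field_simp
      rw [mul_add, mul_neg, h6] at h5; linarith [hv.2]
  · intro v p hv hE
    have hk := hκ0 v hv
    have h1 := hWq v hv vs hs
    have hvs : 0 ≤ v - vs := by linarith [hv.1]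
    rw [sub_self, abs_zero, add_zero, abs_of_nonneg hvs] at h1
    have h2 := neg_abs_le (W v - W vs)
    have h3 : p ^ 2 ≤ 2 * L / k0 * (v - vs) ^ 2 := by
      rw [div_mul_eq_mul_div, le_div_iff₀ hk0]
      nlinarith [mul_le_mul_of_nonneg_right hk (sq_nonneg p)]
    have h4 : 2 * L / k0 ≤ C1 ^ 2 := by
      have : 0 ≤ 1 / b + 1 + C2 * C3 := by positivity
      have h6 : 0 ≤ 2 * L / k0 := by positivity
      have h7 : 2 * L / k0 + 1 ≤ C1 := by rw [hC1]; linarith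
      have h8 : ∀ x : ℝ, 0 ≤ x → x ≤ (x + 1) ^ 2 := fun x hx => by nlinarith
      exact (h8 _ h6).trans (pow_le_pow_left₀ (by positivity) h7 2)
    have h5 : |p| ^ 2 ≤ (C1 * (v - vs)) ^ 2 := by
      rw [sq_abs, mul_pow]; exact h3.trans (mul_le_mul_of_nonneg_right h4 (sq_nonneg _))
    exact (sq_le_sq₀ (abs_nonneg _) (mul_nonneg hC₁0 hvs)).1 h5

end

end

section

section

variable {I : Set ℝ} {κ W : ℝ → ℝ} {vs vr vm V C1 C2 m : ℝ}
local notation "rate" => saddleRate κ W vs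

lemma add_le_rate_mul {α a p : ℝ} (hα : 0 < α) (ha : 0 ≤ a) (hp : 0 ≤ p) :
    a + p ≤ (1 + 1 / α) * (p + α * a) := by
  have e : (1 + 1 / α) * (p + α * a) = p + 1 / α * p + α * a + a := by field_simp; ring
  have : 0 ≤ 1 / α * p := by positivity
  have : 0 ≤ α * a := by positivity
  linarith

namespace WellBounds

variable (h : Well I κ W vs vr) (hb : WellBounds I κ W vs vr vm V C1 C2 m)

include h hb

lemma vs_mem : vs ∈ Icc vs vm := ⟨le_rfl, (h.lt.trans hb.lt).le⟩

lemma acc_saddle : acc κ W vs 0 = 0 := by simp [acc, h.crit]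

lemma drift_nonneg : 0 ≤ C1 * (vm - vs) + C2 * V := by
  have := hb.C₁_nonneg; have := hb.C₂_nonneg; have := hb.V_nonneg
  have : 0 ≤ vm - vs := by linarith [hb.lt, h.lt]
  positivity

lemma orbit_drift {e a b : ℝ} {v : ℝ → ℝ} (he0 : 0 ≤ e) (he1 : e ≤ 1)
    (hv : IsOrbit I κ W (W vs + e) v) (hab : a ≤ b)
    (hx : ∀ x ∈ Icc a b, v x ∈ Icc vs vm ∧ 0 ≤ deriv v x) :
    (∀ x, HasDerivAt (fun x => C1 * v x - C2 * deriv v x)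
      (C1 * deriv v x - C2 * deriv (deriv v) x) x) ∧
    (∀ x ∈ Icc a b, |v x - vs| + |deriv v x| ≤ C1 * deriv v x - C2 * deriv (deriv v) x) ∧
    (C1 * v b - C2 * deriv v b) - (C1 * v a - C2 * deriv v a) ≤ C1 * (vm - vs) + C2 * V := by
  refine ⟨fun x => ((hv.hasDerivAt x).const_mul C1).sub ((hv.hasDerivAt_deriv x).const_mul C2),
    fun x hx' => ?_, ?_⟩
  · obtain ⟨h1, h2⟩ := hx x hx'
    rw [abs_of_nonneg (sub_nonneg.2 h1.1), abs_of_nonneg h2, hv.deriv_deriv h.pos]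
    exact hb.drift _ _ e h1 he0 he1 h2 (hv.energy x)
  · obtain ⟨ha1, ha2⟩ := hx a (left_mem_Icc.2 hab)
    obtain ⟨hb1, hb2⟩ := hx b (right_mem_Icc.2 hab)
    have hVa := (le_abs_self _).trans (hb.slope _ _ e ha1 he1 (hv.energy a))
    have e1 := mul_le_mul_of_nonneg_left (by linarith [hb1.2, ha1.1] : v b - v a ≤ vm - vs)
      hb.C₁_nonneg
    have e2 := mul_le_mul_of_nonneg_left (by linarith : deriv v a - deriv v b ≤ V) hb.C₂_nonneg
    linarith

/-- Growth of orbits leaving the saddle. -/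
lemma exists_growth : ∃ C ≥ 1, ∀ (e : ℝ) (v : ℝ → ℝ), 0 ≤ e → e ≤ 1 → IsOrbit I κ W (W vs + e) v →
    ∀ a b, a ≤ b → (∀ x ∈ Icc a b, v x ∈ Icc vs vm ∧ 0 ≤ deriv v x) →
    deriv v b + rate * (v b - vs) ≤
      C * (deriv v a + rate * (v a - vs)) * exp (rate * (b - a)) ∧
    (deriv v a + rate * (v a - vs)) * exp (rate * (b - a)) ≤
      C * (deriv v b + rate * (v b - vs)) := by
  obtain ⟨Cq, hCq, hq⟩ := h.acc_quadratic hb.sub (vs_mem h hb) hb.V_nonneg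
  have hα := h.rate_pos
  set α := rate with hαdef
  set k := Cq * (1 + 1 / α) with hk
  have hk0 : 0 < k := by positivity
  set T := C1 * (vm - vs) + C2 * V with hT
  have hT0 : 0 ≤ T := drift_nonneg h hb
  refine ⟨exp (k * T), Real.one_le_exp (by positivity), fun e v he0 he1 hv a b hab hx => ?_⟩
  set z : ℝ → ℝ := fun x => deriv v x + α * (v x - vs) with hz
  set z' : ℝ → ℝ := fun x => deriv (deriv v) x + α * deriv v x with hz'
  set Ω : ℝ → ℝ := fun x => C1 * v x - C2 * deriv v x with hΩ
  set Ω' : ℝ → ℝ := fun x => C1 * deriv v x - C2 * deriv (deriv v) x with hΩ'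
  have hzd : ∀ x, HasDerivAt z (z' x) x := fun x =>
    (hv.hasDerivAt_deriv x).add (((hv.hasDerivAt x).sub_const vs).const_mul α)
  obtain ⟨hΩd, hdr, hΩT⟩ := orbit_drift h hb he0 he1 hv hab hx
  have hle : ∀ x ∈ Icc a b, |z' x - α * z x| ≤ k * Ω' x * z x := by
    intro x hx'
    obtain ⟨h1, h2⟩ := hx x hx'
    have hVx := hb.slope _ _ e h1 he1 (hv.energy x)
    have hd := hdr x hx'
    have hqx := hq (v x) h1 vs (vs_mem h hb) (deriv v x) 0 hVx (by simpa using hb.V_nonneg)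
    rw [acc_saddle h hb, ← hv.deriv_deriv h.pos] at hqx
    simp only [sub_self, mul_zero, abs_zero, add_zero, sub_zero] at hqx
    have h3 : 0 ≤ v x - vs := by linarith [h1.1]
    rw [abs_of_nonneg h3, abs_of_nonneg h2] at hqx hd
    have e1 : z' x - α * z x = deriv (deriv v) x - α ^ 2 * (v x - vs) := by
      simp only [hz, hz']; ring
    have h4 : v x - vs + deriv v x ≤ (1 + 1 / α) * z x := add_le_rate_mul hα h3 h2
    have hz0 : 0 ≤ z x := by simp only [hz]; positivity
    rw [e1]
    calc _ ≤ _ := hqx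
      _ ≤ Cq * (C1 * deriv v x - C2 * deriv (deriv v) x) * ((1 + 1 / α) * z x) := by
          have : 0 ≤ C1 * deriv v x - C2 * deriv (deriv v) x := by linarith
          gcongr
      _ = k * Ω' x * z x := by simp only [hk, hΩ']; ring
  have hz0 : ∀ x ∈ Icc a b, 0 ≤ z x := fun x hx' => by
    obtain ⟨h1, h2⟩ := hx x hx'
    have : 0 ≤ v x - vs := by linarith [h1.1]
    simp only [hz]; positivity
  have hid : ∀ x, HasDerivAt (fun x => α * x) α x := fun x => by
    simpa using (hasDerivAt_id x).const_mul α
  constructor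
  · have := gronwall_le hab (fun x _ => hzd x) (fun x _ => (hid x).add ((hΩd x).const_mul k))
      (fun x hx' => by have := (le_abs_self _).trans (hle x hx'); linarith)
    refine this.trans ?_
    simp only [Pi.add_apply]
    rw [show α * b + k * Ω b - (α * a + k * Ω a) = k * (Ω b - Ω a) + α * (b - a) by ring,
      exp_add, ← mul_assoc, mul_comm (exp (k * T))]
    have := hz0 a (left_mem_Icc.2 hab)
    change z a * _ * _ ≤ z a * _ * _; gcongr
  · have := le_gronwall hab (fun x _ => hzd x) (fun x _ => (hid x).sub ((hΩd x).const_mul k))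
      (fun x hx' => by have := (neg_abs_le _).trans' (neg_le_neg (hle x hx')); linarith)
    simp only [Pi.sub_apply] at this
    rw [show α * b - k * Ω b - (α * a - k * Ω a) = α * (b - a) - k * (Ω b - Ω a) by ring,
      sub_eq_add_neg, exp_add, ← mul_assoc] at this
    have h5 := mul_le_mul_of_nonneg_right this (exp_nonneg (k * (Ω b - Ω a)))
    rw [mul_assoc _ (exp (-_)), ← exp_add, neg_add_cancel, Real.exp_zero, mul_one] at h5
    refine h5.trans ?_
    rw [mul_comm]
    have := hz0 b (right_mem_Icc.2 hab)
    change _ * z b ≤ _ * z b; gcongr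

/-- Divergence of nearby orbits leaving the saddle. -/
lemma exists_comparison : ∃ C ≥ 1, ∀ (e f : ℝ) (v u : ℝ → ℝ), 0 ≤ e → e ≤ 1 → 0 ≤ f → f ≤ 1 →
    IsOrbit I κ W (W vs + e) v → IsOrbit I κ W (W vs + f) u →
    ∀ a b, a ≤ b → (∀ x ∈ Icc a b, v x ∈ Icc vs vm ∧ 0 ≤ deriv v x) →
    (∀ x ∈ Icc a b, u x ∈ Icc vs vm ∧ 0 ≤ deriv u x) →
    rate ^ 2 * (v a - u a) ^ 2 + (deriv v a - deriv u a) ^ 2 ≤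
      C * (rate ^ 2 * (v b - u b) ^ 2 + (deriv v b - deriv u b) ^ 2) *
        exp (2 * rate * (b - a)) := by
  obtain ⟨Cq, hCq, hq⟩ := h.acc_quadratic hb.sub (vs_mem h hb) hb.V_nonneg
  have hα := h.rate_pos
  set α := rate with hαdef
  set k := Cq * (2 + 1 / α) with hk
  have hk0 : 0 < k := by positivity
  set T := C1 * (vm - vs) + C2 * V with hT
  have hT0 : 0 ≤ T := drift_nonneg h hb
  refine ⟨exp (k * (T + T)), Real.one_le_exp (by positivity),
    fun e f v u he0 he1 hf0 hf1 hv hu a b hab hx hy => ?_⟩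
  set D : ℝ → ℝ := fun x => α ^ 2 * (v x - u x) ^ 2 + (deriv v x - deriv u x) ^ 2 with hD
  set D' : ℝ → ℝ := fun x => 2 * α ^ 2 * (v x - u x) * (deriv v x - deriv u x) +
    2 * (deriv v x - deriv u x) * (deriv (deriv v) x - deriv (deriv u) x) with hD'
  have hDd : ∀ x, HasDerivAt D (D' x) x := fun x => by
    have h1 := ((((hv.hasDerivAt x).sub (hu.hasDerivAt x)).pow 2).const_mul (α ^ 2)).add
      (((hv.hasDerivAt_deriv x).sub (hu.hasDerivAt_deriv x)).pow 2)
    refine HasDerivAt.congr_deriv (f := D) h1 ?_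
    simp only [hD']; norm_num; ring
  obtain ⟨v1, v2, v3⟩ := orbit_drift h hb he0 he1 hv hab hx
  obtain ⟨u1, u2, u3⟩ := orbit_drift h hb hf0 hf1 hu hab hy
  have hid : ∀ x, HasDerivAt (fun x => -(2 * α) * x) (-(2 * α)) x := fun x => by
    simpa using (hasDerivAt_id x).const_mul (-(2 * α))
  have key := le_gronwall hab (fun x _ => hDd x)
    (fun x _ => (hid x).sub (((v1 x).add (u1 x)).const_mul k)) (fun x hx' => by
      obtain ⟨hx1, -⟩ := hx x hx'
      obtain ⟨hy1, -⟩ := hy x hx'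
      have hVv := hb.slope _ _ e hx1 he1 (hv.energy x)
      have hVu := hb.slope _ _ f hy1 hf1 (hu.energy x)
      have hqx := hq (v x) hx1 (u x) hy1 _ _ hVv hVu
      rw [← hv.deriv_deriv h.pos, ← hu.deriv_deriv h.pos] at hqx
      have hw := add_le_add (v2 x hx') (u2 x hx')
      set w := C1 * deriv v x - C2 * deriv (deriv v) x + (C1 * deriv u x - C2 * deriv (deriv u) x)
      set δ := v x - u x with hδ
      set ρ := deriv v x - deriv u x with hρ
      set R := deriv (deriv v) x - α ^ 2 * (v x - vs) - (deriv (deriv u) x - α ^ 2 * (u x - vs))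
        with hR
      have hw0 : 0 ≤ w := le_trans (by positivity) hw
      have hR' : |R| ≤ Cq * w * (|δ| + |ρ|) := hqx.trans (by gcongr)
      have e1 : D' x = 4 * α ^ 2 * δ * ρ + 2 * ρ * R := by simp only [hD', hR, hδ, hρ]; ring
      have e2 : D x = α ^ 2 * |δ| ^ 2 + |ρ| ^ 2 := by simp only [hD, sq_abs, hδ, hρ]
      have q1 : -(2 * α * D x) ≤ 4 * α ^ 2 * δ * ρ := by
        have : D x = α ^ 2 * δ ^ 2 + ρ ^ 2 := by simp only [hD, hδ, hρ]
        rw [this]; nlinarith [mul_nonneg hα.le (sq_nonneg (α * δ + ρ))]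
      have q2 : |2 * ρ * R| ≤ k * w * D x := by
        rw [abs_mul, abs_mul, abs_two]
        calc 2 * |ρ| * |R| ≤ 2 * |ρ| * (Cq * w * (|δ| + |ρ|)) := by gcongr
          _ = Cq * w * (2 * |ρ| * |δ| + 2 * |ρ| ^ 2) := by ring
          _ ≤ Cq * w * ((2 + 1 / α) * D x) := by
              gcongr
              rw [e2]
              have : (2 + 1 / α) * (α ^ 2 * |δ| ^ 2 + |ρ| ^ 2) = 2 * α ^ 2 * |δ| ^ 2 + 2 * |ρ| ^ 2 +
                  (α * |δ| ^ 2 + 1 / α * |ρ| ^ 2) := by field_simp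
              rw [this]
              have h5 : 2 * |ρ| * |δ| ≤ α * |δ| ^ 2 + 1 / α * |ρ| ^ 2 := by
                have : α * |δ| ^ 2 + 1 / α * |ρ| ^ 2 - 2 * |ρ| * |δ| =
                    1 / α * (α * |δ| - |ρ|) ^ 2 := by field_simp; ring
                have : 0 ≤ 1 / α * (α * |δ| - |ρ|) ^ 2 := by positivity
                linarith
              have : 0 ≤ 2 * α ^ 2 * |δ| ^ 2 := by positivity
              linarith
          _ = k * w * D x := by rw [hk]; ring
      have q3 := neg_abs_le (2 * ρ * R)
      rw [e1]
      have e3 : (-(2 * α) - k * w) * D x = -(2 * α * D x) - k * w * D x := by ring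
      rw [e3]
      linarith)
  have hD0 : 0 ≤ D b := by simp only [hD]; positivity
  simp only [Pi.sub_apply, Pi.add_apply] at key
  set Δ := (C1 * v b - C2 * deriv v b + (C1 * u b - C2 * deriv u b)) -
    (C1 * v a - C2 * deriv v a + (C1 * u a - C2 * deriv u a)) with hΔ
  have hΔT : Δ ≤ T + T := by rw [hΔ]; linarith
  have e4 : -(2 * α) * b - k * (C1 * v b - C2 * deriv v b + (C1 * u b - C2 * deriv u b)) -
      (-(2 * α) * a - k * (C1 * v a - C2 * deriv v a + (C1 * u a - C2 * deriv u a))) =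
      -(2 * α * (b - a) + k * Δ) := by rw [hΔ]; ring
  rw [e4] at key
  have h5 := mul_le_mul_of_nonneg_right key (exp_nonneg (2 * α * (b - a) + k * Δ))
  rw [mul_assoc, ← exp_add, neg_add_cancel, Real.exp_zero, mul_one] at h5
  refine h5.trans ?_
  rw [add_comm, exp_add, ← mul_assoc]
  change D b * _ * _ ≤ _ * D b * _
  rw [mul_comm _ (D b)]; gcongr

lemma lt_of_energy {e : ℝ} {v : ℝ → ℝ} (he : e < m * (vm - vr))
    (hv : IsOrbit I κ W (W vs + e) v) {x₀ : ℝ} (h0 : v x₀ < vm) (x : ℝ) : v x < vm := by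
  by_contra hx
  obtain ⟨y, hy⟩ := mem_range_of_exists_le_of_exists_ge hv.continuous ⟨x₀, h0.le⟩ ⟨x, not_lt.1 hx⟩
  have h1 := hb.rise vm ⟨hb.lt.le, le_rfl⟩
  have h2 := hv.energy y
  have h3 : 0 ≤ 1 / 2 * κ (v y) * deriv v y ^ 2 := by
    have := (h.pos _ (hv.mem y)).le
    positivity
  rw [hy] at h2 h3; linarith

end WellBounds

/-- Soliton orbits, centred at their turning point `vr`. -/
structure IsHomoclinic (I : Set ℝ) (κ W : ℝ → ℝ) (vs vr : ℝ) (u : ℝ → ℝ) : Prop where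
  orbit : IsOrbit I κ W (W vs) u
  center : u 0 = vr
  top : Tendsto u atTop (𝓝 vs)
  bot : Tendsto u atBot (𝓝 vs)

namespace IsHomoclinic

variable {u : ℝ → ℝ} (h : Well I κ W vs vr) (hu : IsHomoclinic I κ W vs vr u)

include h hu

lemma deriv_zero : deriv u 0 = 0 := by
  have h1 := hu.orbit.energy 0
  rw [hu.center, h.level] at h1
  have h2 := h.pos _ h.mem_r
  have h3 : κ vr * deriv u 0 ^ 2 = 0 := by linarith
  simpa [h2.ne'] using h3

lemma even (x : ℝ) : u (-x) = u x := by
  simpa using h.orbit_symm hu.orbit (deriv_zero h hu) x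

lemma ne_saddle (x : ℝ) : u x ≠ vs := fun hx => by
  have h1 := hu.orbit.energy x
  rw [hx] at h1
  have h2 := h.pos _ h.mem
  have h3 : κ vs * deriv u x ^ 2 = 0 := by linarith
  have h4 : deriv u x = 0 := by simpa [h2.ne'] using h3
  have hc : IsOrbit I κ W (W vs) (fun _ => vs) :=
    ⟨contDiff_const, fun _ => h.mem, fun x => by simp, fun x => by simp [h.crit]⟩
  have h5 := h.orbit_unique hu.orbit hc (x₀ := x) hx (by rw [h4]; simp)
  have h6 := hu.center
  rw [h5] at h6; exact h.lt.ne h6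

lemma gt_saddle (x : ℝ) : vs < u x := by
  by_contra hx
  obtain ⟨y, hy⟩ := mem_range_of_exists_le_of_exists_ge hu.orbit.continuous ⟨x, not_lt.1 hx⟩
    ⟨0, by rw [hu.center]; exact h.lt.le⟩
  exact ne_saddle h hu y hy

lemma le_turning (hb : WellBounds I κ W vs vr vm V C1 C2 m) (x : ℝ) : u x ≤ vr := by
  by_contra hx
  obtain ⟨y, hy⟩ := mem_range_of_exists_le_of_exists_ge (c := min (u x) vm) hu.orbit.continuous
    ⟨0, by rw [hu.center]; exact le_min (not_le.1 hx).le hb.lt.le⟩ ⟨x, min_le_left _ _⟩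
  have h0 : vr < u y := by rw [hy]; exact lt_min (not_le.1 hx) hb.lt
  have h1 := hb.rise (u y) ⟨h0.le, by rw [hy]; exact min_le_right _ _⟩
  have h2 := hu.orbit.energy y
  have h3 : 0 ≤ 1 / 2 * κ (u y) * deriv u y ^ 2 := by
    have := (h.pos _ (hu.orbit.mem y)).le
    positivity
  have h4 : 0 < m * (u y - vr) := mul_pos hb.m_pos (by linarith)
  linarith

lemma deriv_pos (hb : WellBounds I κ W vs vr vm V C1 C2 m) {x : ℝ} (hx : x < 0) :
    0 < deriv u x := by
  have hne : ∀ y < 0, deriv u y ≠ 0 := fun y hy h0 => by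
    have h1 := hu.orbit.energy y
    rw [h0] at h1
    have h2 : u y = vr := by
      by_contra hne
      have := h.below (u y) ⟨gt_saddle h hu y, lt_of_le_of_ne (le_turning h hu hb y) hne⟩
      norm_num at h1; linarith
    have h3 := h.orbit_unique (hu.orbit.comp_add y) hu.orbit (x₀ := 0) (by
      simp only [zero_add]; rw [h2, hu.center]) (by
      rw [deriv_comp_add_const, zero_add, h0, deriv_zero h hu])
    have hper : Function.Periodic u y := fun t => congrFun h3 t
    have h4 : Tendsto (fun n : ℕ => u (n * y)) atTop (𝓝 vs) :=
      hu.bot.comp (tendsto_natCast_atTop_atTop.atTop_mul_const_of_neg hy)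
    have h5 : ∀ n : ℕ, u (n * y) = vr := fun n => by rw [hper.nat_mul_eq, hu.center]
    simp only [h5] at h4; exact h.lt.ne (tendsto_nhds_unique h4 tendsto_const_nhds)
  by_contra hneg
  have hx' : deriv u x < 0 := lt_of_le_of_ne (not_lt.1 hneg) (hne x hx)
  have hall : ∀ y < 0, deriv u y < 0 := fun y hy => by
    by_contra hy'
    obtain ⟨t, ht, ht'⟩ := isPreconnected_Iio.intermediate_value (f := deriv u) (mem_Iio.2 hx)
      (mem_Iio.2 hy) hu.orbit.continuous_deriv.continuousOn ⟨hx'.le, not_lt.1 hy'⟩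
    exact hne t ht ht'
  have hanti : AntitoneOn u (Iic 0) := by
    refine antitoneOn_of_deriv_nonpos (convex_Iic 0) hu.orbit.continuous.continuousOn
      (fun t _ => (hu.orbit.hasDerivAt t).differentiableAt.differentiableWithinAt) fun t ht => ?_
    rw [interior_Iic] at ht; exact (hall t ht).le
  have : vr ≤ vs := ge_of_tendsto hu.bot ((eventually_le_atBot (0 : ℝ)).mono fun t ht => by
    rw [← hu.center]; exact hanti ht self_mem_Iic ht)
  linarith [h.lt]

lemma leaving (hb : WellBounds I κ W vs vr vm V C1 C2 m) {x : ℝ} (hx : x ≤ 0) :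
    u x ∈ Icc vs vm ∧ 0 ≤ deriv u x := by
  refine ⟨⟨(gt_saddle h hu x).le, (le_turning h hu hb x).trans hb.lt.le⟩, ?_⟩
  rcases hx.eq_or_lt with rfl | hx
  · rw [deriv_zero h hu]
  · exact (deriv_pos h hu hb hx).le

lemma abs_deriv_even (x : ℝ) : |deriv u (-x)| = |deriv u x| := by
  have := deriv_orbit_symm (v := u) (x₀ := 0) (by simpa using even h hu) x
  simp only [mul_zero, zero_sub] at this
  rw [this, abs_neg]

/-- Two-sided exponential estimate for solitons. -/
lemma exists_decay (hb : WellBounds I κ W vs vr vm V C1 C2 m) : ∃ C > 0, ∀ x : ℝ,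
    |u x - vs| + |deriv u x| ≤ C * exp (-rate * |x|) ∧
    exp (-rate * |x|) ≤ C * |u x - vs| := by
  obtain ⟨C, hC1, hC⟩ := hb.exists_growth h
  have hα := h.rate_pos
  set α := rate with hαdef
  have hd : 0 < vr - vs := by linarith [h.lt]
  have hneg : ∀ x ≤ 0, |u x - vs| + |deriv u x| ≤
      ((1 + 1 / α) * (C * (α * (vr - vs)))) * exp (α * x) ∧
      exp (α * x) ≤ (C * (C1 + α) / (α * (vr - vs))) * |u x - vs| := by
    intro x hx
    obtain ⟨h1, h2⟩ := leaving h hu hb hx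
    have horb : IsOrbit I κ W (W vs + 0) u := by rw [add_zero]; exact hu.orbit
    obtain ⟨g1, g2⟩ := hC 0 u le_rfl zero_le_one horb x 0 hx fun t ht => leaving h hu hb ht.2
    rw [deriv_zero h hu, hu.center, zero_add, zero_sub] at g1 g2
    have hvs : 0 ≤ u x - vs := by linarith [h1.1]
    rw [abs_of_nonneg hvs, abs_of_nonneg h2]
    have hE : exp (α * -x) * exp (α * x) = 1 := by rw [← exp_add]; simp
    constructor
    · have h3 := mul_le_mul_of_nonneg_right g2 (exp_nonneg (α * x))
      rw [mul_assoc, hE, mul_one] at h3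
      have h4 := add_le_rate_mul hα hvs h2
      calc _ ≤ _ := h4
        _ ≤ (1 + 1 / α) * (C * (α * (vr - vs)) * exp (α * x)) := by gcongr
        _ = _ := by ring
    · have h3 := mul_le_mul_of_nonneg_right g1 (exp_nonneg (α * x))
      rw [mul_assoc _ (exp _), hE, mul_one] at h3
      have h4 := (le_abs_self _).trans (hb.slope_le (u x) (deriv u x) h1 (hu.orbit.energy x))
      rw [div_mul_eq_mul_div, le_div_iff₀ (by positivity), mul_comm]
      calc _ ≤ C * (deriv u x + α * (u x - vs)) := h3
        _ ≤ C * (C1 * (u x - vs) + α * (u x - vs)) := by gcongr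
        _ = _ := by ring
  set K := (1 + 1 / α) * (C * (α * (vr - vs))) with hK
  set K' := C * (C1 + α) / (α * (vr - vs)) with hK'
  have hK0 : 0 < K := by positivity
  have hK'0 : 0 < K' := by have := hb.C₁_nonneg; positivity
  have habs : ∀ x : ℝ, |u x - vs| + |deriv u x| = |u (-|x|) - vs| + |deriv u (-|x|)| ∧
      |u x - vs| = |u (-|x|) - vs| := by
    intro x
    rcases abs_cases x with ⟨h1, -⟩ | ⟨h1, -⟩ <;> rw [h1]
    · rw [even h hu, abs_deriv_even h hu]; exact ⟨rfl, rfl⟩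
    · rw [neg_neg]; exact ⟨rfl, rfl⟩
  refine ⟨K + K', by positivity, fun x => ?_⟩
  obtain ⟨h1, h2⟩ := hneg (-|x|) (by simp)
  rw [(habs x).1, (habs x).2, neg_mul, ← mul_neg]
  constructor
  · refine h1.trans ?_
    gcongr; linarith
  · refine h2.trans ?_
    gcongr; linarith

end IsHomoclinic

end

end

section

section

variable {I : Set ℝ} {κ W : ℝ → ℝ} {vs vr vm V C1 C2 m : ℝ}
local notation "rate" => saddleRate κ W vs

/-- One half of a two-pulse orbit: it leaves the saddle value upwards and reaches its first
turning point at `X`. -/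
structure IsHalfPulse (I : Set ℝ) (κ W : ℝ → ℝ) (vs ε : ℝ) (v : ℝ → ℝ) (X : ℝ) : Prop where
  orbit : IsOrbit I κ W (W vs + ε ^ 2) v
  value_zero : v 0 = vs
  slope_zero : 0 < deriv v 0
  first : IsLeast {x : ℝ | 0 < x ∧ deriv v x = 0} X

namespace IsHalfPulse

variable {ε X : ℝ} {v u : ℝ → ℝ} (hv : IsHalfPulse I κ W vs ε v X)

include hv

lemma pos : 0 < X := hv.first.1.1

lemma deriv_end : deriv v X = 0 := hv.first.1.2

lemma deriv_nonneg {x : ℝ} (hx : x ∈ Icc 0 X) : 0 ≤ deriv v x := by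
  by_contra hneg
  obtain ⟨t, ht, ht'⟩ := intermediate_value_Icc' hx.1 hv.orbit.continuous_deriv.continuousOn
    ⟨(not_le.1 hneg).le, hv.slope_zero.le⟩
  have h0 : 0 < t := lt_of_le_of_ne ht.1 fun h => by
    subst h; exact hv.slope_zero.ne' ht'
  have h1 := hv.first.2 ⟨h0, ht'⟩
  have h2 : x = X := le_antisymm hx.2 (h1.trans ht.2)
  rw [h2, hv.deriv_end] at hneg; exact hneg le_rfl

lemma monotoneOn : MonotoneOn v (Icc 0 X) :=
  monotoneOn_of_deriv_nonneg (convex_Icc _ _) hv.orbit.continuous.continuousOn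
    (fun t _ => (hv.orbit.hasDerivAt t).differentiableAt.differentiableWithinAt)
    fun _ ht => hv.deriv_nonneg (interior_subset ht)

variable (h : Well I κ W vs vr) (hb : WellBounds I κ W vs vr vm V C1 C2 m)

include h

lemma symm (x : ℝ) : v (2 * X - x) = v x := h.orbit_symm hv.orbit hv.deriv_end x

lemma deriv_symm (x : ℝ) : deriv v (2 * X - x) = -deriv v x := deriv_orbit_symm (hv.symm h) x

include hb

lemma leaving (he : ε ^ 2 < m * (vm - vr)) {x : ℝ} (hx : x ∈ Icc 0 X) :
    v x ∈ Icc vs vm ∧ 0 ≤ deriv v x := by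
  refine ⟨⟨?_, ?_⟩, hv.deriv_nonneg hx⟩
  · rw [← hv.value_zero]; exact hv.monotoneOn (left_mem_Icc.2 hv.pos.le) hx hx.1
  · exact (hb.lt_of_energy h he hv.orbit (x₀ := 0) (by
      rw [hv.value_zero]; exact h.lt.trans hb.lt) x).le

lemma turning (hε : ε ≠ 0) (he : ε ^ 2 < m * (vm - vr)) : vr ≤ v X ∧ m * (v X - vr) ≤ ε ^ 2 := by
  obtain ⟨h1, -⟩ := hv.leaving h hb he (right_mem_Icc.2 hv.pos.le)
  have h2 := hv.orbit.energy X
  rw [hv.deriv_end] at h2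
  have h3 : 0 < ε ^ 2 := by positivity
  have h4 : vr ≤ v X := by
    by_contra hlt
    rcases h1.1.eq_or_lt with h5 | h5
    · rw [← h5] at h2; linarith
    · have := h.below _ ⟨h5, not_le.1 hlt⟩
      linarith
  have := hb.rise _ ⟨h4, h1.2⟩
  exact ⟨h4, by linarith⟩

end IsHalfPulse

set_option maxHeartbeats 800000 in
/-- Estimates for one half of the two-pulse orbit, and its distance to the soliton. -/
lemma Well.exists_halfPulse_estimates (h : Well I κ W vs vr) {u : ℝ → ℝ}
    (hu : IsHomoclinic I κ W vs vr u) : ∃ vm C ε₀ : ℝ, 0 < C ∧ 0 < ε₀ ∧ Icc vs vm ⊆ I ∧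
      (∀ y, u y ∈ Icc vs vm) ∧
      (∀ y, |u y - vs| + |deriv u y| ≤ C * exp (-rate * |y|)) ∧
      (∀ y, exp (-rate * |y|) ≤ C * |u y - vs|) ∧
      ∀ ε X : ℝ, ∀ v : ℝ → ℝ, 0 < ε → ε < ε₀ → IsHalfPulse I κ W vs ε v X →
        ε ≤ C * exp (-rate * X) ∧
        exp (-rate * X) ≤ C * ε ∧
        ∀ y ∈ Icc (-X) X, v (y + X) ∈ Icc vs vm ∧
          |v (y + X) - vs| + |deriv v (y + X)| ≤ C * exp (-rate * |y|) ∧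
          |v (y + X) - u y| + |deriv v (y + X) - deriv u y| ≤
            C * exp (-rate * (2 * X - |y|)) := by
  obtain ⟨vm, V, C1, C2, m, hb⟩ := h.exists_bounds
  obtain ⟨Cd, hCd, hd⟩ := IsHomoclinic.exists_decay h hu hb
  obtain ⟨Cg, hCg, hg⟩ := hb.exists_growth h
  obtain ⟨Cc, hCc, hc⟩ := hb.exists_comparison h
  have hα := h.rate_pos
  set α := rate with hαdef
  have hκ := h.pos _ h.mem
  have hm := hb.m_pos
  set L := vm - vs with hL
  have hLr : vr - vs ≤ L := by rw [hL]; linarith [hb.lt]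
  have hr0 : 0 < vr - vs := by linarith [h.lt]
  have hL0 : 0 < L := by linarith
  set s := Real.sqrt (κ vs / 2) with hs
  have hs0 : 0 < s := Real.sqrt_pos.2 (by positivity)
  have hs2 : s ^ 2 = κ vs / 2 := Real.sq_sqrt (by positivity)
  set A1 := s * (Cg * (α * L)) with hA1
  set A2 := Cg / (s * (α * (vr - vs))) with hA2
  set A3 := (1 + 1 / α) * (Cg * (α * L)) with hA3
  set A4 := (1 + 1 / α) * (Cc * α * (A1 ^ 2 / m)) with hA4
  have hA₁0 : 0 < A1 := by positivity
  have hA₂0 : 0 < A2 := by positivity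
  have hA₃0 : 0 < A3 := by positivity
  have hA₄0 : 0 < A4 := by positivity
  have hgap : 0 < m * (vm - vr) := mul_pos hm (by linarith [hb.lt])
  refine ⟨vm, Cd + A1 + A2 + A3 + A4, min 1 (Real.sqrt (m * (vm - vr))), by positivity,
    lt_min one_pos (Real.sqrt_pos.2 hgap), hb.sub, fun y => ⟨(IsHomoclinic.gt_saddle h hu y).le,
      (IsHomoclinic.le_turning h hu hb y).trans hb.lt.le⟩, fun y => ?_, fun y => ?_, ?_⟩
  · refine (hd y).1.trans ?_
    gcongr; linarith
  · refine (hd y).2.trans ?_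
    gcongr; linarith
  intro ε X v hε hε₀ hv
  have hε1 : ε ^ 2 ≤ 1 := pow_le_one₀ hε.le (hε₀.trans_le (min_le_left _ _)).le
  have he : ε ^ 2 < m * (vm - vr) := by
    rw [← Real.sq_sqrt hgap.le]
    exact pow_lt_pow_left₀ (hε₀.trans_le (min_le_right _ _)) hε.le two_ne_zero
  have hX := hv.pos
  have hlv := fun {x : ℝ} (hx : x ∈ Icc 0 X) => hv.leaving h hb he hx
  obtain ⟨ht1, ht2⟩ := hv.turning h hb hε.ne' he
  obtain ⟨hX1, -⟩ := hlv (right_mem_Icc.2 hX.le)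
  have hslope : ε = s * deriv v 0 := by
    have h1 := hv.orbit.energy 0
    rw [hv.value_zero] at h1
    have h2 : ε ^ 2 = (s * deriv v 0) ^ 2 := by rw [mul_pow, hs2]; linarith
    exact (pow_left_inj₀ hε.le (mul_nonneg hs0.le hv.slope_zero.le) two_ne_zero).1 h2
  have hgx : ∀ x ∈ Icc 0 X, _ := fun x hx => hg (ε ^ 2) v (sq_nonneg _) hε1 hv.orbit x X hx.2
    fun t ht => hlv ⟨hx.1.trans ht.1, ht.2⟩
  have hE : ∀ t : ℝ, exp t * exp (-t) = 1 := fun t => by rw [← exp_add]; simp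
  have hgrow : ∀ x ∈ Icc 0 X, deriv v x + α * (v x - vs) ≤
      Cg * (α * L) * exp (-(α * (X - x))) := fun x hx => by
    have h1 := (hgx x hx).2
    rw [hv.deriv_end, zero_add] at h1
    have h2 := mul_le_mul_of_nonneg_right h1 (exp_nonneg (-(α * (X - x))))
    rw [mul_assoc, hE, mul_one] at h2
    refine h2.trans ?_
    have : v X - vs ≤ L := by linarith [hX1.2]
    gcongr
  have hlow : ε ≤ A1 * exp (-α * X) := by
    have h1 := hgrow 0 (left_mem_Icc.2 hX.le)
    rw [hv.value_zero, sub_self, mul_zero, add_zero, sub_zero] at h1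
    rw [hslope, hA1, mul_assoc, neg_mul]; gcongr
  have hhigh : exp (-α * X) ≤ A2 * ε := by
    have h1 := (hgx 0 (left_mem_Icc.2 hX.le)).1
    rw [hv.value_zero, hv.deriv_end, sub_self, mul_zero, add_zero, zero_add, sub_zero] at h1
    have h2 := mul_le_mul_of_nonneg_right h1 (exp_nonneg (-(α * X)))
    rw [mul_assoc _ (exp _), hE, mul_one] at h2
    have h3 : α * (vr - vs) ≤ α * (v X - vs) := by gcongr
    have h4 := (mul_le_mul_of_nonneg_right h3 (exp_nonneg (-(α * X)))).trans h2
    rw [hA2, div_mul_eq_mul_div, le_div_iff₀ (by positivity), neg_mul, hslope]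
    calc _ = s * (α * (vr - vs) * exp (-(α * X))) := by ring
      _ ≤ s * (Cg * deriv v 0) := by gcongr
      _ = _ := by ring
  have hneg : ∀ y ∈ Icc (-X) 0, v (y + X) ∈ Icc vs vm ∧
      |v (y + X) - vs| + |deriv v (y + X)| ≤ A3 * exp (α * y) ∧
      |v (y + X) - u y| + |deriv v (y + X) - deriv u y| ≤ A4 * exp (-α * (2 * X + y)) := fun y hy => by
    have hy' : y + X ∈ Icc 0 X := ⟨by linarith [hy.1], by linarith [hy.2]⟩
    obtain ⟨h1, h2⟩ := hlv hy'
    refine ⟨h1, ?_, ?_⟩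
    · have h3 := hgrow _ hy'
      have h4 : 0 ≤ v (y + X) - vs := by linarith [h1.1]
      rw [abs_of_nonneg h4, abs_of_nonneg h2, hA3, mul_assoc]
      rw [show -(α * (X - (y + X))) = α * y by ring] at h3
      exact (add_le_rate_mul hα h4 h2).trans (mul_le_mul_of_nonneg_left h3 (by positivity))
    · have horb : IsOrbit I κ W (W vs + 0) u := by rw [add_zero]; exact hu.orbit
      have h3 := hc (ε ^ 2) 0 (fun t => v (t + X)) u (sq_nonneg _) hε1 le_rfl zero_le_one
        (hv.orbit.comp_add X) horb y 0 hy.2 (fun t ht => by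
          rw [deriv_comp_add_const]
          exact hlv ⟨by linarith [hy.1, ht.1], by linarith [ht.2]⟩)
        (fun t ht => IsHomoclinic.leaving h hu hb ht.2)
      simp only [deriv_comp_add_const, zero_add, hv.deriv_end, IsHomoclinic.deriv_zero h hu,
        hu.center, sub_self, zero_sub] at h3
      set δ := v (y + X) - u y
      set ρ := deriv v (y + X) - deriv u y
      have h5 : v X - vr ≤ A1 ^ 2 / m * exp (-α * X) ^ 2 := by
        rw [div_mul_eq_mul_div, le_div_iff₀ hm, ← mul_pow, mul_comm]
        exact ht2.trans (pow_le_pow_left₀ hε.le hlow 2)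
      set Y := Cc * α * (A1 ^ 2 / m) * exp (-α * (2 * X + y)) with hY
      have hY0 : 0 ≤ Y := by positivity
      have h6 : α ^ 2 * δ ^ 2 + ρ ^ 2 ≤ Y ^ 2 := by
        refine h3.trans ?_
        have e1 : Y ^ 2 = Cc ^ 2 * (α ^ 2 * (A1 ^ 2 / m * exp (-α * X) ^ 2) ^ 2) *
            exp (2 * α * -y) := by
          rw [hY, show -α * (2 * X + y) = -α * X + -α * X + -(α * y) by ring,
            show 2 * α * -y = -(α * y) + -(α * y) by ring, exp_add, exp_add, exp_add]
          ring
        rw [e1, zero_pow two_ne_zero, add_zero]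
        have h7 : (v X - vr) ^ 2 ≤ (A1 ^ 2 / m * exp (-α * X) ^ 2) ^ 2 :=
          pow_le_pow_left₀ (by linarith) h5 2
        gcongr; exact le_self_pow₀ hCc two_ne_zero
      have h7 : α * |δ| ≤ Y := by
        refine abs_le_of_sq_le_sq' ?_ hY0 |>.2
        rw [mul_pow, sq_abs]; linarith [sq_nonneg ρ]
      have h8 : |ρ| ≤ Y := by
        refine abs_le_of_sq_le_sq ?_ hY0
        have := sq_nonneg (α * δ)
        rw [mul_pow] at this; linarith
      have h9 : |δ| ≤ 1 / α * Y := by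
        rw [div_mul_eq_mul_div, one_mul, le_div_iff₀ hα, mul_comm]; exact h7
      calc |δ| + |ρ| ≤ 1 / α * Y + Y := add_le_add h9 h8
        _ = _ := by rw [hA4, hY]; ring
  refine ⟨hlow.trans (by gcongr; linarith), hhigh.trans (by gcongr; linarith), fun y hy => ?_⟩
  rcases le_total y 0 with hy0 | hy0
  · obtain ⟨h1, h2, h3⟩ := hneg y ⟨hy.1, hy0⟩
    rw [abs_of_nonpos hy0]
    refine ⟨h1, h2.trans ?_, h3.trans ?_⟩
    · rw [neg_mul_neg]; gcongr; linarith
    · rw [sub_neg_eq_add]; gcongr; linarith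
  · obtain ⟨h1, h2, h3⟩ := hneg (-y) ⟨by linarith [hy.2], by linarith⟩
    have e1 : v (y + X) = v (-y + X) := by rw [← hv.symm h]; ring_nf
    have e2 : deriv v (y + X) = -deriv v (-y + X) := by rw [← hv.deriv_symm h]; ring_nf
    have e3 : u y = u (-y) := (IsHomoclinic.even h hu y).symm
    have e4 : deriv u y = -deriv u (-y) := by
      have := deriv_orbit_symm (v := u) (x₀ := 0) (by simpa using IsHomoclinic.even h hu) y
      simp only [mul_zero, zero_sub] at this
      rw [this, neg_neg]
    rw [abs_of_nonneg hy0, e1, e2, e3, e4, abs_neg, neg_sub_neg, abs_sub_comm (deriv u _)]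
    refine ⟨h1, h2.trans ?_, h3.trans ?_⟩
    · rw [mul_neg, ← neg_mul]; gcongr; linarith
    · rw [← sub_eq_add_neg]; gcongr; linarith

end

end

section

/-! ### Coefficient matrices along orbits -/

/-- Matrices depending smoothly on a value, quadratically on a slope, and affinely on a spectral
parameter. -/
structure CoeffFamily (n : Type) where
  value : n → n → ℝ → ℝ
  slope : n → n → ℝ → ℝ
  spectral : n → n → ℝ → ℝ

namespace CoeffFamily

variable {n : Type} (F : CoeffFamily n)

/-- The matrix at value `w` and slope `p`. -/
def eval (w p : ℝ) (z : ℂ) : Matrix n n ℂ :=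
  Matrix.of fun i j => ((F.value i j w + F.slope i j w * p ^ 2 : ℝ) : ℂ) +
    z * (F.spectral i j w : ℝ)

/-- The derivative with respect to the value at the endstate. -/
def lin (vs : ℝ) (z : ℂ) : Matrix n n ℂ :=
  Matrix.of fun i j => ((deriv (F.value i j) vs : ℝ) : ℂ) + z * ((deriv (F.spectral i j) vs : ℝ) : ℂ)

structure Smooth (I : Set ℝ) : Prop where
  value : ∀ i j, ContDiffOn ℝ ∞ (F.value i j) I
  slope : ∀ i j, ContDiffOn ℝ ∞ (F.slope i j) I
  spectral : ∀ i j, ContDiffOn ℝ ∞ (F.spectral i j) I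

variable {F} {I : Set ℝ} {κ W : ℝ → ℝ} {vs a b V Z : ℝ}
local notation "rate" => saddleRate κ W vs

lemma Smooth.exists_entry_bounds (hF : F.Smooth I) (hI : IsOpen I) (hab : Icc a b ⊆ I)
    (hs : vs ∈ Icc a b) (hV : 0 ≤ V) (hZ : 0 ≤ Z) (i j : n) : ∃ C > 0, ∀ z : ℂ, ‖z‖ ≤ Z →
      ‖F.lin vs z i j‖ ≤ C ∧ ∀ v1 ∈ Icc a b, ∀ v2 ∈ Icc a b, ∀ p1 p2 : ℝ, |p1| ≤ V → |p2| ≤ V →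
        ‖F.eval v1 p1 z i j - F.eval v2 p2 z i j - ((v1 - v2 : ℝ) : ℂ) * F.lin vs z i j‖ ≤
          C * ((|v1 - vs| + |p1|) + (|v2 - vs| + |p2|)) * (|v1 - v2| + |p1 - p2|) ∧
        ‖F.eval v1 p1 z i j - F.eval v2 p2 z i j‖ ≤ C * (|v1 - v2| + |p1 - p2|) ∧
        ‖F.eval v1 p1 z i j‖ ≤ C := by
  obtain ⟨C1, hC1, h1⟩ := exists_quadratic hI (hF.value i j) (hF.slope i j) hab hs hV
  obtain ⟨C2, hC2, h2⟩ := exists_quadratic hI (hF.spectral i j) (contDiffOn_const (c := 0)) hab hs hV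
  set D := |deriv (F.value i j) vs| + Z * |deriv (F.spectral i j) vs| with hD
  set Q := C1 + Z * C2 with hQ
  set ρ := 2 * ((b - a) + V) with hρ
  set G := |F.value i j vs| + Z * |F.spectral i j vs| with hG
  have hba : 0 ≤ b - a := by linarith [hs.1, hs.2]
  have hD0 : 0 ≤ D := by positivity
  have hQ0 : 0 < Q := by positivity
  have hρ0 : 0 ≤ ρ := by positivity
  have hG0 : 0 ≤ G := by positivity
  refine ⟨Q + D + Q * ρ + (G + (Q * ρ + D) * ρ), by positivity, fun z hz => ?_⟩
  have hlin : ‖F.lin vs z i j‖ ≤ D := by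
    simp only [lin, of_apply]
    refine (norm_add_le _ _).trans ?_
    rw [norm_mul, norm_real, norm_real, norm_eq_abs, norm_eq_abs, hD]; gcongr
  have hquad : ∀ v1 ∈ Icc a b, ∀ v2 ∈ Icc a b, ∀ p1 p2 : ℝ, |p1| ≤ V → |p2| ≤ V →
      ‖F.eval v1 p1 z i j - F.eval v2 p2 z i j - ((v1 - v2 : ℝ) : ℂ) * F.lin vs z i j‖ ≤
        Q * ((|v1 - vs| + |p1|) + (|v2 - vs| + |p2|)) * (|v1 - v2| + |p1 - p2|) := fun v1 hv1 v2 hv2 p1 p2 hp1 hp2 => by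
    have e1 := h1 v1 hv1 v2 hv2 p1 p2 hp1 hp2
    have e2 := h2 v1 hv1 v2 hv2 p1 p2 hp1 hp2
    simp only [zero_mul, add_zero] at e2
    have e : F.eval v1 p1 z i j - F.eval v2 p2 z i j - ((v1 - v2 : ℝ) : ℂ) * F.lin vs z i j =
        (((F.value i j v1 + F.slope i j v1 * p1 ^ 2 - deriv (F.value i j) vs * (v1 - vs)) -
          (F.value i j v2 + F.slope i j v2 * p2 ^ 2 - deriv (F.value i j) vs * (v2 - vs)) : ℝ) : ℂ) +
        z * (((F.spectral i j v1 - deriv (F.spectral i j) vs * (v1 - vs)) -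
          (F.spectral i j v2 - deriv (F.spectral i j) vs * (v2 - vs)) : ℝ) : ℂ) := by
      simp only [eval, lin, of_apply]
      push_cast; ring
    rw [e]
    refine (norm_add_le _ _).trans ?_
    rw [norm_mul, norm_real, norm_real, norm_eq_abs, norm_eq_abs]
    calc _ ≤ _ := add_le_add e1 (mul_le_mul hz e2 (abs_nonneg _) hZ)
      _ = _ := by rw [hQ]; ring
  have hvb : ∀ v ∈ Icc a b, |v - vs| ≤ b - a := fun v hv => by
    rw [abs_le]; constructor <;> linarith [hv.1, hv.2, hs.1, hs.2]
  have hlip : ∀ v1 ∈ Icc a b, ∀ v2 ∈ Icc a b, ∀ p1 p2 : ℝ, |p1| ≤ V → |p2| ≤ V →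
      ‖F.eval v1 p1 z i j - F.eval v2 p2 z i j‖ ≤ (Q * ρ + D) * (|v1 - v2| + |p1 - p2|) := fun v1 hv1 v2 hv2 p1 p2 hp1 hp2 => by
    have e1 := hquad v1 hv1 v2 hv2 p1 p2 hp1 hp2
    have e2 : (|v1 - vs| + |p1|) + (|v2 - vs| + |p2|) ≤ ρ := by
      rw [hρ]; linarith [hvb v1 hv1, hvb v2 hv2]
    calc _ ≤ ‖F.eval v1 p1 z i j - F.eval v2 p2 z i j - ((v1 - v2 : ℝ) : ℂ) * F.lin vs z i j‖ +
          ‖((v1 - v2 : ℝ) : ℂ) * F.lin vs z i j‖ := norm_le_norm_sub_add _ _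
      _ ≤ Q * ρ * (|v1 - v2| + |p1 - p2|) + |v1 - v2| * D := by
          refine add_le_add (e1.trans (by gcongr)) ?_
          rw [norm_mul, norm_real, norm_eq_abs]; gcongr
      _ ≤ _ := by
          have : 0 ≤ D * |p1 - p2| := by positivity
          linarith
  have hbd : ∀ v ∈ Icc a b, ∀ p : ℝ, |p| ≤ V → ‖F.eval v p z i j‖ ≤ G + (Q * ρ + D) * ρ := fun v hv p hp => by
    have e1 := hlip v hv vs hs p 0 hp (by simpa using hV)
    have e2 : ‖F.eval vs 0 z i j‖ ≤ G := by
      simp only [eval, of_apply]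
      refine (norm_add_le _ _).trans ?_
      rw [norm_mul, norm_real, norm_real, norm_eq_abs, norm_eq_abs, hG]
      rw [zero_pow two_ne_zero, mul_zero, add_zero]; gcongr
    have e3 : |v - vs| + |p - 0| ≤ ρ := by rw [sub_zero, hρ]; linarith [hvb v hv]
    calc _ ≤ ‖F.eval v p z i j - F.eval vs 0 z i j‖ + ‖F.eval vs 0 z i j‖ :=
          norm_le_norm_sub_add _ _
      _ ≤ (Q * ρ + D) * ρ + G := add_le_add (e1.trans (by gcongr)) e2
      _ = _ := add_comm _ _
  have n1 : 0 ≤ Q * ρ := by positivity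
  have n2 : 0 ≤ G + (Q * ρ + D) * ρ := by positivity
  refine ⟨hlin.trans (by linarith), fun v1 hv1 v2 hv2 p1 p2 hp1 hp2 => ⟨?_, ?_, ?_⟩⟩
  · refine (hquad v1 hv1 v2 hv2 p1 p2 hp1 hp2).trans ?_
    gcongr; linarith
  · refine (hlip v1 hv1 v2 hv2 p1 p2 hp1 hp2).trans ?_
    exact mul_le_mul_of_nonneg_right (by linarith) (by positivity)
  · exact (hbd v1 hv1 p1 hp1).trans (by linarith)

lemma Smooth.exists_bounds [Fintype n] (hF : F.Smooth I) (hI : IsOpen I) (hab : Icc a b ⊆ I)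
    (hs : vs ∈ Icc a b) (hV : 0 ≤ V) (hZ : 0 ≤ Z) : ∃ C > 0, ∀ z : ℂ, ‖z‖ ≤ Z → ∀ i j,
      ‖F.lin vs z i j‖ ≤ C ∧ ∀ v1 ∈ Icc a b, ∀ v2 ∈ Icc a b, ∀ p1 p2 : ℝ, |p1| ≤ V → |p2| ≤ V →
        ‖F.eval v1 p1 z i j - F.eval v2 p2 z i j - ((v1 - v2 : ℝ) : ℂ) * F.lin vs z i j‖ ≤
          C * ((|v1 - vs| + |p1|) + (|v2 - vs| + |p2|)) * (|v1 - v2| + |p1 - p2|) ∧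
        ‖F.eval v1 p1 z i j - F.eval v2 p2 z i j‖ ≤ C * (|v1 - v2| + |p1 - p2|) ∧
        ‖F.eval v1 p1 z i j‖ ≤ C := by
  choose C hC h using hF.exists_entry_bounds hI hab hs hV hZ
  have hle : ∀ i j, C i j ≤ 1 + ∑ k, ∑ l, C k l := fun i j => by
    have h1 : C i j ≤ ∑ l, C i l :=
      single_le_sum (f := C i) (fun l _ => (hC i l).le) (Finset.mem_univ j)
    have h2 : ∑ l, C i l ≤ ∑ k, ∑ l, C k l :=
      single_le_sum (f := fun k => ∑ l, C k l)
        (fun k _ => sum_nonneg fun l _ => (hC k l).le) (Finset.mem_univ i)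
    linarith
  refine ⟨1 + ∑ k, ∑ l, C k l, ?_, fun z hz i j => ?_⟩
  · have : 0 ≤ ∑ k, ∑ l, C k l :=
      sum_nonneg fun k _ => sum_nonneg fun l _ => (hC k l).le
    linarith
  obtain ⟨h1, h2⟩ := h i j z hz
  refine ⟨h1.trans (hle i j), fun v1 hv1 v2 hv2 p1 p2 hp1 hp2 => ?_⟩
  obtain ⟨q1, q2, q3⟩ := h2 v1 hv1 v2 hv2 p1 p2 hp1 hp2
  have := hle i j
  exact ⟨q1.trans (by gcongr), q2.trans (by gcongr), q3.trans (hle i j)⟩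

/-- The perturbation along an orbit, in block coordinates. -/
def pert (F : CoeffFamily (Fin 4)) (R L : Mat4) (vs : ℝ) (z : ℂ) (v : ℝ → ℝ) (y : ℝ) : Mat4 :=
  L * (F.eval (v y) (deriv v y) z - F.eval vs 0 z) * R

/-- Coefficient of the gauge that removes the linear part of the unstable trace. -/
def gaugeCoeff (F : CoeffFamily (Fin 4)) (E : Mat4) (vs α : ℝ) (z : ℂ) : ℂ :=
  (F.lin vs z * E).trace / (α ^ 2 : ℝ)

end CoeffFamily

lemma norm_trace_mul_le {X E : Mat4} {c e : ℝ} (hc : 0 ≤ c)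
    (hX : ∀ i j, ‖X i j‖ ≤ c) (hE : ∀ i j, ‖E i j‖ ≤ e) : ‖(X * E).trace‖ ≤ 16 * (c * e) := by
  rw [Matrix.trace]
  refine (norm_sum_le_of_le _ fun i _ => norm_mul_entry_le hc hX hE i i).trans ?_
  simp only [sum_const, card_univ, card_fin, nsmul_eq_mul]
  push_cast; linarith

lemma norm_conj_entry_le {L X R : Mat4} {c e : ℝ} (he : 0 ≤ e) (hc : 0 ≤ c)
    (hL : ∀ i j, ‖L i j‖ ≤ e) (hX : ∀ i j, ‖X i j‖ ≤ c) (hR : ∀ i j, ‖R i j‖ ≤ e) (i j : Fin 4) :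
    ‖(L * X * R) i j‖ ≤ 16 * e ^ 2 * c := by
  refine (norm_mul_entry_le (by positivity) (fun i j => norm_mul_entry_le he hL hX i j) hR i j).trans
    (le_of_eq ?_)
  simp only [card_fin]
  push_cast; ring

lemma BlockFrame.norm_proj_le {A E R L : Mat4} {σ η c : ℝ} (h : BlockFrame A E R L σ η) (hc : 0 ≤ c)
    (hR : ∀ i j, ‖R i j‖ ≤ c) (hL : ∀ i j, ‖L i j‖ ≤ c) (i j : Fin 4) : ‖E i j‖ ≤ 16 * c ^ 2 := by
  have h1 : ∀ i j, ‖headProj i j‖ ≤ 1 := fun i j => by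
    fin_cases i <;> fin_cases j <;> simp [headProj, Matrix.diagonal]
  rw [← h.proj, ← mul_one (16 * c ^ 2)]; exact norm_conj_entry_le hc zero_le_one hR h1 hL i j

section

variable {I : Set ℝ} {κ W : ℝ → ℝ} {vs a b C0 c Z : ℝ} {F : CoeffFamily (Fin 4)}
local notation "rate" => saddleRate κ W vs

open CoeffFamily in
set_option maxHeartbeats 1600000 in
/-- Uniform bounds for the perturbations along orbits homoclinic, or nearly so, to the saddle. -/
lemma Saddle.exists_localized (h : Saddle I κ W vs) (hF : F.Smooth I)
    (htr : ∀ w ∈ I, ∀ p z, (F.eval w p z).trace = (F.eval vs 0 z).trace) (hab : Icc a b ⊆ I)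
    (hs : vs ∈ Icc a b) (hC0 : 0 ≤ C0) (hc : 0 ≤ c) (hZ : 0 ≤ Z) :
    ∃ K : ℝ, 0 ≤ K ∧ ∀ (z : ℂ) (R L E : Mat4) (σ η : ℝ), ‖z‖ ≤ Z →
      BlockFrame (F.eval vs 0 z) E R L σ η → (∀ i j, ‖R i j‖ ≤ c) → (∀ i j, ‖L i j‖ ≤ c) →
      (∀ (μ : ℝ) (v : ℝ → ℝ) (s : Set ℝ), IsOrbit I κ W μ v →
        (∀ y ∈ s, v y ∈ Icc a b ∧
          |v y - vs| + |deriv v y| ≤ C0 * exp (-rate * |y|)) →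
        Localized K rate (F.pert R L vs z v)
          (fun y => F.gaugeCoeff E vs rate z * deriv v y)
          (fun y => F.gaugeCoeff E vs rate z * deriv (deriv v) y) s) ∧
      ∀ (μ μ' X : ℝ) (v u : ℝ → ℝ), IsOrbit I κ W μ v → IsOrbit I κ W μ' u →
        (∀ y ∈ Icc (-X) X, v y ∈ Icc a b ∧
          |v y - vs| + |deriv v y| ≤ C0 * exp (-rate * |y|)) →
        (∀ y ∈ Icc (-X) X, u y ∈ Icc a b ∧
          |u y - vs| + |deriv u y| ≤ C0 * exp (-rate * |y|)) →
        (∀ y ∈ Icc (-X) X, |v y - u y| + |deriv v y - deriv u y| ≤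
          C0 * exp (-rate * (2 * X - |y|))) →
        IsNear K rate X (F.pert R L vs z v)
          (fun y => F.gaugeCoeff E vs rate z * deriv v y)
          (fun y => F.gaugeCoeff E vs rate z * deriv (deriv v) y)
          (F.pert R L vs z u) (fun y => F.gaugeCoeff E vs rate z * deriv (deriv u) y) := by
  obtain ⟨C, hC, hcf⟩ := hF.exists_bounds h.isOpen hab hs hC0 hZ
  obtain ⟨Cq, hCq, hq⟩ := h.acc_quadratic hab hs hC0
  obtain ⟨Cl, hCl, hl⟩ := h.acc_lipschitz hab hC0
  have hα := h.rate_pos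
  set α := rate with hαdef
  have hacc : acc κ W vs 0 = 0 := by simp [acc, h.crit]
  set g := 16 * (C * (16 * c ^ 2)) / α ^ 2 with hg
  have hg0 : 0 ≤ g := by positivity
  set K1 := 16 * c ^ 2 * C with hK1
  set K2 := g * Cl with hK2
  set K3 := 2 * (16 * (C * (16 * c ^ 2)) + g * Cq) with hK3
  have hK₁0 : 0 ≤ K1 := by positivity
  have hK₂0 : 0 ≤ K2 := by positivity
  have hK₃0 : 0 ≤ K3 := by positivity
  refine ⟨(K1 + K2) * C0 + K3 * C0 ^ 2, by positivity, fun z R L E σ η hz hfr hR hL => ?_⟩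
  set G := F.gaugeCoeff E vs α z with hGdef
  have hE := hfr.norm_proj_le hc hR hL
  have hG : ‖G‖ ≤ g := by
    rw [hGdef, gaugeCoeff, norm_div, norm_real, Real.norm_of_nonneg (sq_nonneg α), hg]
    have := norm_trace_mul_le hC.le (fun i j => (hcf z hz i j).1) hE
    gcongr
  have hcen : ∀ v : ℝ → ℝ, ∀ y, F.pert R L vs z v y 0 0 + F.pert R L vs z v y 1 1 =
      ((F.eval (v y) (deriv v y) z - F.eval vs 0 z) * E).trace := fun v y => hfr.trace_conj _
  have hGα : G * (α ^ 2 : ℝ) = (F.lin vs z * E).trace := by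
    rw [hGdef, gaugeCoeff, div_mul_cancel₀]
    exact_mod_cast (pow_pos hα 2).ne'
  have key : ∀ v1 ∈ Icc a b, ∀ v2 ∈ Icc a b, ∀ p1 p2 : ℝ, |p1| ≤ C0 → |p2| ≤ C0 →
      ‖((F.eval v1 p1 z - F.eval v2 p2 z) * E).trace - G * ((acc κ W v1 p1 - acc κ W v2 p2 : ℝ) : ℂ)‖ ≤
        K3 / 2 * ((|v1 - vs| + |p1|) + (|v2 - vs| + |p2|)) * (|v1 - v2| + |p1 - p2|) := fun v1 hv1 v2 hv2 p1 p2 hp1 hp2 => by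
    have e1 := hq v1 hv1 v2 hv2 p1 p2 hp1 hp2
    have e : ((F.eval v1 p1 z - F.eval v2 p2 z) * E).trace -
        G * ((acc κ W v1 p1 - acc κ W v2 p2 : ℝ) : ℂ) =
        ((F.eval v1 p1 z - F.eval v2 p2 z - ((v1 - v2 : ℝ) : ℂ) • F.lin vs z) * E).trace -
        G * (((acc κ W v1 p1 - α ^ 2 * (v1 - vs)) - (acc κ W v2 p2 - α ^ 2 * (v2 - vs)) : ℝ) : ℂ) := by
      rw [sub_mul _ (_ • _), trace_sub, smul_mul, trace_smul, ← hGα]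
      push_cast; simp only [smul_eq_mul]; ring
    rw [e]
    set w := (|v1 - vs| + |p1|) + (|v2 - vs| + |p2|)
    set δ := |v1 - v2| + |p1 - p2|
    have e2 := norm_trace_mul_le (X := F.eval v1 p1 z - F.eval v2 p2 z -
      ((v1 - v2 : ℝ) : ℂ) • F.lin vs z) (c := C * w * δ) (by positivity)
      (fun i j => by simpa using ((hcf z hz i j).2 v1 hv1 v2 hv2 p1 p2 hp1 hp2).1) hE
    refine (norm_sub_le _ _).trans ?_
    rw [norm_mul G, norm_real, norm_eq_abs]
    calc _ ≤ 16 * (C * w * δ * (16 * c ^ 2)) + g * (Cq * w * δ) := by gcongr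
      _ = _ := by rw [hK3]; ring
  have hexp : ∀ y : ℝ, exp (-2 * α * |y|) = exp (-α * |y|) ^ 2 := fun y => by
    rw [← Real.exp_nat_mul]; congr 1; push_cast; ring
  have hle1 : ∀ y : ℝ, exp (-α * |y|) ≤ 1 := fun y =>
    exp_le_one_iff.2 (by nlinarith [abs_nonneg y])
  have hloc : ∀ (v : ℝ → ℝ) (y : ℝ), |v y - vs| + |deriv v y| ≤ C0 * exp (-α * |y|) →
      |deriv v y| ≤ C0 := fun v y hy => by
    have : C0 * exp (-α * |y|) ≤ C0 * 1 := by gcongr; exact hle1 y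
    linarith [abs_nonneg (v y - vs)]
  have first : ∀ (μ : ℝ) (v : ℝ → ℝ) (s : Set ℝ), IsOrbit I κ W μ v →
      (∀ y ∈ s, v y ∈ Icc a b ∧ |v y - vs| + |deriv v y| ≤ C0 * exp (-α * |y|)) →
      Localized ((K1 + K2) * C0 + K3 * C0 ^ 2) α (F.pert R L vs z v)
        (fun y => G * deriv v y) (fun y => G * deriv (deriv v) y) s := fun μ v s hv hy => by
    refine ⟨fun x hx => ?_, fun x hx i j => ?_, fun x hx => ?_, fun x hx => ?_, fun x hx => ?_⟩
    · exact ((hv.hasDerivAt_deriv x).ofReal_comp.const_mul G).hasDerivWithinAt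
    · obtain ⟨h1, h2⟩ := hy x hx
      refine (norm_conj_entry_le (X := F.eval (v x) (deriv v x) z - F.eval vs 0 z)
        (c := C * (C0 * exp (-α * |x|))) hc (by positivity) hL (fun i j => ?_) hR i j).trans ?_
      · refine ((hcf z hz i j).2 _ h1 _ hs _ 0 (hloc v x h2) (by simpa using hC0)).2.1.trans ?_
        rw [sub_zero]; gcongr
      · rw [← mul_assoc (16 * c ^ 2), ← mul_assoc]
        gcongr; nlinarith [mul_nonneg hK₂0 hC0, mul_nonneg hK₃0 (sq_nonneg C0)]
    · obtain ⟨h1, h2⟩ := hy x hx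
      have h3 := hl _ h1 _ hs _ 0 (hloc v x h2) (by simpa using hC0)
      rw [hacc, sub_zero, sub_zero, ← hv.deriv_deriv h.pos] at h3
      rw [norm_mul, norm_real, norm_eq_abs]
      calc _ ≤ g * (Cl * (C0 * exp (-α * |x|))) := by gcongr; exact h3.trans (by gcongr)
        _ = K2 * C0 * exp (-α * |x|) := by rw [hK2]; ring
        _ ≤ _ := by
          gcongr; nlinarith [mul_nonneg hK₁0 hC0, mul_nonneg hK₃0 (sq_nonneg C0)]
    · obtain ⟨h1, h2⟩ := hy x hx
      have h3 := key _ h1 _ hs _ 0 (hloc v x h2) (by simpa using hC0)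
      rw [hacc, sub_zero, sub_zero, ← hv.deriv_deriv h.pos, sub_self, abs_zero, add_zero,
        add_zero] at h3
      rw [hcen, hexp]
      refine h3.trans ?_
      calc _ ≤ K3 / 2 * (C0 * exp (-α * |x|)) * (C0 * exp (-α * |x|)) := by gcongr
        _ = K3 / 2 * C0 ^ 2 * exp (-α * |x|) ^ 2 := by ring
        _ ≤ _ := by
          gcongr
          nlinarith [mul_nonneg hK₁0 hC0, mul_nonneg hK₂0 hC0, mul_nonneg hK₃0 (sq_nonneg C0)]
    · rw [pert, trace_mul_comm, ← mul_assoc, hfr.right_inv, one_mul,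
        trace_sub, htr _ (hv.mem x), sub_self]
  refine ⟨first, fun μ μ' X v u hv hu hyv hyu hd => ⟨first μ v _ hv hyv, ?_, ?_, ?_⟩⟩
  · intro x hx i j
    obtain ⟨h1, h2⟩ := hyv x hx
    obtain ⟨h3, h4⟩ := hyu x hx
    have e : F.pert R L vs z v x i j - F.pert R L vs z u x i j =
        (L * (F.eval (v x) (deriv v x) z - F.eval (u x) (deriv u x) z) * R) i j := by
      rw [← Matrix.sub_apply, pert, pert, ← sub_mul, ← mul_sub, sub_sub_sub_cancel_right]
    rw [e, show -2 * α * X + α * |x| = -α * (2 * X - |x|) by ring]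
    refine (norm_conj_entry_le (X := F.eval (v x) (deriv v x) z - F.eval (u x) (deriv u x) z)
      (c := C * (C0 * exp (-α * (2 * X - |x|)))) hc (by positivity) hL
      (fun i j => ?_) hR i j).trans ?_
    · refine ((hcf z hz i j).2 _ h1 _ h3 _ _ (hloc v x h2) (hloc u x h4)).2.1.trans ?_
      gcongr; exact hd x hx
    · rw [← mul_assoc (16 * c ^ 2), ← mul_assoc]
      gcongr; nlinarith [mul_nonneg hK₂0 hC0, mul_nonneg hK₃0 (sq_nonneg C0)]
  · intro x hx
    obtain ⟨h1, h2⟩ := hyv x hx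
    obtain ⟨h3, h4⟩ := hyu x hx
    have h5 := hl _ h1 _ h3 _ _ (hloc v x h2) (hloc u x h4)
    rw [← hv.deriv_deriv h.pos, ← hu.deriv_deriv h.pos] at h5
    rw [← mul_sub, ← Complex.ofReal_sub, norm_mul, norm_real, norm_eq_abs,
      show -2 * α * X + α * |x| = -α * (2 * X - |x|) by ring]
    calc _ ≤ g * (Cl * (C0 * exp (-α * (2 * X - |x|)))) := by
          gcongr; exact h5.trans (by gcongr; exact hd x hx)
      _ = K2 * C0 * exp (-α * (2 * X - |x|)) := by rw [hK2]; ring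
      _ ≤ _ := by
          gcongr; nlinarith [mul_nonneg hK₁0 hC0, mul_nonneg hK₃0 (sq_nonneg C0)]
  · intro x hx
    obtain ⟨h1, h2⟩ := hyv x hx
    obtain ⟨h3, h4⟩ := hyu x hx
    have h5 := key _ h1 _ h3 _ _ (hloc v x h2) (hloc u x h4)
    rw [← hv.deriv_deriv h.pos, ← hu.deriv_deriv h.pos] at h5
    have e : (F.pert R L vs z v x 0 0 + F.pert R L vs z v x 1 1 - G * deriv (deriv v) x) -
        (F.pert R L vs z u x 0 0 + F.pert R L vs z u x 1 1 - G * deriv (deriv u) x) =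
        ((F.eval (v x) (deriv v x) z - F.eval (u x) (deriv u x) z) * E).trace -
          G * ((deriv (deriv v) x - deriv (deriv u) x : ℝ) : ℂ) := by
      rw [hcen, hcen, ← sub_sub_sub_cancel_right (F.eval (v x) _ z) (F.eval (u x) _ z) (F.eval vs 0 z),
        sub_mul (_ - _), trace_sub]
      push_cast; ring
    rw [e]
    refine h5.trans ?_
    have e2 : exp (-2 * α * X) = exp (-α * |x|) * exp (-α * (2 * X - |x|)) := by
      rw [← exp_add]; ring_nf
    calc _ ≤ K3 / 2 * (C0 * exp (-α * |x|) + C0 * exp (-α * |x|)) *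
          (C0 * exp (-α * (2 * X - |x|))) := by gcongr; exact hd x hx
      _ = K3 * C0 ^ 2 * exp (-2 * α * X) := by rw [e2]; ring
      _ ≤ _ := by
          gcongr; nlinarith [mul_nonneg hK₁0 hC0, mul_nonneg hK₂0 hC0]

end

end

section

/-! ### Reflection of the phase plane -/

section

variable {I : Set ℝ} {κ W : ℝ → ℝ} {vs vl μ ε X : ℝ} {v : ℝ → ℝ}
local notation "rate" => saddleRate κ W vs

lemma deriv_deriv_comp_neg (f : ℝ → ℝ) (x : ℝ) :
    deriv (deriv fun y => f (-y)) x = deriv (deriv f) (-x) := by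
  have h : (deriv fun y => f (-y)) = fun y => -deriv f (-y) := by funext y; exact deriv_comp_neg ..
  rw [h, deriv.fun_neg, deriv_comp_neg, neg_neg]

lemma Saddle.reflect (h : Saddle I κ W vs) :
    Saddle (Neg.neg ⁻¹' I) (fun w => κ (-w)) (fun w => W (-w)) (-vs) where
  isOpen := h.isOpen.preimage continuous_neg
  ordConnected := ⟨fun x hx y hy z hz =>
    h.ordConnected.out hy hx ⟨neg_le_neg hz.2, neg_le_neg hz.1⟩⟩
  smooth_κ := h.smooth_κ.comp contDiff_neg.contDiffOn fun _ hx => hx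
  smooth_W := h.smooth_W.comp contDiff_neg.contDiffOn fun _ hx => hx
  pos := fun w hw => h.pos _ hw
  mem := by simpa using h.mem
  crit := by rw [deriv_comp_neg, neg_neg, h.crit, neg_zero]
  neg := by rw [deriv_deriv_comp_neg, neg_neg]; exact h.neg

lemma saddleRate_reflect :
    saddleRate (fun w => κ (-w)) (fun w => W (-w)) (-vs) = rate := by
  rw [saddleRate, saddleRate, deriv_deriv_comp_neg, neg_neg]

lemma deriv_reflect (v : ℝ → ℝ) (x : ℝ) : deriv (fun y => -v (-y)) x = deriv v (-x) := by
  rw [deriv.fun_neg, deriv_comp_neg, neg_neg]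

lemma IsOrbit.reflect (h : IsOrbit I κ W μ v) :
    IsOrbit (Neg.neg ⁻¹' I) (fun w => κ (-w)) (fun w => W (-w)) μ (fun x => -v (-x)) where
  smooth := (h.smooth.comp contDiff_neg).neg
  mem := fun x => by simpa using h.mem (-x)
  energy := fun x => by
    have := h.energy (-x)
    simp only [deriv_reflect, neg_neg]; exact this
  eulerLagrange := fun x => by
    have h1 : (deriv fun y => -v (-y)) = fun y => deriv v (-y) := funext (deriv_reflect v)
    have := h.eulerLagrange (-x)
    simp only [h1, deriv_comp_neg, neg_neg]; linarith

lemma IsHalfPulse.of_left (h : IsOrbit I κ W (W vs + ε ^ 2) v) (h0 : v 0 = vs)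
    (h1 : 0 < deriv v 0) (hX : IsGreatest {x : ℝ | x < 0 ∧ deriv v x = 0} X) :
    IsHalfPulse (Neg.neg ⁻¹' I) (fun w => κ (-w)) (fun w => W (-w)) (-vs) ε (fun x => -v (-x))
      (-X) where
  orbit := by rw [neg_neg]; exact h.reflect
  value_zero := by simp [h0]
  slope_zero := by rw [deriv_reflect, neg_zero]; exact h1
  first := by
    refine ⟨⟨by simpa using hX.1.1, by rw [deriv_reflect, neg_neg]; exact hX.1.2⟩, ?_⟩
    rintro x ⟨hx, hx'⟩
    rw [deriv_reflect] at hx'; exact neg_le.1 (hX.2 ⟨by simpa using hx, hx'⟩)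

end

/-- A potential with a saddle and two wells at the same level. -/
structure DoubleWell (I : Set ℝ) (κ W : ℝ → ℝ) (vl vs vr : ℝ) : Prop where
  right : Well I κ W vs vr
  left : Well (Neg.neg ⁻¹' I) (fun w => κ (-w)) (fun w => W (-w)) (-vs) (-vl)

/-- A two-pulse orbit with its first critical points on either side of the origin. -/
structure IsDoublePulse (I : Set ℝ) (κ W : ℝ → ℝ) (vs ε : ℝ) (v : ℝ → ℝ) (Xl Xr : ℝ) : Prop where
  orbit : IsOrbit I κ W (W vs + ε ^ 2) v
  value_zero : v 0 = vs
  slope_zero : 0 < deriv v 0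
  first_max : IsLeast {x : ℝ | 0 < x ∧ deriv v x = 0} Xr
  last_min : IsGreatest {x : ℝ | x < 0 ∧ deriv v x = 0} Xl

/-- `v` follows `u` on `[-X, X]`, both being localized with rate `α`. -/
structure Follows (a b vs α C X : ℝ) (v u : ℝ → ℝ) : Prop where
  mem : ∀ y ∈ Icc (-X) X, v y ∈ Icc a b
  decay : ∀ y ∈ Icc (-X) X, |v y - vs| + |deriv v y| ≤ C * exp (-α * |y|)
  diff : ∀ y ∈ Icc (-X) X, |v y - u y| + |deriv v y - deriv u y| ≤ C * exp (-α * (2 * X - |y|))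

/-- A soliton with values in `[a, b]` and decay rate exactly `α`. -/
structure Decays (a b vs α C : ℝ) (u : ℝ → ℝ) : Prop where
  mem : ∀ y, u y ∈ Icc a b
  upper : ∀ y, |u y - vs| + |deriv u y| ≤ C * exp (-α * |y|)
  lower : ∀ y, exp (-α * |y|) ≤ C * |u y - vs|

section

variable {I : Set ℝ} {κ W : ℝ → ℝ} {vl vs vr ε Xl Xr : ℝ} {v ul ur : ℝ → ℝ}
local notation "rate" => saddleRate κ W vs

/-- Estimates for the two-pulse orbit of small energy. -/
lemma DoubleWell.exists_estimates (h : DoubleWell I κ W vl vs vr)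
    (hr : IsHomoclinic I κ W vs vr ur)
    (hl : IsHomoclinic (Neg.neg ⁻¹' I) (fun w => κ (-w)) (fun w => W (-w)) (-vs) (-vl)
      fun x => -ul (-x)) :
    ∃ a b C ε₀ : ℝ, 0 < C ∧ 0 < ε₀ ∧ Icc a b ⊆ I ∧ vs ∈ Icc a b ∧
      Decays a b vs rate C ul ∧ Decays a b vs rate C ur ∧
      ∀ ε Xl Xr : ℝ, ∀ v : ℝ → ℝ, 0 < ε → ε < ε₀ → IsDoublePulse I κ W vs ε v Xl Xr →
        (ε ≤ C * exp (-rate * Xr) ∧ exp (-rate * Xr) ≤ C * ε) ∧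
        (ε ≤ C * exp (-rate * -Xl) ∧ exp (-rate * -Xl) ≤ C * ε) ∧
        Follows a b vs rate C Xr (fun y => v (y + Xr)) ur ∧
        Follows a b vs rate C (-Xl) (fun y => v (y + Xl)) ul := by
  obtain ⟨b, C, ε1, hC, hε1, hbI, hub, hu1, hu2, hest⟩ := h.right.exists_halfPulse_estimates hr
  obtain ⟨a, C', ε2, hC', hε2, haI, hua, hu3, hu4, hest'⟩ := h.left.exists_halfPulse_estimates hl
  rw [saddleRate_reflect] at hu3 hu4 hest'
  have hα := h.right.rate_pos
  set α := rate with hαdef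
  have hsb : vs ≤ b := (hub 0).1.trans (hub 0).2
  have has : -a ≤ vs := by linarith [(hua 0).1.trans (hua 0).2]
  have hmr : ∀ {w}, w ∈ Icc vs b → w ∈ Icc (-a) b := fun hw => ⟨has.trans hw.1, hw.2⟩
  have hml : ∀ {w}, -w ∈ Icc (-vs) a → w ∈ Icc (-a) b := fun hw =>
    ⟨by linarith [hw.2], by linarith [hw.1]⟩
  have m1 : C ≤ C + C' := by linarith
  have m2 : C' ≤ C + C' := by linarith
  refine ⟨-a, b, C + C', min ε1 ε2, by positivity, lt_min hε1 hε2, fun w hw => ?_, ⟨has, hsb⟩,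
    ⟨fun y => ?_, fun y => ?_, fun y => ?_⟩, ⟨fun y => hmr (hub y), fun y => (hu1 y).trans ?_,
      fun y => (hu2 y).trans ?_⟩, ?_⟩
  · rcases le_total vs w with h1 | h1
    · exact hbI ⟨h1, hw.2⟩
    · simpa using haI (a := -w) ⟨neg_le_neg h1, by linarith [hw.1]⟩
  · have := hua (-y)
    rw [neg_neg] at this; exact hml this
  · have := hu3 (-y)
    rw [deriv_reflect, neg_neg, abs_neg, neg_sub_neg, abs_sub_comm] at this
    exact this.trans (by gcongr)
  · have := hu4 (-y)
    rw [neg_neg, abs_neg, neg_sub_neg, abs_sub_comm] at this; exact this.trans (by gcongr)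
  · gcongr
  · gcongr
  intro ε Xl Xr v hε hε' hv
  obtain ⟨r1, r2, r3⟩ := hest ε Xr v hε (hε'.trans_le (min_le_left _ _))
    ⟨hv.orbit, hv.value_zero, hv.slope_zero, hv.first_max⟩
  obtain ⟨l1, l2, l3⟩ := hest' ε (-Xl) _ hε (hε'.trans_le (min_le_right _ _))
    (IsHalfPulse.of_left hv.orbit hv.value_zero hv.slope_zero hv.last_min)
  refine ⟨⟨r1.trans (by gcongr), r2.trans (by gcongr)⟩, ⟨l1.trans (by gcongr), l2.trans (by gcongr)⟩,
    ⟨fun y hy => hmr (r3 y hy).1, fun y hy => ?_, fun y hy => ?_⟩,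
    ⟨fun y hy => ?_, fun y hy => ?_, fun y hy => ?_⟩⟩
  · rw [deriv_comp_add_const]; exact (r3 y hy).2.1.trans (by gcongr)
  · rw [deriv_comp_add_const]; exact (r3 y hy).2.2.trans (by gcongr)
  all_goals
    obtain ⟨q1, q2, q3⟩ := l3 (-y) ⟨by linarith [hy.2], by linarith [hy.1]⟩
    rw [show -(-y + -Xl) = y + Xl by ring] at q1
    rw [deriv_reflect, show -(-y + -Xl) = y + Xl by ring, abs_neg, neg_sub_neg, abs_sub_comm] at q2
    rw [deriv_reflect, deriv_reflect, show -(-y + -Xl) = y + Xl by ring, abs_neg, neg_neg,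
      neg_sub_neg, abs_sub_comm] at q3
  · exact hml q1
  · rw [deriv_comp_add_const]; exact q2.trans (by gcongr)
  · rw [deriv_comp_add_const]; exact q3.trans (by gcongr)

lemma IsDoublePulse.symm_right (h : Saddle I κ W vs) (hv : IsDoublePulse I κ W vs ε v Xl Xr)
    (x : ℝ) : v (2 * Xr - x) = v x := h.orbit_symm hv.orbit hv.first_max.1.2 x

lemma IsDoublePulse.symm_left (h : Saddle I κ W vs) (hv : IsDoublePulse I κ W vs ε v Xl Xr)
    (x : ℝ) : v (2 * Xl - x) = v x := h.orbit_symm hv.orbit hv.last_min.1.2 x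

lemma IsDoublePulse.periodic (h : Saddle I κ W vs) (hv : IsDoublePulse I κ W vs ε v Xl Xr) :
    Function.Periodic v (2 * (Xr - Xl)) := fun x => by
  rw [← hv.symm_left h x, ← hv.symm_right h (2 * Xl - x)]; ring_nf

lemma IsDoublePulse.deriv_ends (h : Saddle I κ W vs) (hv : IsDoublePulse I κ W vs ε v Xl Xr) :
    deriv v (2 * Xr) = -deriv v 0 ∧ deriv v (2 * Xl) = -deriv v 0 := by
  have h1 := deriv_orbit_symm (hv.symm_right h) 0
  have h2 := deriv_orbit_symm (hv.symm_left h) 0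
  rw [sub_zero] at h1 h2; exact ⟨h1, h2⟩

end

/-! ### Travelling waves of the Hamiltonian equation -/

namespace Model

lemma smooth_g {I : Set ℝ} {τ : ℝ → ℝ} {b c lam2 : ℝ} (hτ : ContDiffOn ℝ ∞ τ I)
    (hpos : ∀ v ∈ I, 0 < τ v) : ContDiffOn ℝ ∞ (g τ b c lam2) I :=
  (contDiffOn_const.div hτ fun v hv => (hpos v hv).ne').neg.mul
    ((contDiffOn_const.mul contDiffOn_id).add contDiffOn_const)

lemma smooth_W {M : Model} (hM : M.Admissible) : ContDiffOn ℝ ∞ M.W M.I := by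
  cases M with
  | scalar I κ f b c lam1 =>
    obtain ⟨-, -, -, hf, -, -⟩ := hM
    exact (hf.neg.sub (contDiffOn_const.mul (contDiffOn_id.pow 2))).sub
      (contDiffOn_const.mul contDiffOn_id)
  | system I κ f τ b c lam1 lam2 =>
    obtain ⟨-, -, -, hf, hτ, -, -, hpos⟩ := hM
    exact (hf.neg.add ((contDiffOn_const.mul hτ).mul ((smooth_g hτ hpos).pow 2))).sub
      (contDiffOn_const.mul contDiffOn_id)

lemma isOpen {M : Model} (hM : M.Admissible) : IsOpen M.I := by cases M <;> exact hM.1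

lemma ordConnected {M : Model} (hM : M.Admissible) : M.I.OrdConnected := by cases M <;> exact hM.2.1

lemma smooth_κ {M : Model} (hM : M.Admissible) : ContDiffOn ℝ ∞ M.κ M.I := by
  cases M <;> exact hM.2.2.1

lemma κ_pos {M : Model} (hM : M.Admissible) : ∀ v ∈ M.I, 0 < M.κ v := by
  cases M with
  | scalar => exact hM.2.2.2.2.2
  | system => exact hM.2.2.2.2.2.2.1

variable {M : Model} {vl vs vr : ℝ}

lemma TwoHomoclinics.toSaddle (hW : M.TwoHomoclinics vl vs vr) (hM : M.Admissible) :
    Saddle M.I M.κ M.W vs where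
  isOpen := isOpen hM
  ordConnected := ordConnected hM
  smooth_κ := smooth_κ hM
  smooth_W := smooth_W hM
  pos := κ_pos hM
  mem := hW.mem_s
  crit := hW.crit
  neg := hW.saddle

lemma TwoHomoclinics.doubleWell (hW : M.TwoHomoclinics vl vs vr) (hM : M.Admissible) :
    DoubleWell M.I M.κ M.W vl vs vr where
  right :=
    { hW.toSaddle hM with
      mem_r := hW.mem_r
      lt := hW.lt_r
      level := hW.level_r
      slope := hW.slope_r
      below := fun v hv => hW.below v (Or.inr hv) }
  left :=
    { (hW.toSaddle hM).reflect with
      mem_r := by simpa using hW.mem_l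
      lt := neg_lt_neg hW.lt_l
      level := by simpa using hW.level_l
      slope := by
        rw [deriv_comp_neg, neg_neg]; exact neg_pos.2 hW.slope_l
      below := fun v hv => by
        rw [neg_neg]
        exact hW.below _ (Or.inl ⟨by linarith [hv.2], by linarith [hv.1]⟩) }

lemma IsProfile.isOrbit {μ : ℝ} {v : ℝ → ℝ} (h : M.IsProfile μ v) : IsOrbit M.I M.κ M.W μ v :=
  ⟨h.smooth, h.mem, h.energy, h.eulerLagrange⟩

lemma IsSoliton.isHomoclinic {v0 : ℝ} {v : ℝ → ℝ} (h : M.IsSoliton vs v0 v) :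
    IsHomoclinic M.I M.κ M.W vs v0 v :=
  ⟨h.profile.isOrbit, h.center, h.endstate_top, h.endstate_bot⟩

lemma IsSoliton.isHomoclinic_reflect {v0 : ℝ} {v : ℝ → ℝ} (h : M.IsSoliton vs v0 v) :
    IsHomoclinic (Neg.neg ⁻¹' M.I) (fun w => M.κ (-w)) (fun w => M.W (-w)) (-vs) (-v0)
      fun x => -v (-x) where
  orbit := by rw [neg_neg]; exact h.profile.isOrbit.reflect
  center := by rw [neg_zero, h.center]
  top := (h.endstate_bot.comp tendsto_neg_atTop_atBot).neg
  bot := (h.endstate_top.comp tendsto_neg_atBot_atTop).neg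

lemma IsTwoPulse.isDoublePulse {ε Xl Xr X : ℝ} {v : ℝ → ℝ} (h : M.IsTwoPulse vs ε v Xl Xr X) :
    IsDoublePulse M.I M.κ M.W vs ε v Xl Xr :=
  ⟨h.profile.isOrbit, h.value_zero, h.slope_zero, h.first_max, h.last_min⟩

lemma IsTwoPulse.period_le {ε Xl Xr X : ℝ} {v : ℝ → ℝ} (h : M.IsTwoPulse vs ε v Xl Xr X)
    (hs : Saddle M.I M.κ M.W vs) : X ≤ 2 * (Xr - Xl) :=
  h.period.2 ⟨by linarith [h.first_max.1.1, h.last_min.1.1], h.isDoublePulse.periodic hs⟩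

lemma smooth_lift (hM : M.Admissible) (i : Fin M.N) : ContDiffOn ℝ ∞ (fun w => M.lift w i) M.I := by
  cases M with
  | scalar I κ f b c lam1 =>
    fin_cases i; exact contDiffOn_id
  | system I κ f τ b c lam1 lam2 =>
    obtain ⟨-, -, -, -, hτ, -, -, hpos⟩ := hM
    fin_cases i
    · exact contDiffOn_id
    · exact smooth_g hτ hpos

lemma abs_sub_le_lift (M : Model) (w1 w2 : ℝ) : |w1 - w2| ≤ ‖M.lift w1 - M.lift w2‖ := by
  cases M with
  | scalar I κ f b c lam1 => exact norm_le_pi_norm ((scalar I κ f b c lam1).lift w1 - (scalar I κ f b c lam1).lift w2) 0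
  | system I κ f τ b c lam1 lam2 =>
    exact norm_le_pi_norm ((system I κ f τ b c lam1 lam2).lift w1 -
      (system I κ f τ b c lam1 lam2).lift w2) 0

end Model

/-- Bounds for smooth functions along curves. -/
lemma exists_curve_bounds {I : Set ℝ} {φ : ℝ → ℝ} {a b V : ℝ} (hI : IsOpen I)
    (hφ : ContDiffOn ℝ ∞ φ I) (hab : Icc a b ⊆ I) (hV : 0 ≤ V) : ∃ C > 0,
      ∀ w1 ∈ Icc a b, ∀ w2 ∈ Icc a b, |φ w1 - φ w2| ≤ C * |w1 - w2| ∧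
        ∀ p1 p2 : ℝ, |p1| ≤ V → |deriv φ w1 * p1| ≤ C * |p1| ∧
          |deriv φ w1 * p1 - deriv φ w2 * p2| ≤ C * (|w1 - w2| + |p1 - p2|) := by
  obtain ⟨C0, hC0, h0⟩ := exists_lipschitz hI hφ hab
  obtain ⟨C1, hC1, h1⟩ := exists_lipschitz hI (contDiffOn_deriv hI hφ) hab
  obtain ⟨C2, hC2, h2⟩ := exists_bound_of_contDiffOn (contDiffOn_deriv hI hφ) hab
  refine ⟨C0 + C1 * V + C2, by positivity, fun w1 hw1 w2 hw2 => ⟨(h0 _ hw1 _ hw2).trans ?_,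
    fun p1 p2 hp1 => ⟨?_, ?_⟩⟩⟩
  · gcongr; nlinarith [mul_nonneg hC1.le hV]
  · rw [abs_mul]
    have := h2 _ hw1
    gcongr; nlinarith [mul_nonneg hC1.le hV, mul_nonneg hC0.le hV]
  · have e : deriv φ w1 * p1 - deriv φ w2 * p2 =
        (deriv φ w1 - deriv φ w2) * p1 + deriv φ w2 * (p1 - p2) := by ring
    rw [e]
    refine (abs_add_le _ _).trans ?_
    rw [abs_mul, abs_mul]
    calc _ ≤ C1 * |w1 - w2| * V + C2 * |p1 - p2| := by
          gcongr
          · exact h1 _ hw1 _ hw2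
          · exact h2 _ hw2
      _ ≤ _ := by
          have := abs_nonneg (w1 - w2)
          have := abs_nonneg (p1 - p2)
          have : 0 ≤ C0 * |w1 - w2| := by positivity
          have : 0 ≤ C0 * |p1 - p2| := by positivity
          have : 0 ≤ C1 * V * |p1 - p2| := by positivity
          have : 0 ≤ C2 * |w1 - w2| := by positivity
          nlinarith

namespace Model

variable {M : Model} {vl vs vr : ℝ}

lemma exists_lift_bounds (hM : M.Admissible) {a b V : ℝ} (hab : Icc a b ⊆ M.I) (hV : 0 ≤ V) :
    ∃ C > 0, ∀ (v u : ℝ → ℝ) (x y : ℝ), DifferentiableAt ℝ v x → DifferentiableAt ℝ u y →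
      v x ∈ Icc a b → u y ∈ Icc a b → |deriv v x| ≤ V →
      ‖M.lift (v x) - M.lift (u y)‖ ≤ C * |v x - u y| ∧
      ‖deriv (fun t => M.lift (v t)) x‖ ≤ C * |deriv v x| ∧
      ‖deriv (fun t => M.lift (v t)) x - deriv (fun t => M.lift (u t)) y‖ ≤
        C * (|v x - u y| + |deriv v x - deriv u y|) := by
  choose C hC h using fun i => exists_curve_bounds (isOpen hM) (smooth_lift hM i) hab hV
  have hle : ∀ i, C i ≤ 1 + ∑ k, C k := fun i => by
    have := single_le_sum (f := C) (fun k _ => (hC k).le) (Finset.mem_univ i)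
    linarith
  have hpos : 0 < 1 + ∑ k, C k := by
    have : 0 ≤ ∑ k, C k := sum_nonneg fun k _ => (hC k).le
    linarith
  have hder : ∀ (v : ℝ → ℝ) (x : ℝ), DifferentiableAt ℝ v x → v x ∈ Icc a b → ∀ i,
      deriv (fun t => M.lift (v t)) x i = deriv (fun w => M.lift w i) (v x) * deriv v x := fun v x hv hx i => by
    have h1 : HasDerivAt (fun t => M.lift (v t))
        (fun i => deriv (fun w => M.lift w i) (v x) * deriv v x) x :=
      hasDerivAt_pi.2 fun i => (hasDerivAt_of_contDiffOn (isOpen hM) (smooth_lift hM i) (by simp)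
        (hab hx)).comp x hv.hasDerivAt
    rw [h1.deriv]
  refine ⟨1 + ∑ k, C k, hpos, fun v u x y hv hu hvx huy hV' => ⟨?_, ?_, ?_⟩⟩
  · refine (pi_norm_le_iff_of_nonneg (by positivity)).2 fun i => ?_
    have := hle i
    exact (h i _ hvx _ huy).1.trans (by gcongr)
  · refine (pi_norm_le_iff_of_nonneg (by positivity)).2 fun i => ?_
    have := hle i
    rw [hder v x hv hvx]; exact ((h i _ hvx _ huy).2 _ 0 hV').1.trans (by gcongr)
  · refine (pi_norm_le_iff_of_nonneg (by positivity)).2 fun i => ?_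
    have := hle i
    rw [Pi.sub_apply, hder v x hv hvx, hder u y hu huy]
    exact ((h i _ hvx _ huy).2 _ _ hV').2.trans (by gcongr)

lemma solitonDecay_of_decays (hM : M.Admissible) {a b C α : ℝ} {ul ur : ℝ → ℝ}
    (hab : Icc a b ⊆ M.I) (hs : vs ∈ Icc a b) (hC : 0 < C) (hα : 0 < α)
    (hl : Decays a b vs α C ul) (hr : Decays a b vs α C ur) (hdl : Differentiable ℝ ul)
    (hdr : Differentiable ℝ ur) : M.SolitonDecay vs ul ur α := by
  obtain ⟨D, hD, h⟩ := exists_lift_bounds hM hab hC.le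
  refine ⟨D * C, by positivity, ?_⟩
  have key : ∀ u, Decays a b vs α C u → Differentiable ℝ u → ∀ x : ℝ,
      ‖M.lift (u x) - M.lift vs‖ + ‖deriv (fun y => M.lift (u y)) x‖ ≤
        D * C * exp (-α * |x|) := fun u hu hdu x => by
    have h0 := hu.upper x
    have hV : |deriv u x| ≤ C := by
      have : C * exp (-α * |x|) ≤ C * 1 := by
        gcongr; exact exp_le_one_iff.2 (by nlinarith [abs_nonneg x])
      linarith [abs_nonneg (u x - vs)]
    obtain ⟨h1, h2, -⟩ := h u (fun _ => vs) x x (hdu x) (differentiableAt_const _) (hu.mem x) hs hV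
    calc _ ≤ D * |u x - vs| + D * |deriv u x| := add_le_add h1 h2
      _ = D * (|u x - vs| + |deriv u x|) := by ring
      _ ≤ D * (C * exp (-α * |x|)) := by gcongr
      _ = _ := by ring
  rintro u (rfl | rfl)
  exacts [key _ hl hdl, key _ hr hdr]

lemma SolitonDecay.rate_le {a b C α ν : ℝ} {ul ur : ℝ → ℝ} (hC : 0 < C)
    (hr : Decays a b vs α C ur) (h : M.SolitonDecay vs ul ur ν) : ν ≤ α := by
  obtain ⟨D, hD, h⟩ := h
  by_contra hlt
  have hbd : ∀ x : ℝ, 0 ≤ x → exp ((ν - α) * x) ≤ C * D := fun x hx => by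
    have h1 := h ur (by simp) x
    have h2 := hr.lower x
    have h3 := M.abs_sub_le_lift (ur x) vs
    rw [abs_of_nonneg hx] at h1 h2
    have h4 : exp (-α * x) ≤ C * (D * exp (-ν * x)) :=
      h2.trans (by gcongr; linarith [norm_nonneg (deriv (fun y => M.lift (ur y)) x)])
    have h5 := mul_le_mul_of_nonneg_right h4 (exp_nonneg (ν * x))
    rw [← exp_add, mul_assoc, mul_assoc, ← exp_add, neg_mul, neg_mul ν, neg_add_cancel,
      Real.exp_zero, mul_one] at h5
    rwa [show (ν - α) * x = -(α * x) + ν * x by ring]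
  have hlim : Tendsto (fun x : ℝ => exp ((ν - α) * x)) atTop atTop :=
    Real.tendsto_exp_atTop.comp (tendsto_id.const_mul_atTop (by linarith))
  obtain ⟨x, hx, hx'⟩ := ((hlim.eventually_gt_atTop (C * D)).and (eventually_ge_atTop 0)).exists
  exact absurd (hbd x hx') (not_le.2 hx)

/-- States along a pulse that follows a soliton are exponentially close to those of the soliton. -/
lemma exists_lift_bound_of_follows (hM : M.Admissible) {a b C α : ℝ} (hab : Icc a b ⊆ M.I) (hC : 0 < C)
    (hα : 0 < α) : ∃ D > 0, ∀ (v u : ℝ → ℝ) (X : ℝ), Follows a b vs α C X v u →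
      (∀ y, u y ∈ Icc a b) → Differentiable ℝ v → Differentiable ℝ u → ∀ y ∈ Icc (-X) X,
      ‖M.lift (v y) - M.lift (u y)‖ +
        ‖deriv (fun x => M.lift (v x)) y - deriv (fun x => M.lift (u x)) y‖ ≤
        D * exp (-α * X) := by
  obtain ⟨D, hD, h⟩ := exists_lift_bounds hM hab hC.le
  refine ⟨2 * D * C, by positivity, fun v u X hf hu hdv hdu y hy => ?_⟩
  have h0 := hf.decay y hy
  have hV : |deriv v y| ≤ C := by
    have : C * exp (-α * |y|) ≤ C * 1 := by
      gcongr; exact exp_le_one_iff.2 (by nlinarith [abs_nonneg y])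
    linarith [abs_nonneg (v y - vs)]
  obtain ⟨h1, -, h2⟩ := h v u y y (hdv y) (hdu y) (hf.mem y hy) (hu y) hV
  have h3 := hf.diff y hy
  have h4 : exp (-α * (2 * X - |y|)) ≤ exp (-α * X) := by
    refine exp_le_exp.2 ?_
    have : |y| ≤ X := abs_le.2 hy
    nlinarith
  calc _ ≤ D * |v y - u y| + D * (|v y - u y| + |deriv v y - deriv u y|) := add_le_add h1 h2
    _ ≤ D * (|v y - u y| + |deriv v y - deriv u y|) +
        D * (|v y - u y| + |deriv v y - deriv u y|) := by
        gcongr; linarith [abs_nonneg (deriv v y - deriv u y)]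
    _ ≤ D * (C * exp (-α * X)) + D * (C * exp (-α * X)) := by gcongr <;> exact h3.trans (by gcongr)
    _ = _ := by ring

end Model

end

section

/-! ### The coefficient family of the spectral problem -/

namespace Model

/-- Part of `q₀` depending on the value only. -/
def qValue (κ W f : ℝ → ℝ) (w : ℝ) : ℝ := deriv (deriv f) w - deriv κ w * (-deriv W w / κ w)

/-- Coefficient of the squared slope in `q₀`. -/
def qSlope (κ : ℝ → ℝ) (w : ℝ) : ℝ :=
  -(1 / 2) * deriv (deriv κ) w - deriv κ w * (-deriv κ w / (2 * κ w))

lemma q₀_eq {I : Set ℝ} {κ W f v : ℝ → ℝ} {vs μ : ℝ} (h : Saddle I κ W vs) (hv : IsOrbit I κ W μ v)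
    (x : ℝ) : q₀ κ f v x = qValue κ W f (v x) + qSlope κ (v x) * deriv v x ^ 2 := by
  have h1 := (hasDerivAt_of_contDiffOn h.isOpen (contDiffOn_deriv h.isOpen h.smooth_κ) (by simp)
    (hv.mem x)).comp x (hv.hasDerivAt x)
  have h2 : deriv (fun y => deriv κ (v y) * deriv v y) x = _ := (h1.mul (hv.hasDerivAt_deriv x)).deriv
  rw [q₀, h2, hv.deriv_deriv h.pos, acc, qValue, qSlope, Function.comp_apply]; ring

lemma smooth_qValue {I : Set ℝ} {κ W f : ℝ → ℝ} {vs : ℝ} (h : Saddle I κ W vs)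
    (hf : ContDiffOn ℝ ∞ f I) : ContDiffOn ℝ ∞ (qValue κ W f) I :=
  (contDiffOn_deriv h.isOpen (contDiffOn_deriv h.isOpen hf)).sub
    ((contDiffOn_deriv h.isOpen h.smooth_κ).mul h.smooth_acc₀)

lemma smooth_qSlope {I : Set ℝ} {κ W : ℝ → ℝ} {vs : ℝ} (h : Saddle I κ W vs) :
    ContDiffOn ℝ ∞ (qSlope κ) I :=
  (contDiffOn_const.mul (contDiffOn_deriv h.isOpen (contDiffOn_deriv h.isOpen h.smooth_κ))).sub
    ((contDiffOn_deriv h.isOpen h.smooth_κ).mul h.smooth_acc₁)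

/-- Off-diagonal entry of the Hessian as a function of the value. -/
def aValue (τ : ℝ → ℝ) (b c lam2 w : ℝ) : ℝ := deriv τ w * g τ b c lam2 w + c / b

lemma smooth_aValue {I : Set ℝ} {τ : ℝ → ℝ} {b c lam2 : ℝ} (hI : IsOpen I) (hτ : ContDiffOn ℝ ∞ τ I)
    (hpos : ∀ v ∈ I, 0 < τ v) : ContDiffOn ℝ ∞ (aValue τ b c lam2) I :=
  ((contDiffOn_deriv hI hτ).mul (smooth_g hτ hpos)).add contDiffOn_const

/-- Upper left entry of the reduced Hessian as a function of the value. -/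
def qaValue (κ W f τ : ℝ → ℝ) (b c lam2 w : ℝ) : ℝ :=
  qValue κ W f w + 1 / 2 * deriv (deriv τ) w * g τ b c lam2 w ^ 2 - aValue τ b c lam2 w ^ 2 / τ w

lemma smooth_qaValue {I : Set ℝ} {κ W f τ : ℝ → ℝ} {vs b c lam2 : ℝ} (h : Saddle I κ W vs)
    (hf : ContDiffOn ℝ ∞ f I) (hτ : ContDiffOn ℝ ∞ τ I) (hpos : ∀ v ∈ I, 0 < τ v) :
    ContDiffOn ℝ ∞ (qaValue κ W f τ b c lam2) I :=
  ((smooth_qValue h hf).add ((contDiffOn_const.mul (contDiffOn_deriv h.isOpen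
    (contDiffOn_deriv h.isOpen hτ))).mul ((smooth_g hτ hpos).pow 2))).sub
    (((smooth_aValue h.isOpen hτ hpos).pow 2).div hτ fun v hv => (hpos v hv).ne')

/-- Coefficients of the first-order system as functions of value and slope. -/
def coeff : (M : Model) → CoeffFamily (Fin M.dim)
  | scalar I κ f b c lam1 =>
    { value := fun i j w => (!![0, 1 / κ w, 0;
        qValue κ (scalar I κ f b c lam1).W f w + c / b, 0, -1;
        0, 0, 0] : Matrix (Fin 3) (Fin 3) ℝ) i j
      slope := fun i j w => (!![0, 0, 0; qSlope κ w, 0, 0; 0, 0, 0] : Matrix (Fin 3) (Fin 3) ℝ) i j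
      spectral := fun i j _ => (!![0, 0, 0; 0, 0, 0; 1 / b, 0, 0] : Matrix (Fin 3) (Fin 3) ℝ) i j }
  | system I κ f τ b c lam1 lam2 =>
    { value := fun i j w => (!![0, 1 / κ w, 0, 0;
        qaValue κ (system I κ f τ b c lam1 lam2).W f τ b c lam2 w, 0, -1, aValue τ b c lam2 w / τ w;
        0, 0, 0, 0;
        0, 0, 0, 0] : Matrix (Fin 4) (Fin 4) ℝ) i j
      slope := fun i j w => (!![0, 0, 0, 0; qSlope κ w, 0, 0, 0; 0, 0, 0, 0; 0, 0, 0, 0] :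
        Matrix (Fin 4) (Fin 4) ℝ) i j
      spectral := fun i j w => (!![0, 0, 0, 0; 0, 0, 0, 0;
        -(1 / b) * (aValue τ b c lam2 w / τ w), 0, 0, 1 / b / τ w;
        1 / b, 0, 0, 0] : Matrix (Fin 4) (Fin 4) ℝ) i j }

variable {M : Model} {vs : ℝ}

lemma smooth_coeff (hM : M.Admissible) (hs : Saddle M.I M.κ M.W vs) : M.coeff.Smooth M.I := by
  cases M with
  | scalar I κ f b c lam1 =>
    have hf : ContDiffOn ℝ ∞ f I := hM.2.2.2.1
    have h1 : ContDiffOn ℝ ∞ (fun w => 1 / κ w) I :=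
      contDiffOn_const.div hs.smooth_κ fun v hv => (hs.pos v hv).ne'
    have h2 := (smooth_qValue hs hf).add (contDiffOn_const (c := c / b))
    have h3 := smooth_qSlope hs
    refine ⟨fun i j => ?_, fun i j => ?_, fun i j => contDiffOn_const⟩ <;>
    fin_cases i <;> fin_cases j <;> first
      | exact contDiffOn_const
      | exact h1
      | exact h2
      | exact h3
  | system I κ f τ b c lam1 lam2 =>
    obtain ⟨-, -, -, hf, hτ, -, -, hpos⟩ := hM
    have h1 : ContDiffOn ℝ ∞ (fun w => 1 / κ w) I :=
      contDiffOn_const.div hs.smooth_κ fun v hv => (hs.pos v hv).ne'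
    have h2 := smooth_qaValue (b := b) (c := c) (lam2 := lam2) hs hf hτ hpos
    have h3 := smooth_qSlope hs
    have h4 : ContDiffOn ℝ ∞ (fun w => aValue τ b c lam2 w / τ w) I :=
      (smooth_aValue hs.isOpen hτ hpos).div hτ fun v hv => (hpos v hv).ne'
    have h5 : ContDiffOn ℝ ∞ (fun w => -(1 / b) * (aValue τ b c lam2 w / τ w)) I :=
      contDiffOn_const.mul h4
    have h6 : ContDiffOn ℝ ∞ (fun w => 1 / b / τ w) I :=
      contDiffOn_const.div hτ fun v hv => (hpos v hv).ne'
    refine ⟨fun i j => ?_, fun i j => ?_, fun i j => ?_⟩ <;>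
    fin_cases i <;> fin_cases j <;> first
      | exact contDiffOn_const
      | exact h1
      | exact h2
      | exact h3
      | exact h4
      | exact h5
      | exact h6

lemma A_eq_eval (hs : Saddle M.I M.κ M.W vs) {μ : ℝ} {v : ℝ → ℝ} (hv : IsOrbit M.I M.κ M.W μ v)
    (x : ℝ) (z : ℂ) : M.A v x z = M.coeff.eval (v x) (deriv v x) z := by
  cases M with
  | scalar I κ f b c lam1 =>
    have h1 := q₀_eq (f := f) hs hv x
    ext i j
    fin_cases i <;> fin_cases j <;> simp [A, coeff, CoeffFamily.eval, qS]
    · have h2 : q₀ κ f v x = qValue κ (scalar I κ f b c lam1).W f (v x) +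
          qSlope κ (v x) * deriv v x ^ 2 := h1
      rw [h2]
      push_cast; ring
    · rw [div_eq_mul_inv]
  | system I κ f τ b c lam1 lam2 =>
    have h1 := q₀_eq (f := f) hs hv x
    ext i j
    fin_cases i <;> fin_cases j <;> simp [A, coeff, CoeffFamily.eval, qE, aE, aValue, qaValue]
    · have h2 : q₀ κ f v x = qValue κ (system I κ f τ b c lam1 lam2).W f (v x) +
          qSlope κ (v x) * deriv v x ^ 2 := h1
      rw [h2]
      push_cast; ring
    all_goals ring

lemma trace_coeff (w p : ℝ) (z : ℂ) : (M.coeff.eval w p z).trace = 0 := by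
  cases M with
  | scalar I κ f b c lam1 =>
    rw [Matrix.trace, Fin.sum_univ_three]; simp [coeff, CoeffFamily.eval]
  | system I κ f τ b c lam1 lam2 =>
    rw [Matrix.trace, Fin.sum_univ_four]; simp [coeff, CoeffFamily.eval]

lemma isOrbit_const {I : Set ℝ} {κ W : ℝ → ℝ} (hs : Saddle I κ W vs) :
    IsOrbit I κ W (W vs) fun _ => vs :=
  ⟨contDiff_const, fun _ => hs.mem, fun x => by simp, fun x => by simp [hs.crit]⟩

lemma Ainf_eq_eval (hs : Saddle M.I M.κ M.W vs) (z : ℂ) : M.Ainf vs z = M.coeff.eval vs 0 z := by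
  rw [Ainf, A_eq_eval hs (isOrbit_const hs), deriv_const]

end Model

/-! ### Padding a system of order three -/

section

variable {R : Type*} [CommRing R]

/-- Block diagonal extension of a `3 × 3` matrix by a scalar. -/
def padMatrix (X : Matrix (Fin 3) (Fin 3) R) (s : R) : Matrix (Fin 4) (Fin 4) R :=
  Matrix.reindex finSumFinEquiv finSumFinEquiv
    (Matrix.fromBlocks X 0 0 (Matrix.of fun _ _ : Fin 1 => s))

/-- Entrywise description of padding. -/
lemma forall_padMatrix {P : Fin 4 → Fin 4 → Prop}
    (h1 : ∀ i j : Fin 3, P (finSumFinEquiv (Sum.inl i : Fin 3 ⊕ Fin 1))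
      (finSumFinEquiv (Sum.inl j : Fin 3 ⊕ Fin 1)))
    (h2 : ∀ i : Fin 3, P (finSumFinEquiv (Sum.inl i : Fin 3 ⊕ Fin 1))
      (finSumFinEquiv (Sum.inr 0 : Fin 3 ⊕ Fin 1)))
    (h3 : ∀ j : Fin 3, P (finSumFinEquiv (Sum.inr 0 : Fin 3 ⊕ Fin 1))
      (finSumFinEquiv (Sum.inl j : Fin 3 ⊕ Fin 1)))
    (h4 : P (finSumFinEquiv (Sum.inr 0 : Fin 3 ⊕ Fin 1))
      (finSumFinEquiv (Sum.inr 0 : Fin 3 ⊕ Fin 1))) (i j : Fin 4) : P i j := by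
  obtain ⟨i, rfl⟩ := (finSumFinEquiv (m := 3) (n := 1)).surjective i
  obtain ⟨j, rfl⟩ := (finSumFinEquiv (m := 3) (n := 1)).surjective j
  rcases i with i | i <;> rcases j with j | j
  · exact h1 i j
  · rw [Subsingleton.elim j 0]; exact h2 i
  · rw [Subsingleton.elim i 0]; exact h3 j
  · rw [Subsingleton.elim i 0, Subsingleton.elim j 0]; exact h4

lemma padMatrix_inl (X : Matrix (Fin 3) (Fin 3) R) (s : R) (i j : Fin 3) :
    padMatrix X s (finSumFinEquiv (Sum.inl i : Fin 3 ⊕ Fin 1))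
      (finSumFinEquiv (Sum.inl j : Fin 3 ⊕ Fin 1)) = X i j := by
  simp [padMatrix]

lemma padMatrix_mul (X Y : Matrix (Fin 3) (Fin 3) R) (s t : R) :
    padMatrix X s * padMatrix Y t = padMatrix (X * Y) (s * t) := by
  simp only [padMatrix, reindex_apply, Matrix.submatrix_mul_equiv, Matrix.fromBlocks_multiply]
  congr 1
  simp only [Matrix.mul_zero, Matrix.zero_mul, add_zero, zero_add]
  congr 1
  ext i j; simp [Matrix.mul_apply]

lemma padMatrix_one : padMatrix (1 : Matrix (Fin 3) (Fin 3) R) 1 = 1 := by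
  have h : (Matrix.of fun _ _ : Fin 1 => (1 : R)) = 1 := by ext i j; fin_cases i; fin_cases j; rfl
  rw [padMatrix, h, Matrix.fromBlocks_one, reindex_apply, Matrix.submatrix_one_equiv]

lemma padMatrix_add (X Y : Matrix (Fin 3) (Fin 3) R) (s t : R) :
    padMatrix X s + padMatrix Y t = padMatrix (X + Y) (s + t) := by
  ext i j
  revert i j
  refine forall_padMatrix ?_ ?_ ?_ ?_ <;> intros <;> simp [padMatrix]

lemma padMatrix_sub (X Y : Matrix (Fin 3) (Fin 3) R) (s t : R) :
    padMatrix X s - padMatrix Y t = padMatrix (X - Y) (s - t) := by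
  rw [sub_eq_iff_eq_add, padMatrix_add, sub_add_cancel, sub_add_cancel]

lemma padMatrix_smul (r : R) (X : Matrix (Fin 3) (Fin 3) R) (s : R) :
    r • padMatrix X s = padMatrix (r • X) (r * s) := by
  ext i j
  revert i j
  refine forall_padMatrix ?_ ?_ ?_ ?_ <;> intros <;> simp [padMatrix]

lemma det_padMatrix (X : Matrix (Fin 3) (Fin 3) R) (s : R) : (padMatrix X s).det = X.det * s := by
  rw [padMatrix, Matrix.det_reindex_self, Matrix.det_fromBlocks_zero₂₁, Matrix.det_fin_one]; rfl

lemma trace_padMatrix (X : Matrix (Fin 3) (Fin 3) R) (s : R) :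
    (padMatrix X s).trace = X.trace + s := by
  rw [Matrix.trace, ← (finSumFinEquiv (m := 3) (n := 1)).sum_comp, Fintype.sum_sum_type]
  simp [padMatrix, Matrix.trace]

lemma padMatrix_inv {K : Type*} [Field K] {X : Matrix (Fin 3) (Fin 3) K} {s : K} (hX : IsUnit X)
    (hs : s ≠ 0) : (padMatrix X s)⁻¹ = padMatrix X⁻¹ s⁻¹ := by
  refine Matrix.inv_eq_right_inv ?_
  rw [padMatrix_mul, mul_nonsing_inv _ (isUnit_det hX), mul_inv_cancel₀ hs, padMatrix_one]

lemma isUnit_padMatrix {K : Type*} [Field K] {X : Matrix (Fin 3) (Fin 3) K} {s : K} :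
    IsUnit (padMatrix X s) ↔ IsUnit X ∧ s ≠ 0 := by
  rw [isUnit_iff_isUnit_det, isUnit_iff_isUnit_det, det_padMatrix, isUnit_iff_ne_zero,
    isUnit_iff_ne_zero, mul_ne_zero_iff]

end

namespace CoeffFamily

variable (F : CoeffFamily (Fin 3)) (s : ℝ)

/-- Extension of a coefficient family by a decoupled scalar equation. -/
def pad : CoeffFamily (Fin 4) where
  value := fun i j w => padMatrix (Matrix.of fun i j => F.value i j w) s i j
  slope := fun i j w => padMatrix (Matrix.of fun i j => F.slope i j w) 0 i j
  spectral := fun i j w => padMatrix (Matrix.of fun i j => F.spectral i j w) 0 i j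

lemma eval_pad (w p : ℝ) (z : ℂ) : (F.pad s).eval w p z = padMatrix (F.eval w p z) s := by
  ext i j
  revert i j
  refine forall_padMatrix ?_ ?_ ?_ ?_ <;> intros <;> simp [eval, pad, padMatrix]

variable {F} in
lemma Smooth.pad {I : Set ℝ} (hF : F.Smooth I) : (F.pad s).Smooth I := by
  refine ⟨?_, ?_, ?_⟩ <;> refine forall_padMatrix ?_ ?_ ?_ ?_ <;> intros <;>
    simp only [CoeffFamily.pad, padMatrix, reindex_apply, submatrix_apply,
      Equiv.symm_apply_apply, Matrix.fromBlocks_apply₁₁, Matrix.fromBlocks_apply₁₂,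
      Matrix.fromBlocks_apply₂₁, Matrix.fromBlocks_apply₂₂, of_apply, Matrix.zero_apply]
  all_goals first
    | exact contDiffOn_const
    | exact hF.value _ _
    | exact hF.slope _ _
    | exact hF.spectral _ _

end CoeffFamily

end

section

/-! ### Spectral projections -/

section

open Matrix

variable {n : Type} [Fintype n] [DecidableEq n] {A E : Matrix n n ℂ} {σ : ℝ}

lemma mem_spectrum_iff_exists {μ : ℂ} : μ ∈ spectrum ℂ A ↔ ∃ w ≠ 0, A *ᵥ w = μ • w := by
  rw [← Matrix.spectrum_toLin', ← Module.End.hasEigenvalue_iff_mem_spectrum]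
  constructor
  · intro h
    obtain ⟨w, hw⟩ := h.exists_hasEigenvector
    exact ⟨w, hw.2, by simpa using hw.apply_eq_smul⟩
  · rintro ⟨w, hw, h⟩
    exact Module.End.hasEigenvalue_of_hasEigenvector
      (Module.End.hasEigenvector_iff.2 ⟨Module.End.mem_eigenspace_iff.2 (by simpa using h), hw⟩)

/-- `E` is a projection commuting with `A`; on its range the eigenvalues of `A` have real part at
least `σ`, on its kernel at most `-σ`. -/
structure IsSpectralProj (A E : Matrix n n ℂ) (σ : ℝ) : Prop where
  idem : E * E = E
  comm : A * E = E * A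
  unstable : ∀ (w : n → ℂ) (μ : ℂ), w ≠ 0 → E *ᵥ w = w → A *ᵥ w = μ • w → σ ≤ μ.re
  stable : ∀ (w : n → ℂ) (μ : ℂ), w ≠ 0 → E *ᵥ w = 0 → A *ᵥ w = μ • w → μ.re ≤ -σ

/-- Full rank factorization of a projection. -/
lemma exists_factor (hE : E * E = E) : ∃ (k : ℕ) (R : Matrix n (Fin k) ℂ)
    (L : Matrix (Fin k) n ℂ), L * R = 1 ∧ R * L = E := by
  set b := Module.finBasis ℂ (LinearMap.range E.mulVecLin) with hb
  set R : Matrix n (Fin _) ℂ := Matrix.of fun i k => (b k : n → ℂ) i with hR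
  set L : Matrix (Fin _) n ℂ := Matrix.of fun k j => b.repr ⟨E *ᵥ Pi.single j 1, ⟨_, rfl⟩⟩ k with hL
  have hRL : R * L = E := by
    ext i j
    have h1 := congrArg (fun w : LinearMap.range E.mulVecLin => (w : n → ℂ) i)
      (b.sum_repr ⟨E *ᵥ Pi.single j 1, ⟨_, rfl⟩⟩)
    simp only [Submodule.coe_sum, Submodule.coe_smul, Finset.sum_apply, Pi.smul_apply,
      smul_eq_mul, mulVec_single_one] at h1
    rw [Matrix.mul_apply]
    simp only [hR, hL, of_apply, mulVec_single_one]
    exact (sum_congr rfl fun k _ => mul_comm _ _).trans h1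
  have hinj : Function.Injective R.mulVec := by
    rw [Matrix.mulVec_injective_iff]
    have h1 : R.col = (LinearMap.range E.mulVecLin).subtype ∘ b := rfl
    rw [h1]; exact b.linearIndependent.map' _ (Submodule.ker_subtype _)
  have hER : E * R = R := by
    ext i k
    obtain ⟨w, hw⟩ := (b k).2
    have h1 : E *ᵥ (b k : n → ℂ) = b k := by rw [← hw, mulVecLin_apply, mulVec_mulVec, hE]
    exact congrFun h1 i
  refine ⟨_, R, L, ?_, hRL⟩
  refine ext_of_mulVec_single fun j => hinj ?_
  rw [mulVec_mulVec, ← Matrix.mul_assoc, hRL, hER, mulVec_mulVec, Matrix.mul_one]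

namespace SpectralFrame

variable (F : SpectralFrame A)

lemma blocks : F.Lm * F.Rm = 1 ∧ F.Lm * F.Rp = 0 ∧ F.Lp * F.Rm = 0 ∧ F.Lp * F.Rp = 1 := by
  have h := F.left_inv
  rw [fromRows_mul_fromCols, ← fromBlocks_one, fromBlocks_inj] at h; exact h

lemma sum_proj : F.projUnstable + F.projStable = 1 := by
  have h := F.right_inv
  rwa [fromCols_mul_fromRows] at h

lemma projUnstable_mulVec {w : n → ℂ} (hw : w ∈ unstableSubspace A) : F.projUnstable *ᵥ w = w := by
  rw [← F.span_m, ← range_mulVecLin] at hw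
  obtain ⟨c, rfl⟩ := hw
  rw [mulVecLin_apply, projUnstable, mulVec_mulVec, Matrix.mul_assoc, F.blocks.1, Matrix.mul_one]

lemma projUnstable_mulVec_stable {w : n → ℂ} (hw : w ∈ stableSubspace A) :
    F.projUnstable *ᵥ w = 0 := by
  rw [← F.span_p, ← range_mulVecLin] at hw
  obtain ⟨c, rfl⟩ := hw
  rw [mulVecLin_apply, projUnstable, mulVec_mulVec, Matrix.mul_assoc, F.blocks.2.1, Matrix.mul_zero,
    zero_mulVec]

lemma projUnstable_mem (w : n → ℂ) : F.projUnstable *ᵥ w ∈ unstableSubspace A := by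
  rw [← F.span_m, ← range_mulVecLin, projUnstable, ← mulVec_mulVec]; exact ⟨_, rfl⟩

lemma projStable_mem (w : n → ℂ) : F.projStable *ᵥ w ∈ stableSubspace A := by
  rw [← F.span_p, ← range_mulVecLin, projStable, ← mulVec_mulVec]; exact ⟨_, rfl⟩

lemma decomp (w : n → ℂ) : w = F.projUnstable *ᵥ w + F.projStable *ᵥ w := by
  rw [← add_mulVec, F.sum_proj, one_mulVec]

lemma projUnstable_unique (F' : SpectralFrame A) : F.projUnstable = F'.projUnstable := by
  refine ext_of_mulVec_single fun j => ?_
  set w : n → ℂ := Pi.single j 1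
  conv_lhs => rw [F'.decomp w]
  rw [mulVec_add, F.projUnstable_mulVec (F'.projUnstable_mem w),
    F.projUnstable_mulVec_stable (F'.projStable_mem w), add_zero]

lemma trace_projUnstable : F.projUnstable.trace = F.nu := by
  rw [projUnstable, trace_mul_comm, F.blocks.1, trace_one, card_fin]

lemma trace_projStable : F.projStable.trace = F.ns := by
  rw [projStable, trace_mul_comm, F.blocks.2.2.2, trace_one, card_fin]

lemma nu_add_ns : F.nu + F.ns = card n := by
  have h := congrArg trace F.sum_proj
  rw [trace_add, F.trace_projUnstable, F.trace_projStable, trace_one] at h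
  exact_mod_cast h

lemma trace_mul_projStable (hA : A.trace = 0) :
    (A * F.projStable).trace = -(A * F.projUnstable).trace := by
  have h := congrArg trace (congrArg (A * ·) F.sum_proj)
  simp only [mul_add, trace_add, mul_one, hA] at h
  exact eq_neg_of_add_eq_zero_right h

end SpectralFrame

lemma mulVec_mem_iSup {ι : Type} {s : ι → ℂ} {w : n → ℂ}
    (hw : w ∈ ⨆ μ : ι, Module.End.maxGenEigenspace (Matrix.toLin' A) (s μ)) :
    A *ᵥ w ∈ ⨆ μ : ι, Module.End.maxGenEigenspace (Matrix.toLin' A) (s μ) := by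
  have h : (⨆ μ : ι, Module.End.maxGenEigenspace (Matrix.toLin' A) (s μ)) ≤
      (⨆ μ : ι, Module.End.maxGenEigenspace (Matrix.toLin' A) (s μ)).comap (Matrix.toLin' A) :=
    iSup_le fun μ v hv => Submodule.mem_iSup_of_mem μ
      (Module.End.mapsTo_maxGenEigenspace_of_comm (Commute.refl _) (s μ) hv)
  exact h hw

lemma SpectralFrame.comm (F : SpectralFrame A) : A * F.projUnstable = F.projUnstable * A := by
  refine ext_of_mulVec_single fun j => ?_
  set w : n → ℂ := Pi.single j 1
  have h1 : A *ᵥ (F.projUnstable *ᵥ w) ∈ unstableSubspace A :=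
    mulVec_mem_iSup (s := fun μ : {μ : ℂ // 0 < μ.re} => (μ : ℂ)) (F.projUnstable_mem w)
  have h2 : A *ᵥ (F.projStable *ᵥ w) ∈ stableSubspace A :=
    mulVec_mem_iSup (s := fun μ : {μ : ℂ // μ.re < 0} => (μ : ℂ)) (F.projStable_mem w)
  rw [← mulVec_mulVec, ← mulVec_mulVec]
  conv_rhs => rw [F.decomp w, mulVec_add, mulVec_add, F.projUnstable_mulVec h1,
    F.projUnstable_mulVec_stable h2, add_zero]

lemma mem_unstableSubspace {w : n → ℂ} {μ : ℂ} (hμ : 0 < μ.re) (h : A *ᵥ w = μ • w) :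
    w ∈ unstableSubspace A :=
  Submodule.mem_iSup_of_mem (⟨μ, hμ⟩ : {μ : ℂ // 0 < μ.re})
    (Module.End.eigenspace_le_maxGenEigenspace (Module.End.mem_eigenspace_iff.2 (by simpa using h)))

lemma mem_stableSubspace {w : n → ℂ} {μ : ℂ} (hμ : μ.re < 0) (h : A *ᵥ w = μ • w) :
    w ∈ stableSubspace A :=
  Submodule.mem_iSup_of_mem (⟨μ, hμ⟩ : {μ : ℂ // μ.re < 0})
    (Module.End.eigenspace_le_maxGenEigenspace (Module.End.mem_eigenspace_iff.2 (by simpa using h)))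

lemma SpectralFrame.isSpectralProj (F : SpectralFrame A) (hσ : 0 < σ)
    (h : ∀ μ ∈ spectrum ℂ A, σ ≤ |μ.re|) : IsSpectralProj A F.projUnstable σ where
  idem := by
    rw [SpectralFrame.projUnstable, Matrix.mul_assoc, ← Matrix.mul_assoc F.Lm, F.blocks.1,
      Matrix.one_mul]
  comm := F.comm
  unstable := fun w μ hw hE hA => by
    have h1 := h μ (mem_spectrum_iff_exists.2 ⟨w, hw, hA⟩)
    rcases lt_trichotomy μ.re 0 with h2 | h2 | h2
    · rw [F.projUnstable_mulVec_stable (mem_stableSubspace h2 hA)] at hE; exact absurd hE.symm hw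
    · rw [h2, abs_zero] at h1; linarith
    · rwa [abs_of_pos h2] at h1
  stable := fun w μ hw hE hA => by
    have h1 := h μ (mem_spectrum_iff_exists.2 ⟨w, hw, hA⟩)
    rcases lt_trichotomy μ.re 0 with h2 | h2 | h2
    · rw [abs_of_neg h2] at h1; linarith
    · rw [h2, abs_zero] at h1; linarith
    · rw [F.projUnstable_mulVec (mem_unstableSubspace h2 hA)] at hE; exact absurd hE hw

lemma isCompl_spectral (h : ∀ μ ∈ spectrum ℂ A, μ.re ≠ 0) :
    IsCompl (unstableSubspace A) (stableSubspace A) := by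
  set f : Module.End ℂ (n → ℂ) := Matrix.toLin' A with hf
  have e1 : unstableSubspace A = ⨆ μ ∈ {μ : ℂ | 0 < μ.re}, f.maxGenEigenspace μ := by
    rw [unstableSubspace, iSup_subtype']; rfl
  have e2 : stableSubspace A = ⨆ μ ∈ {μ : ℂ | μ.re < 0}, f.maxGenEigenspace μ := by
    rw [stableSubspace, iSup_subtype']; rfl
  constructor
  · rw [e1, e2]
    refine f.independent_maxGenEigenspace.disjoint_biSup_biSup ?_
    exact Set.disjoint_left.2 fun μ h1 h2 => lt_asymm (mem_setOf.1 h1) h2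
  · rw [codisjoint_iff, eq_top_iff, ← Module.End.iSup_maxGenEigenspace_eq_top f]
    refine iSup_le fun μ => ?_
    rcases lt_trichotomy μ.re 0 with h2 | h2 | h2
    · rw [e2]; exact le_sup_of_le_right (le_biSup f.maxGenEigenspace (mem_setOf.2 h2))
    · have h3 : f.maxGenEigenspace μ = ⊥ := by
        rw [Module.End.maxGenEigenspace_eq]
        by_contra hne
        have h4 : f.HasGenEigenvalue μ (f.maxGenEigenspaceIndex μ) := hne
        have h5 := Module.End.hasEigenvalue_of_hasGenEigenvalue h4
        rw [Module.End.hasEigenvalue_iff_mem_spectrum, hf, Matrix.spectrum_toLin'] at h5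
        exact h μ h5 h2
      rw [h3]; exact bot_le
    · rw [e1]; exact le_sup_of_le_left (le_biSup f.maxGenEigenspace (mem_setOf.2 h2))

lemma nonempty_spectralFrame (h : ∀ μ ∈ spectrum ℂ A, μ.re ≠ 0) : Nonempty (SpectralFrame A) := by
  have hc := isCompl_spectral h
  have key : ∀ {S T : Submodule ℂ (n → ℂ)} (hST : IsCompl S T),
      ∃ E : Matrix n n ℂ, (∀ w ∈ S, E *ᵥ w = w) ∧ (∀ w ∈ T, E *ᵥ w = 0) ∧ ∀ w, E *ᵥ w ∈ S := by
    intro S T hST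
    refine ⟨LinearMap.toMatrix' (S.projection T hST), fun w hw => ?_, fun w hw => ?_, fun w => ?_⟩
    all_goals rw [LinearMap.toMatrix'_mulVec]
    · exact Submodule.projection_apply_left hST ⟨w, hw⟩
    · exact (Submodule.projection_apply_eq_zero_iff hST).2 hw
    · exact Submodule.projection_apply_mem hST w
  obtain ⟨E, hE1, hE2, hE3⟩ := key hc
  have hidem : E * E = E := ext_of_mulVec_single fun j => by
    rw [← mulVec_mulVec]; exact hE1 _ (hE3 _)
  have hE4 : ∀ w, (1 - E) *ᵥ w ∈ stableSubspace A := fun w => by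
    obtain ⟨a, ha, b, hb, rfl⟩ := Submodule.mem_sup.1
      ((codisjoint_iff.1 hc.codisjoint).symm ▸ Submodule.mem_top : w ∈ _ ⊔ _)
    rw [sub_mulVec, one_mulVec, mulVec_add, hE1 a ha, hE2 b hb, add_zero, add_sub_cancel_left]
    exact hb
  have hidem' : (1 - E) * (1 - E) = 1 - E := IsIdempotentElem.one_sub hidem
  obtain ⟨k, Rm, Lm, h1, h2⟩ := exists_factor hidem
  obtain ⟨l, Rp, Lp, h3, h4⟩ := exists_factor hidem'
  have hmp : Lm * Rp = 0 := by
    calc Lm * Rp = (Lm * Rm) * Lm * (Rp * (Lp * Rp)) := by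
          rw [h1, h3, Matrix.one_mul, Matrix.mul_one]
      _ = Lm * ((Rm * Lm) * (Rp * Lp)) * Rp := by simp only [Matrix.mul_assoc]
      _ = 0 := by
          rw [h2, h4, Matrix.mul_sub, hidem, Matrix.mul_one, sub_self, Matrix.mul_zero, Matrix.zero_mul]
  have hpm : Lp * Rm = 0 := by
    calc Lp * Rm = (Lp * Rp) * Lp * (Rm * (Lm * Rm)) := by
          rw [h1, h3, Matrix.one_mul, Matrix.mul_one]
      _ = Lp * ((Rp * Lp) * (Rm * Lm)) * Rm := by simp only [Matrix.mul_assoc]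
      _ = 0 := by
          rw [h2, h4, Matrix.sub_mul, hidem, Matrix.one_mul, sub_self, Matrix.mul_zero, Matrix.zero_mul]
  have hind : ∀ {k : ℕ} {R : Matrix n (Fin k) ℂ} {L : Matrix (Fin k) n ℂ}, L * R = 1 →
      LinearIndependent ℂ R.col := fun {k R L} hLR => by
    rw [← Matrix.mulVec_injective_iff]
    intro a b hab
    have := congrArg (L *ᵥ ·) hab
    simpa only [mulVec_mulVec, hLR, one_mulVec] using this
  have hsp : ∀ {k : ℕ} {R : Matrix n (Fin k) ℂ} {L : Matrix (Fin k) n ℂ} {P : Matrix n n ℂ}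
      {S : Submodule ℂ (n → ℂ)}, L * R = 1 → R * L = P → (∀ w, P *ᵥ w ∈ S) →
      (∀ w ∈ S, P *ᵥ w = w) → Submodule.span ℂ (Set.range R.col) = S := by
    intro k R L P S hLR hRL hP hS
    rw [← range_mulVecLin]
    refine le_antisymm ?_ fun w hw => ⟨L *ᵥ w, ?_⟩
    · rintro _ ⟨c, rfl⟩
      have : R *ᵥ c = P *ᵥ (R *ᵥ c) := by
        rw [← hRL, mulVec_mulVec, Matrix.mul_assoc, hLR, Matrix.mul_one]
      rw [mulVecLin_apply, this]; exact hP _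
    · rw [mulVecLin_apply, mulVec_mulVec, hRL, hS w hw]
  exact ⟨{
    nu := k, ns := l, Rm := Rm, Rp := Rp, Lm := Lm, Lp := Lp, indep_m := hind h1, indep_p := hind h3
    span_m := hsp h1 h2 hE3 hE1
    span_p := hsp h3 h4 hE4 fun w hw => by rw [sub_mulVec, one_mulVec, hE2 w hw, sub_zero]
    left_inv := by rw [fromRows_mul_fromCols, h1, h3, hmp, hpm, fromBlocks_one]
    right_inv := by rw [fromCols_mul_fromRows, h2, h4, add_sub_cancel] }⟩

/-- Splitting defined by a spectral projection of rank two. -/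
lemma IsSpectralProj.exists_splitting {A E : Mat4} (h : IsSpectralProj A E σ)
    (htr : E.trace = 2) : ∃ Rm Rp Lm Lp, Splitting A Rm Rp Lm Lp σ ∧ Rm * Lm = E := by
  have hidem' : (1 - E) * (1 - E) = 1 - E := IsIdempotentElem.one_sub h.idem
  obtain ⟨k, Rm, Lm, h1, h2⟩ := exists_factor h.idem
  obtain ⟨l, Rp, Lp, h3, h4⟩ := exists_factor hidem'
  have hk : k = 2 := by
    have := congrArg trace h2
    rw [trace_mul_comm, h1, trace_one, card_fin, htr] at this
    exact_mod_cast this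
  have hl : l = 2 := by
    have := congrArg trace h4
    rw [trace_mul_comm, h3, trace_one, card_fin, trace_sub, trace_one, htr, card_fin] at this
    norm_num at this
    exact_mod_cast this
  subst hk hl
  have hER : E * Rm = Rm := by rw [← h2, Matrix.mul_assoc, h1, Matrix.mul_one]
  have hERp : E * Rp = 0 := by
    have : (1 - E) * Rp = Rp := by rw [← h4, Matrix.mul_assoc, h3, Matrix.mul_one]
    rw [Matrix.sub_mul, Matrix.one_mul, sub_eq_self] at this; exact this
  have hLE : Lm * E = Lm := by rw [← h2, ← Matrix.mul_assoc, h1, Matrix.one_mul]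
  have hLEp : Lp * E = 0 := by
    have : Lp * (1 - E) = Lp := by rw [← h4, ← Matrix.mul_assoc, h3, Matrix.one_mul]
    rw [Matrix.mul_sub, Matrix.mul_one, sub_eq_self] at this; exact this
  have hp : A * Rp = Rp * (Lp * A * Rp) := by
    have h5 : E * (A * Rp) = 0 := by
      rw [← Matrix.mul_assoc, ← h.comm, Matrix.mul_assoc, hERp, Matrix.mul_zero]
    have h6 : (1 - E) * (A * Rp) = A * Rp := by rw [Matrix.sub_mul, Matrix.one_mul, h5, sub_zero]
    rw [← h4] at h6
    simpa only [Matrix.mul_assoc] using h6.symm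
  have hm : A * Rm = Rm * (Lm * A * Rm) := by
    have h5 : E * (A * Rm) = A * Rm := by rw [← Matrix.mul_assoc, ← h.comm, Matrix.mul_assoc, hER]
    rw [← h2] at h5
    simpa only [Matrix.mul_assoc] using h5.symm
  have hspec : ∀ {R : Matrix (Fin 4) (Fin 2) ℂ} {L : Matrix (Fin 2) (Fin 4) ℂ} {μ : ℂ}, L * R = 1 →
      A * R = R * (L * A * R) → (L * A * R - μ • (1 : Mat2)).det = 0 →
      ∃ c, R *ᵥ c ≠ 0 ∧ A *ᵥ (R *ᵥ c) = μ • (R *ᵥ c) := by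
    intro R L μ hLR hAR hdet
    obtain ⟨c, hc, hc'⟩ := Matrix.exists_mulVec_eq_zero_iff.2 hdet
    refine ⟨c, fun h0 => hc ?_, ?_⟩
    · have := congrArg (L *ᵥ ·) h0
      simpa only [mulVec_mulVec, hLR, one_mulVec, mulVec_zero] using this
    · rw [sub_mulVec, smul_mulVec, one_mulVec, sub_eq_zero] at hc'
      rw [mulVec_mulVec, hAR, ← mulVec_mulVec, hc', mulVec_smul]
  refine ⟨Rm, Rp, Lm, Lp, ⟨h1, ?_, ?_, h3, ?_, hm, hp, fun μ hμ => ?_, fun μ hμ => ?_⟩, h2⟩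
  · rw [← hLE, Matrix.mul_assoc, hERp, Matrix.mul_zero]
  · rw [← hER, ← Matrix.mul_assoc, hLEp, Matrix.zero_mul]
  · rw [h2, h4, add_sub_cancel]
  · obtain ⟨c, hc, hc'⟩ := hspec h1 hm hμ
    exact h.unstable _ μ hc (by rw [mulVec_mulVec, hER]) hc'
  · obtain ⟨c, hc, hc'⟩ := hspec h3 hp hμ
    exact h.stable _ μ hc (by rw [mulVec_mulVec, hERp, zero_mulVec]) hc'

end

end

section

/-! ### Hyperbolicity and inertia of the endstate -/

section

open Matrix

open scoped NNReal in
lemma tendsto_pow_mulVec {k : ℕ} {C : Matrix (Fin k) (Fin k) ℂ}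
    (h : ∀ (w : Fin k → ℂ) (μ : ℂ), w ≠ 0 → C *ᵥ w = μ • w → ‖μ‖ < 1) (y : Fin k → ℂ) :
    Tendsto (fun m : ℕ => (C ^ m) *ᵥ y) atTop (𝓝 0) := by
  rcases isEmpty_or_nonempty (Fin k) with he | he
  · have : ∀ w : Fin k → ℂ, w = 0 := fun w => Subsingleton.elim _ _
    simp only [this]; exact tendsto_const_nhds
  letI : NormedRing (Matrix (Fin k) (Fin k) ℂ) := Matrix.linftyOpNormedRing
  letI : NormedAlgebra ℂ (Matrix (Fin k) (Fin k) ℂ) := Matrix.linftyOpNormedAlgebra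
  haveI : CompleteSpace (Matrix (Fin k) (Fin k) ℂ) := FiniteDimensional.complete ℂ _
  have h1 : spectralRadius ℂ C < (1 : ℝ≥0) :=
    spectrum.spectralRadius_lt_of_forall_lt C fun μ hμ => by
      obtain ⟨w, hw, hw'⟩ := mem_spectrum_iff_exists.1 hμ
      exact_mod_cast h w μ hw hw'
  obtain ⟨r, hr1, hr2⟩ := ENNReal.lt_iff_exists_nnreal_btwn.1 h1
  have h2 := (spectrum.pow_nnnorm_pow_one_div_tendsto_nhds_spectralRadius C).eventually_lt_const hr1
  have h3 : ∀ᶠ m : ℕ in atTop, ‖C ^ m‖ ≤ (r : ℝ) ^ m := by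
    filter_upwards [h2, eventually_gt_atTop 0] with m hm hm0
    have h4 := ENNReal.rpow_le_rpow hm.le (by positivity : (0 : ℝ) ≤ m)
    rw [← ENNReal.rpow_mul, one_div, inv_mul_cancel₀ (by positivity), ENNReal.rpow_one,
      ENNReal.rpow_natCast] at h4
    exact_mod_cast h4
  have h5 : Tendsto (fun m : ℕ => (r : ℝ) ^ m * ‖y‖) atTop (𝓝 0) := by
    simpa using (tendsto_pow_atTop_nhds_zero_of_lt_one r.2 (by exact_mod_cast hr2)).mul_const ‖y‖
  refine squeeze_zero_norm' (h3.mono fun m hm => ?_) h5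
  exact (Matrix.linfty_opNorm_mulVec _ _).trans (by gcongr)

/-- A form that does not decrease along a linear flow all of whose eigenvalues are unstable is
nonnegative. -/
lemma form_nonneg {k : ℕ} {T : Matrix (Fin k) (Fin k) ℂ} {h : (Fin k → ℂ) → ℝ}
    (hT : ∀ (w : Fin k → ℂ) (μ : ℂ), w ≠ 0 → T *ᵥ w = μ • w → 0 < μ.re) (hc : Continuous h)
    (h0 : h 0 = 0) (hd : ∀ x, h (T *ᵥ x - x) ≤ h (T *ᵥ x + x)) (y : Fin k → ℂ) :
    0 ≤ h y ∧ ∃ x, T *ᵥ x + x = y := by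
  have hdet : IsUnit (T + 1).det := by
    rw [isUnit_iff_ne_zero]
    intro hdet
    obtain ⟨w, hw, hw'⟩ := Matrix.exists_mulVec_eq_zero_iff.2 hdet
    rw [add_mulVec, one_mulVec, add_eq_zero_iff_eq_neg] at hw'
    have := hT w (-1) hw (by rw [hw', neg_one_smul])
    norm_num at this
  set S := (T + 1)⁻¹ with hS
  have hTS : (T + 1) * S = 1 := mul_nonsing_inv _ hdet
  have hinv : ∀ y, T *ᵥ (S *ᵥ y) + S *ᵥ y = y := fun y => by
    have := congrArg (· *ᵥ y) hTS
    simpa only [← mulVec_mulVec, add_mulVec, one_mulVec] using this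
  refine ⟨?_, S *ᵥ y, hinv y⟩
  have hstep : ∀ y, h (((T - 1) * S) *ᵥ y) ≤ h y := fun y => by
    have := hd (S *ᵥ y)
    rwa [hinv, show T *ᵥ (S *ᵥ y) - S *ᵥ y = ((T - 1) * S) *ᵥ y by
      rw [← mulVec_mulVec, sub_mulVec, one_mulVec]] at this
  have hpow : ∀ m : ℕ, h ((((T - 1) * S) ^ m) *ᵥ y) ≤ h y := by
    intro m
    induction m with
    | zero => simp
    | succ m ih =>
      rw [pow_succ', ← mulVec_mulVec]; exact (hstep _).trans ih
  have hlim := tendsto_pow_mulVec (C := (T - 1) * S) (fun w μ hw hμ => by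
    set x := S *ᵥ w with hx
    have h1 : T *ᵥ x - x = μ • (T *ᵥ x + x) := by
      rw [hx, hinv, ← hμ, ← mulVec_mulVec, sub_mulVec, one_mulVec]
    have hx0 : x ≠ 0 := fun h0 => hw (by rw [← hinv w, ← hx, h0, mulVec_zero, add_zero])
    have h2 : (1 - μ) • T *ᵥ x = (1 + μ) • x := by
      rw [smul_add] at h1
      rw [sub_smul, add_smul, one_smul, one_smul]
      linear_combination (exp := 1) h1
    have hμ1 : 1 - μ ≠ 0 := fun h0 => by
      have h3 : μ = 1 := (sub_eq_zero.1 h0).symm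
      rw [h3, sub_self, zero_smul] at h2
      exact hx0 ((smul_eq_zero.1 h2.symm).resolve_left (by norm_num))
    have h3 := hT x ((1 - μ)⁻¹ * (1 + μ)) hx0 (by
      rw [mul_smul, ← h2, smul_smul, inv_mul_cancel₀ hμ1, one_smul])
    rw [mul_comm, ← div_eq_mul_inv, Complex.div_re, ← add_div] at h3
    have h4 : 0 < (1 + μ).re * (1 - μ).re + (1 + μ).im * (1 - μ).im :=
      (div_pos_iff_of_pos_right (Complex.normSq_pos.2 hμ1)).1 h3
    simp only [Complex.add_re, Complex.sub_re, Complex.add_im, Complex.sub_im, Complex.one_re,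
      Complex.one_im] at h4
    have h5 : ‖μ‖ ^ 2 < 1 := by rw [Complex.sq_norm, normSq_apply]; nlinarith
    nlinarith [norm_nonneg μ]) y
  have h6 := (hc.tendsto 0).comp hlim
  rw [h0] at h6; exact le_of_tendsto h6 (Eventually.of_forall hpow)

variable {n : Type} [Fintype n] [DecidableEq n] {A E : Matrix n n ℂ} {σ : ℝ} {h : (n → ℂ) → ℝ}

/-- A Hermitian form, increasing along the flow of `A` and strictly so on invariant sets. -/
structure IsLyapunov (A : Matrix n n ℂ) (h : (n → ℂ) → ℝ) : Prop where
  cont : Continuous h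
  smul : ∀ (c : ℂ) (x : n → ℂ), h (c • x) = ‖c‖ ^ 2 * h x
  mono : ∀ x, h (A *ᵥ x - x) ≤ h (A *ᵥ x + x)
  strict : ∀ x y, h (A *ᵥ x + x) ≤ h (A *ᵥ x - x) → h (A *ᵥ y + y) ≤ h (A *ᵥ y - y) →
    A *ᵥ y + y = A *ᵥ x - x → x = 0 ∧ y = 0

namespace IsLyapunov

lemma zero (hA : IsLyapunov A h) : h 0 = 0 := by
  simpa using hA.smul 0 0

lemma neg (hA : IsLyapunov A h) : IsLyapunov (-A) fun x => -h x := by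
  have hn : ∀ x, h (-x) = h x := fun x => by
    simpa using hA.smul (-1) x
  have e1 : ∀ x, h ((-A) *ᵥ x + x) = h (A *ᵥ x - x) := fun x => by
    rw [← hn, neg_mulVec]; congr 1; abel
  have e2 : ∀ x, h ((-A) *ᵥ x - x) = h (A *ᵥ x + x) := fun x => by
    rw [← hn, neg_mulVec]; congr 1; abel
  refine ⟨hA.cont.neg, fun c x => by rw [hA.smul]; ring, fun x => ?_, fun x y hx hy hxy => ?_⟩
  · rw [e1, e2]; exact neg_le_neg (hA.mono x)
  · rw [e1, e2] at hx hy
    rw [neg_mulVec, neg_mulVec] at hxy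
    have hxy' : A *ᵥ x + x = A *ᵥ y - y := by
      have := congrArg Neg.neg hxy
      rw [neg_add, neg_neg, neg_sub, sub_neg_eq_add] at this
      rw [add_comm, ← this, sub_eq_add_neg]
    exact (hA.strict y x (neg_le_neg_iff.1 hy) (neg_le_neg_iff.1 hx) hxy').symm

lemma re_ne_zero (hA : IsLyapunov A h) {μ : ℂ} (hμ : μ ∈ spectrum ℂ A) : μ.re ≠ 0 := by
  intro h0
  obtain ⟨w, hw, hw'⟩ := mem_spectrum_iff_exists.1 hμ
  have hd : ∀ c : ℂ, h (A *ᵥ (c • w) + c • w) = h (A *ᵥ (c • w) - c • w) := fun c => by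
    rw [mulVec_smul, hw', smul_smul, ← add_smul, ← sub_smul, hA.smul, hA.smul]
    congr 1
    rw [show c * μ + c = c * (μ + 1) by ring, show c * μ - c = c * (μ - 1) by ring, norm_mul,
      norm_mul, mul_pow, mul_pow, Complex.sq_norm (μ + 1), Complex.sq_norm (μ - 1),
      normSq_apply, normSq_apply]
    simp [h0]
  have h1 : μ + 1 ≠ 0 := fun h1 => by
    have := congrArg Complex.re h1
    simp [h0] at this
  have := hA.strict ((1 : ℂ) • w) (((μ - 1) / (μ + 1)) • w) (hd 1).le (hd _).le (by
    rw [one_smul, mulVec_smul, hw', smul_smul, ← add_smul,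
      show (μ - 1) / (μ + 1) * μ + (μ - 1) / (μ + 1) = μ - 1 by field_simp, sub_smul, one_smul])
  exact hw (by simpa using this.1)

/-- The form is definite on the range of a spectral projection. -/
lemma eq_zero_of_nonpos (hA : IsLyapunov A h) (hE : IsSpectralProj A E σ) (hσ : 0 < σ) {k : ℕ}
    {R : Matrix n (Fin k) ℂ} {L : Matrix (Fin k) n ℂ} (hLR : L * R = 1) (hRL : R * L = E)
    {c : Fin k → ℂ} (hc : h (R *ᵥ c) ≤ 0) : c = 0 := by
  have hER : E * R = R := by rw [← hRL, Matrix.mul_assoc, hLR, Matrix.mul_one]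
  have hAR : A * R = R * (L * A * R) := by
    have h5 : E * (A * R) = A * R := by rw [← Matrix.mul_assoc, ← hE.comm, Matrix.mul_assoc, hER]
    rw [← hRL] at h5
    simpa only [Matrix.mul_assoc] using h5.symm
  set T := L * A * R
  have hinj : ∀ {c}, R *ᵥ c = 0 → c = 0 := fun {c} h0 => by
    have := congrArg (L *ᵥ ·) h0
    simpa only [mulVec_mulVec, hLR, one_mulVec, mulVec_zero] using this
  have hRT : ∀ x, R *ᵥ (T *ᵥ x) = A *ᵥ (R *ᵥ x) := fun x => by
    rw [mulVec_mulVec, ← hAR, mulVec_mulVec]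
  have key := form_nonneg (T := T) (h := fun x => h (R *ᵥ x)) (fun w μ hw hμ => by
    refine hσ.trans_le (hE.unstable (R *ᵥ w) μ (fun h0 => hw (hinj h0)) ?_ ?_)
    · rw [mulVec_mulVec, hER]
    · rw [← hRT, hμ, mulVec_smul])
    (hA.cont.comp (R.mulVecLin.continuous_of_finiteDimensional)) (by
      rw [mulVec_zero, hA.zero]) (fun x => by
      simp only [mulVec_sub, mulVec_add, hRT]; exact hA.mono _)
  obtain ⟨-, x, hx⟩ := key c
  obtain ⟨h1, y, hy⟩ := key (T *ᵥ x - x)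
  have h2 := (key (T *ᵥ y - y)).1
  rw [← hx] at hc
  have h3 := hA.mono (R *ᵥ x)
  simp only [mulVec_sub, mulVec_add, hRT] at hc h1 h2
  have hy' : A *ᵥ (R *ᵥ y) + R *ᵥ y = A *ᵥ (R *ᵥ x) - R *ᵥ x := by
    rw [← hRT, ← hRT, ← mulVec_add, ← mulVec_sub, hy]
  have h4 := (hA.strict (R *ᵥ x) (R *ᵥ y) (hc.trans h1) (by
    rw [hy']; exact h3.trans (hc.trans h2)) hy').1
  rw [← hx, hinj h4, mulVec_zero, add_zero]

lemma rank_le (hA : IsLyapunov A h) (hE : IsSpectralProj A E σ) (hσ : 0 < σ) {k m : ℕ}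
    {R : Matrix n (Fin k) ℂ} {L : Matrix (Fin k) n ℂ} (hLR : L * R = 1) (hRL : R * L = E)
    (φ : (n → ℂ) →ₗ[ℂ] (Fin m → ℂ)) (hφ : ∀ x, φ x = 0 → h x = 0) : k ≤ m := by
  by_contra hlt
  have h1 : LinearMap.ker (φ ∘ₗ R.mulVecLin) ≠ ⊥ :=
    LinearMap.ker_ne_bot_of_finrank_lt (by simpa using hlt)
  obtain ⟨c, hc, hc0⟩ := (Submodule.ne_bot_iff _).1 h1
  exact hc0 (hA.eq_zero_of_nonpos hE hσ hLR hRL (hφ _ hc).le)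

lemma frame_rank_le (hA : IsLyapunov A h) (F : SpectralFrame A) (hσ : 0 < σ)
    (hs : ∀ μ ∈ spectrum ℂ A, σ ≤ |μ.re|) {m : ℕ} (φ : (n → ℂ) →ₗ[ℂ] (Fin m → ℂ))
    (hφ : ∀ x, φ x = 0 → h x = 0) : F.nu ≤ m ∧ F.ns ≤ m := by
  have hE := F.isSpectralProj hσ hs
  refine ⟨hA.rank_le hE hσ F.blocks.1 rfl φ hφ, ?_⟩
  have e : F.projStable = 1 - F.projUnstable := eq_sub_of_add_eq' F.sum_proj
  have hE' : IsSpectralProj (-A) F.projStable σ := by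
    have e2 : ∀ {w : n → ℂ} {μ : ℂ}, (-A) *ᵥ w = μ • w → A *ᵥ w = (-μ) • w := fun {w μ} hw => by
      rw [neg_smul, ← hw, neg_mulVec, neg_neg]
    rw [e]
    refine ⟨IsIdempotentElem.one_sub hE.idem, ?_, fun w μ hw h1 h2 => ?_, fun w μ hw h1 h2 => ?_⟩
    · simp only [mul_sub, sub_mul, neg_mul, mul_neg, hE.comm, mul_one, one_mul]
      abel
    · rw [sub_mulVec, one_mulVec, sub_eq_self] at h1
      have := hE.stable w _ hw h1 (e2 h2)
      rw [Complex.neg_re] at this; linarith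
    · rw [sub_mulVec, one_mulVec, sub_eq_zero] at h1
      have := hE.unstable w _ hw h1.symm (e2 h2)
      rw [Complex.neg_re] at this; linarith
  exact hA.neg.rank_le hE' hσ F.blocks.2.2.2 rfl φ fun x hx => by rw [hφ x hx, neg_zero]

end IsLyapunov

end

end

section

section

open Matrix

lemma IsLyapunov.of_diagonal {n : Type} [Fintype n] [DecidableEq n] {A : Matrix n n ℂ}
    {h : (n → ℂ) → ℝ} {r : ℝ} (w : n → ℝ) (hr : r ≠ 0) (hw : ∀ i, 0 ≤ w i) (hc : Continuous h)
    (hs : ∀ (c : ℂ) (x : n → ℂ), h (c • x) = ‖c‖ ^ 2 * h x)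
    (hd : ∀ x, h (A *ᵥ x + x) - h (A *ᵥ x - x) = 2 * r ^ 2 * ∑ i, w i * normSq (x i))
    (hz : ∀ x y, (∀ i, w i ≠ 0 → x i = 0 ∧ y i = 0) → A *ᵥ y + y = A *ᵥ x - x → x = 0 ∧ y = 0) :
    IsLyapunov A h := by
  have hr2 : 0 < 2 * r ^ 2 := by positivity
  have h0 : ∀ x : n → ℂ, ∀ i ∈ Finset.univ, 0 ≤ w i * normSq (x i) := fun x i _ =>
    mul_nonneg (hw i) (normSq_nonneg _)
  have hstr : ∀ x, h (A *ᵥ x + x) ≤ h (A *ᵥ x - x) → ∀ i, w i ≠ 0 → x i = 0 := fun x hx i hi => by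
    have h1 : ∑ i, w i * normSq (x i) ≤ 0 :=
      nonpos_of_mul_nonpos_right (by linarith [hd x]) hr2
    have h2 := (Finset.sum_eq_zero_iff_of_nonneg (h0 x)).1 (h1.antisymm (sum_nonneg (h0 x))) i
      (Finset.mem_univ i)
    exact Complex.normSq_eq_zero.1 ((mul_eq_zero.1 h2).resolve_left hi)
  refine ⟨hc, hs, fun x => ?_, fun x y hx hy => hz x y fun i hi => ⟨hstr x hx i hi, hstr y hy i hi⟩⟩
  linarith [hd x, mul_nonneg hr2.le (sum_nonneg (h0 x))]

lemma isLyapunov_four {k Q t e : ℝ} {ζ : ℂ} (hk : 0 < k) (hQ : 0 < Q) (ht : 0 < t) (hζ : ζ.re ≠ 0) :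
    IsLyapunov (!![0, (k : ℂ), 0, 0; (Q : ℂ), 0, -1, (e : ℂ); -(ζ * e), 0, 0, ζ * t; ζ, 0, 0, 0] :
      Mat4) (fun w => ζ.re * ((w 2 * conj (w 3)).re + (conj ζ * w 1 * conj (w 0)).re)) := by
  set A : Mat4 :=
    !![0, (k : ℂ), 0, 0; (Q : ℂ), 0, -1, (e : ℂ); -(ζ * e), 0, 0, ζ * t; ζ, 0, 0, 0] with hA
  have hmul : ∀ x, A *ᵥ x = ![k * x 1, Q * x 0 - x 2 + e * x 3, -(ζ * e) * x 0 + ζ * t * x 3,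
      ζ * x 0] := fun x => by
    ext i
    fin_cases i <;> simp [hA, mulVec, dotProduct, Fin.sum_univ_four, sub_eq_add_neg]
  refine .of_diagonal ![Q, k, 0, t] hζ (fun i => ?_) (by fun_prop) (fun c x => ?_) (fun x => ?_)
    fun x y h0 hxy => ?_
  · fin_cases i <;> simp [*, le_of_lt]
  · simp [Complex.sq_norm, normSq_apply]; ring
  · obtain ⟨a, b, c, d, rfl⟩ : ∃ a b c d, x = ![a, b, c, d] :=
      ⟨x 0, x 1, x 2, x 3, by ext i; fin_cases i <;> rfl⟩
    rw [hmul]; simp [Fin.sum_univ_four, normSq_apply]; ring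
  · obtain ⟨x0, y0⟩ := h0 0 hQ.ne'
    obtain ⟨x1, y1⟩ := h0 1 hk.ne'
    obtain ⟨x3, y3⟩ := h0 3 ht.ne'
    rw [hmul, hmul] at hxy
    have c1 := congrFun hxy 1
    have c2 := congrFun hxy 2
    simp [x0, x1, x3, y0, y1, y3] at c1 c2
    have hx2 : x 2 = 0 := by
      have : x 2 + x 2 = 0 := by linear_combination c2 - c1
      simpa using this
    have hy2 : y 2 = 0 := by rw [c1, hx2]
    constructor <;> ext i <;> fin_cases i <;> assumption

lemma isLyapunov_three {k Q : ℝ} {ζ : ℂ} (hk : 0 < k) (hQ : 0 < Q) (hζ : ζ.re ≠ 0) :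
    IsLyapunov (!![0, (k : ℂ), 0; (Q : ℂ), 0, -1; ζ, 0, 0] : Mat3)
      (fun w => ζ.re * (1 / 2 * (w 2 * conj (w 2)).re + (conj ζ * w 1 * conj (w 0)).re)) := by
  set A : Mat3 := !![0, (k : ℂ), 0; (Q : ℂ), 0, -1; ζ, 0, 0] with hA
  have hmul : ∀ x, A *ᵥ x = ![k * x 1, Q * x 0 - x 2, ζ * x 0] := fun x => by
    ext i
    fin_cases i <;> simp [hA, mulVec, dotProduct, Fin.sum_univ_three, sub_eq_add_neg]
  refine .of_diagonal ![Q, k, 0] hζ (fun i => ?_) (by fun_prop) (fun c x => ?_) (fun x => ?_)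
    fun x y h0 hxy => ?_
  · fin_cases i <;> simp [*, le_of_lt]
  · simp [Complex.sq_norm, normSq_apply]; ring
  · obtain ⟨a, b, c, rfl⟩ : ∃ a b c, x = ![a, b, c] :=
      ⟨x 0, x 1, x 2, by ext i; fin_cases i <;> rfl⟩
    rw [hmul]; simp [Fin.sum_univ_three, normSq_apply]; ring
  · obtain ⟨x0, y0⟩ := h0 0 hQ.ne'
    obtain ⟨x1, y1⟩ := h0 1 hk.ne'
    rw [hmul, hmul] at hxy
    have c1 := congrFun hxy 1
    have c2 := congrFun hxy 2
    simp [x0, x1, y0, y1] at c1 c2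
    have hx2 : x 2 = 0 := by
      have : x 2 + x 2 = 0 := by linear_combination c2 - c1
      simpa using this
    have hy2 : y 2 = 0 := by rw [c1, hx2]
    constructor <;> ext i <;> fin_cases i <;> assumption

end

namespace Model

lemma qValue_scalar {I : Set ℝ} {κ f : ℝ → ℝ} {b c lam1 vs : ℝ}
    (hM : (scalar I κ f b c lam1).Admissible) (hs : Saddle I κ (scalar I κ f b c lam1).W vs) :
    qValue κ (scalar I κ f b c lam1).W f vs + c / b =
      -deriv (deriv (scalar I κ f b c lam1).W) vs := by
  set W := (scalar I κ f b c lam1).W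
  have hf : ContDiffOn ℝ ∞ f I := hM.2.2.2.1
  have h1 : ∀ v ∈ I, HasDerivAt W (-deriv f v - c / b * v - lam1) v :=
    fun v hv => by
      have h2 := (((hasDerivAt_of_contDiffOn hs.isOpen hf (by simp) hv).neg.sub
        (((hasDerivAt_id v).pow 2).const_mul (1 / 2 * (c / b)))).sub
        ((hasDerivAt_id v).const_mul lam1))
      refine HasDerivAt.congr_deriv (f := W) h2 ?_
      simp; ring
  have h3 : deriv W =ᶠ[𝓝 vs] fun v => -deriv f v - c / b * v - lam1 := by
    filter_upwards [hs.isOpen.mem_nhds hs.mem] with v hv using (h1 v hv).deriv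
  have h4 := (((hasDerivAt_of_contDiffOn hs.isOpen (contDiffOn_deriv hs.isOpen hf) (by simp)
    hs.mem).neg.sub ((hasDerivAt_id vs).const_mul (c / b))).sub_const lam1)
  have h5 : deriv (deriv W) vs = _ := h3.deriv_eq.trans h4.deriv
  rw [h5, qValue, hs.crit]; ring

lemma qaValue_system {I : Set ℝ} {κ f τ : ℝ → ℝ} {b c lam1 lam2 vs : ℝ}
    (hM : (system I κ f τ b c lam1 lam2).Admissible)
    (hs : Saddle I κ (system I κ f τ b c lam1 lam2).W vs) :
    qaValue κ (system I κ f τ b c lam1 lam2).W f τ b c lam2 vs =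
      -deriv (deriv (system I κ f τ b c lam1 lam2).W) vs := by
  obtain ⟨hI, -, -, hf, hτ, -, -, hpos⟩ := hM
  set W := (system I κ f τ b c lam1 lam2).W with hWdef
  have hτ' : ∀ v ∈ I, HasDerivAt τ (deriv τ v) v := fun v hv =>
    hasDerivAt_of_contDiffOn hI hτ (by simp) hv
  have hg : ∀ v ∈ I, HasDerivAt (g τ b c lam2) (-aValue τ b c lam2 v / τ v) v := fun v hv => by
    have h1 := ((((hasDerivAt_const v (1 : ℝ)).div (hτ' v hv) (hpos v hv).ne').neg).mul
      (((hasDerivAt_id v).const_mul (c / b)).add_const lam2))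
    refine HasDerivAt.congr_deriv (f := g τ b c lam2) h1 ?_
    have := (hpos v hv).ne'
    simp only [aValue, g, id, Pi.neg_apply, Pi.div_apply]
    field_simp; ring
  have h1 : ∀ v ∈ I, HasDerivAt W (-deriv f v + (1 / 2 * deriv τ v * g τ b c lam2 v ^ 2 -
      aValue τ b c lam2 v * g τ b c lam2 v) - lam1) v := fun v hv => by
    have h2 := (((hasDerivAt_of_contDiffOn hI hf (by simp) hv).neg.add
      (((hτ' v hv).const_mul (1 / 2)).mul ((hg v hv).pow 2))).sub
      ((hasDerivAt_id v).const_mul lam1))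
    refine HasDerivAt.congr_deriv (f := W) h2 ?_
    have := (hpos v hv).ne'
    simp
    field_simp; ring
  have h3 : deriv W =ᶠ[𝓝 vs] fun v => -deriv f v + (1 / 2 * deriv τ v * g τ b c lam2 v ^ 2 -
      aValue τ b c lam2 v * g τ b c lam2 v) - lam1 := by
    filter_upwards [hI.mem_nhds hs.mem] with v hv using (h1 v hv).deriv
  have hτ2 := hasDerivAt_of_contDiffOn hI (contDiffOn_deriv hI hτ) (by simp) hs.mem
  have ha : HasDerivAt (aValue τ b c lam2) _ vs := (hτ2.mul (hg vs hs.mem)).add_const (c / b)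
  have h4 := ((hasDerivAt_of_contDiffOn hI (contDiffOn_deriv hI hf) (by simp) hs.mem).neg.add
    (((hτ2.const_mul (1 / 2)).mul ((hg vs hs.mem).pow 2)).sub (ha.mul (hg vs hs.mem)))).sub_const lam1
  have h5 : deriv (deriv W) vs = _ := h3.deriv_eq.trans h4.deriv
  have := (hpos vs hs.mem).ne'
  rw [h5, qaValue, qValue, hs.crit]
  simp only [Pi.pow_apply]
  have ea : aValue τ b c lam2 vs = deriv τ vs * g τ b c lam2 vs + c / b := rfl
  simp
  field_simp
  rw [ea]; ring

variable {M : Model} {vs : ℝ}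

/-- The endstate matrix admits a Lyapunov form with a large isotropic subspace. -/
lemma exists_lyapunov (hM : M.Admissible) (hs : Saddle M.I M.κ M.W vs) {z : ℂ} (hz : 0 < z.re) :
    ∃ (h : (Fin M.dim → ℂ) → ℝ) (φ : (Fin M.dim → ℂ) →ₗ[ℂ] (Fin 2 → ℂ)),
      IsLyapunov (M.Ainf vs z) h ∧ ∀ x, φ x = 0 → h x = 0 := by
  have hre : ∀ {b : ℝ}, b ≠ 0 → (z / b).re ≠ 0 := fun {b} hb => by
    rw [Complex.div_ofReal_re]; exact (div_ne_zero hz.ne' hb)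
  have hQ : 0 < -deriv (deriv M.W) vs := neg_pos.2 hs.neg
  have hκ := one_div_pos.2 (hs.pos _ hs.mem)
  rw [Ainf_eq_eval hs]
  cases M with
  | scalar I κ f b c lam1 =>
    have hb : b ≠ 0 := hM.2.2.2.2.1
    have h1 := isLyapunov_three hκ hQ (hre hb)
    rw [← qValue_scalar hM hs] at h1
    refine ⟨_, LinearMap.pi ![LinearMap.proj (0 : Fin 3), LinearMap.proj (2 : Fin 3)],
      Eq.mpr (congrArg (fun A : Mat3 => IsLyapunov A _) ?_) h1, ?_⟩
    · show (coeff _).eval vs 0 z = _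
      ext i j
      fin_cases i <;> fin_cases j <;> simp [coeff, CoeffFamily.eval, Model.κ, div_eq_mul_inv]
    · intro x hx
      have e0 : x 0 = 0 := congrFun hx 0
      have e1 : x 2 = 0 := congrFun hx 1
      simp [e0, e1]
  | system I κ f τ b c lam1 lam2 =>
    have hb : b ≠ 0 := hM.2.2.2.2.2.1
    have hτ := hM.2.2.2.2.2.2.2 vs hs.mem
    have h1 := isLyapunov_four (e := aValue τ b c lam2 vs / τ vs) hκ hQ (one_div_pos.2 hτ) (hre hb)
    rw [← qaValue_system hM hs] at h1
    refine ⟨_, LinearMap.pi ![LinearMap.proj (0 : Fin 4), LinearMap.proj (3 : Fin 4)],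
      Eq.mpr (congrArg (fun A : Mat4 => IsLyapunov A _) ?_) h1, ?_⟩
    · show (coeff _).eval vs 0 z = _
      ext i j
      fin_cases i <;> fin_cases j <;> simp [coeff, CoeffFamily.eval, Model.κ, div_eq_mul_inv]
      all_goals ring
    · intro x hx
      have e0 : x 0 = 0 := congrFun hx 0
      have e1 : x 3 = 0 := congrFun hx 1
      simp [e0, e1]

end Model

end

section

/-! ### Transmission determinants -/

section

variable {n : Type} [Fintype n] [DecidableEq n] {A : ℝ → Matrix n n ℂ} {Ainf E : Matrix n n ℂ}
  {P Q : ℝ → Matrix n n ℂ} {s : Set ℝ} {l : Filter ℝ} {d : ℂ}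

/-- `W = P Z` reduces `W' = A W` to `Z' = A∞ Z` on `s`, and `P → 1` along `l`. -/
structure Conjugates (A : ℝ → Matrix n n ℂ) (Ainf : Matrix n n ℂ) (P : ℝ → Matrix n n ℂ)
    (s : Set ℝ) (l : Filter ℝ) : Prop where
  isUnit : ∀ y ∈ s, IsUnit (P y)
  ode : ∀ y ∈ s, HasMatDeriv P (A y * P y - P y * Ainf) s y
  tendsto_one : Tendsto P l (𝓝 1)

lemma Conjugates.conj (h : Conjugates A Ainf P s l) {R L : Matrix n n ℂ} (hL : L * R = 1)
    (hR : R * L = 1) :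
    Conjugates (fun y => L * A y * R) (L * Ainf * R) (fun y => L * P y * R) s l where
  isUnit y hy := ((show IsUnit L from ⟨⟨L, R, hL, hR⟩, rfl⟩).mul (h.isUnit y hy)).mul
    ⟨⟨R, L, hR, hL⟩, rfl⟩
  ode y hy := (((h.ode y hy).const_mul L).mul_const R).congr_deriv (by
    rw [mul_sub, sub_mul]
    congr 1
    · calc _ = L * A y * (1 * P y) * R := by rw [one_mul]; simp only [mul_assoc]
        _ = _ := by rw [← hR]; simp only [mul_assoc]
    · calc _ = L * P y * (1 * Ainf) * R := by rw [one_mul]; simp only [mul_assoc]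
        _ = _ := by rw [← hR]; simp only [mul_assoc])
  tendsto_one := by
    have h1 := (h.tendsto_one.const_mul L).mul_const R
    rwa [mul_one, hL] at h1

lemma det_eq_one_of_conjugates [l.NeBot] (hs : Convex ℝ s) (hsl : s ∈ l)
    (hode : ∀ y ∈ s, HasMatDeriv P (A y * P y - P y * Ainf) s y) (hP : Tendsto P l (𝓝 1))
    (htr : ∀ y ∈ s, (A y).trace = Ainf.trace) {y : ℝ} (hy : y ∈ s) : (P y).det = 1 := by
  have hder : ∀ x ∈ s, HasDerivWithinAt (fun x => (P x).det) 0 s x := fun x hx => by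
    refine (hode x hx).det.congr_deriv ?_
    rw [mul_sub, trace_sub, ← mul_assoc, ← mul_assoc,
      Matrix.adjugate_mul, trace_mul_comm, ← mul_assoc, mul_adjugate,
      smul_mul, smul_mul, trace_smul, trace_smul, one_mul,
      one_mul, htr x hx, sub_self]
  have h1 : Tendsto (fun x => (P x).det) l (𝓝 1) := by
    simpa [Function.comp_def] using ((Continuous.matrix_det continuous_id).tendsto (1 : Matrix n n ℂ)).comp hP
  have h2 : Tendsto (fun x => (P x).det) l (𝓝 (P y).det) :=
    tendsto_const_nhds.congr' (by
      filter_upwards [hsl] with x hx using const_of_hasDerivWithinAt_zero hs hder hy hx)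
  exact tendsto_nhds_unique h2 h1

/-- `d` is the determinant describing the transmission of the range of `E` from `-∞` to `+∞`. -/
def IsTransmission (A : ℝ → Matrix n n ℂ) (Ainf E : Matrix n n ℂ) (d : ℂ) : Prop :=
  ∃ Q P, Conjugates A Ainf Q (Iic 0) atBot ∧ Conjugates A Ainf P (Ici 0) atTop ∧
    d = (1 + ((P 0)⁻¹ * Q 0 - 1) * E).det

lemma SpectralFrame.det_unstable (F : SpectralFrame Ainf) (X : Matrix n n ℂ) :
    (F.Lm * X * F.Rm).det = (1 + (X - 1) * F.projUnstable).det := by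
  have e : F.Lm * X * F.Rm = 1 + F.Lm * ((X - 1) * F.Rm) := by
    rw [Matrix.sub_mul, Matrix.mul_sub, Matrix.one_mul, F.blocks.1, Matrix.mul_assoc,
      add_sub_cancel]
  rw [e, Matrix.det_one_add_mul_comm, projUnstable, Matrix.mul_assoc]

lemma SpectralFrame.det_stable (F : SpectralFrame Ainf) {X Y : Matrix n n ℂ} (hXY : X * Y = 1)
    (hX : X.det = 1) : (F.Lp * X * F.Rp).det = (1 + (Y - 1) * F.projUnstable).det := by
  have e : F.Lp * X * F.Rp = 1 + F.Lp * ((X - 1) * F.Rp) := by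
    rw [Matrix.sub_mul, Matrix.mul_sub, Matrix.one_mul, F.blocks.2.2.2, Matrix.mul_assoc,
      add_sub_cancel]
  have e2 : 1 + (X - 1) * (F.Rp * F.Lp) = X * (1 + (Y - 1) * F.projUnstable) := by
    rw [← projStable, eq_sub_of_add_eq' F.sum_proj]
    have : X * (1 + (Y - 1) * F.projUnstable) =
      X + (X * Y) * F.projUnstable - X * F.projUnstable := by noncomm_ring
    rw [this, hXY]; noncomm_ring
  rw [e, Matrix.det_one_add_mul_comm, Matrix.mul_assoc, e2, det_mul, hX, one_mul]

lemma isLimitEvans_iff {Al Ar : ℝ → Matrix n n ℂ} (hl : ∀ y, (Al y).trace = Ainf.trace)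
    (hr : ∀ y, (Ar y).trace = Ainf.trace) : IsLimitEvans Al Ar Ainf d ↔
      ∃ (F : SpectralFrame Ainf) (dl dr : ℂ), IsTransmission Al Ainf F.projUnstable dl ∧
        IsTransmission Ar Ainf F.projUnstable dr ∧ d = dl * dr := by
  have key : ∀ (F : SpectralFrame Ainf) {P Q : ℝ → Matrix n n ℂ},
      Conjugates Ar Ainf Q (Iic 0) atBot → Conjugates Ar Ainf P (Ici 0) atTop →
      (F.Lp * (Q 0)⁻¹ * P 0 * F.Rp).det = (1 + ((P 0)⁻¹ * Q 0 - 1) * F.projUnstable).det := fun F P Q hQ hP => by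
    have hQ1 := isUnit_det (hQ.isUnit 0 self_mem_Iic)
    have hP1 := isUnit_det (hP.isUnit 0 self_mem_Ici)
    rw [Matrix.mul_assoc F.Lp]
    refine F.det_stable ?_ ?_
    · rw [Matrix.mul_assoc, mul_nonsing_inv_cancel_left _ _ hP1, nonsing_inv_mul _ hQ1]
    · rw [det_mul, det_nonsing_inv,
        det_eq_one_of_conjugates (convex_Iic 0) (Iic_mem_atBot 0) hQ.ode hQ.tendsto_one
          (fun y _ => hr y) self_mem_Iic,
        det_eq_one_of_conjugates (convex_Ici 0) (Ici_mem_atTop 0) hP.ode hP.tendsto_one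
          (fun y _ => hr y) self_mem_Ici, Ring.inverse_one, one_mul]
  constructor
  · rintro ⟨F, Ql, Pl, Qr, Pr, h1, h2, h3, h4, rfl⟩
    have c3 : Conjugates Ar Ainf Qr (Iic 0) atBot := ⟨h3.1, h3.2, h3.3⟩
    have c4 : Conjugates Ar Ainf Pr (Ici 0) atTop := ⟨h4.1, h4.2, h4.3⟩
    refine ⟨F, _, _, ⟨Ql, Pl, ⟨h1.1, h1.2, h1.3⟩, ⟨h2.1, h2.2, h2.3⟩, rfl⟩,
      ⟨Qr, Pr, c3, c4, rfl⟩, ?_⟩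
    rw [key F c3 c4, Matrix.mul_assoc F.Lm, F.det_unstable]
  · rintro ⟨F, dl, dr, ⟨Ql, Pl, h1, h2, rfl⟩, ⟨Qr, Pr, h3, h4, rfl⟩, rfl⟩
    refine ⟨F, Ql, Pl, Qr, Pr, ⟨h1.1, h1.2, h1.3⟩, ⟨h2.1, h2.2, h2.3⟩, ⟨h3.1, h3.2, h3.3⟩,
      ⟨h4.1, h4.2, h4.3⟩, ?_⟩
    rw [key F h3 h4, Matrix.mul_assoc F.Lm, F.det_unstable]

lemma IsFundamental.det_eq {Ψ : ℝ → Matrix n n ℂ} (hΨ : IsFundamental A Ψ)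
    (hA : ∀ y, (A y).trace = 0) (x : ℝ) : (Ψ x).det = (Ψ 0).det := by
  refine const_of_hasDerivWithinAt_zero (f := fun x => (Ψ x).det) convex_univ (fun x _ => ?_)
    (mem_univ x) (mem_univ 0)
  have h1 : HasMatDeriv Ψ (A x * Ψ x) univ x := fun i j => (hΨ.2 x i j).hasDerivWithinAt
  exact h1.det_of_linear.congr_deriv (by rw [hA, zero_mul])

lemma IsFundamental.isUnit {Ψ : ℝ → Matrix n n ℂ} (hΨ : IsFundamental A Ψ)
    (hA : ∀ y, (A y).trace = 0) (x : ℝ) : IsUnit (Ψ x) := by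
  rw [isUnit_iff_isUnit_det, hΨ.det_eq hA]; exact isUnit_det hΨ.1

lemma rescaledEvans_eq (F : SpectralFrame Ainf) (h0 : Ainf.trace = 0)
    (hA : ∀ y, (A y).trace = 0) {Ψ : ℝ → Matrix n n ℂ} (hΨ : IsFundamental A Ψ) (Xl Xr : ℝ) (γ : ℂ) :
    rescaledEvans F Ψ Xl Xr γ = cexp (-(Ainf * F.projUnstable).trace * (2 * Xr - 2 * Xl)) *
      ((-γ) ^ F.ns)⁻¹ * (Ψ (2 * Xr) * (Ψ (2 * Xl))⁻¹ - γ • (1 : Matrix n n ℂ)).det := by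
  have e : Ψ 0 * (Ψ (2 * Xl))⁻¹ - γ • (Ψ 0 * (Ψ (2 * Xr))⁻¹) =
      Ψ 0 * (Ψ (2 * Xr))⁻¹ * (Ψ (2 * Xr) * (Ψ (2 * Xl))⁻¹ - γ • 1) := by
    rw [mul_sub, Matrix.mul_smul, mul_one, mul_assoc,
      Matrix.nonsing_inv_mul_cancel_left _ _ (isUnit_det (hΨ.isUnit hA _))]
  rw [rescaledEvans, balancedEvans, e, det_mul, det_mul, det_nonsing_inv,
    hΨ.det_eq hA (2 * Xr), Ring.mul_inverse_cancel _ (isUnit_det hΨ.1),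
    one_mul, ← Complex.exp_add, F.trace_mul_projStable h0]
  congr 3; ring

lemma exists_spectral_gap (h : ∀ μ ∈ spectrum ℂ Ainf, μ.re ≠ 0) :
    ∃ σ > 0, ∀ μ ∈ spectrum ℂ Ainf, σ ≤ |μ.re| := by
  by_cases hne : (Matrix.finite_spectrum Ainf).toFinset.Nonempty
  · obtain ⟨μ, hμ, hmin⟩ := Finset.exists_min_image _ (fun μ : ℂ => |μ.re|) hne
    exact ⟨|μ.re|, abs_pos.2 (h μ ((Set.Finite.mem_toFinset _).1 hμ)),
      fun ν hν => hmin ν ((Set.Finite.mem_toFinset _).2 hν)⟩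
  · exact ⟨1, one_pos, fun μ hμ => (hne ⟨μ, (Set.Finite.mem_toFinset _).2 hμ⟩).elim⟩

end

/-! ### Existence of conjugators -/

section

variable {N : Mat4} {B : ℝ → Mat4} {K α : ℝ}

lemma exists_forward_conjugator
    (hN : ∀ i j, i ≠ j → ¬ (i = 0 ∧ j = 1) → ¬ (i = 2 ∧ j = 3) → N i j = 0)
    (hB : ∀ i j, Continuous fun y => B y i j)
    (hBb : ∀ y i j, ‖B y i j‖ ≤ K * exp (-α * |y|)) (htr : ∀ y, (B y).trace = 0) (hα : 0 < α) :
    ∃ P, Conjugates (fun y => N + B y) N P (Ici 0) atTop := by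
  obtain ⟨β, hβ, hβ'⟩ := (Set.Ioo_infinite hα).exists_notMem_finset
    (Finset.univ.image fun p : Fin 4 × Fin 4 => (N p.2 p.2).re - (N p.1 p.1).re)
  obtain ⟨q, -, hq⟩ := Finset.exists_min_image Finset.univ
    (fun p : Fin 4 × Fin 4 => |β + (N p.1 p.1).re - (N p.2 p.2).re|) Finset.univ_nonempty
  set g := |β + (N q.1 q.1).re - (N q.2 q.2).re| with hg
  have hg0 : 0 < g := abs_pos.2 fun h0 => hβ' (Finset.mem_image.2 ⟨q, Finset.mem_univ _, by linarith⟩)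
  have hK : 0 ≤ K := by simpa using (norm_nonneg _).trans (hBb 0 0 0)
  set w := ‖N 0 1‖ + ‖N 2 3‖ with hw
  have hw0 : 0 ≤ w := by positivity
  set t := min 1 (g / (8 * (w + 1))) with ht
  have ht0 : 0 < t := lt_min one_pos (by positivity)
  have htw : 8 * (t * w) ≤ g := by
    have h1 : t ≤ g / (8 * (w + 1)) := min_le_right _ _
    rw [le_div_iff₀ (by positivity)] at h1; nlinarith
  have htc : (t : ℂ) ≠ 0 := by exact_mod_cast ht0.ne'
  set D : Mat4 := Matrix.diagonal ![1, t, 1, t] with hD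
  set D' : Mat4 := Matrix.diagonal ![1, (t : ℂ)⁻¹, 1, (t : ℂ)⁻¹] with hD'
  have h1 : D' * D = 1 := by
    rw [hD, hD', Matrix.diagonal_mul_diagonal, ← Matrix.diagonal_one]
    congr 1; ext i; fin_cases i <;> simp [htc]
  have h2 : D * D' = 1 := mul_eq_one_comm.1 h1
  have hent : ∀ (X : Mat4) i j,
      (D' * X * D) i j = ![1, (t : ℂ)⁻¹, 1, (t : ℂ)⁻¹] i * X i j * ![1, (t : ℂ), 1, t] j := fun X i j => by
    rw [hD, hD', mul_diagonal, Matrix.diagonal_mul]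
  have htl : t ≤ 1 := min_le_left _ _
  have hti : (1 : ℝ) ≤ t⁻¹ := (one_le_inv₀ ht0).2 htl
  have hdiag : ∀ i, (D' * N * D) i i = N i i := fun i => by
    rw [hent]; fin_cases i <;> simp <;> field_simp
  have n0 : ∀ i j, i ≠ j → ¬ (i = 0 ∧ j = 1) → ¬ (i = 2 ∧ j = 3) → (D' * N * D) i j = 0 :=
    fun i j a b c => by rw [hent, hN i j a b c]; simp
  have n01 : ‖(D' * N * D) 0 1‖ ≤ t * w := by
    rw [hent]; simp [abs_of_pos ht0]; nlinarith [norm_nonneg (N 0 1), norm_nonneg (N 2 3)]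
  have n23 : ‖(D' * N * D) 2 3‖ ≤ t * w := by
    rw [hent]; simp [abs_of_pos ht0]; nlinarith [norm_nonneg (N 0 1), norm_nonneg (N 2 3)]
  have htw0 : 0 ≤ t * w := by positivity
  obtain ⟨P, hP1, hP2, hP3⟩ := exists_conjugator (N := D' * N * D) (B := fun y => D' * B y * D)
    (K := t⁻¹ * K) (α := α) (β := β) (g := g) (η := t * w)
    (fun i j => by simp only [hent]; exact ((continuous_const.mul (hB i j)).mul continuous_const))
    (fun y hy i j => by
      have h3 := hBb y i j
      rw [abs_of_nonneg hy] at h3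
      have h4 : ∀ i, ‖(![1, (t : ℂ)⁻¹, 1, (t : ℂ)⁻¹] : Fin 4 → ℂ) i‖ ≤ t⁻¹ := fun i => by
        fin_cases i <;> simp [abs_of_pos ht0, hti]
      have h5 : ∀ i, ‖(![1, (t : ℂ), 1, t] : Fin 4 → ℂ) i‖ ≤ 1 := fun i => by
        fin_cases i <;> simp [abs_of_pos ht0, htl]
      rw [hent, norm_mul, norm_mul]
      calc _ ≤ t⁻¹ * (K * exp (-α * y)) * 1 :=
            mul_le_mul (mul_le_mul (h4 i) h3 (norm_nonneg _) (by positivity)) (h5 j)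
              (norm_nonneg _) (by positivity)
        _ = _ := by ring)
    (fun y => by rw [trace_mul_comm, ← mul_assoc, h2, one_mul, htr])
    hβ.1 hβ.2.le hg0 (fun i j => by rw [hdiag, hdiag]; exact hq (i, j) (Finset.mem_univ _))
    (fun i => by
      rw [Finset.sum_erase_eq_sub (Finset.mem_univ i), Fin.sum_univ_four]
      fin_cases i <;> simp [n0, n01, n23, htw0])
    (fun i => by
      rw [Finset.sum_erase_eq_sub (Finset.mem_univ i), Fin.sum_univ_four]
      fin_cases i <;> simp [n0, n01, n23, htw0]) htw
  have hc : Conjugates (fun y => D' * N * D + D' * B y * D) (D' * N * D) P (Ici 0) atTop :=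
    ⟨hP1, hP2, hP3⟩
  have hc' := hc.conj h2 h1
  have e : ∀ X : Mat4, D * (D' * X * D) * D' = X := fun X => by
    calc _ = (D * D') * X * (D * D') := by simp only [mul_assoc]
      _ = X := by rw [h2, one_mul, mul_one]
  simp only [mul_add, add_mul, e] at hc'; exact ⟨_, hc'⟩

lemma exists_backward_conjugator
    (hN : ∀ i j, i ≠ j → ¬ (i = 0 ∧ j = 1) → ¬ (i = 2 ∧ j = 3) → N i j = 0)
    (hB : ∀ i j, Continuous fun y => B y i j)
    (hBb : ∀ y i j, ‖B y i j‖ ≤ K * exp (-α * |y|)) (htr : ∀ y, (B y).trace = 0) (hα : 0 < α) :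
    ∃ Q, Conjugates (fun y => N + B y) N Q (Iic 0) atBot := by
  obtain ⟨P, hP⟩ := exists_forward_conjugator (N := -N) (B := fun y => -B (-y)) (K := K) (α := α)
    (fun i j a b c => by rw [Matrix.neg_apply, hN i j a b c, neg_zero])
    (fun i j => ((hB i j).comp continuous_neg).neg)
    (fun y i j => by rw [Matrix.neg_apply, norm_neg, ← abs_neg y]; exact hBb _ i j)
    (fun y => by rw [Matrix.trace_neg, htr, neg_zero]) hα
  have hm : ∀ {y : ℝ}, y ∈ Iic (0 : ℝ) → -y ∈ Ici (0 : ℝ) := fun {y} hy => by simpa using hy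
  refine ⟨fun y => P (-y), fun y hy => hP.isUnit _ (hm hy), fun y hy => ?_,
    hP.tendsto_one.comp tendsto_neg_atBot_atTop⟩
  refine (hP.ode _ (hm hy)).comp_neg.congr_deriv ?_
  rw [neg_neg]; noncomm_ring

end

end

section

/-! ### Evans functions of systems of order four -/

/-- The coefficient matrices along a curve. -/
def CoeffFamily.along {n : Type} (F : CoeffFamily n) (u : ℝ → ℝ) (z : ℂ) (y : ℝ) : Matrix n n ℂ :=
  F.eval (u y) (deriv u y) z

section

variable {I : Set ℝ} {κ W : ℝ → ℝ} {vs a b C Z σ η β ε Xl Xr μ : ℝ} {u ul ur : ℝ → ℝ}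
  {F : CoeffFamily (Fin 4)} {z d : ℂ} {E R L : Mat4}
local notation "rate" => saddleRate κ W vs

lemma CoeffFamily.Smooth.continuous_along {n : Type} {F : CoeffFamily n} (hF : F.Smooth I)
    (hu : IsOrbit I κ W μ u) (z : ℂ) (i j : n) : Continuous fun y => F.along u z y i j := by
  have h : ∀ {f : ℝ → ℝ}, ContDiffOn ℝ ∞ f I → Continuous fun y => f (u y) := fun hf =>
    hf.continuousOn.comp_continuous hu.continuous hu.mem
  simp only [CoeffFamily.along, CoeffFamily.eval, of_apply]
  exact (Complex.continuous_ofReal.comp ((h (hF.value i j)).add ((h (hF.slope i j)).mul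
    (hu.continuous_deriv.pow 2)))).add (continuous_const.mul
      (Complex.continuous_ofReal.comp (h (hF.spectral i j))))

lemma CoeffFamily.add_pert (F : CoeffFamily (Fin 4)) (R L : Mat4) (vs : ℝ) (z : ℂ) (u : ℝ → ℝ)
    (y : ℝ) : L * F.eval vs 0 z * R + F.pert R L vs z u y = L * F.along u z y * R := by
  rw [CoeffFamily.pert, ← add_mul, ← mul_add, add_sub_cancel, CoeffFamily.along]

/-- Block frames with uniform bounds on the perturbations. -/
lemma Saddle.exists_frames (h : Saddle I κ W vs) (hF : F.Smooth I)
    (htr : ∀ w ∈ I, ∀ p z, (F.eval w p z).trace = (F.eval vs 0 z).trace) (hab : Icc a b ⊆ I)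
    (hs : vs ∈ Icc a b) (hC : 0 < C) (hσ : 0 < σ) (hη : 0 < η) (hZ : 0 ≤ Z) :
    ∃ K : ℝ, 0 ≤ K ∧ ∀ (z : ℂ) (E : Mat4), ‖z‖ ≤ Z →
      IsSpectralProj (F.eval vs 0 z) E σ → E.trace = 2 →
      ∃ R L, BlockFrame (F.eval vs 0 z) E R L σ η ∧
      (∀ (μ : ℝ) (u : ℝ → ℝ), IsOrbit I κ W μ u → Decays a b vs rate C u →
        Localized K rate (F.pert R L vs z u)
          (fun y => F.gaugeCoeff E vs rate z * deriv u y)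
          (fun y => F.gaugeCoeff E vs rate z * deriv (deriv u) y) univ) ∧
      ∀ (μ μ' X : ℝ) (v u : ℝ → ℝ), IsOrbit I κ W μ v → IsOrbit I κ W μ' u →
        Follows a b vs rate C X v u → Decays a b vs rate C u →
        IsNear K rate X (F.pert R L vs z v)
          (fun y => F.gaugeCoeff E vs rate z * deriv v y)
          (fun y => F.gaugeCoeff E vs rate z * deriv (deriv v) y)
          (F.pert R L vs z u)
          (fun y => F.gaugeCoeff E vs rate z * deriv (deriv u) y) := by
  obtain ⟨Λ, hΛ, hb⟩ := hF.exists_bounds h.isOpen hab hs le_rfl hZ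
  have hc : 0 ≤ frameConst Λ σ η := by rw [frameConst]; positivity
  obtain ⟨K, hK, hloc⟩ := h.exists_localized hF htr hab hs hC.le hc hZ
  refine ⟨K, hK, fun z E hz hE hE2 => ?_⟩
  obtain ⟨Rm, Rp, Lm, Lp, hsp, rfl⟩ := hE.exists_splitting hE2
  obtain ⟨R, L, hfr, hR, hL⟩ := hsp.exists_blockFrame hσ hη hΛ.le
    fun i j => ((hb z hz i j).2 vs hs vs hs 0 0 (by simp) (by simp)).2.2
  obtain ⟨h1, h2⟩ := hloc z R L _ σ η hz hfr hR hL
  exact ⟨R, L, hfr, fun μ u hu hd => h1 μ u univ hu fun y _ => ⟨hd.mem y, hd.upper y⟩,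
    fun μ μ' X v u hv hu hf hd => h2 μ μ' X v u hv hu (fun y hy => ⟨hf.mem y hy, hf.decay y hy⟩)
      (fun y _ => ⟨hd.mem y, hd.upper y⟩) hf.diff⟩

variable {K α : ℝ} {p p' : ℝ → ℂ}

lemma BlockFrame.exists_transmission (hfr : BlockFrame (F.eval vs 0 z) E R L σ η) (hF : F.Smooth I)
    (hu : IsOrbit I κ W μ u) (hα : 0 < α) (hloc : Localized K α (F.pert R L vs z u) p p' univ) :
    ∃ d, IsTransmission (F.along u z) (F.eval vs 0 z) E d := by
  have hc : ∀ i j, Continuous fun y => F.pert R L vs z u y i j := fun i j => by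
    have h1 := hF.continuous_along hu z
    simp only [CoeffFamily.pert, Matrix.mul_apply, Matrix.sub_apply]
    exact continuous_finsetSum _ fun k _ => (continuous_finsetSum _ fun l _ =>
      continuous_const.mul ((h1 l k).sub continuous_const)).mul continuous_const
  have hb := fun y i j => hloc.bound y (mem_univ y) i j
  have ht := fun y => hloc.traceless y (mem_univ y)
  obtain ⟨Q, hQ⟩ := exists_backward_conjugator hfr.block.zero hc hb ht hα
  obtain ⟨P, hP⟩ := exists_forward_conjugator hfr.block.zero hc hb ht hα
  have e : ∀ X : Mat4, R * (L * X * R) * L = X := fun X => by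
    calc _ = (R * L) * X * (R * L) := by simp only [mul_assoc]
      _ = X := by rw [hfr.right_inv, one_mul, mul_one]
  have hQ' := hQ.conj hfr.right_inv hfr.left_inv
  have hP' := hP.conj hfr.right_inv hfr.left_inv
  simp only [CoeffFamily.add_pert, e] at hQ' hP'; exact ⟨_, _, _, hQ', hP', rfl⟩

lemma conj_inv {R L : Mat4} (hL : L * R = 1) (X : Mat4) : (L * X * R)⁻¹ = L * X⁻¹ * R := by
  rw [Matrix.mul_inv_rev, Matrix.mul_inv_rev, Matrix.inv_eq_left_inv hL,
    Matrix.inv_eq_right_inv hL, mul_assoc]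

lemma conj_mul {R L : Mat4} (hR : R * L = 1)
    (X Y : Mat4) : L * X * R * (L * Y * R) = L * (X * Y) * R := by
  calc _ = L * X * (R * L) * Y * R := by simp only [mul_assoc]
    _ = _ := by rw [hR, mul_one]; simp only [mul_assoc]

lemma IsTransmission.isPulse (hd : IsTransmission (F.along u z) (F.eval vs 0 z) E d)
    (hfr : BlockFrame (F.eval vs 0 z) E R L σ η) (hF : F.Smooth I) (hu : IsOrbit I κ W μ u)
    (hα : 0 < α) (hdec : Decays a b vs α C u) {G : ℂ}
    (hloc : Localized K α (F.pert R L vs z u) (fun y => G * deriv u y) p' univ) :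
    IsPulse (L * F.eval vs 0 z * R) K α (F.pert R L vs z u) (fun y => G * deriv u y) p' d := by
  have hlim : ∀ {l : Filter ℝ}, Tendsto (fun y : ℝ => |y|) l atTop →
      Tendsto (fun y => G * ((deriv u y : ℝ) : ℂ)) l (𝓝 0) := fun {l} hl => by
    have h1 : Tendsto (fun y : ℝ => ‖G‖ * (C * exp (-α * |y|))) l (𝓝 0) := by
      simpa using ((Real.tendsto_exp_atBot.comp
        (hl.const_mul_atTop_of_neg (neg_lt_zero.2 hα))).const_mul C).const_mul ‖G‖
    refine squeeze_zero_norm (fun y => ?_) h1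
    rw [norm_mul, norm_real, norm_eq_abs]
    have := hdec.upper y
    gcongr; linarith [abs_nonneg (u y - vs)]
  obtain ⟨Q, P, hQ, hP, rfl⟩ := hd
  have hK : 0 ≤ K := by simpa using (norm_nonneg _).trans (hloc.bound 0 trivial 0 0)
  set N := L * F.eval vs 0 z * R with hN
  obtain ⟨M, hM, hMu⟩ := exists_line_flow (A := fun y => N + F.pert R L vs z u y)
    (Λ := (∑ i, ∑ j, ‖N i j‖) + K) (t := N.trace)
    (fun i j => by
      simp only [hN, CoeffFamily.add_pert, Matrix.mul_apply]
      exact continuous_finsetSum _ fun k _ => (continuous_finsetSum _ fun l _ =>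
        continuous_const.mul (hF.continuous_along hu z l k)).mul continuous_const)
    (fun y i j => (norm_add_le _ _).trans (add_le_add
      (norm_entry_le_sum N i j)
      ((hloc.bound y trivial i j).trans (mul_le_of_le_one_right hK
        (exp_le_one_iff.2 (by nlinarith [abs_nonneg y]))))))
    (fun y => by rw [trace_add, hloc.traceless y trivial, add_zero])
  have hQ' := hQ.conj hfr.left_inv hfr.right_inv
  have hP' := hP.conj hfr.left_inv hfr.right_inv
  simp only [← CoeffFamily.add_pert F R L vs z u] at hQ' hP'
  refine ⟨hloc, hlim tendsto_abs_atBot_atTop, hlim tendsto_abs_atTop_atTop, M, _, _,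
    ⟨fun x _ => hM x, fun x _ => hMu x⟩, ⟨hQ'.1, hQ'.2, hQ'.3⟩, ⟨hP'.1, hP'.2, hP'.3⟩, ?_⟩
  rw [conj_inv hfr.left_inv, conj_mul hfr.right_inv, hfr.minor₂_conj]

/-- Transmission determinants exist and are unique. -/
lemma Saddle.exists_unique_transmission (h : Saddle I κ W vs) (hF : F.Smooth I)
    (htr : ∀ w ∈ I, ∀ p z, (F.eval w p z).trace = (F.eval vs 0 z).trace) (hab : Icc a b ⊆ I)
    (hs : vs ∈ Icc a b) (hC : 0 < C) (hσ : 0 < σ) (hE : IsSpectralProj (F.eval vs 0 z) E σ)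
    (hE2 : E.trace = 2) (hu : IsOrbit I κ W μ u) (hdec : Decays a b vs rate C u) :
    ∃! d, IsTransmission (F.along u z) (F.eval vs 0 z) E d := by
  obtain ⟨K, hK, hfrm⟩ := h.exists_frames (Z := ‖z‖) hF htr hab hs hC hσ (half_pos hσ) (norm_nonneg z)
  obtain ⟨R, L, hfr, hloc, -⟩ := hfrm z E le_rfl hE hE2
  have hl := hloc μ u hu hdec
  have hα := h.rate_pos
  obtain ⟨d, hd⟩ := hfr.exists_transmission hF hu hα hl
  refine ⟨d, hd, fun e he => ?_⟩
  have hm : 0 < min rate σ := lt_min hα hσ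
  exact IsPulse.unique (β := min rate σ / 2) hfr.block (half_pos hm)
    (by linarith [min_le_right rate σ]) (by linarith [min_le_left rate σ])
    hK (he.isPulse hfr hF hu hα hdec hl) (hd.isPulse hfr hF hu hα hdec hl)

/-- Two solitons with the same endstate. -/
structure PulsePair (I : Set ℝ) (κ W : ℝ → ℝ) (vs a b C : ℝ) (ul ur : ℝ → ℝ) : Prop where
  saddle : Saddle I κ W vs
  sub : Icc a b ⊆ I
  mem : vs ∈ Icc a b
  pos : 0 < C
  orbit_l : IsOrbit I κ W (W vs) ul
  orbit_r : IsOrbit I κ W (W vs) ur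
  decays_l : Decays a b vs (saddleRate κ W vs) C ul
  decays_r : Decays a b vs (saddleRate κ W vs) C ur

/-- Uniform approximation of the determinant of a two-pulse orbit by those of the solitons. -/
lemma PulsePair.exists_estimate (h : PulsePair I κ W vs a b C ul ur) (hF : F.Smooth I)
    (htr : ∀ w ∈ I, ∀ p z, (F.eval w p z).trace = (F.eval vs 0 z).trace) (hβ0 : 0 < β)
    (hβσ : β < σ) (hβ : β < rate) (hZ : 0 ≤ Z) :
    ∃ D > 0, ∀ (z : ℂ) (E : Mat4), ‖z‖ ≤ Z →
      IsSpectralProj (F.eval vs 0 z) E σ → E.trace = 2 → ∀ dl dr : ℂ,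
      IsTransmission (F.along ul z) (F.eval vs 0 z) E dl →
      IsTransmission (F.along ur z) (F.eval vs 0 z) E dr → ‖dl * dr‖ ≤ D ∧
      ∀ (ε Xl Xr : ℝ) (v : ℝ → ℝ), IsDoublePulse I κ W vs ε v Xl Xr →
        Follows a b vs rate C Xr (fun y => v (y + Xr)) ur →
        Follows a b vs rate C (-Xl) (fun y => v (y + Xl)) ul →
        ∀ Ψ : ℝ → Mat4, (∀ x, HasMatDeriv Ψ (F.along v z x * Ψ x) univ x) →
        (∀ x, IsUnit (Ψ x)) → ∀ γ : ℂ, ‖γ‖ = 1 →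
        ‖cexp (-(F.eval vs 0 z * E).trace * (2 * Xr - 2 * Xl)) * (γ ^ 2)⁻¹ *
          (Ψ (2 * Xr) * (Ψ (2 * Xl))⁻¹ - γ • (1 : Mat4)).det - dl * dr‖ ≤
          D * (exp (-2 * β * Xr) + exp (-2 * β * -Xl)) := by
  have hσ : 0 < σ := hβ0.trans hβσ
  have hη : 0 < σ - β := sub_pos.2 hβσ
  have hα := h.saddle.rate_pos
  obtain ⟨K, hK, hfrm⟩ := h.saddle.exists_frames hF htr h.sub h.mem h.pos hσ hη hZ
  set α := rate with hαdef
  refine ⟨max (evansConst K (α - β)) (compoundConst K (α - β) * compoundConst K (α - β)) + 1,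
    by have := (mul_self_nonneg (compoundConst K (α - β))).trans (le_max_right (evansConst K (α - β)) _)
       positivity,
    fun z E hz hE hE2 dl dr hdl hdr => ?_⟩
  obtain ⟨R, L, hfr, hloc, hnear⟩ := hfrm z E hz hE hE2
  have hsum : β + (σ - β) ≤ σ := by linarith
  have pl := hdl.isPulse hfr hF h.orbit_l hα h.decays_l (hloc _ _ h.orbit_l h.decays_l)
  have pr := hdr.isPulse hfr hF h.orbit_r hα h.decays_r (hloc _ _ h.orbit_r h.decays_r)
  constructor
  · have h1 := pl.norm_le hfr.block hβ0 hsum hβ hK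
    have h2 := pr.norm_le hfr.block hβ0 hsum hβ hK
    rw [norm_mul]
    refine (mul_le_mul h1 h2 (norm_nonneg _) ((norm_nonneg _).trans h1)).trans ?_
    linarith [le_max_right (evansConst K (α - β)) (compoundConst K (α - β) * compoundConst K (α - β))]
  · intro ε Xl Xr v hv hfr' hfl Ψ hΨ hΨu γ hγ
    set G := F.gaugeCoeff E vs α z
    have flow : ∀ c s, IsFlow (L * F.eval vs 0 z * R) (F.pert R L vs z fun y => v (y + c))
        (fun y => L * Ψ (y + c) * R) s := fun c s => by
      refine ⟨fun x _ => ?_, fun x _ => ?_⟩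
      · have h1 : HasMatDeriv (fun y => Ψ (y + c)) (F.along v z (x + c) * Ψ (x + c)) univ x :=
          fun i j => ((hΨ (x + c) i j).hasDerivAt univ_mem).comp_add_const x c |>.hasDerivWithinAt
        have e : F.along (fun y => v (y + c)) z x = F.along v z (x + c) := by
          simp only [CoeffFamily.along, deriv_comp_add_const]
        rw [CoeffFamily.add_pert, e, conj_mul hfr.right_inv]
        exact ((h1.const_mul L).mul_const R).mono (subset_univ s)
      · exact ((show IsUnit L from ⟨⟨L, R, hfr.left_inv, hfr.right_inv⟩, rfl⟩).mul (hΨu _)).mul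
          ⟨⟨R, L, hfr.right_inv, hfr.left_inv⟩, rfl⟩
    have key := norm_evans_block_sub_le (γ := γ) hfr.block hη.le hβ0 hsum hβ hK pr pl
      hv.first_max.1.1.le (neg_nonneg.2 hv.last_min.1.1.le)
      (hnear _ _ _ _ _ (hv.orbit.comp_add Xr) h.orbit_r hfr' h.decays_r)
      (hnear _ _ _ _ _ (hv.orbit.comp_add Xl) h.orbit_l hfl h.decays_l)
      (flow Xr _) (flow Xl _)
      (by
        have h1 := (hv.deriv_ends h.saddle).1
        have h2 := (hv.deriv_ends h.saddle).2
        simp only [deriv_comp_add_const, neg_add_cancel, neg_neg, ← two_mul, h1,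
          show -Xl + Xl = 0 by ring, h2]
        push_cast; ring)
      hγ
    simp only [neg_neg, neg_add_cancel, ← two_mul, show -Xr + Xr = 0 by ring] at key
    rw [conj_inv hfr.left_inv, conj_inv hfr.left_inv, conj_mul hfr.right_inv,
      conj_mul hfr.right_inv, conj_mul hfr.right_inv, mul_assoc (Ψ (2 * Xr)),
      Matrix.nonsing_inv_mul_cancel_left _ _ (isUnit_det (hΨu 0)),
      hfr.growth_eq, mul_comm dr] at key
    have e : L * (Ψ (2 * Xr) * (Ψ (2 * Xl))⁻¹) * R - γ • 1 =
        L * (Ψ (2 * Xr) * (Ψ (2 * Xl))⁻¹ - γ • 1) * R := by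
      rw [mul_sub, sub_mul, Matrix.mul_smul, smul_mul, mul_one, hfr.left_inv]
    rw [e, det_mul, det_mul, mul_right_comm L.det, ← det_mul, hfr.left_inv,
      Matrix.det_one, one_mul] at key
    refine le_trans (le_of_eq ?_) (key.trans (mul_le_mul_of_nonneg_right ?_ (by positivity)))
    · push_cast
      congr 5; ring_nf
    · linarith [le_max_left (evansConst K (α - β)) (compoundConst K (α - β) * compoundConst K (α - β))]

end

end

section

/-! ### Reduction of order three to order four -/

section

variable {A E Ainf : Mat3} {B P : ℝ → Mat3} {s : Set ℝ} {l : Filter ℝ} {c e d : ℂ} {σ x : ℝ}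

lemma HasMatDeriv.pad {M' : Mat3} {t : ℝ → ℂ} {t' : ℂ}
    (hM : HasMatDeriv P M' s x) (ht : HasDerivWithinAt t t' s x) :
    HasMatDeriv (fun y => padMatrix (P y) (t y)) (padMatrix M' t') s x := by
  refine forall_padMatrix (fun i j => ?_) (fun i => ?_) (fun j => ?_) ?_ <;>
    simp only [padMatrix, reindex_apply, submatrix_apply, Equiv.symm_apply_apply,
      Matrix.fromBlocks_apply₁₁, Matrix.fromBlocks_apply₁₂, Matrix.fromBlocks_apply₂₁,
      Matrix.fromBlocks_apply₂₂, of_apply, Matrix.zero_apply]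
  · exact hM i j
  · exact hasDerivWithinAt_const ..
  · exact hasDerivWithinAt_const ..
  · exact ht

lemma Conjugates.pad (h : Conjugates B Ainf P s l) (c : ℂ) :
    Conjugates (fun y => padMatrix (B y) c) (padMatrix Ainf c) (fun y => padMatrix (P y) 1) s l where
  isUnit y hy := isUnit_padMatrix.2 ⟨h.isUnit y hy, one_ne_zero⟩
  ode y hy := ((h.ode y hy).pad (hasDerivWithinAt_const y s (1 : ℂ))).congr_deriv (by
    rw [padMatrix_mul, padMatrix_mul, padMatrix_sub, mul_one, one_mul, sub_self])
  tendsto_one := by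
    rw [← padMatrix_one]
    have h1 : Continuous fun X : Mat3 => padMatrix X 1 :=
      (continuous_id.matrix_fromBlocks continuous_const continuous_const
        continuous_const).matrix_reindex _ _
    exact (h1.tendsto 1).comp h.tendsto_one

/-- The leading block of order three. -/
def headBlock (X : Mat4) : Mat3 :=
  Matrix.of fun i j => X (finSumFinEquiv (Sum.inl i : Fin 3 ⊕ Fin 1))
    (finSumFinEquiv (Sum.inl j : Fin 3 ⊕ Fin 1))

lemma headBlock_pad_mul (X : Mat3) (c : ℂ) (Y : Mat4) :
    headBlock (padMatrix X c * Y) = X * headBlock Y := by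
  ext i j
  rw [headBlock, of_apply, Matrix.mul_apply, Matrix.mul_apply,
    ← (finSumFinEquiv (m := 3) (n := 1)).sum_comp, Fintype.sum_sum_type]
  simp [padMatrix, headBlock]

lemma headBlock_mul_pad (X : Mat3) (c : ℂ) (Y : Mat4) :
    headBlock (Y * padMatrix X c) = headBlock Y * X := by
  ext i j
  rw [headBlock, of_apply, Matrix.mul_apply, Matrix.mul_apply,
    ← (finSumFinEquiv (m := 3) (n := 1)).sum_comp, Fintype.sum_sum_type]
  simp [padMatrix, headBlock]

lemma Conjugates.headBlock [l.NeBot] {P : ℝ → Mat4}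
    (h : Conjugates (fun y => padMatrix (B y) c) (padMatrix Ainf c) P s l) (hs : Convex ℝ s)
    (hsl : s ∈ l) (htr : ∀ y ∈ s, (B y).trace = Ainf.trace) :
    Conjugates B Ainf (fun y => headBlock (P y)) s l := by
  have hode : ∀ y ∈ s, HasMatDeriv (fun y => TwoPulse.headBlock (P y))
      (B y * TwoPulse.headBlock (P y) - TwoPulse.headBlock (P y) * Ainf) s y := fun y hy i j => by
    rw [← headBlock_pad_mul _ c, ← headBlock_mul_pad _ c]; exact h.ode y hy _ _
  have hlim : Tendsto (fun y => TwoPulse.headBlock (P y)) l (𝓝 1) := by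
    have h1 : Continuous TwoPulse.headBlock :=
      continuous_matrix fun i j => continuous_id.matrix_elem _ _
    have h2 : TwoPulse.headBlock 1 = 1 := by
      ext i j; rw [← padMatrix_one, TwoPulse.headBlock, of_apply, padMatrix_inl]
    rw [← h2]; exact (h1.tendsto 1).comp h.tendsto_one
  refine ⟨fun y hy => ?_, hode, hlim⟩
  rw [isUnit_iff_isUnit_det, det_eq_one_of_conjugates hs hsl hode hlim htr hy]; exact isUnit_one

lemma IsTransmission.pad (h : IsTransmission B Ainf E d) (c e : ℂ) :
    IsTransmission (fun y => padMatrix (B y) c) (padMatrix Ainf c) (padMatrix E e) d := by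
  obtain ⟨Q, P, hQ, hP, rfl⟩ := h
  refine ⟨_, _, hQ.pad c, hP.pad c, ?_⟩
  have h1 : (1 : Mat4) + ((padMatrix (P 0) 1)⁻¹ * padMatrix (Q 0) 1 - 1) *
      padMatrix E e = padMatrix (1 + ((P 0)⁻¹ * Q 0 - 1) * E) 1 := by
    rw [padMatrix_inv (hP.isUnit 0 self_mem_Ici) one_ne_zero, padMatrix_mul, ← padMatrix_one,
      padMatrix_sub, padMatrix_mul, padMatrix_add]
    simp
  rw [h1, det_padMatrix, mul_one]

lemma padMatrix_mulVec_inl (X : Mat3) (c : ℂ) (w : Fin 4 → ℂ) (i : Fin 3) :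
    (padMatrix X c).mulVec w (finSumFinEquiv (Sum.inl i : Fin 3 ⊕ Fin 1)) =
      X.mulVec (fun j => w (finSumFinEquiv (Sum.inl j : Fin 3 ⊕ Fin 1))) i := by
  rw [Matrix.mulVec, dotProduct, ← (finSumFinEquiv (m := 3) (n := 1)).sum_comp,
    Fintype.sum_sum_type]
  simp [padMatrix, Matrix.mulVec, dotProduct]

lemma padMatrix_mulVec_inr (X : Mat3) (c : ℂ) (w : Fin 4 → ℂ) :
    (padMatrix X c).mulVec w (finSumFinEquiv (Sum.inr 0 : Fin 3 ⊕ Fin 1)) =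
      c * w (finSumFinEquiv (Sum.inr 0 : Fin 3 ⊕ Fin 1)) := by
  rw [Matrix.mulVec, dotProduct, ← (finSumFinEquiv (m := 3) (n := 1)).sum_comp,
    Fintype.sum_sum_type]
  simp [padMatrix]

lemma IsSpectralProj.pad (h : IsSpectralProj A E σ) (he : e * e = e) (h1 : e ≠ 0 → σ ≤ c.re)
    (h0 : e ≠ 1 → c.re ≤ -σ) : IsSpectralProj (padMatrix A c) (padMatrix E e) σ := by
  have key : ∀ {w : Fin 4 → ℂ} {μ : ℂ}, w ≠ 0 → (padMatrix A c).mulVec w = μ • w →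
      (w (finSumFinEquiv (Sum.inr 0 : Fin 3 ⊕ Fin 1)) ≠ 0 ∧ c = μ) ∨
      ((fun j => w (finSumFinEquiv (Sum.inl j : Fin 3 ⊕ Fin 1))) ≠ 0 ∧
        A.mulVec (fun j => w (finSumFinEquiv (Sum.inl j : Fin 3 ⊕ Fin 1))) =
          μ • fun j => w (finSumFinEquiv (Sum.inl j : Fin 3 ⊕ Fin 1))) := by
    intro w μ hw hA
    by_cases hl : w (finSumFinEquiv (Sum.inr 0 : Fin 3 ⊕ Fin 1)) = 0
    · refine Or.inr ⟨fun h2 => hw ?_, ?_⟩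
      · ext i
        obtain ⟨i, rfl⟩ := (finSumFinEquiv (m := 3) (n := 1)).surjective i
        rcases i with i | i
        · exact congrFun h2 i
        · rw [Subsingleton.elim i 0]; exact hl
      · ext i
        rw [← padMatrix_mulVec_inl A c, hA]; rfl
    · refine Or.inl ⟨hl, mul_right_cancel₀ hl ?_⟩
      rw [← padMatrix_mulVec_inr A, hA]; rfl
  refine ⟨by rw [padMatrix_mul, h.idem, he], by rw [padMatrix_mul, padMatrix_mul, h.comm, mul_comm],
    fun w μ hw hE hA => ?_, fun w μ hw hE hA => ?_⟩
  · rcases key hw hA with ⟨hl, rfl⟩ | ⟨hl, hA'⟩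
    · refine h1 fun h2 => hl ?_
      rw [← hE, padMatrix_mulVec_inr, h2, zero_mul]
    · refine h.unstable _ μ hl ?_ hA'
      ext i
      rw [← padMatrix_mulVec_inl E e, hE]
  · rcases key hw hA with ⟨hl, rfl⟩ | ⟨hl, hA'⟩
    · refine h0 fun h2 => hl ?_
      rw [← one_mul (w _), ← h2, ← padMatrix_mulVec_inr E, hE]; rfl
    · refine h.stable _ μ hl ?_ hA'
      ext i
      rw [← padMatrix_mulVec_inl E e, hE]; rfl

lemma SpectralFrame.exists_pad (F : SpectralFrame A) (hσ : 0 < σ)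
    (h : ∀ μ ∈ spectrum ℂ A, σ ≤ |μ.re|) (hu : F.nu ≤ 2) (hs : F.ns ≤ 2) :
    ∃ (c : ℝ) (e : ℂ), (c = σ ∧ e = 1 ∧ F.ns = 2 ∨ c = -σ ∧ e = 0 ∧ F.ns = 1) ∧
      IsSpectralProj (padMatrix A c) (padMatrix F.projUnstable e) σ ∧
      (padMatrix F.projUnstable e).trace = 2 := by
  have hsum := F.nu_add_ns
  rw [card_fin] at hsum
  have hp := F.isSpectralProj hσ h
  rcases (show F.ns = 2 ∨ F.ns = 1 by omega) with h2 | h2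
  · refine ⟨σ, 1, Or.inl ⟨rfl, rfl, h2⟩, hp.pad (by ring) (by simp) (by simp), ?_⟩
    rw [trace_padMatrix, F.trace_projUnstable, show F.nu = 1 by omega]; norm_num
  · refine ⟨-σ, 0, Or.inr ⟨rfl, rfl, h2⟩, hp.pad (by ring) (by simp) (by simp), ?_⟩
    rw [trace_padMatrix, F.trace_projUnstable, show F.nu = 2 by omega]; norm_num

end

/-! ### Uniform statements for both orders -/

section

variable {n : Type} [Fintype n] [DecidableEq n]

/-- Transmission determinants of solitons exist and are unique. -/
def UniqueTransmission (F : CoeffFamily n) (I : Set ℝ) (κ W : ℝ → ℝ) (vs a b C : ℝ) : Prop :=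
  ∀ (z : ℂ) (u : ℝ → ℝ) (Fr : SpectralFrame (F.eval vs 0 z)), IsOrbit I κ W (W vs) u →
    Decays a b vs (saddleRate κ W vs) C u → (∀ μ ∈ spectrum ℂ (F.eval vs 0 z), μ.re ≠ 0) →
    Fr.nu ≤ 2 → Fr.ns ≤ 2 →
    ∃! d, IsTransmission (F.along u z) (F.eval vs 0 z) Fr.projUnstable d

/-- The rescaled Evans function of two-pulse orbits is uniformly close to the product of the
transmission determinants of the solitons. -/
def UniformApproximation (F : CoeffFamily n) (I : Set ℝ) (κ W : ℝ → ℝ) (vs a b C : ℝ)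
    (ul ur : ℝ → ℝ) (σ β Z : ℝ) : Prop :=
  ∃ D > 0, ∀ (z : ℂ) (Fr : SpectralFrame (F.eval vs 0 z)), ‖z‖ ≤ Z →
    (∀ μ ∈ spectrum ℂ (F.eval vs 0 z), σ ≤ |μ.re|) → Fr.nu ≤ 2 → Fr.ns ≤ 2 → ∀ dl dr : ℂ,
    IsTransmission (F.along ul z) (F.eval vs 0 z) Fr.projUnstable dl →
    IsTransmission (F.along ur z) (F.eval vs 0 z) Fr.projUnstable dr →
    ∀ (ε Xl Xr : ℝ) (v : ℝ → ℝ), IsDoublePulse I κ W vs ε v Xl Xr →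
      Follows a b vs (saddleRate κ W vs) C Xr (fun y => v (y + Xr)) ur →
      Follows a b vs (saddleRate κ W vs) C (-Xl) (fun y => v (y + Xl)) ul →
      exp (-2 * β * Xr) ≤ 1 / 2 → ∀ Ψ : ℝ → Matrix n n ℂ, IsFundamental (F.along v z) Ψ →
      ∀ γ : ℂ, ‖γ‖ = 1 → ‖rescaledEvans Fr Ψ Xl Xr γ - dl * dr‖ ≤
        D * (exp (-2 * β * Xr) + exp (-2 * β * -Xl))

end

namespace PulsePair

variable {I : Set ℝ} {κ W : ℝ → ℝ} {vs a b C Z σ β : ℝ} {ul ur : ℝ → ℝ}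
local notation "rate" => saddleRate κ W vs

lemma uniqueTransmission_four (h : PulsePair I κ W vs a b C ul ur) {F : CoeffFamily (Fin 4)}
    (hF : F.Smooth I) (htr : ∀ w p z, (F.eval w p z).trace = 0) :
    UniqueTransmission F I κ W vs a b C := by
  intro z u Fr hu hd hsp hnu hns
  obtain ⟨σ, hσ, hgap⟩ := exists_spectral_gap hsp
  have hsum := Fr.nu_add_ns
  rw [card_fin] at hsum
  exact h.saddle.exists_unique_transmission hF (fun w _ p z => by rw [htr, htr]) h.sub h.mem h.pos hσ
    (Fr.isSpectralProj hσ hgap) (by rw [Fr.trace_projUnstable, show Fr.nu = 2 by omega]; norm_num)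
    hu hd

lemma uniqueTransmission_three (h : PulsePair I κ W vs a b C ul ur) {F : CoeffFamily (Fin 3)}
    (hF : F.Smooth I) (htr : ∀ w p z, (F.eval w p z).trace = 0) :
    UniqueTransmission F I κ W vs a b C := by
  intro z u Fr hu hd hsp hnu hns
  obtain ⟨σ, hσ, hgap⟩ := exists_spectral_gap hsp
  obtain ⟨c, e, -, hp, hp2⟩ := Fr.exists_pad hσ hgap hnu hns
  rw [← F.eval_pad] at hp
  obtain ⟨d, ⟨Q, P, hQ, hP, -⟩, huniq⟩ := h.saddle.exists_unique_transmission (hF.pad c)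
    (fun w _ p z => by rw [F.eval_pad, F.eval_pad, trace_padMatrix, trace_padMatrix, htr, htr])
    h.sub h.mem h.pos hσ hp hp2 hu hd
  have e1 : (F.pad c).along u z = fun y => padMatrix (F.along u z y) c :=
    funext fun y => F.eval_pad c _ _ _
  rw [e1, F.eval_pad] at hQ hP huniq
  refine ⟨_, ⟨_, _, hQ.headBlock (convex_Iic 0) (Iic_mem_atBot 0) fun y _ => ?_,
    hP.headBlock (convex_Ici 0) (Ici_mem_atTop 0) fun y _ => ?_, rfl⟩, ?_⟩
  · rw [CoeffFamily.along, htr, htr]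
  · rw [CoeffFamily.along, htr, htr]
  · intro d' hd'
    rw [huniq d' (hd'.pad c e)]
    refine (huniq _ (IsTransmission.pad ⟨_, _, hQ.headBlock (convex_Iic 0) (Iic_mem_atBot 0)
      fun y _ => ?_, hP.headBlock (convex_Ici 0) (Ici_mem_atTop 0) fun y _ => ?_, rfl⟩ c e)).symm
    · rw [CoeffFamily.along, htr, htr]
    · rw [CoeffFamily.along, htr, htr]

lemma uniformApproximation_four (h : PulsePair I κ W vs a b C ul ur) {F : CoeffFamily (Fin 4)}
    (hF : F.Smooth I) (htr : ∀ w p z, (F.eval w p z).trace = 0) (hβ0 : 0 < β) (hβσ : β < σ)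
    (hβ : β < rate) (hZ : 0 ≤ Z) :
    UniformApproximation F I κ W vs a b C ul ur σ β Z := by
  obtain ⟨D, hD, hest⟩ := h.exists_estimate hF (fun w _ p z => by rw [htr, htr]) hβ0 hβσ hβ hZ
  refine ⟨D, hD, fun z Fr hz hgap hnu hns dl dr hdl hdr ε Xl Xr v hv hfr hfl _ Ψ hΨ γ hγ => ?_⟩
  have hsum := Fr.nu_add_ns
  rw [card_fin] at hsum
  have htr' : ∀ y, (F.along v z y).trace = 0 := fun y => htr _ _ _
  have key := (hest z _ hz (Fr.isSpectralProj (hβ0.trans hβσ) hgap)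
    (by rw [Fr.trace_projUnstable, show Fr.nu = 2 by omega]; norm_num) dl dr hdl hdr).2 ε Xl Xr v hv
    hfr hfl Ψ (fun x i j => (hΨ.2 x i j).hasDerivWithinAt) (hΨ.isUnit htr') γ hγ
  rwa [rescaledEvans_eq Fr (htr _ _ _) htr' hΨ, show Fr.ns = 2 by omega, even_two.neg_pow]

lemma uniformApproximation_three (h : PulsePair I κ W vs a b C ul ur) {F : CoeffFamily (Fin 3)}
    (hF : F.Smooth I) (htr : ∀ w p z, (F.eval w p z).trace = 0) (hβ0 : 0 < β) (hβσ : β < σ)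
    (hβ : β < rate) (hZ : 0 ≤ Z) :
    UniformApproximation F I κ W vs a b C ul ur σ β Z := by
  have hσ := hβ0.trans hβσ
  have htr4 : ∀ c : ℝ, ∀ w ∈ I, ∀ p z, ((F.pad c).eval w p z).trace = ((F.pad c).eval vs 0 z).trace :=
    fun c w _ p z => by rw [F.eval_pad, F.eval_pad, trace_padMatrix, trace_padMatrix, htr, htr]
  obtain ⟨D1, hD1, hest₁⟩ := h.exists_estimate (hF.pad σ) (htr4 σ) hβ0 hβσ hβ hZ
  obtain ⟨D2, hD2, hest₂⟩ := h.exists_estimate (hF.pad (-σ)) (htr4 (-σ)) hβ0 hβσ hβ hZ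
  refine ⟨4 * max D1 D2, by have := lt_of_lt_of_le hD1 (le_max_left D1 D2); positivity,
    fun z Fr hz hgap hnu hns dl dr hdl hdr ε Xl Xr v hv hfr hfl hsmall Ψ hΨ γ hγ => ?_⟩
  have hγ0 : γ ≠ 0 := fun h0 => by simp [h0] at hγ
  have htr' : ∀ y, (F.along v z y).trace = 0 := fun y => htr _ _ _
  set m := exp (-2 * β * Xr) + exp (-2 * β * -Xl) with hm
  have hm0 : exp (-2 * β * Xr) ≤ m := by linarith [exp_pos (-2 * β * -Xl)]
  have hXr := hv.first_max.1.1
  have hXl := hv.last_min.1.1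
  have hexp : exp (-σ * (2 * Xr - 2 * Xl)) ≤ exp (-2 * β * Xr) := by
    refine exp_le_exp.2 ?_
    nlinarith [mul_pos hσ hXr, mul_pos (sub_pos.2 hβσ) hXr, mul_pos hσ (neg_pos.2 hXl)]
  obtain ⟨c, e, hce, hp, hp2⟩ := Fr.exists_pad hσ hgap hnu hns
  have e1 : ∀ u, (F.pad c).along u z = fun y => padMatrix (F.along u z y) c := fun u =>
    funext fun y => F.eval_pad c _ _ _
  set Φ : ℝ → Mat4 := fun x => padMatrix (Ψ x) (cexp (c * x)) with hΦ
  have hΦd : ∀ x, HasMatDeriv Φ ((F.pad c).along v z x * Φ x) univ x := fun x => by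
    have h1 : HasMatDeriv Ψ (F.along v z x * Ψ x) univ x := fun i j => (hΨ.2 x i j).hasDerivWithinAt
    have h2 : HasDerivWithinAt (fun x : ℝ => cexp (c * x)) (c * cexp (c * x)) univ x := by
      have := ((hasDerivAt_id x).ofReal_comp.const_mul (c : ℂ)).cexp
      simpa [mul_comm] using this
    refine (h1.pad h2).congr_deriv ?_
    rw [e1, hΦ, padMatrix_mul]
  have hΦu : ∀ x, IsUnit (Φ x) := fun x =>
    isUnit_padMatrix.2 ⟨hΨ.isUnit htr' x, Complex.exp_ne_zero _⟩
  have key : ‖dl * dr‖ ≤ max D1 D2 ∧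
      ‖cexp (-((F.pad c).eval vs 0 z * padMatrix Fr.projUnstable e).trace *
        (2 * Xr - 2 * Xl)) * (γ ^ 2)⁻¹ *
        (Φ (2 * Xr) * (Φ (2 * Xl))⁻¹ - γ • (1 : Mat4)).det - dl * dr‖ ≤
          max D1 D2 * m := by
    have tl := hdl.pad c e
    have tr := hdr.pad c e
    rw [← F.eval_pad] at hp
    rw [← e1, ← F.eval_pad] at tl tr
    rcases hce with ⟨rfl, -⟩ | ⟨rfl, -⟩
    · obtain ⟨k1, k2⟩ := hest₁ z _ hz hp hp2 dl dr tl tr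
      exact ⟨k1.trans (le_max_left _ _), (k2 ε Xl Xr v hv hfr hfl Φ hΦd hΦu γ hγ).trans
        (mul_le_mul_of_nonneg_right (le_max_left _ _) (by positivity))⟩
    · obtain ⟨k1, k2⟩ := hest₂ z _ hz hp hp2 dl dr tl tr
      exact ⟨k1.trans (le_max_right _ _), (k2 ε Xl Xr v hv hfr hfl Φ hΦd hΦu γ hγ).trans
        (mul_le_mul_of_nonneg_right (le_max_right _ _) (by positivity))⟩
  obtain ⟨δ, hδ, hδe⟩ : ∃ δ : ℂ, ‖δ‖ = exp (-σ * (2 * Xr - 2 * Xl)) ∧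
      cexp (-((F.pad c).eval vs 0 z * padMatrix Fr.projUnstable e).trace *
        (2 * Xr - 2 * Xl)) * (γ ^ 2)⁻¹ *
        (Φ (2 * Xr) * (Φ (2 * Xl))⁻¹ - γ • (1 : Mat4)).det =
        rescaledEvans Fr Ψ Xl Xr γ * (1 - δ) := by
    have e2 : Φ (2 * Xr) * (Φ (2 * Xl))⁻¹ - γ • (1 : Mat4) =
        padMatrix (Ψ (2 * Xr) * (Ψ (2 * Xl))⁻¹ - γ • 1)
          (cexp (c * (2 * Xr - 2 * Xl)) - γ) := by
      rw [hΦ, padMatrix_inv (hΨ.isUnit htr' _) (Complex.exp_ne_zero _), padMatrix_mul,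
        ← padMatrix_one, padMatrix_smul, padMatrix_sub, ← Complex.exp_neg, ← Complex.exp_add]
      congr 2
      · push_cast; ring_nf
      · ring
    rw [e2, det_padMatrix, F.eval_pad, padMatrix_mul, trace_padMatrix,
      rescaledEvans_eq Fr (htr _ _ _) htr' hΨ]
    set t := (F.eval vs 0 z * Fr.projUnstable).trace
    set Δ := (Ψ (2 * Xr) * (Ψ (2 * Xl))⁻¹ - γ • (1 : Mat3)).det
    have hn : ‖cexp (-σ * (2 * Xr - 2 * Xl))‖ = exp (-σ * (2 * Xr - 2 * Xl)) := by
      rw [Complex.norm_exp]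
      congr 1
      norm_cast
    rcases hce with ⟨rfl, rfl, h2⟩ | ⟨rfl, rfl, h2⟩
    · refine ⟨γ * cexp (-c * (2 * Xr - 2 * Xl)), by rw [norm_mul, hγ, one_mul, hn], ?_⟩
      rw [h2, even_two.neg_pow, mul_one, show -(t + (c : ℂ)) * (2 * Xr - 2 * Xl) =
        -t * (2 * Xr - 2 * Xl) + -c * (2 * Xr - 2 * Xl) by ring, Complex.exp_add]
      have h3 : cexp (-c * (2 * Xr - 2 * Xl)) * cexp (c * (2 * Xr - 2 * Xl)) = 1 := by
        rw [← Complex.exp_add, ← Complex.exp_zero]; congr 1; ring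
      linear_combination (cexp (-t * (2 * Xr - 2 * Xl)) * (γ ^ 2)⁻¹ * Δ) * h3
    · refine ⟨γ⁻¹ * cexp (-σ * (2 * Xr - 2 * Xl)), by
        rw [norm_mul, norm_inv, hγ, inv_one, one_mul, hn], ?_⟩
      rw [h2, mul_zero, add_zero]
      push_cast
      field_simp; ring
  rw [hδe] at key
  have hδ2 : ‖δ‖ ≤ 1 / 2 := by rw [hδ]; exact hexp.trans hsmall
  have h1 : 1 / 2 ≤ ‖1 - δ‖ := by
    have := norm_sub_norm_le (1 : ℂ) δ
    rw [norm_one] at this; linarith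
  have h2 : (rescaledEvans Fr Ψ Xl Xr γ - dl * dr) * (1 - δ) =
      (rescaledEvans Fr Ψ Xl Xr γ * (1 - δ) - dl * dr) + dl * dr * δ := by ring
  have h3 : ‖rescaledEvans Fr Ψ Xl Xr γ - dl * dr‖ * ‖1 - δ‖ ≤
      max D1 D2 * m + max D1 D2 * m := by
    rw [← norm_mul, h2]
    refine (norm_add_le _ _).trans (add_le_add key.2 ?_)
    rw [norm_mul]
    exact mul_le_mul key.1 (by rw [hδ]; exact hexp.trans hm0) (norm_nonneg _)
      ((norm_nonneg _).trans key.1)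
  nlinarith [norm_nonneg (rescaledEvans Fr Ψ Xl Xr γ - dl * dr)]

end PulsePair

end

section

/-! ### Application to the Hamiltonian models -/

namespace Model

variable {M : Model} {vs vl vr a b C Z σ β : ℝ} {ul ur : ℝ → ℝ}

lemma uniqueTransmission (hM : M.Admissible) (h : PulsePair M.I M.κ M.W vs a b C ul ur) :
    UniqueTransmission M.coeff M.I M.κ M.W vs a b C := by
  have hF := smooth_coeff hM h.saddle
  cases M with
  | scalar => exact h.uniqueTransmission_three hF trace_coeff
  | system => exact h.uniqueTransmission_four hF trace_coeff

lemma uniformApproximation (hM : M.Admissible) (h : PulsePair M.I M.κ M.W vs a b C ul ur)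
    (hβ0 : 0 < β) (hβσ : β < σ) (hβ : β < saddleRate M.κ M.W vs) (hZ : 0 ≤ Z) :
    UniformApproximation M.coeff M.I M.κ M.W vs a b C ul ur σ β Z := by
  have hF := smooth_coeff hM h.saddle
  cases M with
  | scalar => exact h.uniformApproximation_three hF trace_coeff hβ0 hβσ hβ hZ
  | system => exact h.uniformApproximation_four hF trace_coeff hβ0 hβσ hβ hZ

lemma A_eq_along (hs : Saddle M.I M.κ M.W vs) {μ : ℝ} {v : ℝ → ℝ}
    (hv : IsOrbit M.I M.κ M.W μ v) (z : ℂ) : (fun x => M.A v x z) = M.coeff.along v z :=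
  funext fun x => A_eq_eval hs hv x z

lemma re_ne_zero_of_mem_spectrum (hM : M.Admissible) (hs : Saddle M.I M.κ M.W vs) {z : ℂ}
    (hz : 0 < z.re) : ∀ μ ∈ spectrum ℂ (M.Ainf vs z), μ.re ≠ 0 := by
  obtain ⟨h, φ, hL, -⟩ := exists_lyapunov hM hs hz
  exact fun μ hμ => hL.re_ne_zero hμ

lemma rank_le_two (hM : M.Admissible) (hs : Saddle M.I M.κ M.W vs) {z : ℂ} (hz : 0 < z.re)
    (Fr : SpectralFrame (M.Ainf vs z)) : Fr.nu ≤ 2 ∧ Fr.ns ≤ 2 := by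
  obtain ⟨h, φ, hL, hφ⟩ := exists_lyapunov hM hs hz
  obtain ⟨σ, hσ, hgap⟩ := exists_spectral_gap (re_ne_zero_of_mem_spectrum hM hs hz)
  exact hL.frame_rank_le Fr hσ hgap φ hφ

lemma exists_transmissions (hM : M.Admissible) (h : PulsePair M.I M.κ M.W vs a b C ul ur) (z : ℂ) :
    ∃ dl dr : ℂ, 0 < z.re → ∀ Fr : SpectralFrame (M.Ainf vs z),
      (∀ d, IsTransmission (fun x => M.A ul x z) (M.Ainf vs z) Fr.projUnstable d ↔ d = dl) ∧
      ∀ d, IsTransmission (fun x => M.A ur x z) (M.Ainf vs z) Fr.projUnstable d ↔ d = dr := by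
  by_cases hz : 0 < z.re
  swap
  · exact ⟨0, 0, fun h0 => (hz h0).elim⟩
  have hre := re_ne_zero_of_mem_spectrum hM h.saddle hz
  obtain ⟨F0⟩ := nonempty_spectralFrame hre
  have hrk := rank_le_two hM h.saddle hz F0
  have hut := uniqueTransmission hM h
  have key : ∀ u, IsOrbit M.I M.κ M.W (M.W vs) u → Decays a b vs (saddleRate M.κ M.W vs) C u →
      ∃! d, IsTransmission (fun x => M.A u x z) (M.Ainf vs z) F0.projUnstable d := fun u hu hd => by
    rw [A_eq_along h.saddle hu]
    revert F0 hre
    rw [Ainf_eq_eval h.saddle]; exact fun hre F0 hrk => hut z u F0 hu hd hre hrk.1 hrk.2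
  obtain ⟨dl, h1, h2⟩ := key ul h.orbit_l h.decays_l
  obtain ⟨dr, h3, h4⟩ := key ur h.orbit_r h.decays_r
  refine ⟨dl, dr, fun _ Fr => ?_⟩
  rw [Fr.projUnstable_unique F0]
  exact ⟨fun d => ⟨h2 d, fun e => e ▸ h1⟩, fun d => ⟨h4 d, fun e => e ▸ h3⟩⟩

lemma trace_A (hs : Saddle M.I M.κ M.W vs) {μ : ℝ} {v : ℝ → ℝ}
    (hv : IsOrbit M.I M.κ M.W μ v) (x : ℝ) (z : ℂ) : (M.A v x z).trace = (M.Ainf vs z).trace := by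
  rw [A_eq_eval hs hv, Ainf_eq_eval hs, trace_coeff, trace_coeff]

lemma isLimitEvans_iff_of_transmissions (hM : M.Admissible)
    (h : PulsePair M.I M.κ M.W vs a b C ul ur) {z dl dr d : ℂ} (hz : 0 < z.re)
    (hd : ∀ Fr : SpectralFrame (M.Ainf vs z),
      (∀ d, IsTransmission (fun x => M.A ul x z) (M.Ainf vs z) Fr.projUnstable d ↔ d = dl) ∧
      ∀ d, IsTransmission (fun x => M.A ur x z) (M.Ainf vs z) Fr.projUnstable d ↔ d = dr) :
    IsLimitEvans (fun x => M.A ul x z) (fun x => M.A ur x z) (M.Ainf vs z) d ↔ d = dl * dr := by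
  rw [isLimitEvans_iff (fun y => trace_A h.saddle h.orbit_l y z)
    fun y => trace_A h.saddle h.orbit_r y z]
  constructor
  · rintro ⟨Fr, el, er, hl, hr, rfl⟩
    rw [((hd Fr).1 el).1 hl, ((hd Fr).2 er).1 hr]
  · rintro rfl
    obtain ⟨F0⟩ := nonempty_spectralFrame (re_ne_zero_of_mem_spectrum hM h.saddle hz)
    exact ⟨F0, dl, dr, ((hd F0).1 dl).2 rfl, ((hd F0).2 dr).2 rfl, rfl⟩

lemma waveConvergence_of_follows (hM : M.Admissible) (h : PulsePair M.I M.κ M.W vs a b C ul ur)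
    {ε₀ : ℝ} (hε₀ : 0 < ε₀)
    (hf : ∀ ε Xl Xr : ℝ, ∀ v : ℝ → ℝ, 0 < ε → ε < ε₀ → IsDoublePulse M.I M.κ M.W vs ε v Xl Xr →
      Follows a b vs (saddleRate M.κ M.W vs) C Xr (fun y => v (y + Xr)) ur ∧
      Follows a b vs (saddleRate M.κ M.W vs) C (-Xl) (fun y => v (y + Xl)) ul) :
    M.WaveConvergence vs ul ur (saddleRate M.κ M.W vs) := by
  obtain ⟨D, hD, hl⟩ := exists_lift_bound_of_follows hM h.sub h.pos h.saddle.rate_pos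
  refine ⟨D, hD, ε₀, hε₀, fun ε h1 h2 v Xl Xr X hv => ?_⟩
  obtain ⟨fr, fl⟩ := hf ε Xl Xr v h1 h2 hv.isDoublePulse
  have hdiff : ∀ {μ : ℝ} {w : ℝ → ℝ}, IsOrbit M.I M.κ M.W μ w → Differentiable ℝ w := fun hw =>
    hw.smooth.differentiable (by norm_num)
  have ho := hv.isDoublePulse.orbit
  constructor
  · intro y hy
    have := hl _ _ _ fl h.decays_l.mem (hdiff (ho.comp_add Xl)) (hdiff h.orbit_l) y
      (by rwa [neg_neg])
    rwa [deriv_comp_add_const (fun x => M.lift (v x)), neg_mul_neg] at this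
  · intro y hy
    have := hl _ _ _ fr h.decays_r.mem (hdiff (ho.comp_add Xr)) (hdiff h.orbit_r) y hy
    rwa [deriv_comp_add_const (fun x => M.lift (v x))] at this

end Model

lemma exp_add_exp_le {α β ν C ε x y X : ℝ} (hα : 0 < α) (hβ : 0 ≤ β) (hν : ν ≤ β) (hC : 0 < C)
    (hX0 : 0 ≤ X) (hX : X ≤ 2 * (x + y)) (h1 : ε ≤ C * exp (-α * x)) (h2 : exp (-α * x) ≤ C * ε)
    (h3 : ε ≤ C * exp (-α * y)) (h4 : exp (-α * y) ≤ C * ε) :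
    exp (-2 * β * x) + exp (-2 * β * y) ≤
      2 * exp (β * (2 * Real.log C / α)) * exp (-ν * (X / 2)) := by
  set m := 2 * Real.log C / α with hm
  have hmα : m * α = 2 * Real.log C := div_mul_cancel₀ _ hα.ne'
  have key : ∀ {s t : ℝ}, exp (-α * s) ≤ C * ε → ε ≤ C * exp (-α * t) → t ≤ s + m := by
    intro s t hs ht
    have h5 : exp (-α * s) ≤ exp (m * α + -α * t) := by
      rw [hmα, exp_add, two_mul, exp_add, Real.exp_log hC, mul_assoc]
      exact hs.trans (mul_le_mul_of_nonneg_left ht hC.le)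
    have h6 := exp_le_exp.1 h5
    nlinarith
  have hxy := key h2 h3
  have hyx := key h4 h1
  have hνX : ν * (X / 2) ≤ β * (x + y) := by
    calc ν * (X / 2) ≤ β * (X / 2) := by gcongr
      _ ≤ _ := by gcongr; linarith
  have e : ∀ {w : ℝ}, x + y ≤ 2 * w + m → exp (-2 * β * w) ≤
      exp (β * m) * exp (-ν * (X / 2)) := fun {w} hw => by
    rw [← exp_add]
    refine exp_le_exp.2 ?_
    nlinarith [mul_le_mul_of_nonneg_left hw hβ]
  linarith [e (w := x) (by linarith), e (w := y) (by linarith)]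

namespace Model

variable {M : Model} {vs a b C : ℝ} {ul ur : ℝ → ℝ}

lemma exists_evans_estimate (hM : M.Admissible) (h : PulsePair M.I M.κ M.W vs a b C ul ur)
    {ε₀ : ℝ} (hε₀ : 0 < ε₀)
    (hf : ∀ ε Xl Xr : ℝ, ∀ v : ℝ → ℝ, 0 < ε → ε < ε₀ → IsDoublePulse M.I M.κ M.W vs ε v Xl Xr →
        (ε ≤ C * exp (-saddleRate M.κ M.W vs * Xr) ∧ exp (-saddleRate M.κ M.W vs * Xr) ≤ C * ε) ∧
        (ε ≤ C * exp (-saddleRate M.κ M.W vs * -Xl) ∧ exp (-saddleRate M.κ M.W vs * -Xl) ≤ C * ε) ∧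
        Follows a b vs (saddleRate M.κ M.W vs) C Xr (fun y => v (y + Xr)) ur ∧
        Follows a b vs (saddleRate M.κ M.W vs) C (-Xl) (fun y => v (y + Xl)) ul)
    {dl dr : ℂ → ℂ} (hd : ∀ z : ℂ, 0 < z.re → ∀ Fr : SpectralFrame (M.Ainf vs z),
      (∀ d, IsTransmission (fun x => M.A ul x z) (M.Ainf vs z) Fr.projUnstable d ↔ d = dl z) ∧
      ∀ d, IsTransmission (fun x => M.A ur x z) (M.Ainf vs z) Fr.projUnstable d ↔ d = dr z)
    {K : Set ℂ} (hK : IsCompact K) (hK0 : K ⊆ {z : ℂ | 0 < z.re}) {σ : ℝ}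
    (hσ : IsLeast {r : ℝ | ∃ z ∈ K, ∃ η ∈ spectrum ℂ (M.Ainf vs z), r = |η.re|} σ) {ν : ℝ}
    (hν : ν < saddleRate M.κ M.W vs) (hνσ : ν < σ) :
    ∃ D > 0, ∃ ε1 > 0, ∀ ε : ℝ, 0 < ε → ε < ε1 →
      ∀ (v : ℝ → ℝ) (Xl Xr X : ℝ), M.IsTwoPulse vs ε v Xl Xr X →
      ∀ z ∈ K, ∀ γ : ℂ, ‖γ‖ = 1 → ∀ (Fr : SpectralFrame (M.Ainf vs z))
        (Ψ : ℝ → Matrix (Fin M.dim) (Fin M.dim) ℂ), IsFundamental (fun x => M.A v x z) Ψ →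
        ‖rescaledEvans Fr Ψ Xl Xr γ - dl z * dr z‖ ≤ D * exp (-ν * (X / 2)) := by
  have hs := h.saddle
  have hα := hs.rate_pos
  set α := saddleRate M.κ M.W vs with hαdef
  have hσ0 : 0 < σ := by
    obtain ⟨z, hz, η, hη, rfl⟩ := hσ.1
    exact abs_pos.2 (re_ne_zero_of_mem_spectrum hM hs (hK0 hz) η hη)
  obtain ⟨β, hβ1, hβ2⟩ := exists_between (max_lt (lt_min hν hνσ) (lt_min hα hσ0))
  obtain ⟨hνβ, hβ0⟩ := max_lt_iff.1 hβ1
  obtain ⟨hβα, hβσ⟩ := lt_min_iff.1 hβ2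
  obtain ⟨Z, hZ⟩ := hK.isBounded.exists_norm_le
  obtain ⟨D, hD, happ⟩ := uniformApproximation (Z := max Z 0) hM h hβ0 hβσ hβα (le_max_right _ _)
  have hC := h.pos
  refine ⟨D * (2 * exp (β * (2 * Real.log C / α))), by positivity,
    min ε₀ (exp (-α / (2 * β)) / C), lt_min hε₀ (by positivity), ?_⟩
  intro ε hε hε1 v Xl Xr X hv z hz γ hγ Fr Ψ hΨ
  have hdp := hv.isDoublePulse
  obtain ⟨⟨h1, h2⟩, ⟨h3, h4⟩, fr, fl⟩ := hf ε Xl Xr v hε (hε1.trans_le (min_le_left _ _)) hdp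
  have hsmall : exp (-2 * β * Xr) ≤ 1 / 2 := by
    have h5 : C * ε ≤ exp (-α / (2 * β)) := by
      rw [mul_comm, ← le_div_iff₀ hC]; exact (hε1.trans_le (min_le_right _ _)).le
    have h6 := exp_le_exp.1 (h2.trans h5)
    rw [neg_div, neg_mul, neg_le_neg_iff, div_le_iff₀ (by positivity)] at h6
    have h7 : 1 ≤ Xr * (2 * β) := by nlinarith
    refine (exp_le_exp.2 (by linarith : -2 * β * Xr ≤ -1)).trans ?_
    rw [Real.exp_neg, one_div]; exact inv_anti₀ two_pos (by linarith [Real.add_one_le_exp (1 : ℝ)])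
  have key : ‖rescaledEvans Fr Ψ Xl Xr γ - dl z * dr z‖ ≤
      D * (exp (-2 * β * Xr) + exp (-2 * β * -Xl)) := by
    have hrk := rank_le_two hM hs (hK0 hz) Fr
    have hl := ((hd z (hK0 hz) Fr).1 _).2 rfl
    have hr := ((hd z (hK0 hz) Fr).2 _).2 rfl
    have hgap : ∀ μ ∈ spectrum ℂ (M.Ainf vs z), σ ≤ |μ.re| := fun μ hμ => hσ.2 ⟨z, hz, μ, hμ, rfl⟩
    rw [A_eq_along hs h.orbit_l] at hl
    rw [A_eq_along hs h.orbit_r] at hr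
    rw [A_eq_along hs hdp.orbit] at hΨ
    clear hd
    revert Fr
    rw [Ainf_eq_eval hs] at *
    intro Fr hrk hl hr
    exact happ z Fr ((hZ z hz).trans (le_max_left _ _)) hgap hrk.1 hrk.2 _ _ hl hr ε Xl Xr v hdp fr fl
      hsmall Ψ hΨ γ hγ
  refine key.trans ?_
  rw [mul_assoc D]
  refine mul_le_mul_of_nonneg_left (exp_add_exp_le hα hβ0.le hνβ.le hC hv.period.1.1.le ?_ h1 h2 h3 h4)
    hD.le
  linarith [hv.period_le hs]

end Model

end

end TwoPulse

end

theorem proposition4p9 (M : TwoPulse.Model) (hM : M.Admissible)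
    (vl vs vr : ℝ) (hW : M.TwoHomoclinics vl vs vr)
    (ul ur : ℝ → ℝ) (hl : M.IsSoliton vs vl ul) (hr : M.IsSoliton vs vr ur) :
    (∃ ν > 0, M.SolitonDecay vs ul ur ν) ∧
    (∃ θ > 0, M.WaveConvergence vs ul ur θ) ∧
    ∃ D₀ : ℂ → ℂ,
      (∀ z : ℂ, 0 < z.re → ∀ d : ℂ,
        TwoPulse.IsLimitEvans (fun x => M.A ul x z) (fun x => M.A ur x z) (M.Ainf vs z) d ↔
          d = D₀ z) ∧
      ∀ ν θ : ℝ, 0 < ν → 0 < θ →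
        M.SolitonDecay vs ul ur ν → M.WaveConvergence vs ul ur θ →
        ∀ K : Set ℂ, IsCompact K → K ⊆ {z : ℂ | 0 < z.re} →
        ∀ σ : ℝ, IsLeast {r : ℝ | ∃ z ∈ K, ∃ η ∈ spectrum ℂ (M.Ainf vs z), r = |η.re|} σ →
        ∀ ν' : ℝ, ν' < min θ (min ν σ) →
        ∃ C > 0, ∃ ε₀ > 0, ∀ ε : ℝ, 0 < ε → ε < ε₀ →
          ∀ (v : ℝ → ℝ) (Xl Xr X : ℝ), M.IsTwoPulse vs ε v Xl Xr X →
          ∀ z ∈ K, ∀ γ : ℂ, ‖γ‖ = 1 →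
          ∀ (F : TwoPulse.SpectralFrame (M.Ainf vs z))
            (Ψ : ℝ → Matrix (Fin M.dim) (Fin M.dim) ℂ),
            TwoPulse.IsFundamental (fun x => M.A v x z) Ψ →
            ‖TwoPulse.rescaledEvans F Ψ Xl Xr γ - D₀ z‖ ≤ C * Real.exp (-ν' * (X / 2)) := by
  have hs := hW.toSaddle hM
  obtain ⟨a, b, C, ε₀, hC, hε₀, hab, hmem, hdl, hdr, hf⟩ :=
    (hW.doubleWell hM).exists_estimates hr.isHomoclinic hl.isHomoclinic_reflect
  have hp : TwoPulse.PulsePair M.I M.κ M.W vs a b C ul ur :=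
    ⟨hs, hab, hmem, hC, hl.profile.isOrbit, hr.profile.isOrbit, hdl, hdr⟩
  have hdiff : ∀ {v0 : ℝ} {u : ℝ → ℝ}, M.IsSoliton vs v0 u → Differentiable ℝ u := fun hu =>
    hu.profile.smooth.differentiable (by norm_num)
  refine ⟨⟨_, hs.rate_pos, TwoPulse.Model.solitonDecay_of_decays hM hab hmem hC hs.rate_pos hdl hdr
    (hdiff hl) (hdiff hr)⟩, ⟨_, hs.rate_pos, TwoPulse.Model.waveConvergence_of_follows hM hp hε₀
      fun ε Xl Xr v h1 h2 h3 => (hf ε Xl Xr v h1 h2 h3).2.2⟩, ?_⟩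
  choose dl dr hd using TwoPulse.Model.exists_transmissions hM hp
  refine ⟨fun z => dl z * dr z, fun z hz d =>
    TwoPulse.Model.isLimitEvans_iff_of_transmissions hM hp hz (hd z hz), ?_⟩
  intro ν θ _ _ hν _ K hK hK0 σ hσ ν' hν'
  have h1 : ν' < min ν σ := hν'.trans_le (min_le_right _ _)
  exact TwoPulse.Model.exists_evans_estimate hM hp hε₀ hf hd hK hK0 hσ
    ((h1.trans_le (min_le_left _ _)).trans_le (hν.rate_le hC hdr)) (h1.trans_le (min_le_right _ _))
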